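/- Let $k$ be an algebraically closed field of characteristic $\neq 2$, let $l$ be an even positive integer, and let $V$ be an $l$-dimensional vector space over $k$ with basis $v_1,\dots,v_l$. Let $q$ be the quadratic form $q(v+f)=f(v)$ on $V\oplus V^*$, with polar form $q(x,y)=q(x+y)-q(x)-q(y)$. Let $\mathfrak{so}_{2l}=\mathfrak{so}(V\oplus V^*,q)$; it is spanned by the maps $\sigma_{x,y}=q(x,\cdot)y-q(y,\cdot)x$ and embeds in the Clifford algebra $\mathrm{Cl}(V\oplus V^*,q)$ by $\sigma_{x,y}\mapsto-\tfrac12(x\cdot y-y\cdot x)$. The Clifford algebra acts on the exterior algebra $\bigwedge V$: $v\in V$ acts by left multiplication and $f\in V^*$ by the odd superderivation extending $f$. Restricting to $\mathfrak{so}_{2l}$ gives the half-spin representation $\rho^+$ on $S^+=\bigwedge_{\bar 0}V$. Let $\hat{\ }$ be the involution of $\bigwedge V$ fixing all vectors of $V$, let $\Phi(s)$ be the coefficient of $v_1\cdots v_l$ in $s$, and put $\hat b(s,t)=\Phi(\hat s\,t)$. Let $\mathfrak g=\mathfrak g_{\bar 0}\oplus\mathfrak g_{\bar 1}$ be the $\mathbb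 Z_2$-graded algebra with $\mathfrak g_{\bar 0}=\mathfrak{so}_{2l}$, $\mathfrak g_{\bar 1}=S^+$ and product given by the Lie bracket of $\mathfrak{so}_{2l}$, by $[\sigma,s]=-[s,\sigma]=\rho^+(\sigma)(s)$, and by the element $[s,t]\in\mathfrak{so}_{2l}$ determined by $$\tfrac12\operatorname{tr}\bigl(\sigma[s,t]\bigr)=\hat b\bigl(\rho^+(\sigma)(s),t\bigr)\qquad(\sigma\in\mathfrak{so}_{2l},\ s,t\in S^+),$$ where $\operatorname{tr}$ is the trace on $V\oplus V^*$. Then: (i) $\mathfrak g$ is a Lie algebra if and only if $l=8$ or $l=4$. If $l=8$, then $\mathfrak g$ is simple and isomorphic to the split Lie algebra of type $E_8$ over $k$ (the Chevalley algebra); if $l=4$, then $\mathfrak g$ is simple and isomorphic to $\mathfrak{so}_9$ (type $B_4$). (ii) $\mathfrak g$ is a Lie superalgebra if and only if either $l=6$ and $\operatorname{char}k=3$, or $l=2$. If $l=6$ and $\operatorname{char}k=3$, then $\mathfrak g$ is isomorphic, as a Lie superalgebra, to $\mathfrak{inder}(T)\oplus T$, where $T$ is the symplectic (Freudenthal) triple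 system of the Jordan algebra $J=H_3(Q)$ of hermitian $3\times3$ matrices over the quaternion algebra $Q$ over $k$, defined below. If $l=2$, then $\mathfrak g$ is isomorphic, as a Lie superalgebra, to $\mathfrak{osp}(1,2)\oplus\mathfrak{sl}_2$. Here $T=\{(\alpha,a,b,\beta):\alpha,\beta\in k,\ a,b\in J\}$; with $t(a,b)$ the trace form of $J$ and $a\times b=2a\circ b-t(a)b-t(b)a+(t(a)t(b)-t(a,b))1$, the triple product of $x_i=(\alpha_i,a_i,b_i,\beta_i)$ is $$[x_1x_2x_3]=\bigl(\gamma(x_1,x_2,x_3),\ c(x_1,x_2,x_3),\ -c(\bar x_1,\bar x_2,\bar x_3),\ -\gamma(\bar x_1,\bar x_2,\bar x_3)\bigr),\qquad \overline{(\alpha,a,b,\beta)}=(\beta,b,a,\alpha),$$ $$\gamma=\bigl(-3(\alpha_1\beta_2+\alpha_2\beta_1)+t(a_1,b_2)+t(a_2,b_1)\bigr)\alpha_3+2\bigl(\alpha_1t(b_2,a_3)+\alpha_2t(b_1,a_3)-t(a_1\times a_2,a_3)\bigr),$$ $$\begin{aligned}c={}&\bigl(-(\alpha_1\beta_2+\alpha_2\beta_1)+t(a_1,b_2)+t(a_2,b_1)\bigr)a_3+2\bigl(t(b_2,a_3)-\beta_2\alpha_3\bigr)a_1+2\bigl(t(b_1,a_3)-\beta_1\alpha_3\bigr)a_2\\&+2\alpha_1\,b_2\times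 b_3+2\alpha_2\,b_1\times b_3+2\alpha_3\,b_1\times b_2\\&-2\bigl((a_1\times a_2)\times b_3+(a_1\times a_3)\times b_2+(a_2\times a_3)\times b_1\bigr).\end{aligned}$$ The Lie algebra $\mathfrak{inder}(T)\subseteq\operatorname{End}_k(T)$ is generated by the maps $d_{x,y}=[x\,y\,\cdot\,]$, and the product of $\mathfrak{inder}(T)\oplus T$ is the commutator on $\mathfrak{inder}(T)$, with $[d,x]=-[x,d]=d(x)$ and $[x,y]=d_{x,y}$ for $d\in\mathfrak{inder}(T)$ and $x,y\in T$. -/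

import Mathlib

attribute [local instance 100] LieRing.ofAssociativeRing

/-! ### `ℤ/2`-graded algebras, Lie algebras and Lie superalgebras -/

/-- A `ℤ/2`-graded (nonassociative) `k`-algebra with even part `E` and odd part `O`: the four
homogeneous components of a bilinear multiplication on `E ⊕ O`. -/
structure Z2Algebra (k E O : Type*) [CommRing k] [AddCommGroup E] [Module k E]
    [AddCommGroup O] [Module k O] where
  /-- even times even -/
  ee : E →ₗ[k] E →ₗ[k] E
  /-- even times odd -/
  eo : E →ₗ[k] O →ₗ[k] O
  /-- odd times even -/
  oe : O →ₗ[k] E →ₗ[k] O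
  /-- odd times odd -/
  oo : O →ₗ[k] O →ₗ[k] E

namespace Z2Algebra

variable {k E O : Type*} [CommRing k] [AddCommGroup E] [Module k E] [AddCommGroup O] [Module k O]

/-- The multiplication of the whole algebra `E ⊕ O`. -/
def mul (G : Z2Algebra k E O) (x y : E × O) : E × O :=
  (G.ee x.1 y.1 + G.oo x.2 y.2, G.eo x.1 y.2 + G.oe x.2 y.1)

/-- Forgetting the grading, the algebra `E ⊕ O` is a Lie algebra. -/
structure IsLieAlgebra (G : Z2Algebra k E O) : Prop where
  mul_self : ∀ x, G.mul x x = 0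
  jacobi : ∀ x y z, G.mul x (G.mul y z) + G.mul y (G.mul z x) + G.mul z (G.mul x y) = 0

/-- The graded algebra `E ⊕ O` is a Lie superalgebra: super-anticommutativity and the super Jacobi
identity on homogeneous elements, together with `[[s, s], s] = 0` for odd `s` (which follows from
the super Jacobi identity when `3` is invertible and is part of the definition otherwise). -/
structure IsLieSuperalgebra (G : Z2Algebra k E O) : Prop where
  ee_self : ∀ x, G.ee x x = 0
  oe_eq : ∀ s x, G.oe s x = - G.eo x s
  oo_comm : ∀ s t, G.oo s t = G.oo t s
  jacobi_eee : ∀ x y z, G.ee x (G.ee y z) = G.ee (G.ee x y) z + G.ee y (G.ee x z)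
  jacobi_eeo : ∀ x y s, G.eo x (G.eo y s) = G.eo (G.ee x y) s + G.eo y (G.eo x s)
  jacobi_eoo : ∀ x s t, G.ee x (G.oo s t) = G.oo (G.eo x s) t + G.oo s (G.eo x t)
  jacobi_ooo : ∀ s t u, G.eo (G.oo s t) u + G.eo (G.oo t u) s + G.eo (G.oo u s) t = 0
  cube : ∀ s, G.eo (G.oo s s) s = 0

/-- The (ungraded) algebra `E ⊕ O` is simple: its multiplication is not zero and it has no
two-sided ideals except `0` and the whole algebra. -/
def IsSimple (G : Z2Algebra k E O) : Prop :=
  (∃ x y, G.mul x y ≠ 0) ∧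
    ∀ I : Submodule k (E × O), (∀ x, ∀ y ∈ I, G.mul x y ∈ I ∧ G.mul y x ∈ I) → I = ⊥ ∨ I = ⊤

variable (k) in
/-- The (ungraded) algebra `E ⊕ O` is isomorphic to the algebra `L` with product `⁅·, ·⁆`. -/
def IsoBracket (G : Z2Algebra k E O) (L : Type*) [AddCommGroup L] [Module k L] [Bracket L L] :
    Prop :=
  ∃ e : (E × O) ≃ₗ[k] L, ∀ x y, e (G.mul x y) = ⁅e x, e y⁆

/-- Two `ℤ/2`-graded algebras are isomorphic, by an isomorphism that preserves the grading. -/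
def Iso {E' O' : Type*} [AddCommGroup E'] [Module k E'] [AddCommGroup O'] [Module k O']
    (G : Z2Algebra k E O) (G' : Z2Algebra k E' O') : Prop :=
  ∃ (e : E ≃ₗ[k] E') (o : O ≃ₗ[k] O'),
    (∀ x y, e (G.ee x y) = G'.ee (e x) (e y)) ∧ (∀ x s, o (G.eo x s) = G'.eo (e x) (o s)) ∧
    (∀ s x, o (G.oe s x) = G'.oe (o s) (e x)) ∧ (∀ s t, e (G.oo s t) = G'.oo (o s) (o t))

/-- The graded subalgebra on a subspace `P` of the even part and a subspace `Q` of the odd part. -/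
def restrict (G : Z2Algebra k E O) (P : Submodule k E) (Q : Submodule k O)
    (hee : ∀ x ∈ P, ∀ y ∈ P, G.ee x y ∈ P) (heo : ∀ x ∈ P, ∀ s ∈ Q, G.eo x s ∈ Q)
    (hoe : ∀ s ∈ Q, ∀ x ∈ P, G.oe s x ∈ Q) (hoo : ∀ s ∈ Q, ∀ t ∈ Q, G.oo s t ∈ P) :
    Z2Algebra k P Q where
  ee := LinearMap.mk₂ k (fun x y => ⟨G.ee x y, hee _ x.2 _ y.2⟩)
    (by intros; ext; simp) (by intros; ext; simp) (by intros; ext; simp) (by intros; ext; simp)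
  eo := LinearMap.mk₂ k (fun x y => ⟨G.eo x y, heo _ x.2 _ y.2⟩)
    (by intros; ext; simp) (by intros; ext; simp) (by intros; ext; simp) (by intros; ext; simp)
  oe := LinearMap.mk₂ k (fun x y => ⟨G.oe x y, hoe _ x.2 _ y.2⟩)
    (by intros; ext; simp) (by intros; ext; simp) (by intros; ext; simp) (by intros; ext; simp)
  oo := LinearMap.mk₂ k (fun x y => ⟨G.oo x y, hoo _ x.2 _ y.2⟩)
    (by intros; ext; simp) (by intros; ext; simp) (by intros; ext; simp) (by intros; ext; simp)

section ofAction

variable {L M : Type*} [LieRing L] [LieAlgebra k L] [AddCommGroup M] [Module k M]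

/-- The `ℤ/2`-graded algebra `L ⊕ M` with even part the Lie algebra `L` and odd part `M`, where
`[x, s] = -[s, x] = ρ(x)(s)` and `[s, t] = β(s, t)` for `x` even and `s`, `t` odd. -/
def ofAction (ρ : L →ₗ[k] M →ₗ[k] M) (β : M →ₗ[k] M →ₗ[k] L) : Z2Algebra k L M where
  ee := (LieModule.toEnd k L L : L →ₗ[k] Module.End k L)
  eo := ρ
  oe := -ρ.flip
  oo := β

/-- The direct sum of a `ℤ/2`-graded algebra with a Lie algebra in even degree. -/
def sumLie (G : Z2Algebra k E O) (L : Type*) [LieRing L] [LieAlgebra k L] :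
    Z2Algebra k (E × L) O where
  ee := LinearMap.mk₂ k (fun x y => (G.ee x.1 y.1, ⁅x.2, y.2⁆))
    (by intros; ext <;> simp) (by intros; ext <;> simp)
    (by intros; ext <;> simp) (by intros; ext <;> simp)
  eo := G.eo ∘ₗ LinearMap.fst k E L
  oe := G.oe.compl₂ (LinearMap.fst k E L)
  oo := G.oo.compr₂ (LinearMap.inl k E L)

end ofAction

end Z2Algebra

/-! ### The orthosymplectic Lie superalgebras -/

section Orthosymplectic

variable (m n k : Type*) [Fintype m] [DecidableEq m] [Fintype n] [DecidableEq n] [CommRing k]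

/-- The general linear Lie superalgebra `gl(m|n)`: an even element `(A, D)` is the block diagonal
matrix with blocks `A`, `D`, an odd element `(B, C)` is the matrix with upper right block `B` and
lower left block `C`, and the product is the supercommutator `XY - (-1)^{|X||Y|} YX`. -/
def glSuper : Z2Algebra k (Matrix m m k × Matrix n n k) (Matrix m n k × Matrix n m k) where
  ee := LinearMap.mk₂ k
    (fun x y => (x.1 * y.1 - y.1 * x.1, x.2 * y.2 - y.2 * x.2))
    (by intros; ext1 <;> simp [add_mul, mul_add] <;> abel)
    (by intros; ext1 <;> simp [smul_sub])
    (by intros; ext1 <;> simp [add_mul, mul_add] <;> abel)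
    (by intros; ext1 <;> simp [smul_sub])
  eo := LinearMap.mk₂ k
    (fun x s => (x.1 * s.1 - s.1 * x.2, x.2 * s.2 - s.2 * x.1))
    (by intros; ext1 <;> simp [Matrix.add_mul, Matrix.mul_add] <;> abel)
    (by intros; ext1 <;> simp [smul_sub])
    (by intros; ext1 <;> simp [Matrix.add_mul, Matrix.mul_add] <;> abel)
    (by intros; ext1 <;> simp [smul_sub])
  oe := LinearMap.mk₂ k
    (fun s x => (s.1 * x.2 - x.1 * s.1, s.2 * x.1 - x.2 * s.2))
    (by intros; ext1 <;> simp [Matrix.add_mul, Matrix.mul_add] <;> abel)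
    (by intros; ext1 <;> simp [smul_sub])
    (by intros; ext1 <;> simp [Matrix.add_mul, Matrix.mul_add] <;> abel)
    (by intros; ext1 <;> simp [smul_sub])
  oo := LinearMap.mk₂ k
    (fun s t => (s.1 * t.2 + t.1 * s.2, s.2 * t.1 + t.2 * s.1))
    (by intros; ext1 <;> simp [Matrix.add_mul, Matrix.mul_add] <;> abel)
    (by intros; ext1 <;> simp [smul_add])
    (by intros; ext1 <;> simp [Matrix.add_mul, Matrix.mul_add] <;> abel)
    (by intros; ext1 <;> simp [smul_add])

/-- The even part of `osp(m|2n)`: pairs of an orthogonal and a symplectic matrix. -/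
def ospEven : Submodule k (Matrix m m k × Matrix (n ⊕ n) (n ⊕ n) k) :=
  (LieAlgebra.Orthogonal.so m k).toSubmodule.prod (LieAlgebra.Symplectic.sp n k).toSubmodule

/-- The odd part of `osp(m|2n)`: the odd `X = (B, C)` with
`β(X u, v) + (-1)^{|u|} β(u, X v) = 0` for the supersymmetric form `β` that is given by the identity
matrix on the even part and by the alternating matrix `J` on the odd part of `k^{m|2n}`. -/
def ospOdd : Submodule k (Matrix m (n ⊕ n) k × Matrix (n ⊕ n) m k) where
  carrier := {s | s.1 + s.2.transpose * Matrix.J n k = 0}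
  zero_mem' := by simp
  add_mem' := by
    intro a b ha hb
    simp only [Set.mem_ofPred_eq, Prod.fst_add, Prod.snd_add, Matrix.transpose_add,
      Matrix.add_mul] at *
    rw [add_add_add_comm, ha, hb, add_zero]
  smul_mem' := by
    intro c a ha
    simp only [Set.mem_ofPred_eq, Prod.smul_fst, Prod.smul_snd, Matrix.transpose_smul,
      Matrix.smul_mul] at *
    rw [← smul_add, ha, smul_zero]

variable {m n k}

theorem mem_ospEven {x : Matrix m m k × Matrix (n ⊕ n) (n ⊕ n) k} :
    x ∈ ospEven m n k ↔ x.1.transpose = -x.1 ∧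
      x.2.transpose * Matrix.J n k = -(Matrix.J n k * x.2) := by
  rw [ospEven, Submodule.mem_prod]
  refine and_congr (LieAlgebra.Orthogonal.mem_so _ _ _) ?_
  change x.2 ∈ skewAdjointMatricesSubmodule (Matrix.J n k) ↔ _
  rw [mem_skewAdjointMatricesSubmodule]
  simp [Matrix.IsSkewAdjoint, Matrix.IsAdjointPair]

theorem mem_ospOdd {s : Matrix m (n ⊕ n) k × Matrix (n ⊕ n) m k} :
    s ∈ ospOdd m n k ↔ s.1 = -(s.2.transpose * Matrix.J n k) :=
  add_eq_zero_iff_eq_neg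

theorem ospOdd_transpose {s : Matrix m (n ⊕ n) k × Matrix (n ⊕ n) m k} (hs : s ∈ ospOdd m n k) :
    s.1.transpose = Matrix.J n k * s.2 := by
  rw [mem_ospOdd.1 hs]
  simp [Matrix.J_transpose]

variable (m n k)

/-- The orthosymplectic Lie superalgebra `osp(m|2n)`, as a graded subalgebra of `gl(m|2n)`. -/
def osp : Z2Algebra k (ospEven m n k) (ospOdd m n k) :=
  (glSuper m (n ⊕ n) k).restrict (ospEven m n k) (ospOdd m n k)
    (by
      intro x hx y hy
      rw [mem_ospEven] at *
      obtain ⟨hx1, hx2⟩ := hx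
      obtain ⟨hy1, hy2⟩ := hy
      simp only [glSuper, LinearMap.mk₂_apply, Matrix.transpose_sub, Matrix.transpose_mul]
      refine ⟨by rw [hx1, hy1]; noncomm_ring, ?_⟩
      rw [sub_mul, mul_assoc, mul_assoc, hx2, hy2, mul_neg, mul_neg, ← mul_assoc, ← mul_assoc, hx2,
        hy2]
      noncomm_ring)
    (by
      intro x hx s hs
      rw [mem_ospEven] at hx
      rw [mem_ospOdd] at *
      obtain ⟨hx1, hx2⟩ := hx
      simp only [glSuper, LinearMap.mk₂_apply, Matrix.transpose_sub, Matrix.transpose_mul]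
      rw [Matrix.sub_mul, Matrix.mul_assoc, hx2, hx1, hs]
      simp [Matrix.mul_assoc])
    (by
      intro s hs x hx
      rw [mem_ospEven] at hx
      rw [mem_ospOdd] at *
      obtain ⟨hx1, hx2⟩ := hx
      simp only [glSuper, LinearMap.mk₂_apply, Matrix.transpose_sub, Matrix.transpose_mul]
      rw [Matrix.sub_mul, Matrix.mul_assoc s.2.transpose, hx2, hx1, hs]
      simp [Matrix.mul_assoc])
    (by
      intro s hs t ht
      have hs' := ospOdd_transpose hs
      have ht' := ospOdd_transpose ht
      rw [mem_ospOdd] at hs ht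
      rw [mem_ospEven]
      simp only [glSuper, LinearMap.mk₂_apply, Matrix.transpose_add, Matrix.transpose_mul]
      rw [hs', ht', hs, ht]
      constructor
      · simp [Matrix.mul_assoc]
      · simp [Matrix.mul_assoc, Matrix.add_mul, Matrix.mul_add])

end Orthosymplectic

/-! ### The Chevalley algebra of a simply laced root lattice -/

section SimplyLaced

variable {n : ℕ} (A : Matrix (Fin n) (Fin n) ℤ)

/-- The symmetric bilinear form `(x, y) = ∑ xᵢ Aᵢⱼ yⱼ` on the root lattice `ℤⁿ` of the simply laced
Cartan matrix `A`, with the simple roots as standard basis. -/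
def latticeForm (x y : Fin n → ℤ) : ℤ := ∑ i, ∑ j, x i * A i j * y j

/-- The roots: the vectors of norm `2` in the root lattice. -/
abbrev LatticeRoot : Type := {x : Fin n → ℤ // latticeForm A x x = 2}

/-- The exponent of the bimultiplicative sign `ε(x, y) = (-1) ^ (∑ᵢ xᵢ yᵢ + ∑_{j < i} xᵢ Aᵢⱼ yⱼ)`,
which satisfies `ε(x, x) = (-1) ^ ((x, x) / 2)` and `ε(x, y) ε(y, x) = (-1) ^ (x, y)`. -/
def cocycleExponent (x y : Fin n → ℤ) : ℤ :=
  ∑ i, x i * y i + ∑ i, ∑ j, if j < i then x i * A i j * y j else 0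

variable (k : Type*) [CommRing k]

/-- The underlying space `𝔥 ⊕ ⨁_α k e_α` of the split Lie algebra over `k` with simply laced Cartan
matrix `A`, where `𝔥 = k ⊗ ℤⁿ` is spanned by the simple roots (identified with the simple coroots)
and `α` runs over the roots. -/
def ChevalleyAlgebra : Type _ := (Fin n → k) × (LatticeRoot A →₀ k)

namespace ChevalleyAlgebra

noncomputable instance : AddCommGroup (ChevalleyAlgebra A k) :=
  inferInstanceAs (AddCommGroup ((Fin n → k) × (LatticeRoot A →₀ k)))

noncomputable instance : Module k (ChevalleyAlgebra A k) :=
  inferInstanceAs (Module k ((Fin n → k) × (LatticeRoot A →₀ k)))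

variable {A k}

/-- The value `α(h) = (α, h)` of a root `α` at `h ∈ 𝔥`. -/
def rootEval (α : LatticeRoot A) (h : Fin n → k) : k :=
  ∑ i, ∑ j, ((α.1 i * A i j : ℤ) : k) * h j

/-- The root vector `e_α`. -/
noncomputable def rootVector (α : LatticeRoot A) : ChevalleyAlgebra A k :=
  (0, Finsupp.single α 1)

/-- The product `[e_α, e_β]`: it is `-α` if `α + β = 0`, it is `ε(α, β) e_{α + β}` if `α + β` is a
root, and it is `0` otherwise. -/
noncomputable def rootBracket (α β : LatticeRoot A) : ChevalleyAlgebra A k :=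
  open scoped Classical in
  if α.1 + β.1 = 0 then ((fun i => -(α.1 i : k)), 0)
  else if h : latticeForm A (α.1 + β.1) (α.1 + β.1) = 2 then
    (((cocycleExponent A α.1 β.1).negOnePow : ℤ) : k) • rootVector ⟨α.1 + β.1, h⟩
  else 0

/-- The bracket, with `[h, h'] = 0`, `[h, e_α] = -[e_α, h] = α(h) e_α` for `h`, `h'` in `𝔥`, and
`[e_α, e_β]` as above. -/
noncomputable instance : Bracket (ChevalleyAlgebra A k) (ChevalleyAlgebra A k) where
  bracket x y :=
    (y.2.sum fun β b => (rootEval β x.1 * b) • rootVector β)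
      - (x.2.sum fun α a => (rootEval α y.1 * a) • rootVector α)
      + x.2.sum fun α a => y.2.sum fun β b => (a * b) • rootBracket α β

end ChevalleyAlgebra

/-- The split Lie algebra of type `E₈` over `k`. -/
abbrev LieE8 : Type _ := ChevalleyAlgebra CartanMatrix.E₈ k

end SimplyLaced

/-! ### The Lie superalgebra of a Freudenthal triple system -/

section Freudenthal

variable {k J : Type*} [CommRing k] [AddCommGroup J] [Module k J]
  (t : J →ₗ[k] J →ₗ[k] k) (c : J →ₗ[k] J →ₗ[k] J)

variable (k J) in
/-- The space of matrices `(α, a; b, β)` with `α`, `β` in `k` and `a`, `b` in `J`, written as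
`(α, a, b, β)`. -/
abbrev FreudenthalSpace : Type _ := k × J × J × k

namespace FreudenthalSpace

/-- The map `(α, a; b, β) ↦ (β, b; a, α)`. -/
def swap (x : FreudenthalSpace k J) : FreudenthalSpace k J := (x.2.2.2, x.2.2.1, x.2.1, x.1)

/-- The component of `[x y z]` in the upper left corner. -/
def tripleScalar : FreudenthalSpace k J → FreudenthalSpace k J → FreudenthalSpace k J → k
  | (α₁, a₁, b₁, β₁), (α₂, a₂, b₂, β₂), (α₃, a₃, _, _) =>
    (-3 * (α₁ * β₂ + α₂ * β₁) + t a₁ b₂ + t a₂ b₁) * α₃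
      + 2 * (α₁ * t b₂ a₃ + α₂ * t b₁ a₃ - t (c a₁ a₂) a₃)

/-- The component of `[x y z]` in the upper right corner. -/
def tripleVector : FreudenthalSpace k J → FreudenthalSpace k J → FreudenthalSpace k J → J
  | (α₁, a₁, b₁, β₁), (α₂, a₂, b₂, β₂), (α₃, a₃, b₃, _) =>
    (-(α₁ * β₂ + α₂ * β₁) + t a₁ b₂ + t a₂ b₁) • a₃
      + (2 * (t b₂ a₃ - β₂ * α₃)) • a₁ + (2 * (t b₁ a₃ - β₁ * α₃)) • a₂
      + (2 * α₁) • c b₂ b₃ + (2 * α₂) • c b₁ b₃ + (2 * α₃) • c b₁ b₂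
      - (2 : k) • (c (c a₁ a₂) b₃ + c (c a₁ a₃) b₂ + c (c a₂ a₃) b₁)

/-- The triple product `[x y z]` of the Freudenthal triple system of a cubic form with trace form `t`
and cross product `c`. -/
def triple (x y z : FreudenthalSpace k J) : FreudenthalSpace k J :=
  (tripleScalar t c x y z, tripleVector t c x y z,
    -tripleVector t c x.swap y.swap z.swap, -tripleScalar t c x.swap y.swap z.swap)

variable {t c}

theorem tripleScalar_add (x x' y z : FreudenthalSpace k J) :
    tripleScalar t c (x + x') y z = tripleScalar t c x y z + tripleScalar t c x' y z := by
  simp [tripleScalar]; ring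

theorem tripleScalar_smul (r : k) (x y z : FreudenthalSpace k J) :
    tripleScalar t c (r • x) y z = r * tripleScalar t c x y z := by
  simp [tripleScalar]; ring

theorem tripleScalar_add' (x y y' z : FreudenthalSpace k J) :
    tripleScalar t c x (y + y') z = tripleScalar t c x y z + tripleScalar t c x y' z := by
  simp [tripleScalar]; ring

theorem tripleScalar_smul' (r : k) (x y z : FreudenthalSpace k J) :
    tripleScalar t c x (r • y) z = r * tripleScalar t c x y z := by
  simp [tripleScalar]; ring

theorem tripleScalar_add'' (x y z z' : FreudenthalSpace k J) :
    tripleScalar t c x y (z + z') = tripleScalar t c x y z + tripleScalar t c x y z' := by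
  simp [tripleScalar]; ring

theorem tripleScalar_smul'' (r : k) (x y z : FreudenthalSpace k J) :
    tripleScalar t c x y (r • z) = r * tripleScalar t c x y z := by
  simp [tripleScalar]; ring

theorem tripleVector_add (x x' y z : FreudenthalSpace k J) :
    tripleVector t c (x + x') y z = tripleVector t c x y z + tripleVector t c x' y z := by
  simp [tripleVector]; module

theorem tripleVector_smul (r : k) (x y z : FreudenthalSpace k J) :
    tripleVector t c (r • x) y z = r • tripleVector t c x y z := by
  simp [tripleVector]; module

theorem tripleVector_add' (x y y' z : FreudenthalSpace k J) :
    tripleVector t c x (y + y') z = tripleVector t c x y z + tripleVector t c x y' z := by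
  simp [tripleVector]; module

theorem tripleVector_smul' (r : k) (x y z : FreudenthalSpace k J) :
    tripleVector t c x (r • y) z = r • tripleVector t c x y z := by
  simp [tripleVector]; module

theorem tripleVector_add'' (x y z z' : FreudenthalSpace k J) :
    tripleVector t c x y (z + z') = tripleVector t c x y z + tripleVector t c x y z' := by
  simp [tripleVector]; module

theorem tripleVector_smul'' (r : k) (x y z : FreudenthalSpace k J) :
    tripleVector t c x y (r • z) = r • tripleVector t c x y z := by
  simp [tripleVector]; module

theorem swap_add (x y : FreudenthalSpace k J) : swap (x + y) = swap x + swap y := rfl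

theorem swap_smul (r : k) (x : FreudenthalSpace k J) : swap (r • x) = r • swap x := rfl

variable (t c)

/-- The operator `d_{x,y} : z ↦ [x y z]`. -/
def dOp (x y : FreudenthalSpace k J) : Module.End k (FreudenthalSpace k J) where
  toFun z := triple t c x y z
  map_add' z w := by
    simp only [triple, swap_add, tripleScalar_add'', tripleVector_add'', neg_add, Prod.mk_add_mk]
  map_smul' r z := by
    simp only [triple, swap_smul, tripleScalar_smul'', tripleVector_smul'', RingHom.id_apply,
      Prod.smul_mk, smul_neg, smul_eq_mul, mul_neg]

/-- The Lie algebra of inner derivations, generated by the operators `d_{x,y}`. (These operators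
already span it, because they are derivations of the triple product when `t` and `c` come from a
cubic Jordan algebra.) -/
def inder : LieSubalgebra k (Module.End k (FreudenthalSpace k J)) :=
  LieSubalgebra.lieSpan k _ {D | ∃ x y, D = dOp t c x y}

/-- The bilinear map `(x, y) ↦ d_{x,y}`. -/
def dMap : FreudenthalSpace k J →ₗ[k] FreudenthalSpace k J →ₗ[k] inder t c :=
  LinearMap.mk₂ k (fun x y => ⟨dOp t c x y, LieSubalgebra.subset_lieSpan ⟨x, y, rfl⟩⟩)
    (fun x x' y => Subtype.ext <| LinearMap.ext fun w => by
      change triple t c (x + x') y w = triple t c x y w + triple t c x' y w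
      simp only [triple, swap_add, tripleScalar_add, tripleVector_add, neg_add, Prod.mk_add_mk])
    (fun r x y => Subtype.ext <| LinearMap.ext fun w => by
      change triple t c (r • x) y w = r • triple t c x y w
      simp only [triple, swap_smul, tripleScalar_smul, tripleVector_smul, Prod.smul_mk, smul_neg,
        smul_eq_mul, mul_neg])
    (fun x y y' => Subtype.ext <| LinearMap.ext fun w => by
      change triple t c x (y + y') w = triple t c x y w + triple t c x y' w
      simp only [triple, swap_add, tripleScalar_add', tripleVector_add', neg_add, Prod.mk_add_mk])
    (fun r x y => Subtype.ext <| LinearMap.ext fun w => by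
      change triple t c x (r • y) w = r • triple t c x y w
      simp only [triple, swap_smul, tripleScalar_smul', tripleVector_smul', Prod.smul_mk, smul_neg,
        smul_eq_mul, mul_neg])

/-- The `ℤ/2`-graded algebra `inder(T) ⊕ T` of the Freudenthal triple system `T`, with the natural
action of `inder(T)` on `T` and `[x, y] = d_{x,y}` for `x`, `y` in `T`. -/
def superalgebra : Z2Algebra k (inder t c) (FreudenthalSpace k J) :=
  Z2Algebra.ofAction (inder t c).toSubmodule.subtype (dMap t c)

end FreudenthalSpace

end Freudenthal

section QuaternionHermitian

open scoped Quaternion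

variable (k : Type*) [CommRing k]

/-- The space `H₃(Q)` of hermitian `3 × 3` matrices over the quaternion algebra `Q` over `k` (over
an algebraically closed field of characteristic not `2`, this is the only quaternion algebra). -/
def QuatHerm : Submodule k (Matrix (Fin 3) (Fin 3) ℍ[k]) where
  carrier := {a | a.conjTranspose = a}
  zero_mem' := by simp
  add_mem' := by
    intro a b ha hb
    simp only [Set.mem_ofPred_eq, Matrix.conjTranspose_add] at *
    rw [ha, hb]
  smul_mem' := by
    intro r a ha
    simp only [Set.mem_ofPred_eq] at *
    conv_rhs => rw [← ha]
    refine Matrix.ext fun i j => ?_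
    simp only [Matrix.conjTranspose_apply, Matrix.smul_apply]
    exact QuaternionAlgebra.star_smul r (a j i)

namespace QuatHerm

variable {k}

/-- The generic trace on matrices over the quaternions: the real part of the trace. On the
hermitian matrices it is the trace of the Jordan algebra `H₃(Q)`. -/
def tr : Matrix (Fin 3) (Fin 3) ℍ[k] →ₗ[k] k where
  toFun a := ∑ i, (a i i).re
  map_add' a b := by simp [Finset.sum_add_distrib]
  map_smul' r a := by simp [Finset.mul_sum]

/-- The trace form `t(a, b) = t(a ∘ b)` of the Jordan algebra `H₃(Q)`; it equals the generic trace
of the matrix product `a b`. -/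
def trForm : QuatHerm k →ₗ[k] QuatHerm k →ₗ[k] k :=
  LinearMap.mk₂ k (fun a b => tr (a.1 * b.1))
    (by intros; simp [add_mul]) (by intros; simp) (by intros; simp [mul_add]) (by intros; simp)

/-- The matrix `a × b = 2 a ∘ b - t(a) b - t(b) a + (t(a) t(b) - t(a, b)) 1`. -/
def crossMatrix (a b : Matrix (Fin 3) (Fin 3) ℍ[k]) : Matrix (Fin 3) (Fin 3) ℍ[k] :=
  a * b + b * a - tr a • b - tr b • a + (tr a * tr b - tr (a * b)) • (1 : Matrix _ _ _)

theorem crossMatrix_mem (a b : QuatHerm k) : crossMatrix a.1 b.1 ∈ QuatHerm k := by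
  have h : a.1 * b.1 + b.1 * a.1 ∈ QuatHerm k := by
    have ha : a.1.conjTranspose = a.1 := a.2
    have hb : b.1.conjTranspose = b.1 := b.2
    change Matrix.conjTranspose _ = _
    rw [Matrix.conjTranspose_add, Matrix.conjTranspose_mul, Matrix.conjTranspose_mul, ha, hb,
      add_comm]
  have h1 : (1 : Matrix (Fin 3) (Fin 3) ℍ[k]) ∈ QuatHerm k := by
    change Matrix.conjTranspose _ = _
    simp
  exact add_mem (sub_mem (sub_mem h (Submodule.smul_mem _ _ b.2)) (Submodule.smul_mem _ _ a.2))
    (Submodule.smul_mem _ _ h1)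

/-- The cross product `a × b` of the Jordan algebra `H₃(Q)`, the linearization of the adjoint
`a ↦ a^#` of its generic norm (so that `a × a = 2 a^#`). -/
def cross : QuatHerm k →ₗ[k] QuatHerm k →ₗ[k] QuatHerm k :=
  LinearMap.mk₂ k (fun a b => ⟨crossMatrix a.1 b.1, crossMatrix_mem a b⟩)
    (by
      intro a b d; apply Subtype.ext
      simp only [crossMatrix, Submodule.coe_add, map_add, add_mul, mul_add]; module)
    (by
      intro r a b; apply Subtype.ext
      simp only [crossMatrix, Submodule.coe_smul, map_smul, smul_mul_assoc, mul_smul_comm,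
        smul_eq_mul]
      module)
    (by
      intro a b d; apply Subtype.ext
      simp only [crossMatrix, Submodule.coe_add, map_add, add_mul, mul_add]; module)
    (by
      intro r a b; apply Subtype.ext
      simp only [crossMatrix, Submodule.coe_smul, map_smul, smul_mul_assoc, mul_smul_comm,
        smul_eq_mul]
      module)

end QuatHerm

/-- The `ℤ/2`-graded algebra `inder(T) ⊕ T` for the Freudenthal triple system `T` of the Jordan
algebra `H₃(Q)` of hermitian `3 × 3` matrices over the quaternion algebra. -/
def quaternionicSuperalgebra :
    Z2Algebra k (FreudenthalSpace.inder (QuatHerm.trForm (k := k)) QuatHerm.cross)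
      (FreudenthalSpace k (QuatHerm k)) :=
  FreudenthalSpace.superalgebra QuatHerm.trForm QuatHerm.cross

end QuaternionHermitian

/-! ### Orthogonal Lie algebras of type `D` and their half-spin modules -/

namespace TypeD

open CliffordAlgebra (contractLeft evenOdd)

section Clifford

variable (k V : Type*) [Field k] [AddCommGroup V] [Module k V]

/-- The space `V ⊕ V*`; the vector `x + f` is written as `(f, x)`. It carries the quadratic form
`QuadraticForm.dualProd k V : (f, x) ↦ f x`, with polar form `LinearMap.dualProd k V`. -/
abbrev W : Type _ := Module.Dual k V × V

/-- The orthogonal Lie algebra `so(V ⊕ V*)`. -/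
abbrev So : LieSubalgebra k (Module.End k (W k V)) :=
  skewAdjointLieSubalgebra (LinearMap.dualProd k V)

/-! Shortcut instances that only speed up elaboration. -/

instance : AddCommGroup (So k V) := inferInstance

instance : AddCommMonoid (So k V) := inferInstance

instance : Module k (So k V) := inferInstance

variable {k V}

/-- The action `l_x + d_f` of a vector `x + f` of `V ⊕ V*` on the exterior algebra: left
multiplication by `x` plus the odd superderivation that extends `f`. -/
noncomputable def vectorAction : W k V →ₗ[k] Module.End k (ExteriorAlgebra k V) :=
  (LinearMap.mul k (ExteriorAlgebra k V)).comp (ExteriorAlgebra.ι k ∘ₗ LinearMap.snd k _ _)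
    + (contractLeft (Q := (0 : QuadraticForm k V))) ∘ₗ LinearMap.fst k _ _

theorem vectorAction_apply (w : W k V) (s : ExteriorAlgebra k V) :
    vectorAction w s = ExteriorAlgebra.ι k w.2 * s
      + contractLeft (Q := (0 : QuadraticForm k V)) w.1 s := rfl

theorem vectorAction_sq (w : W k V) :
    vectorAction w * vectorAction w
      = algebraMap k (Module.End k (ExteriorAlgebra k V)) (QuadraticForm.dualProd k V w) := by
  refine LinearMap.ext fun s => ?_
  have h1 : ExteriorAlgebra.ι k w.2 * (ExteriorAlgebra.ι k w.2 * s) = 0 := by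
    rw [← mul_assoc, ExteriorAlgebra.ι_sq_zero, zero_mul]
  have h2 := CliffordAlgebra.contractLeft_ι_mul (Q := (0 : QuadraticForm k V)) (d := w.1) w.2 s
  have h3 := CliffordAlgebra.contractLeft_contractLeft (Q := (0 : QuadraticForm k V)) (d := w.1) s
  rw [Module.End.mul_apply, vectorAction_apply, vectorAction_apply, mul_add, h1, map_add, h3,
    Module.algebraMap_end_apply, QuadraticForm.dualProd_apply, zero_add, add_zero]
  change _ + contractLeft w.1 (CliffordAlgebra.ι _ w.2 * s) = _
  rw [h2]
  exact add_sub_cancel _ _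

/-- The representation `Λ` of the Clifford algebra of `V ⊕ V*` on the exterior algebra of `V`. -/
noncomputable def spinAction :
    CliffordAlgebra (QuadraticForm.dualProd k V) →ₐ[k] Module.End k (ExteriorAlgebra k V) :=
  CliffordAlgebra.lift _ ⟨vectorAction, vectorAction_sq⟩

@[simp]
theorem spinAction_ι (w : W k V) :
    spinAction (CliffordAlgebra.ι (QuadraticForm.dualProd k V) w) = vectorAction w :=
  CliffordAlgebra.lift_ι_apply _ _ _

/-- The commutator `[x, y] = x · y - y · x` of two vectors in the Clifford algebra. -/
noncomputable def vectorComm :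
    W k V →ₗ[k] W k V →ₗ[k] CliffordAlgebra (QuadraticForm.dualProd k V) :=
  let m := (LinearMap.mul k (CliffordAlgebra (QuadraticForm.dualProd k V))).compl₁₂
    (CliffordAlgebra.ι (QuadraticForm.dualProd k V)) (CliffordAlgebra.ι (QuadraticForm.dualProd k V))
  m - m.flip

theorem vectorComm_apply (x y : W k V) :
    vectorComm x y = CliffordAlgebra.ι (QuadraticForm.dualProd k V) x
        * CliffordAlgebra.ι (QuadraticForm.dualProd k V) y
      - CliffordAlgebra.ι (QuadraticForm.dualProd k V) y
        * CliffordAlgebra.ι (QuadraticForm.dualProd k V) x := rfl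

/-- The endomorphism `σ_{x,y} = q(x, ·) y - q(y, ·) x` of `V ⊕ V*`. -/
def sigmaEnd (x y : W k V) : Module.End k (W k V) :=
  (LinearMap.dualProd k V x).smulRight y - (LinearMap.dualProd k V y).smulRight x

theorem sigmaEnd_apply (x y w : W k V) :
    sigmaEnd x y w = LinearMap.dualProd k V x w • y - LinearMap.dualProd k V y w • x := rfl

theorem dualProd_comm (x y : W k V) :
    LinearMap.dualProd k V x y = LinearMap.dualProd k V y x :=
  (LinearMap.isSymm_dualProd k V).eq x y

theorem mem_So {A : Module.End k (W k V)} :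
    A ∈ So k V ↔ ∀ x y, LinearMap.dualProd k V (A x) y = -LinearMap.dualProd k V x (A y) := by
  change A ∈ (LinearMap.dualProd k V).skewAdjointSubmodule ↔ _
  rw [LinearMap.mem_skewAdjointSubmodule]
  refine forall₂_congr fun x y => ?_
  change _ = LinearMap.dualProd k V x (-(A y)) ↔ _
  rw [map_neg]

theorem sigmaEnd_mem (x y : W k V) : sigmaEnd x y ∈ So k V := by
  rw [mem_So]
  intro u w
  simp only [sigmaEnd_apply, map_sub, map_smul, LinearMap.sub_apply, LinearMap.smul_apply,
    smul_eq_mul, dualProd_comm u]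
  ring

/-- The elements `σ_{x,y}` of `so(V ⊕ V*)`. -/
def sigma : W k V →ₗ[k] W k V →ₗ[k] So k V :=
  LinearMap.mk₂ k (fun x y => ⟨sigmaEnd x y, sigmaEnd_mem x y⟩)
    (fun x x' y => Subtype.ext <| LinearMap.ext fun w => by
      change sigmaEnd (x + x') y w = sigmaEnd x y w + sigmaEnd x' y w
      simp only [sigmaEnd_apply, map_add, LinearMap.add_apply]; module)
    (fun r x y => Subtype.ext <| LinearMap.ext fun w => by
      change sigmaEnd (r • x) y w = r • sigmaEnd x y w
      simp only [sigmaEnd_apply, map_smul, LinearMap.smul_apply, smul_eq_mul]; module)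
    (fun x y y' => Subtype.ext <| LinearMap.ext fun w => by
      change sigmaEnd x (y + y') w = sigmaEnd x y w + sigmaEnd x y' w
      simp only [sigmaEnd_apply, map_add, LinearMap.add_apply]; module)
    (fun r x y => Subtype.ext <| LinearMap.ext fun w => by
      change sigmaEnd x (r • y) w = r • sigmaEnd x y w
      simp only [sigmaEnd_apply, map_smul, LinearMap.smul_apply, smul_eq_mul]; module)

theorem sigma_coe_apply (x y w : W k V) :
    (sigma x y : Module.End k (W k V)) w
      = LinearMap.dualProd k V x w • y - LinearMap.dualProd k V y w • x := rfl

theorem sigma_swap (x y : W k V) : sigma x y = -sigma y x := by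
  refine Subtype.ext (LinearMap.ext fun w => ?_)
  change sigmaEnd x y w = -sigmaEnd y x w
  simp only [sigmaEnd_apply]; module

variable (k V) in
/-- The half-spin module `S⁺`: the even part of the exterior algebra of `V`. -/
abbrev SPlus : Submodule k (ExteriorAlgebra k V) := evenOdd (0 : QuadraticForm k V) 0

theorem vectorAction_mem (i : ZMod 2) (w : W k V) (s : ExteriorAlgebra k V)
    (hs : s ∈ evenOdd (0 : QuadraticForm k V) i) :
    vectorAction w s ∈ evenOdd (0 : QuadraticForm k V) (i + 1) := by
  rw [vectorAction_apply]
  have hmul : ∀ (j : ZMod 2) (v : V) (x : ExteriorAlgebra k V),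
      x ∈ evenOdd (0 : QuadraticForm k V) j →
        ExteriorAlgebra.ι k v * x ∈ evenOdd (0 : QuadraticForm k V) (j + 1) := by
    intro j v x hx
    rw [add_comm]
    exact CliffordAlgebra.evenOdd_mul_le _ _ _
      (Submodule.mul_mem_mul (CliffordAlgebra.ι_mem_evenOdd_one _ v) hx)
  refine add_mem (hmul i w.2 s hs) ?_
  have key : ∀ x : ExteriorAlgebra k V, ∀ j : ZMod 2, x ∈ evenOdd (0 : QuadraticForm k V) j →
      contractLeft (Q := (0 : QuadraticForm k V)) w.1 x
        ∈ evenOdd (0 : QuadraticForm k V) (j + 1) := by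
    intro x j hx
    induction x, hx using CliffordAlgebra.evenOdd_induction with
    | range_ι_pow x hx =>
      fin_cases j
      · change x ∈ LinearMap.range (CliffordAlgebra.ι (0 : QuadraticForm k V)) ^ 0 at hx
        rw [pow_zero] at hx
        obtain ⟨r, rfl⟩ := Submodule.mem_one.1 hx
        rw [CliffordAlgebra.contractLeft_algebraMap]
        exact zero_mem _
      · change x ∈ LinearMap.range (CliffordAlgebra.ι (0 : QuadraticForm k V)) ^ 1 at hx
        rw [pow_one] at hx
        obtain ⟨r, rfl⟩ := hx
        rw [CliffordAlgebra.contractLeft_ι]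
        exact SetLike.algebraMap_mem_graded (evenOdd (0 : QuadraticForm k V)) _
    | add x y hx hy ihx ihy => rw [map_add]; exact add_mem ihx ihy
    | ι_mul_ι_mul a b x hx ih =>
      rw [mul_assoc, CliffordAlgebra.contractLeft_ι_mul, CliffordAlgebra.contractLeft_ι_mul,
        mul_sub, mul_smul_comm]
      have h1 := hmul _ a _ (hmul _ b _ ih)
      rw [add_assoc (j + 1), CharTwo.add_self_eq_zero, add_zero] at h1
      exact sub_mem (Submodule.smul_mem _ _ (hmul _ b _ hx))
        (sub_mem (Submodule.smul_mem _ _ (hmul _ a _ hx)) h1)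
  exact key s i hs

end Clifford

section HalfSpin

variable {k V : Type*} [Field k] [AddCommGroup V] [Module k V]
  {l : ℕ} (v : Module.Basis (Fin l) k V)

/-- The vectors `v_i` of the basis, in `V ⊕ V*`. -/
noncomputable def vec (i : Fin l) : W k V := (0, v i)

/-- The vectors `f_i` of the dual basis, in `V ⊕ V*`. -/
noncomputable def covec (i : Fin l) : W k V := (v.coord i, 0)

/-- The embedding of `so(V ⊕ V*)` into the Clifford algebra with
`σ_{x,y} ↦ -½ [x, y]`; see `soToClifford_sigma`. -/
noncomputable def soToClifford : So k V →ₗ[k] CliffordAlgebra (QuadraticForm.dualProd k V) where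
  toFun A := -(1 / 4 : k) • ∑ i,
    (vectorComm (covec v i) (A.1 (vec v i)) + vectorComm (vec v i) (A.1 (covec v i)))
  map_add' A B := by
    rw [← smul_add, ← Finset.sum_add_distrib]
    congr 1
    refine Finset.sum_congr rfl fun i _ => ?_
    change vectorComm _ (A.1 _ + B.1 _) + vectorComm _ (A.1 _ + B.1 _) = _
    rw [map_add, map_add]
    abel
  map_smul' r A := by
    rw [RingHom.id_apply, smul_comm r]
    congr 1
    rw [Finset.smul_sum]
    refine Finset.sum_congr rfl fun i _ => ?_
    change vectorComm (covec v i) (r • A.1 (vec v i)) + vectorComm (vec v i) (r • A.1 (covec v i))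
      = r • (vectorComm (covec v i) (A.1 (vec v i)) + vectorComm (vec v i) (A.1 (covec v i)))
    rw [map_smul, map_smul, smul_add]

theorem soToClifford_apply (A : So k V) :
    soToClifford v A = -(1 / 4 : k) • ∑ i,
      (vectorComm (covec v i) (A.1 (vec v i)) + vectorComm (vec v i) (A.1 (covec v i))) := rfl

theorem dualProd_covec (i : Fin l) (w : W k V) :
    LinearMap.dualProd k V (covec v i) w = v.coord i w.2 := by
  simp [covec]

theorem dualProd_vec (i : Fin l) (w : W k V) :
    LinearMap.dualProd k V (vec v i) w = w.1 (v i) := by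
  simp [vec]

theorem sum_dualProd (w : W k V) :
    ∑ i, (LinearMap.dualProd k V (vec v i) w • covec v i
      + LinearMap.dualProd k V (covec v i) w • vec v i) = w := by
  simp only [dualProd_covec, dualProd_vec]
  refine Prod.ext ?_ ?_
  · simp only [Prod.fst_sum, Prod.fst_add, Prod.smul_fst, covec, vec, smul_zero, add_zero]
    exact v.sum_dual_apply_smul_coord w.1
  · simp only [Prod.snd_sum, Prod.snd_add, Prod.smul_snd, covec, vec, smul_zero, zero_add]
    exact v.sum_repr w.2

theorem soToClifford_sigma (x y : W k V) :
    soToClifford v (sigma x y) = -(1 / 2 : k) • vectorComm x y := by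
  have key : ∀ x y : W k V, ∑ i,
      (vectorComm (covec v i) (LinearMap.dualProd k V (vec v i) x • y)
        + vectorComm (vec v i) (LinearMap.dualProd k V (covec v i) x • y))
      = vectorComm x y := by
    intro x y
    conv_rhs => rw [← sum_dualProd v x]
    simp only [map_sum, map_add, map_smul, LinearMap.sum_apply, LinearMap.add_apply,
      LinearMap.smul_apply]
  have h4 : (1 / 4 : k) * 2 = 1 / 2 := by
    by_cases h : (2 : k) = 0
    · rw [h]; simp
    · have h' : (4 : k) = 2 * 2 := by norm_num
      rw [h']; field_simp
  have hswap : vectorComm y x = -vectorComm x y := by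
    rw [vectorComm_apply, vectorComm_apply, neg_sub]
  have : soToClifford v (sigma x y) = -(1 / 4 : k) • (vectorComm x y - vectorComm y x) := by
    rw [← key x y, ← key y x, ← Finset.sum_sub_distrib, soToClifford_apply]
    congr 1
    refine Finset.sum_congr rfl fun i _ => ?_
    rw [sigma_coe_apply, sigma_coe_apply, map_sub, map_sub,
      dualProd_comm x, dualProd_comm x, dualProd_comm y, dualProd_comm y]
    abel
  rw [this, hswap, sub_neg_eq_add, ← two_smul k, smul_smul, neg_mul, h4]

theorem spinAction_vectorComm_mem (x y : W k V) (s : ExteriorAlgebra k V) (hs : s ∈ SPlus k V) :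
    spinAction (vectorComm x y) s ∈ SPlus k V := by
  rw [vectorComm_apply, map_sub, map_mul, map_mul, spinAction_ι, spinAction_ι]
  exact sub_mem (vectorAction_mem 1 x _ (vectorAction_mem 0 y _ hs))
    (vectorAction_mem 1 y _ (vectorAction_mem 0 x _ hs))

theorem spinAction_soToClifford_mem (A : So k V) (s : ExteriorAlgebra k V) (hs : s ∈ SPlus k V) :
    spinAction (soToClifford v A) s ∈ SPlus k V := by
  rw [soToClifford_apply, map_smul, map_sum, LinearMap.smul_apply, LinearMap.sum_apply]
  refine Submodule.smul_mem _ _ (Submodule.sum_mem _ fun i _ => ?_)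
  rw [map_add, LinearMap.add_apply]
  exact add_mem (spinAction_vectorComm_mem _ _ s hs) (spinAction_vectorComm_mem _ _ s hs)

/-- The half-spin representation `ρ⁺` of `so(V ⊕ V*)` on `S⁺`. -/
noncomputable def halfSpin : So k V →ₗ[k] SPlus k V →ₗ[k] SPlus k V :=
  LinearMap.mk₂ k
    (fun A s => ⟨spinAction (soToClifford v A) s.1, spinAction_soToClifford_mem v A s.1 s.2⟩)
    (fun A B s => Subtype.ext <| by
      change spinAction (soToClifford v (A + B)) s.1
        = spinAction (soToClifford v A) s.1 + spinAction (soToClifford v B) s.1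
      rw [map_add, map_add, LinearMap.add_apply])
    (fun r A s => Subtype.ext <| by
      change spinAction (soToClifford v (r • A)) s.1 = r • spinAction (soToClifford v A) s.1
      rw [map_smul, map_smul, LinearMap.smul_apply])
    (fun A s t => Subtype.ext <| map_add (spinAction (soToClifford v A)) s.1 t.1)
    (fun r A s => Subtype.ext <| map_smul (spinAction (soToClifford v A)) r s.1)

/-- The bilinear form `b̂(s, t) = Φ(ŝ t)` on `S⁺`, where `s ↦ ŝ` is the involution of the exterior
algebra that fixes the vectors and `Φ` is the coefficient of `v₁ ⋯ v_l`. -/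
noncomputable def bHat : SPlus k V →ₗ[k] SPlus k V →ₗ[k] k :=
  LinearMap.mk₂ k
    (fun s t => v.ExteriorAlgebra.coord Finset.univ
      (CliffordAlgebra.reverse (Q := (0 : QuadraticForm k V)) s.1 * t.1))
    (fun s s' t => by rw [Submodule.coe_add, map_add, add_mul, map_add])
    (fun r s t => by rw [Submodule.coe_smul, map_smul, smul_mul_assoc, map_smul])
    (fun s t t' => by rw [Submodule.coe_add, mul_add, map_add])
    (fun r s t => by rw [Submodule.coe_smul, mul_smul_comm, map_smul])

/-- The linear form `A ↦ b̂(ρ⁺(A)(s), t)` on `so(V ⊕ V*)`. -/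
noncomputable def spinForm : SPlus k V →ₗ[k] SPlus k V →ₗ[k] Module.Dual k (So k V) :=
  LinearMap.mk₂ k (fun s t => (bHat v).flip t ∘ₗ (halfSpin v).flip s)
    (fun s s' t => LinearMap.ext fun A => by
      change bHat v (halfSpin v A (s + s')) t = bHat v (halfSpin v A s) t + bHat v (halfSpin v A s') t
      rw [map_add, map_add, LinearMap.add_apply])
    (fun r s t => LinearMap.ext fun A => by
      change bHat v (halfSpin v A (r • s)) t = r • bHat v (halfSpin v A s) t
      rw [map_smul, map_smul, LinearMap.smul_apply])
    (fun s t t' => LinearMap.ext fun A => map_add (bHat v (halfSpin v A s)) t t')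
    (fun r s t => LinearMap.ext fun A => map_smul (bHat v (halfSpin v A s)) r t)

theorem spinForm_apply (s t : SPlus k V) (A : So k V) :
    spinForm v s t A = bHat v (halfSpin v A s) t := rfl

/-- The endomorphism `w ↦ ∑ᵢ (ψ(σ_{f_i,w}) v_i + ψ(σ_{v_i,w}) f_i)`. -/
noncomputable def ofDualEnd (ψ : Module.Dual k (So k V)) : Module.End k (W k V) :=
  ∑ i, ((ψ ∘ₗ sigma (covec v i)).smulRight (vec v i)
    + (ψ ∘ₗ sigma (vec v i)).smulRight (covec v i))

theorem ofDualEnd_apply (ψ : Module.Dual k (So k V)) (w : W k V) :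
    ofDualEnd v ψ w = ∑ i, (ψ (sigma (covec v i) w) • vec v i
      + ψ (sigma (vec v i) w) • covec v i) := by
  simp [ofDualEnd]

theorem dualProd_ofDualEnd (ψ : Module.Dual k (So k V)) (x y : W k V) :
    LinearMap.dualProd k V x (ofDualEnd v ψ y) = ψ (sigma x y) := by
  conv_rhs => rw [← sum_dualProd v x]
  rw [ofDualEnd_apply]
  simp only [map_sum, map_add, map_smul, LinearMap.sum_apply, LinearMap.add_apply,
    LinearMap.smul_apply, smul_eq_mul]
  refine Finset.sum_congr rfl fun i _ => ?_
  rw [dualProd_comm x, dualProd_comm x]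
  ring

theorem ofDualEnd_mem (ψ : Module.Dual k (So k V)) : ofDualEnd v ψ ∈ So k V := by
  rw [mem_So]
  intro x y
  rw [dualProd_comm, dualProd_ofDualEnd, dualProd_ofDualEnd, sigma_swap, map_neg]

/-- The element `A` of `so(V ⊕ V*)` with `½ tr(B A) = ψ(B)` for all `B` in `so(V ⊕ V*)`; see
`half_trace_ofDual`. -/
noncomputable def ofDual : Module.Dual k (So k V) →ₗ[k] So k V where
  toFun ψ := ⟨ofDualEnd v ψ, ofDualEnd_mem v ψ⟩
  map_add' ψ χ := Subtype.ext <| LinearMap.ext fun w => by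
    change ofDualEnd v (ψ + χ) w = ofDualEnd v ψ w + ofDualEnd v χ w
    simp only [ofDualEnd_apply, LinearMap.add_apply, ← Finset.sum_add_distrib]
    exact Finset.sum_congr rfl fun i _ => by module
  map_smul' r ψ := Subtype.ext <| LinearMap.ext fun w => by
    change ofDualEnd v (r • ψ) w = r • ofDualEnd v ψ w
    simp only [ofDualEnd_apply, LinearMap.smul_apply, Finset.smul_sum]
    exact Finset.sum_congr rfl fun i _ => by module

theorem eq_sum_sigma (h2 : (2 : k) ≠ 0) (A : So k V) :
    A = (1 / 2 : k) • ∑ i, (sigma (covec v i) (A.1 (vec v i))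
      + sigma (vec v i) (A.1 (covec v i))) := by
  have h : (2 : k) • A = ∑ i, (sigma (covec v i) (A.1 (vec v i))
      + sigma (vec v i) (A.1 (covec v i))) := by
    refine Subtype.ext (LinearMap.ext fun w => ?_)
    have hA := mem_So.1 A.2
    rw [AddSubmonoidClass.coe_finsetSum, LinearMap.sum_apply]
    change (2 : k) • A.1 w = ∑ i, (sigmaEnd (covec v i) (A.1 (vec v i)) w
      + sigmaEnd (vec v i) (A.1 (covec v i)) w)
    simp only [sigmaEnd_apply, hA]
    have e1 := congrArg A.1 (sum_dualProd v w)
    have e2 := sum_dualProd v (A.1 w)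
    simp only [map_sum, map_add, map_smul] at e1
    rw [two_smul]
    nth_rewrite 1 [← e1]
    rw [← e2, ← Finset.sum_add_distrib]
    simp only [e2]
    exact Finset.sum_congr rfl fun i _ => by module
  rw [← h, smul_smul, one_div, inv_mul_cancel₀ h2, one_smul]

/-- The trace formula that characterizes `ofDual`. -/
theorem half_trace_ofDual (h2 : (2 : k) ≠ 0) (ψ : Module.Dual k (So k V)) (A : So k V) :
    (1 / 2 : k) * LinearMap.trace k (W k V) (A.1 * (ofDual v ψ).1) = ψ A := by
  have : Module.Finite k V := Module.Finite.of_basis v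
  have key : ∀ x y : W k V, (1 / 2 : k) *
      LinearMap.trace k (W k V) ((sigma x y).1 * (ofDual v ψ).1) = ψ (sigma x y) := by
    intro x y
    have hs := map_sub (LinearMap.trace k (W k V))
      (((LinearMap.dualProd k V x) ∘ₗ ofDualEnd v ψ).smulRight y)
      (((LinearMap.dualProd k V y) ∘ₗ ofDualEnd v ψ).smulRight x)
    have e : (sigma x y).1 * (ofDual v ψ).1
        = ((LinearMap.dualProd k V x) ∘ₗ ofDualEnd v ψ).smulRight y
          - ((LinearMap.dualProd k V y) ∘ₗ ofDualEnd v ψ).smulRight x := rfl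
    rw [e]
    refine (congrArg _ hs).trans ?_
    rw [LinearMap.trace_smulRight, LinearMap.trace_smulRight, LinearMap.comp_apply,
      LinearMap.comp_apply, dualProd_ofDualEnd, dualProd_ofDualEnd, sigma_swap y x, map_neg]
    field_simp
    ring
  let T : So k V →ₗ[k] k := (1 / 2 : k) • (LinearMap.trace k (W k V) ∘ₗ
    (LinearMap.mulRight k (ofDual v ψ).1) ∘ₗ (So k V).toSubmodule.subtype)
  change T A = ψ A
  have key' : ∀ x y, T (sigma x y) = ψ (sigma x y) := key
  rw [eq_sum_sigma v h2 A]
  simp only [map_smul, map_sum, map_add, key']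

/-- The invariant product `S⁺ × S⁺ → so(V ⊕ V*)` of two odd elements, determined by
`½ tr(A [s, t]) = b̂(ρ⁺(A)(s), t)`; see `half_trace_oddBracket`. -/
noncomputable def oddBracket : SPlus k V →ₗ[k] SPlus k V →ₗ[k] So k V :=
  (spinForm v).compr₂ (ofDual v)

theorem half_trace_oddBracket (h2 : (2 : k) ≠ 0) (s t : SPlus k V) (A : So k V) :
    (1 / 2 : k) * LinearMap.trace k (W k V) (A.1 * (oddBracket v s t).1)
      = bHat v (halfSpin v A s) t :=
  half_trace_ofDual v h2 _ _

/-- The `ℤ/2`-graded algebra `so(V ⊕ V*) ⊕ S⁺`. -/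
noncomputable def algebra : Z2Algebra k (So k V) (SPlus k V) :=
  Z2Algebra.ofAction (halfSpin v) (oddBracket v)

end HalfSpin

end TypeD

/-! Everything is computed in a weight basis. The monomial e_J = ∏_{j ∈ J} v_j is labelled by the
0-1 vector μ = ind J; its true weight is μ - ½(1,…,1). A vector v_i or f_i adds ±ε_i to μ, and all
signs that occur are (-1) to the value of a single bilinear form, `lowForm`. In these terms b̂(e_μ,
e_ν) is nonzero only for μ + ν = 1, and [e_μ, e_ν] is a multiple of the root element of μ + ν - 1, a
Cartan element if μ + ν = 1, and 0 otherwise.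

Jacobi identity. The identities with an even argument hold for every l, because ρ⁺ is a
representation and b̂ is invariant, so that the odd product is equivariant (`lie_oddBracket`). The
form b̂ is ε-symmetric with ε = (-1)^(l(l-1)/2); hence the odd product is skew for l ≡ 0 and
symmetric for l ≡ 2 modulo 4, which separates the Lie case from the super case. What remains is the
cyclic sum J(s, t, u) of three odd elements, an equivariant trilinear map. Lowering operators kill
e_0 and generate S⁺ from e_1 (the top monomial), and raising operators generate S⁺ from e_0;
therefore J = 0 as soon as J(e_0, e_1, ·) = 0 (`trilinear_eq_zero`). That operator is diagonal. Its
eigenvalue `jacCoeff` on e_J is (l - 2|J|)/4, corrected only for |J| in {0, 2, l-2, l}. For l ≥ 10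
the eigenvalues for |J| = 4 and |J| = 6 differ by 1, so J ≠ 0; for l = 2, 4, 8 all vanish, and for l
= 6 they are ±3 and ±3/2.

Simplicity (`ofAction_isSimple`). For l ≥ 3 the module S⁺ is irreducible and faithful and the odd
products span the even part. A product of three different Cartan elements kills the adjoint module
but is injective on S⁺, so every nonzero ideal meets S⁺ and is everything.

Identifications. For l = 4 the odd products act on the 8-dimensional orthogonal space S⁺ as
elementary skew maps, whence 𝔤 = so(S⁺ ⊕ k). For l = 2 one of the two factors of so₄ = sl₂ × sl₂
acts on the plane S⁺ as sp₂ and the other acts trivially. For l = 8 the lattice E₈ is the union of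
D₈ and a coset that carries the weights of S⁺; root elements and weight vectors, rescaled by signs,
multiply like Chevalley root vectors (`rootVec_mul_rootVec`). For l = 6 one has S⁺ = Λ⁰ ⊕ Λ² ⊕ Λ⁴ ⊕
Λ⁶, and Λ² with the Pfaffian is H₃(Q) with its norm (`cross_theta`). The raising and lowering
operators of so₁₂ become those of the Freudenthal space, and equality of the two triple products is
again spread from the pair (e_0, e_1) (`tripleDefect_eq_zero`). Only Leibniz rules with an extreme
first argument are needed for this, and they follow from the symmetry of t(a, b × d) alone. -/

namespace TypeD
open CliffordAlgebra (contractLeft evenOdd)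
section Instances
variable (k V : Type*) [Field k] [AddCommGroup V] [Module k V]
instance : LieRing (So k V) := inferInstance
instance : LieAlgebra k (So k V) := inferInstance
instance : AddGroup (So k V) := AddCommGroup.toAddGroup
instance : AddMonoid (So k V) := AddCommMonoid.toAddMonoid
instance : Add (So k V) := AddSemigroup.toAdd
instance : Zero (So k V) := AddZero.toZero
instance : Neg (So k V) := SubNegMonoid.toNeg
instance : Sub (So k V) := SubNegMonoid.toSub
instance : SMul k (So k V) := SMulZeroClass.toSMul
end Instances

/-! ### Monomials of the exterior algebra and their signs -/

section Basis

variable {k V : Type*} [Field k] [AddCommGroup V] [Module k V]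
  {l : ℕ} (v : Module.Basis (Fin l) k V)

theorem extBasis_eq_prod (J : Finset (Fin l)) :
    v.ExteriorAlgebra J = ((J.sort (· ≤ ·)).map fun i => ExteriorAlgebra.ι k (v i)).prod := by
  rw [ExteriorAlgebra.basis_apply_ofCard v rfl, ExteriorAlgebra.ιMulti_family,
    ExteriorAlgebra.ιMulti_apply]
  rw [← Finset.listMap_orderEmbOfFin_finRange J rfl, List.map_map, List.ofFn_eq_map]
  rfl

@[simp]
theorem extBasis_empty : v.ExteriorAlgebra ∅ = 1 := by
  simp [extBasis_eq_prod]

theorem extBasis_insert {a : Fin l} {J : Finset (Fin l)} (h : ∀ x ∈ J, a < x) :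
    v.ExteriorAlgebra (insert a J) = ExteriorAlgebra.ι k (v a) * v.ExteriorAlgebra J := by
  rw [extBasis_eq_prod, extBasis_eq_prod, Finset.sort_insert (h₁ := fun x hx => (h x hx).le)
    (h₂ := fun ha => lt_irrefl _ (h a ha)), List.map_cons, List.prod_cons]

/-- The number of elements of `J` below `i`. -/
def countBelow (i : Fin l) (J : Finset (Fin l)) : ℕ := (J.filter (· < i)).card

/-- The new factor is moved past the factors below it. The induction strips off the least factor of
the monomial, so that each step is at most one transposition. -/
theorem ι_mul_extBasis (i : Fin l) (J : Finset (Fin l)) :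
    ExteriorAlgebra.ι k (v i) * v.ExteriorAlgebra J =
      if i ∈ J then 0 else (-1 : k) ^ countBelow i J • v.ExteriorAlgebra (insert i J) := by
  induction J using Finset.induction_on_min with
  | empty => simpa [countBelow] using (extBasis_insert v (a := i) (J := ∅) (by simp)).symm
  | insert a s ha ih =>
    have hna : a ∉ s := fun h => lt_irrefl _ (ha a h)
    rcases lt_trichotomy i a with h | h | h
    · have h1 : ∀ x ∈ insert a s, i < x := by
        intro x hx
        rcases Finset.mem_insert.1 hx with rfl | hx
        · exact h
        · exact h.trans (ha x hx)
      have h2 : i ∉ insert a s := fun h => lt_irrefl _ (h1 i h)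
      have h3 : countBelow i (insert a s) = 0 := by
        rw [countBelow, Finset.card_eq_zero, Finset.filter_eq_empty_iff]
        exact fun x hx => not_lt.2 (h1 x hx).le
      rw [if_neg h2, h3, extBasis_insert v h1, pow_zero, one_smul]
    · subst h
      rw [if_pos (Finset.mem_insert_self _ _), extBasis_insert v ha, ← mul_assoc,
        ExteriorAlgebra.ι_sq_zero, zero_mul]
    · have hsw : ExteriorAlgebra.ι k (v i) * ExteriorAlgebra.ι k (v a)
          = - (ExteriorAlgebra.ι k (v a) * ExteriorAlgebra.ι k (v i)) :=
        eq_neg_of_add_eq_zero_left (ExteriorAlgebra.ι_add_mul_swap _ _)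
      rw [extBasis_insert v ha, ← mul_assoc, hsw, neg_mul, mul_assoc, ih]
      have hm : i ∈ insert a s ↔ i ∈ s := by simp [h.ne']
      by_cases hi : i ∈ s
      · rw [if_pos hi, if_pos (hm.2 hi), mul_zero, neg_zero]
      · have h1 : ∀ x ∈ insert i s, a < x := by
          intro x hx
          rcases Finset.mem_insert.1 hx with rfl | hx
          · exact h
          · exact ha x hx
        have h3 : countBelow i (insert a s) = countBelow i s + 1 := by
          rw [countBelow, Finset.filter_insert, if_pos h, Finset.card_insert_of_notMem (by simp [hna])]
          rfl
        rw [if_neg hi, if_neg (fun h => hi (hm.1 h)), h3, Finset.insert_comm, extBasis_insert v h1,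
          mul_smul_comm, pow_succ, mul_neg_one, neg_smul]

/-- The derivation also passes exactly the factors below `i`, so the sign is the one of left
multiplication; both rules can later be written as one. -/
theorem contract_extBasis (i : Fin l) (J : Finset (Fin l)) :
    contractLeft (Q := (0 : QuadraticForm k V)) (v.coord i) (v.ExteriorAlgebra J) =
      if i ∈ J then (-1 : k) ^ countBelow i J • v.ExteriorAlgebra (J.erase i) else 0 := by
  induction J using Finset.induction_on_min with
  | empty => rw [extBasis_empty, if_neg (by simp)]; exact CliffordAlgebra.contractLeft_one (Q := (0 : QuadraticForm k V)) _
  | insert a s ha ih =>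
    have hna : a ∉ s := fun h => lt_irrefl _ (ha a h)
    have key : contractLeft (Q := (0 : QuadraticForm k V)) (v.coord i)
        (ExteriorAlgebra.ι k (v a) * v.ExteriorAlgebra s) = v.coord i (v a) • v.ExteriorAlgebra s
        - ExteriorAlgebra.ι k (v a) * contractLeft (Q := (0 : QuadraticForm k V)) (v.coord i)
          (v.ExteriorAlgebra s) :=
      CliffordAlgebra.contractLeft_ι_mul (Q := (0 : QuadraticForm k V)) _ _ _
    rw [extBasis_insert v ha, key, ih, Module.Basis.coord_apply, Module.Basis.repr_self]
    by_cases hia : i = a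
    · subst hia
      have h3 : countBelow i (insert i s) = 0 := by
        rw [countBelow, Finset.card_eq_zero, Finset.filter_eq_empty_iff]
        intro x hx
        rcases Finset.mem_insert.1 hx with rfl | hx
        · exact lt_irrefl _
        · exact not_lt.2 (ha x hx).le
      simp [hna, h3]
    · have hm : i ∈ insert a s ↔ i ∈ s := by simp [hia]
      rw [Finsupp.single_eq_of_ne hia, zero_smul, zero_sub]
      by_cases hi : i ∈ s
      · have h3 : countBelow i (insert a s) = countBelow i s + 1 := by
          rw [countBelow, Finset.filter_insert, if_pos (ha i hi),
            Finset.card_insert_of_notMem (by simp [hna])]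
          rfl
        rw [if_pos hi, if_pos (hm.2 hi), h3, Finset.erase_insert_of_ne (Ne.symm hia),
          extBasis_insert v (fun x hx => ha x (Finset.mem_of_mem_erase hx)),
          mul_smul_comm, pow_succ, mul_neg_one, neg_smul]
      · rw [if_neg hi, if_neg (fun h => hi (hm.1 h)), mul_zero, neg_zero]


/-- The indicator vector of a subset. -/
def ind (J : Finset (Fin l)) : Fin l → ℤ := fun i => if i ∈ J then 1 else 0

/-- The bilinear form `∑_{j < i} aᵢ bⱼ`. -/
def lowForm (a b : Fin l → ℤ) : ℤ := ∑ i, ∑ j, if j < i then a i * b j else 0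

theorem lowForm_add_left (a a' b : Fin l → ℤ) :
    lowForm (a + a') b = lowForm a b + lowForm a' b := by
  simp only [lowForm, ← Finset.sum_add_distrib]
  refine Finset.sum_congr rfl fun i _ => Finset.sum_congr rfl fun j _ => ?_
  split_ifs <;> simp [add_mul]

theorem lowForm_add_right (a b b' : Fin l → ℤ) :
    lowForm a (b + b') = lowForm a b + lowForm a b' := by
  simp only [lowForm, ← Finset.sum_add_distrib]
  refine Finset.sum_congr rfl fun i _ => Finset.sum_congr rfl fun j _ => ?_
  split_ifs <;> simp [mul_add]

theorem lowForm_neg_left (a b : Fin l → ℤ) : lowForm (-a) b = -lowForm a b := by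
  have := lowForm_add_left (-a) a b
  rw [neg_add_cancel] at this
  have h0 : lowForm (0 : Fin l → ℤ) b = 0 := by simp [lowForm]
  omega

theorem lowForm_neg_right (a b : Fin l → ℤ) : lowForm a (-b) = -lowForm a b := by
  have := lowForm_add_right a (-b) b
  rw [neg_add_cancel] at this
  have h0 : lowForm a (0 : Fin l → ℤ) = 0 := by simp [lowForm]
  omega

theorem lowForm_single_left (i : Fin l) (r : ℤ) (b : Fin l → ℤ) :
    lowForm (Pi.single i r) b = r * ∑ j, if j < i then b j else 0 := by
  rw [lowForm, Finset.sum_eq_single i, Finset.mul_sum]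
  · refine Finset.sum_congr rfl fun j _ => ?_
    split_ifs <;> simp
  · intro j _ hj
    simp [hj]
  · simp

/-- Here the signs become bilinear: a count on subsets is replaced by a form on integral vectors, so
that signs of composite operators can be added up. -/
theorem lowForm_single_ind (i : Fin l) (J : Finset (Fin l)) (r : ℤ) :
    lowForm (Pi.single i r) (ind J) = r * countBelow i J := by
  rw [lowForm_single_left, countBelow, Finset.card_filter, ← Finset.sum_filter]
  have : Finset.univ.filter (· < i) ∩ J = J.filter (· < i) := by
    ext
    simp [and_comm]
  simp [ind, this]

variable (k) in
/-- The sign `(-1) ^ n` in `k`. -/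
def sgn (n : ℤ) : k := ((n.negOnePow : ℤˣ) : ℤ)

theorem sgn_add (m n : ℤ) : sgn k (m + n) = sgn k m * sgn k n := by
  simp [sgn, Int.negOnePow_add]

theorem sgn_even {n : ℤ} (h : Even n) : sgn k n = 1 := by
  simp [sgn, Int.negOnePow_even n h]

theorem sgn_odd {n : ℤ} (h : Odd n) : sgn k n = -1 := by
  simp [sgn, Int.negOnePow_odd n h]

theorem sgn_natCast (n : ℕ) : sgn k n = (-1) ^ n := by
  rcases Nat.even_or_odd n with h | h
  · rw [sgn_even (by exact_mod_cast h), h.neg_one_pow]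
  · rw [sgn_odd (by exact_mod_cast h), h.neg_one_pow]

theorem sgn_mul_self (n : ℤ) : sgn k n * sgn k n = 1 := by
  rw [← sgn_add, sgn_even (Even.add_self n)]

theorem sgn_neg (n : ℤ) : sgn k (-n) = sgn k n := by
  simp [sgn, Int.negOnePow_neg]

theorem sgn_congr {m n : ℤ} (h : Even (m + n)) : sgn k m = sgn k n := by
  have : sgn k m * sgn k n = 1 := by rw [← sgn_add, sgn_even h]
  calc sgn k m = sgn k m * (sgn k n * sgn k n) := by rw [sgn_mul_self, mul_one]
    _ = sgn k n := by rw [← mul_assoc, this, one_mul]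

theorem sgn_ne_zero (n : ℤ) : sgn k n ≠ 0 := by
  intro h
  have := sgn_mul_self (k := k) n
  simp [h] at this

/-- A vector is a `0`-`1`-vector. -/
def IsIndicator (μ : Fin l → ℤ) : Prop := ∀ i, μ i = 0 ∨ μ i = 1

open scoped Classical in
/-- The basis vector of weight `μ` of the exterior algebra, or `0` if `μ` is not a weight. -/
noncomputable def weightVector (μ : Fin l → ℤ) : ExteriorAlgebra k V :=
  if IsIndicator μ then v.ExteriorAlgebra (Finset.univ.filter fun i => μ i = 1) else 0

theorem isIndicator_ind (J : Finset (Fin l)) : IsIndicator (ind J) := by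
  intro i
  by_cases h : i ∈ J <;> simp [ind, h]

theorem exists_ind {μ : Fin l → ℤ} (h : IsIndicator μ) : ∃ J, μ = ind J := by
  refine ⟨Finset.univ.filter fun i => μ i = 1, funext fun i => ?_⟩
  rcases h i with h | h <;> simp [ind, h]

theorem ind_injective : Function.Injective (ind (l := l)) := by
  intro I J h
  ext i
  have := congrFun h i
  by_cases h1 : i ∈ I <;> by_cases h2 : i ∈ J <;> simp_all [ind]

@[simp]
theorem weightVector_ind (J : Finset (Fin l)) : weightVector v (ind J) = v.ExteriorAlgebra J := by
  rw [weightVector, if_pos (isIndicator_ind J)]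
  congr 1
  ext i
  simp [ind]

theorem weightVector_of_not {μ : Fin l → ℤ} (h : ¬IsIndicator μ) : weightVector v μ = 0 := by
  rw [weightVector, if_neg h]

/-- The weight of the vector `v_i` (for `(i, true)`) or `f_i` (for `(i, false)`). -/
def wt (a : Fin l × Bool) : Fin l → ℤ := Pi.single a.1 (if a.2 then 1 else -1)

/-- The vector `v_i` (for `(i, true)`) or `f_i` (for `(i, false)`). -/
noncomputable def unitVec (a : Fin l × Bool) : W k V := if a.2 then vec v a.1 else covec v a.1

theorem vectorAction_vec (i : Fin l) (s : ExteriorAlgebra k V) :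
    vectorAction (vec v i) s = ExteriorAlgebra.ι k (v i) * s := by
  rw [vectorAction_apply]
  simp [vec]

theorem vectorAction_covec (i : Fin l) (s : ExteriorAlgebra k V) :
    vectorAction (covec v i) s = contractLeft (Q := (0 : QuadraticForm k V)) (v.coord i) s := by
  rw [vectorAction_apply]
  simp [covec]

/-- Multiplication and contraction obey one formula: the value 0 at non-weights covers a repeated
factor as well as a missing one, and the sign of `wt a` does not matter modulo 2. -/
theorem vectorAction_unitVec (a : Fin l × Bool) (J : Finset (Fin l)) :
    vectorAction (unitVec v a) (v.ExteriorAlgebra J)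
      = sgn k (lowForm (wt a) (ind J)) • weightVector v (ind J + wt a) := by
  obtain ⟨i, b⟩ := a
  rw [wt, lowForm_single_ind]
  have hs : sgn k ((if b then 1 else -1) * (countBelow i J : ℤ)) = (-1 : k) ^ countBelow i J := by
    cases b <;> simp [sgn_neg, sgn_natCast]
  dsimp only
  rw [hs]
  cases b
  · rw [unitVec, if_neg (by simp), vectorAction_covec, contract_extBasis]
    by_cases hi : i ∈ J
    · have : ind J + Pi.single i (-1) = ind (J.erase i) := by
        ext j
        by_cases hj : j = i
        · subst hj; simp [ind, hi]
        · simp [ind, hj]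
      simp [hi, this]
    · rw [if_neg hi, if_neg (by simp), weightVector_of_not, smul_zero]
      intro h
      have := h i
      simp [ind, hi] at this
  · rw [unitVec, if_pos rfl, vectorAction_vec, ι_mul_extBasis]
    by_cases hi : i ∈ J
    · rw [if_pos hi, if_pos rfl, weightVector_of_not, smul_zero]
      intro h
      have := h i
      simp [ind, hi] at this
    · have : ind J + Pi.single i 1 = ind (insert i J) := by
        ext j
        by_cases hj : j = i
        · subst hj; simp [ind, hi]
        · simp [ind, hj]
      simp [hi, this]

end Basis
end TypeD

namespace TypeD
open CliffordAlgebra (contractLeft evenOdd)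

/-! ### The spin representation and its invariant form -/

section Clifford

variable {k V : Type*} [Field k] [AddCommGroup V] [Module k V]

/-- Polarization of w · w = q(w). -/
theorem vectorAction_anticomm (x y : W k V) (s : ExteriorAlgebra k V) :
    vectorAction x (vectorAction y s) + vectorAction y (vectorAction x s)
      = LinearMap.dualProd k V x y • s := by
  have h : ∀ w : W k V, vectorAction w (vectorAction w s) = (QuadraticForm.dualProd k V w) • s :=
    fun w => by
      have := LinearMap.congr_fun (vectorAction_sq w) s
      rwa [Module.End.mul_apply, Module.algebraMap_end_apply] at this
  have hxy := h (x + y)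
  simp only [map_add, LinearMap.add_apply, h x, h y] at hxy
  have e : QuadraticForm.dualProd k V (x + y) = QuadraticForm.dualProd k V x
      + QuadraticForm.dualProd k V y + LinearMap.dualProd k V x y := by
    simp [QuadraticForm.dualProd_apply, LinearMap.dualProd_apply_apply]; ring
  rw [e, add_smul, add_smul] at hxy
  have h1 := hxy
  rw [← sub_eq_zero] at h1 ⊢
  rw [← h1]
  abel

theorem lie_sigma (A : So k V) (x y : W k V) :
    ⁅A, sigma x y⁆ = sigma (A.1 x) y + sigma x (A.1 y) := by
  refine Subtype.ext (LinearMap.ext fun w => ?_)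
  have hA := mem_So.1 A.2
  change A.1 (sigmaEnd x y w) - sigmaEnd x y (A.1 w)
    = sigmaEnd (A.1 x) y w + sigmaEnd x (A.1 y) w
  simp only [sigmaEnd_apply, hA, map_sub, map_smul]
  module

end Clifford

section HalfSpin

variable {k V : Type*} [Field k] [AddCommGroup V] [Module k V]
  {l : ℕ} (v : Module.Basis (Fin l) k V)

include v in
/-- Two linear maps on `so(V ⊕ V*)` agree if they agree on the elements `σ_{x,y}`. -/
theorem so_ext {M : Type*} [AddCommGroup M] [Module k M] (h2 : (2 : k) ≠ 0)
    {f g : So k V →ₗ[k] M} (h : ∀ x y, f (sigma x y) = g (sigma x y)) (A : So k V) : f A = g A := by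
  rw [eq_sum_sigma v h2 A]
  simp only [map_smul, map_sum, map_add, h]

/-- The action of `so(V ⊕ V*)` on the exterior algebra. -/
noncomputable def spinOp : So k V →ₗ[k] Module.End k (ExteriorAlgebra k V) :=
  spinAction.toLinearMap ∘ₗ soToClifford v

theorem spinOp_sigma (x y : W k V) (s : ExteriorAlgebra k V) :
    spinOp v (sigma x y) s = -(1 / 2 : k) • (vectorAction x (vectorAction y s)
      - vectorAction y (vectorAction x s)) := by
  change spinAction (soToClifford v (sigma x y)) s = _
  rw [soToClifford_sigma, map_smul, vectorComm_apply, map_sub, map_mul, map_mul, spinAction_ι,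
    spinAction_ι]
  rfl

theorem halfSpin_coe (A : So k V) (s : SPlus k V) :
    (halfSpin v A s : ExteriorAlgebra k V) = spinOp v A s.1 := rfl

theorem spinOp_sigma_of_orthogonal (h2 : (2 : k) ≠ 0) {x y : W k V}
    (h : LinearMap.dualProd k V x y = 0) (s : ExteriorAlgebra k V) :
    spinOp v (sigma x y) s = -vectorAction x (vectorAction y s) := by
  have := vectorAction_anticomm x y s
  rw [h, zero_smul] at this
  rw [spinOp_sigma, eq_neg_of_add_eq_zero_right this, sub_neg_eq_add, ← two_smul k, smul_smul]
  field_simp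
  simp

/-- In the Clifford algebra the commutator of -½(xy - yx) with w is σ_{x,y}(w): move w to the left
by the anticommutation relations. The general case follows since the σ_{x,y} span. -/
theorem spinOp_vectorAction (h2 : (2 : k) ≠ 0) (A : So k V) (w : W k V) (s : ExteriorAlgebra k V) :
    spinOp v A (vectorAction w s) = vectorAction w (spinOp v A s) + vectorAction (A.1 w) s := by
  let f : So k V →ₗ[k] ExteriorAlgebra k V := (spinOp v).flip (vectorAction w s)
  let g : So k V →ₗ[k] ExteriorAlgebra k V := vectorAction w ∘ₗ (spinOp v).flip s
    + (vectorAction (k := k) (V := V)).flip s ∘ₗ LinearMap.applyₗ w ∘ₗ (So k V).toSubmodule.subtype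
  refine so_ext v h2 (f := f) (g := g) (fun x y => ?_) A
  change spinOp v (sigma x y) (vectorAction w s) = vectorAction w (spinOp v (sigma x y) s)
    + vectorAction (sigmaEnd x y w) s
  have h1 := vectorAction_anticomm x w s
  have h1' := vectorAction_anticomm y w s
  have h3 := vectorAction_anticomm x w (vectorAction y s)
  have h4 := vectorAction_anticomm y w (vectorAction x s)
  rw [spinOp_sigma, spinOp_sigma, sigmaEnd_apply, eq_sub_of_add_eq h1, eq_sub_of_add_eq h1',
    map_sub, map_sub, eq_sub_of_add_eq h3, eq_sub_of_add_eq h4, map_smul, map_smul, map_smul,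
    map_sub, map_sub, map_smul, map_smul, LinearMap.sub_apply, LinearMap.smul_apply,
    LinearMap.smul_apply]
  generalize vectorAction w (vectorAction x (vectorAction y s)) = a
  generalize vectorAction w (vectorAction y (vectorAction x s)) = b
  match_scalars <;> field_simp <;> ring

/-- For B = σ_{x,y} the commutator with A acts as a derivation on the two vector factors of B, which
is also what `lie_sigma` says about the bracket. -/
theorem spinOp_lie (h2 : (2 : k) ≠ 0) (A B : So k V) (s : ExteriorAlgebra k V) :
    spinOp v ⁅A, B⁆ s = spinOp v A (spinOp v B s) - spinOp v B (spinOp v A s) := by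
  let f : So k V →ₗ[k] ExteriorAlgebra k V := (spinOp v).flip s ∘ₗ
    (LieModule.toEnd k (So k V) (So k V) A)
  let g : So k V →ₗ[k] ExteriorAlgebra k V := spinOp v A ∘ₗ (spinOp v).flip s
    - (spinOp v).flip (spinOp v A s)
  refine so_ext v h2 (f := f) (g := g) (fun x y => ?_) B
  change spinOp v ⁅A, sigma x y⁆ s = spinOp v A (spinOp v (sigma x y) s)
    - spinOp v (sigma x y) (spinOp v A s)
  rw [lie_sigma, map_add, LinearMap.add_apply]
  simp only [spinOp_sigma, map_smul, map_sub, spinOp_vectorAction v h2, map_add]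
  module

theorem halfSpin_lie (h2 : (2 : k) ≠ 0) (A B : So k V) (s : SPlus k V) :
    halfSpin v ⁅A, B⁆ s = halfSpin v A (halfSpin v B s) - halfSpin v B (halfSpin v A s) :=
  Subtype.ext (spinOp_lie v h2 A B s.1)

/-- The bilinear form `Φ(ŝ t)` on the whole exterior algebra. -/
noncomputable def extForm (s t : ExteriorAlgebra k V) : k :=
  v.ExteriorAlgebra.coord Finset.univ
    (CliffordAlgebra.reverse (Q := (0 : QuadraticForm k V)) s * t)

theorem bHat_eq (s t : SPlus k V) : bHat v s t = extForm v s.1 t.1 := rfl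

theorem extForm_add_left (s s' t : ExteriorAlgebra k V) :
    extForm v (s + s') t = extForm v s t + extForm v s' t := by
  simp only [extForm, map_add, add_mul]

theorem extForm_smul_left (r : k) (s t : ExteriorAlgebra k V) :
    extForm v (r • s) t = r * extForm v s t := by
  simp only [extForm, map_smul, smul_mul_assoc, smul_eq_mul]

theorem extForm_add_right (s t t' : ExteriorAlgebra k V) :
    extForm v s (t + t') = extForm v s t + extForm v s t' := by
  simp only [extForm, map_add, mul_add]

theorem extForm_smul_right (r : k) (s t : ExteriorAlgebra k V) :
    extForm v s (r • t) = r * extForm v s t := by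
  simp only [extForm, map_smul, mul_smul_comm, smul_eq_mul]

theorem extForm_sub_left (s s' t : ExteriorAlgebra k V) :
    extForm v (s - s') t = extForm v s t - extForm v s' t := by
  simp only [extForm, map_sub, sub_mul]

theorem extForm_sub_right (s t t' : ExteriorAlgebra k V) :
    extForm v s (t - t') = extForm v s t - extForm v s t' := by
  simp only [extForm, map_sub, mul_sub]

theorem extForm_one_left (t : ExteriorAlgebra k V) :
    extForm v 1 t = v.ExteriorAlgebra.coord Finset.univ t := by
  rw [extForm]
  have : CliffordAlgebra.reverse (Q := (0 : QuadraticForm k V)) 1 = 1 :=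
    CliffordAlgebra.reverse.map_one
  erw [this]
  rw [one_mul]

/-- Reversal puts the first factor of the left argument next to the right argument. -/
theorem extForm_ι_mul (x : V) (s t : ExteriorAlgebra k V) :
    extForm v (ExteriorAlgebra.ι k x * s) t = extForm v s (ExteriorAlgebra.ι k x * t) := by
  rw [extForm, extForm]
  have : CliffordAlgebra.reverse (Q := (0 : QuadraticForm k V)) (ExteriorAlgebra.ι k x * s)
      = CliffordAlgebra.reverse (Q := (0 : QuadraticForm k V)) s * ExteriorAlgebra.ι k x := by
    refine (CliffordAlgebra.reverse.map_mul _ _).trans ?_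
    congr 1
    exact CliffordAlgebra.reverse_ι _
  rw [this, mul_assoc]

theorem coord_univ_contract (f : Module.Dual k V) (t : ExteriorAlgebra k V) :
    v.ExteriorAlgebra.coord Finset.univ (contractLeft (Q := (0 : QuadraticForm k V)) f t) = 0 := by
  have hf : f = ∑ i, f (v i) • v.coord i := by
    refine v.ext fun j => ?_
    simp
  have key : ∀ i, v.ExteriorAlgebra.coord Finset.univ ∘ₗ
      contractLeft (Q := (0 : QuadraticForm k V)) (v.coord i) = 0 := by
    intro i
    refine v.ExteriorAlgebra.ext fun J => ?_
    rw [LinearMap.comp_apply]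
    erw [contract_extBasis]
    split_ifs with h
    · have : J.erase i ≠ Finset.univ := fun h' => by
        have := Finset.mem_univ i
        rw [← h'] at this
        simp at this
      simp [this]
    · simp
  rw [hf]
  simp only [map_sum, map_smul, LinearMap.sum_apply, LinearMap.smul_apply]
  refine Finset.sum_eq_zero fun i _ => ?_
  have := LinearMap.congr_fun (key i) t
  rw [LinearMap.comp_apply] at this
  erw [this]
  simp

/-- For scalar `s` both sides vanish because a contraction has no component of top degree; a vector
factor of `s` is then moved across by `extForm_ι_mul`, and the two scalar terms f(m) agree. -/
theorem extForm_contract (f : Module.Dual k V) (s t : ExteriorAlgebra k V) :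
    extForm v (contractLeft (Q := (0 : QuadraticForm k V)) f s) t
      = extForm v s (contractLeft (Q := (0 : QuadraticForm k V)) f t) := by
  have hι : ∀ (m : V) (u : ExteriorAlgebra k V), contractLeft (Q := (0 : QuadraticForm k V)) f
      (ExteriorAlgebra.ι k m * u) = f m • u
        - ExteriorAlgebra.ι k m * contractLeft (Q := (0 : QuadraticForm k V)) f u :=
    fun m u => CliffordAlgebra.contractLeft_ι_mul (Q := (0 : QuadraticForm k V)) _ _ _
  induction s using CliffordAlgebra.left_induction generalizing t with
  | algebraMap r =>
    rw [CliffordAlgebra.contractLeft_algebraMap, Algebra.algebraMap_eq_smul_one]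
    have h0 : extForm v 0 t = 0 := by simp [extForm]
    rw [h0, extForm_smul_left]
    have := extForm_one_left v (contractLeft (Q := (0 : QuadraticForm k V)) f t)
    rw [coord_univ_contract] at this
    exact (mul_eq_zero_of_right r this).symm
  | add x y hx hy => rw [map_add, extForm_add_left, extForm_add_left, hx, hy]
  | ι_mul x m hx =>
    change extForm v (contractLeft (Q := (0 : QuadraticForm k V)) f (ExteriorAlgebra.ι k m * x)) t
      = extForm v (ExteriorAlgebra.ι k m * x) _
    rw [hι, extForm_sub_left, extForm_smul_left, extForm_ι_mul, extForm_ι_mul, hx, hι,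
      extForm_sub_right, extForm_smul_right]
    ring

theorem extForm_vectorAction (w : W k V) (s t : ExteriorAlgebra k V) :
    extForm v (vectorAction w s) t = extForm v s (vectorAction w t) := by
  rw [vectorAction_apply, vectorAction_apply, extForm_add_left, extForm_add_right, extForm_ι_mul,
    extForm_contract]

/-- `Φ(ŝ t)` as a bilinear map. -/
noncomputable def extFormHom : ExteriorAlgebra k V →ₗ[k] ExteriorAlgebra k V →ₗ[k] k :=
  LinearMap.mk₂ k (extForm v) (extForm_add_left v) (extForm_smul_left v) (extForm_add_right v)
    (extForm_smul_right v)

/-- Vectors are self-adjoint, so xy has adjoint yx and commutators of vectors are skew. -/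
theorem extForm_spinOp (h2 : (2 : k) ≠ 0) (A : So k V) (s t : ExteriorAlgebra k V) :
    extForm v (spinOp v A s) t = -extForm v s (spinOp v A t) := by
  let f : So k V →ₗ[k] k := (extFormHom v).flip t ∘ₗ (spinOp v).flip s
  let g : So k V →ₗ[k] k := -(extFormHom v s ∘ₗ (spinOp v).flip t)
  refine so_ext v h2 (f := f) (g := g) (fun x y => ?_) A
  change extForm v (spinOp v (sigma x y) s) t = -extForm v s (spinOp v (sigma x y) t)
  rw [spinOp_sigma, spinOp_sigma, extForm_smul_left, extForm_smul_right, extForm_sub_left,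
    extForm_sub_right]
  simp only [extForm_vectorAction]
  ring

theorem bHat_halfSpin (h2 : (2 : k) ≠ 0) (A : So k V) (s t : SPlus k V) :
    bHat v (halfSpin v A s) t = -bHat v s (halfSpin v A t) :=
  extForm_spinOp v h2 A s.1 t.1

theorem dualProd_oddBracket (s t : SPlus k V) (x y : W k V) :
    LinearMap.dualProd k V x ((oddBracket v s t).1 y) = bHat v (halfSpin v (sigma x y) s) t :=
  dualProd_ofDualEnd v _ x y

include v in
theorem dualProd_ext {x y : W k V}
    (h : ∀ z, LinearMap.dualProd k V z x = LinearMap.dualProd k V z y) : x = y := by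
  rw [← sum_dualProd v x, ← sum_dualProd v y]
  simp only [dualProd_comm x, dualProd_comm y, h]

include v in
theorem so_eq_of_dualProd {A B : So k V}
    (h : ∀ x y, LinearMap.dualProd k V x (A.1 y) = LinearMap.dualProd k V x (B.1 y)) : A = B :=
  Subtype.ext (LinearMap.ext fun y => dualProd_ext v fun x => h x y)

/-- The matrix coefficients of the odd product are b̂(σ_{x,y} s, t). Invariance of b̂ under A,
applied to σ_{x,y} s and t, is the assertion once A is commuted past σ_{x,y}. This makes all Jacobi
identities with an even element automatic. -/
theorem lie_oddBracket (h2 : (2 : k) ≠ 0) (A : So k V) (s t : SPlus k V) :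
    ⁅A, oddBracket v s t⁆ = oddBracket v (halfSpin v A s) t + oddBracket v s (halfSpin v A t) := by
  refine so_eq_of_dualProd v fun x y => ?_
  change LinearMap.dualProd k V x (A.1 ((oddBracket v s t).1 y) - (oddBracket v s t).1 (A.1 y))
    = LinearMap.dualProd k V x ((oddBracket v (halfSpin v A s) t).1 y
      + (oddBracket v s (halfSpin v A t)).1 y)
  have hA := mem_So.1 A.2 x ((oddBracket v s t).1 y)
  rw [map_sub, map_add, ← neg_eq_iff_eq_neg.2 hA]
  simp only [dualProd_oddBracket]
  have h := bHat_halfSpin v h2 A (halfSpin v (sigma x y) s) t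
  have h' := halfSpin_lie v h2 A (sigma x y) s
  rw [lie_sigma, map_add, LinearMap.add_apply] at h'
  have h'' : halfSpin v A (halfSpin v (sigma x y) s) = halfSpin v (sigma (A.1 x) y) s
    + halfSpin v (sigma x (A.1 y)) s + halfSpin v (sigma x y) (halfSpin v A s) := by
    rw [h']; abel
  rw [h'', map_add, map_add, LinearMap.add_apply, LinearMap.add_apply] at h
  linear_combination -h

include v in
theorem half_trace_sigma (A : So k V) (x y : W k V) (h2 : (2 : k) ≠ 0) :
    (1 / 2 : k) * LinearMap.trace k (W k V) ((sigma x y).1 * A.1)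
      = LinearMap.dualProd k V x (A.1 y) := by
  have : Module.Finite k V := Module.Finite.of_basis v
  have hs := map_sub (LinearMap.trace k (W k V))
      (((LinearMap.dualProd k V x) ∘ₗ A.1).smulRight y)
      (((LinearMap.dualProd k V y) ∘ₗ A.1).smulRight x)
  refine (congrArg _ hs).trans ?_
  rw [LinearMap.trace_smulRight, LinearMap.trace_smulRight, LinearMap.comp_apply,
    LinearMap.comp_apply, dualProd_comm y, mem_So.1 A.2 x y]
  field_simp
  ring

end HalfSpin
end TypeD

namespace TypeD
open CliffordAlgebra (contractLeft evenOdd)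

/-! ### Weights of the natural module and parity of the sign form -/

section Weights

variable {l : ℕ}

/-- The pairs with j < i and those with i < j are all pairs except the diagonal ones. -/
theorem lowForm_add_swap (x y : Fin l → ℤ) :
    lowForm x y + lowForm y x = (∑ i, x i) * (∑ i, y i) - ∑ i, x i * y i := by
  have h1 : lowForm y x = ∑ i, ∑ j, if i < j then x i * y j else 0 := by
    rw [lowForm, Finset.sum_comm]
    exact Finset.sum_congr rfl fun i _ => Finset.sum_congr rfl fun j _ => by rw [mul_comm]
  have h2 : ∑ i, x i * y i = ∑ i, ∑ j, if i = j then x i * y j else 0 := by simp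
  rw [h1, h2, Finset.sum_mul_sum, lowForm, ← Finset.sum_add_distrib, ← Finset.sum_sub_distrib]
  refine Finset.sum_congr rfl fun i _ => ?_
  rw [← Finset.sum_add_distrib, ← Finset.sum_sub_distrib]
  refine Finset.sum_congr rfl fun j _ => ?_
  rcases lt_trichotomy i j with h | h | h
  · simp [h, h.not_gt, h.ne]
  · simp [h]
  · simp [h, h.not_gt, h.ne']

/-- The weight opposite to a given one. -/
def opp (a : Fin l × Bool) : Fin l × Bool := (a.1, !a.2)

@[simp]
theorem opp_opp (a : Fin l × Bool) : opp (opp a) = a := by simp [opp]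

@[simp]
theorem opp_fst (a : Fin l × Bool) : (opp a).1 = a.1 := rfl

@[simp]
theorem wt_opp (a : Fin l × Bool) : wt (opp a) = -wt a := by
  obtain ⟨i, b⟩ := a
  cases b <;> simp [wt, opp, Pi.single_neg]

theorem wt_apply_self (a : Fin l × Bool) : wt a a.1 = 1 ∨ wt a a.1 = -1 := by
  obtain ⟨i, b⟩ := a
  cases b <;> simp [wt]

theorem wt_apply_of_ne (a : Fin l × Bool) {i : Fin l} (h : i ≠ a.1) : wt a i = 0 := by
  simp [wt, h]

theorem wt_injective : Function.Injective (wt (l := l)) := by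
  intro a b h
  have h1 : a.1 = b.1 := by
    by_contra hne
    have := congrFun h a.1
    rw [wt_apply_of_ne b hne] at this
    rcases wt_apply_self a with h' | h' <;> omega
  obtain ⟨i, s⟩ := a
  obtain ⟨j, t⟩ := b
  obtain rfl : i = j := h1
  have := congrFun h i
  cases s <;> cases t <;> simp [wt] at this ⊢

theorem sum_wt (a : Fin l × Bool) : Odd (∑ i, wt a i) := by
  obtain ⟨i, b⟩ := a
  cases b <;> simp [wt]

theorem sum_wt_mul (a : Fin l × Bool) (x : Fin l → ℤ) :
    ∑ i, wt a i * x i = wt a a.1 * x a.1 := by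
  rw [Finset.sum_eq_single a.1]
  · intro i _ hi
    rw [wt_apply_of_ne a hi, zero_mul]
  · simp

/-- A sum of two weights with different supports determines the weights. -/
theorem wt_add_eq {a b c d : Fin l × Bool} (hab : a.1 ≠ b.1) (hcd : c.1 ≠ d.1)
    (h : wt a + wt b = wt c + wt d) : (a = c ∧ b = d) ∨ (a = d ∧ b = c) := by
  have key : ∀ {a b c d : Fin l × Bool}, a.1 ≠ b.1 → c.1 ≠ d.1 → wt a + wt b = wt c + wt d →
      a.1 = c.1 → a = c ∧ b = d := by
    intro a b c d hab hcd h hac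
    have h0 := congrFun h a.1
    rw [Pi.add_apply, Pi.add_apply, wt_apply_of_ne b hab, wt_apply_of_ne d (hac ▸ hcd), add_zero,
      add_zero] at h0
    have e : a = c := wt_injective (funext fun i => by
      by_cases hi : i = a.1
      · rw [hi, h0]
      · rw [wt_apply_of_ne a hi, wt_apply_of_ne c (hac ▸ hi)])
    subst e
    exact ⟨rfl, wt_injective (add_left_cancel h)⟩
  by_cases h1 : a.1 = c.1
  · exact Or.inl (key hab hcd h h1)
  · refine Or.inr (key hab hcd.symm (h.trans (add_comm _ _)) ?_)
    by_contra h2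
    have h0 := congrFun h a.1
    rw [Pi.add_apply, Pi.add_apply, wt_apply_of_ne b hab, wt_apply_of_ne c h1,
      wt_apply_of_ne d h2] at h0
    rcases wt_apply_self a with h' | h' <;> omega

theorem wt_add_ne_zero {a b : Fin l × Bool} (hab : a.1 ≠ b.1) : wt a + wt b ≠ 0 := by
  intro h
  have h0 := congrFun h a.1
  rw [Pi.add_apply, wt_apply_of_ne b hab, Pi.zero_apply] at h0
  rcases wt_apply_self a with h' | h' <;> omega

/-- Both coordinate sums are odd and the supports are disjoint. Exchanging the two weights thus
changes the sign, just as it does in σ_{x,y} = -σ_{y,x}. -/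
theorem odd_lowForm_wt {a b : Fin l × Bool} (hab : a.1 ≠ b.1) :
    Odd (lowForm (wt a) (wt b) + lowForm (wt b) (wt a)) := by
  rw [lowForm_add_swap, sum_wt_mul, wt_apply_of_ne b hab, mul_zero, sub_zero]
  exact (sum_wt a).mul (sum_wt b)

theorem lowForm_wt_of_fst_eq {a b : Fin l × Bool} (hab : a.1 = b.1) :
    lowForm (wt a) (wt b) = 0 := by
  rw [wt, lowForm_single_left]
  refine mul_eq_zero_of_right _ (Finset.sum_eq_zero fun j _ => ?_)
  split_ifs with h
  · exact wt_apply_of_ne b (hab ▸ h.ne)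
  · rfl

instance : DecidablePred (IsIndicator (l := l)) := fun μ =>
  inferInstanceAs (Decidable (∀ i, μ i = 0 ∨ μ i = 1))

/-- The two steps change different coordinates, so the intermediate vector cannot fail to be a
weight when both ends are weights. Two vectors acting in succession therefore give 0 only if the end
result is no weight. -/
theorem IsIndicator.of_add_wt_add_wt {μ : Fin l → ℤ} {a b : Fin l × Bool} (hab : a.1 ≠ b.1)
    (hμ : IsIndicator μ) (h : IsIndicator (μ + wt b + wt a)) : IsIndicator (μ + wt b) := by
  intro i
  by_cases hi : i = b.1
  · have := h i
    rwa [Pi.add_apply, wt_apply_of_ne a (hi ▸ hab.symm), add_zero] at this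
  · rw [Pi.add_apply, wt_apply_of_ne b hi, add_zero]
    exact hμ i

theorem IsIndicator.one_sub {μ : Fin l → ℤ} (hμ : IsIndicator μ) : IsIndicator (1 - μ) := by
  intro i
  rcases hμ i with h | h <;> simp [h]

theorem sum_ind (J : Finset (Fin l)) : ∑ i, ind J i = J.card := by
  simp [ind]

end Weights

/-! ### Weight vectors of the half-spin module -/

section HalfSpin

variable {k V : Type*} [Field k] [AddCommGroup V] [Module k V]
  {l : ℕ} (v : Module.Basis (Fin l) k V)

theorem dualProd_unitVec (a b : Fin l × Bool) :
    LinearMap.dualProd k V (unitVec v a) (unitVec v b) = if b = opp a then 1 else 0 := by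
  obtain ⟨i, s⟩ := a
  obtain ⟨j, t⟩ := b
  cases s <;> cases t <;> simp [unitVec, opp, vec, covec, Finsupp.single_apply, eq_comm]

theorem dualProd_ext_unitVec {x y : W k V} (h : ∀ a, LinearMap.dualProd k V (unitVec v a) x
    = LinearMap.dualProd k V (unitVec v a) y) : x = y := by
  rw [← sum_dualProd v x, ← sum_dualProd v y]
  refine Finset.sum_congr rfl fun i _ => ?_
  have h1 := h (i, true)
  have h2 := h (i, false)
  simp only [unitVec, if_true, Bool.false_eq_true, if_false] at h1 h2
  simp only [dualProd_comm x, dualProd_comm y, h1, h2]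

theorem linearMap_ext_unitVec {M : Type*} [AddCommGroup M] [Module k M] {f g : W k V →ₗ[k] M}
    (h : ∀ a, f (unitVec v a) = g (unitVec v a)) : f = g := by
  refine LinearMap.ext fun x => ?_
  rw [← sum_dualProd v x]
  simp only [map_sum, map_add, map_smul]
  refine Finset.sum_congr rfl fun i _ => ?_
  have h1 : f (vec v i) = g (vec v i) := h (i, true)
  have h2 : f (covec v i) = g (covec v i) := h (i, false)
  rw [h1, h2]

theorem so_eq_of_unitVec {A B : So k V}
    (h : ∀ a b, LinearMap.dualProd k V (unitVec v a) (A.1 (unitVec v b))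
      = LinearMap.dualProd k V (unitVec v a) (B.1 (unitVec v b))) : A = B :=
  Subtype.ext (linearMap_ext_unitVec v fun b => dualProd_ext_unitVec v fun a => h a b)

theorem vectorAction_unitVec_weightVector (a : Fin l × Bool) {μ : Fin l → ℤ} (hμ : IsIndicator μ) :
    vectorAction (unitVec v a) (weightVector v μ)
      = sgn k (lowForm (wt a) μ) • weightVector v (μ + wt a) := by
  obtain ⟨J, rfl⟩ := exists_ind hμ
  rw [weightVector_ind, vectorAction_unitVec]

theorem vectorAction_unitVec_unitVec {a b : Fin l × Bool} (hab : a.1 ≠ b.1) {μ : Fin l → ℤ}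
    (hμ : IsIndicator μ) :
    vectorAction (unitVec v a) (vectorAction (unitVec v b) (weightVector v μ))
      = sgn k (lowForm (wt a) μ + lowForm (wt a) (wt b) + lowForm (wt b) μ)
        • weightVector v (μ + wt a + wt b) := by
  rw [vectorAction_unitVec_weightVector v b hμ, map_smul]
  by_cases h : IsIndicator (μ + wt b)
  · rw [vectorAction_unitVec_weightVector v a h, smul_smul, ← sgn_add, lowForm_add_right,
      add_right_comm μ, add_comm (lowForm (wt b) μ)]
  · rw [weightVector_of_not v h, map_zero, smul_zero, weightVector_of_not, smul_zero]
    intro h'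
    rw [add_right_comm] at h'
    exact h (hμ.of_add_wt_add_wt hab h')

theorem vectorAction_unitVec_opp (a : Fin l × Bool) {μ : Fin l → ℤ} (hμ : IsIndicator μ) :
    vectorAction (unitVec v (opp a)) (vectorAction (unitVec v a) (weightVector v μ))
      = (if IsIndicator (μ + wt a) then (1 : k) else 0) • weightVector v μ := by
  rw [vectorAction_unitVec_weightVector v a hμ, map_smul]
  by_cases h : IsIndicator (μ + wt a)
  · rw [vectorAction_unitVec_weightVector v _ h, smul_smul, ← sgn_add, lowForm_add_right, wt_opp,
      lowForm_neg_left, lowForm_neg_left, lowForm_wt_of_fst_eq rfl, if_pos h, add_neg_cancel_right]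
    rw [sgn_even (by simp)]
  · rw [weightVector_of_not v h, map_zero, smul_zero, if_neg h, zero_smul]

theorem extBasis_mem (J : Finset (Fin l)) :
    v.ExteriorAlgebra J ∈ evenOdd (0 : QuadraticForm k V) (J.card : ZMod 2) := by
  induction J using Finset.induction_on_min with
  | empty =>
    rw [extBasis_empty]
    exact SetLike.one_mem_graded (evenOdd (0 : QuadraticForm k V))
  | insert a s ha ih =>
    have := vectorAction_mem _ (vec v a) _ ih
    rwa [vectorAction_vec, ← extBasis_insert v ha, ← Nat.cast_add_one,
      ← Finset.card_insert_of_notMem (fun h => lt_irrefl _ (ha a h))] at this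

theorem weightVector_mem {μ : Fin l → ℤ} (h : Even (∑ i, μ i)) : weightVector v μ ∈ SPlus k V := by
  by_cases hμ : IsIndicator μ
  · obtain ⟨J, rfl⟩ := exists_ind hμ
    rw [weightVector_ind]
    have := extBasis_mem v J
    rw [sum_ind] at h
    have h' : ((J.card : ℕ) : ZMod 2) = 0 := (ZMod.natCast_eq_zero_iff_even).2 (by exact_mod_cast h)
    rwa [h'] at this
  · rw [weightVector_of_not v hμ]
    exact zero_mem _

open scoped Classical in
/-- The basis vector of weight `μ` of `S⁺`, or `0` if `μ` is not a weight. -/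
noncomputable def plusVec (μ : Fin l → ℤ) : SPlus k V :=
  if h : Even (∑ i, μ i) then ⟨weightVector v μ, weightVector_mem v h⟩ else 0

theorem plusVec_coe {μ : Fin l → ℤ} (h : Even (∑ i, μ i)) :
    (plusVec v μ : ExteriorAlgebra k V) = weightVector v μ := by
  rw [plusVec, dif_pos h]

theorem plusVec_of_not {μ : Fin l → ℤ} (h : ¬IsIndicator μ) : plusVec v μ = 0 := by
  rw [plusVec]
  split_ifs
  · exact Subtype.ext (weightVector_of_not v h)
  · rfl

/-- The projection of the exterior algebra onto `S⁺`. -/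
noncomputable def plusProj : ExteriorAlgebra k V →ₗ[k] SPlus k V :=
  v.ExteriorAlgebra.constr k fun J => plusVec v (ind J)

/-- The map is half the sum of the identity and the grade involution, as one sees on monomials; on
even elements this is the identity. -/
theorem plusProj_coe (h2 : (2 : k) ≠ 0) (s : SPlus k V) : plusProj v s.1 = s := by
  have h : (SPlus k V).subtype ∘ₗ plusProj v = (1 / 2 : k) • (LinearMap.id
      + (CliffordAlgebra.involute (Q := (0 : QuadraticForm k V))).toLinearMap) := by
    refine v.ExteriorAlgebra.ext fun J => ?_
    have h1 : plusProj v (v.ExteriorAlgebra J) = plusVec v (ind J) :=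
      v.ExteriorAlgebra.constr_basis k _ J
    have hm := extBasis_mem v J
    change (plusProj v (v.ExteriorAlgebra J) : ExteriorAlgebra k V)
      = (1 / 2 : k) • (v.ExteriorAlgebra J
        + CliffordAlgebra.involute (Q := (0 : QuadraticForm k V)) (v.ExteriorAlgebra J))
    rw [h1]
    rcases Nat.even_or_odd J.card with h | h
    · rw [plusVec_coe v (by rw [sum_ind]; exact_mod_cast h), weightVector_ind]
      rw [(ZMod.natCast_eq_zero_iff_even).2 h] at hm
      rw [CliffordAlgebra.involute_eq_of_mem_even hm, ← two_smul k, smul_smul, one_div,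
        inv_mul_cancel₀ h2, one_smul]
    · rw [(ZMod.natCast_eq_one_iff_odd).2 h] at hm
      rw [CliffordAlgebra.involute_eq_of_mem_odd hm, plusVec, dif_neg]
      · simp
      · rw [sum_ind, Int.not_even_iff_odd]
        exact_mod_cast h
  have h' := LinearMap.congr_fun h s.1
  refine Subtype.ext (h'.trans ?_)
  change (1 / 2 : k) • (s.1 + CliffordAlgebra.involute (Q := (0 : QuadraticForm k V)) s.1) = s.1
  rw [CliffordAlgebra.involute_eq_of_mem_even s.2, ← two_smul k, smul_smul, one_div,
    inv_mul_cancel₀ h2, one_smul]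

/-- Two linear maps on `S⁺` agree if they agree on the basis vectors. -/
theorem plus_ext (h2 : (2 : k) ≠ 0) {M : Type*} [AddCommGroup M] [Module k M]
    {f g : SPlus k V →ₗ[k] M} (h : ∀ μ, IsIndicator μ → Even (∑ i, μ i) →
      f (plusVec v μ) = g (plusVec v μ)) : f = g := by
  have key : f ∘ₗ plusProj v = g ∘ₗ plusProj v := by
    refine v.ExteriorAlgebra.ext fun J => ?_
    have h1 : plusProj v (v.ExteriorAlgebra J) = plusVec v (ind J) :=
      v.ExteriorAlgebra.constr_basis k _ J
    rw [LinearMap.comp_apply, LinearMap.comp_apply, h1]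
    by_cases he : Even (∑ i, ind J i)
    · exact h _ (isIndicator_ind J) he
    · rw [plusVec, dif_neg he, map_zero, map_zero]
  refine LinearMap.ext fun s => ?_
  have := LinearMap.congr_fun key s.1
  rwa [LinearMap.comp_apply, LinearMap.comp_apply, plusProj_coe v h2] at this

/-- Orthogonal vectors anticommute, so -½ times their commutator is minus their product, and the
exponents of the two signs add. -/
theorem halfSpin_sigma_unitVec (h2 : (2 : k) ≠ 0) {a b : Fin l × Bool} (hab : a.1 ≠ b.1)
    {μ : Fin l → ℤ} (hμ : IsIndicator μ) (he : Even (∑ i, μ i)) :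
    halfSpin v (sigma (unitVec v a) (unitVec v b)) (plusVec v μ)
      = -sgn k (lowForm (wt a) μ + lowForm (wt a) (wt b) + lowForm (wt b) μ)
        • plusVec v (μ + wt a + wt b) := by
  refine Subtype.ext ?_
  have he' : Even (∑ i, (μ + wt a + wt b) i) := by
    simp only [Pi.add_apply, Finset.sum_add_distrib]
    rw [add_assoc]
    exact he.add ((sum_wt a).add_odd (sum_wt b))
  rw [halfSpin_coe, plusVec_coe v he, spinOp_sigma_of_orthogonal v h2, neg_smul,
    vectorAction_unitVec_unitVec v hab hμ]
  · simp only [NegMemClass.coe_neg, SetLike.val_smul, plusVec_coe v he']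
  · rw [dualProd_unitVec, if_neg]
    rintro rfl
    exact hab rfl

/-- The Cartan element `H_i` that fixes `v_i` and negates `f_i`. -/
noncomputable def cartan (i : Fin l) : So k V := sigma (covec v i) (vec v i)

/-- H_i acts as ½(v_i f_i - f_i v_i), and v_i f_i and f_i v_i are the projections to the monomials
with and without the factor v_i. -/
theorem halfSpin_cartan (h2 : (2 : k) ≠ 0) (i : Fin l) {μ : Fin l → ℤ} (hμ : IsIndicator μ)
    (he : Even (∑ i, μ i)) :
    halfSpin v (cartan v i) (plusVec v μ) = ((μ i : k) - 1 / 2) • plusVec v μ := by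
  refine Subtype.ext ?_
  rw [halfSpin_coe, SetLike.val_smul, plusVec_coe v he, cartan, spinOp_sigma]
  have h1 := vectorAction_unitVec_opp v (i, true) hμ
  have h2' := vectorAction_unitVec_opp v (i, false) hμ
  change vectorAction (covec v i) (vectorAction (vec v i) _) = _ at h1
  change vectorAction (vec v i) (vectorAction (covec v i) _) = _ at h2'
  have h3 : ∀ b, IsIndicator (μ + wt (i, b)) ↔ μ i = if b then 0 else 1 := by
    intro b
    constructor
    · intro h
      have h4 := h i
      have h5 := hμ i
      cases b <;> simp [wt] at h4 ⊢ <;> omega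
    · intro h j
      by_cases hj : j = i
      · subst hj
        cases b <;> simp [wt] at h ⊢ <;> omega
      · rw [Pi.add_apply, wt_apply_of_ne _ hj, add_zero]
        exact hμ j
  rw [h1, h2']
  simp only [h3]
  have h4 : (1 : k) - 1 / 2 = 1 / 2 := by field_simp; ring
  rcases hμ i with h | h
  · simp [h]
  · simp only [h, h4, Int.cast_one, one_ne_zero, if_false, if_true, Bool.false_eq_true]
    module

end HalfSpin
end TypeD

namespace TypeD
open CliffordAlgebra (contractLeft evenOdd)

/-! ### The form b̂ and the odd product of weight vectors -/

section HalfSpin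

variable {k V : Type*} [Field k] [AddCommGroup V] [Module k V]
  {l : ℕ} (v : Module.Basis (Fin l) k V)

theorem lowForm_one_right (μ : Fin l → ℤ) : lowForm μ 1 = ∑ i, μ i * (i : ℕ) := by
  refine Finset.sum_congr rfl fun i _ => ?_
  rw [← Finset.sum_filter]
  have : (Finset.univ.filter (· < i)).card = (i : ℕ) := by
    rw [← Fin.card_Iio i]
    congr 1
    ext
    simp
  simp [mul_comm, this]

/-- Vectors are self-adjoint, so the factors of the left monomial can be moved one by one to the
right one until a coefficient of the top monomial is left. Each factor contributes the number of
indices below it. -/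
theorem extForm_extBasis (I J : Finset (Fin l)) :
    extForm v (v.ExteriorAlgebra I) (v.ExteriorAlgebra J)
      = if ind I + ind J = 1 then sgn k (lowForm (ind I) 1) else 0 := by
  induction I using Finset.induction_on_min generalizing J with
  | empty =>
    have h0 : ind (∅ : Finset (Fin l)) = 0 := by ext; simp [ind]
    have h1 : (1 : Fin l → ℤ) = ind Finset.univ := by ext; simp [ind]
    rw [extBasis_empty, extForm_one_left, h0, zero_add, h1, Module.Basis.coord_apply,
      Module.Basis.repr_self, Finsupp.single_apply, sgn_even (by simp [lowForm])]
    exact if_congr ind_injective.eq_iff.symm rfl rfl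
  | insert a s ha ih =>
    have hna : a ∉ s := fun h => lt_irrefl _ (ha a h)
    rw [extBasis_insert v ha, extForm_ι_mul, ι_mul_extBasis]
    have hind : ind (insert a s) = ind s + Pi.single a 1 := by
      ext j
      by_cases hj : j = a
      · subst hj; simp [ind, hna]
      · simp [ind, hj]
    by_cases haJ : a ∈ J
    · rw [if_pos haJ, if_neg]
      · simp [extForm]
      · intro h
        have := congrFun h a
        simp [ind, haJ] at this
    · have hind' : ind (insert a J) = ind J + Pi.single a 1 := by
        ext j
        by_cases hj : j = a
        · subst hj; simp [ind, haJ]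
        · simp [ind, hj]
      rw [if_neg haJ, extForm_smul_right, ih, hind, hind', add_assoc,
        add_comm (ind J) (Pi.single a 1)]
      split_ifs with h
      · rw [lowForm_add_left, sgn_add, mul_comm]
        congr 1
        rw [lowForm_one_right, ← sgn_natCast]
        -- The supports are complementary and `s` lies above `a`, so every index below `a` belongs
        -- to `J`.
        have hc : countBelow a J = a.1 := by
          rw [countBelow]
          have : J.filter (· < a) = Finset.univ.filter (· < a) := by
            ext j
            simp only [Finset.mem_filter, Finset.mem_univ, true_and, and_iff_right_iff_imp]
            intro hj
            have h' := congrFun h j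
            have hs : j ∉ s := fun hs => (ha j hs).not_gt hj
            by_contra hJ
            simp [ind, hs, hJ, hj.ne] at h'
          rw [this, ← Fin.card_Iio a]
          congr 1
          ext
          simp
        rw [hc, Finset.sum_eq_single a]
        · simp
        · intro j _ hj
          simp [hj]
        · simp
      · simp

theorem extForm_weightVector {μ ν : Fin l → ℤ} (hμ : IsIndicator μ) (hν : IsIndicator ν) :
    extForm v (weightVector v μ) (weightVector v ν)
      = if μ + ν = 1 then sgn k (lowForm μ 1) else 0 := by
  obtain ⟨I, rfl⟩ := exists_ind hμ
  obtain ⟨J, rfl⟩ := exists_ind hν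
  rw [weightVector_ind, weightVector_ind, extForm_extBasis]

theorem bHat_plusVec {μ ν : Fin l → ℤ} (hν : IsIndicator ν)
    (eμ : Even (∑ i, μ i)) (eν : Even (∑ i, ν i)) :
    bHat v (plusVec v μ) (plusVec v ν) = if μ + ν = 1 then sgn k (lowForm μ 1) else 0 := by
  by_cases hμ : IsIndicator μ
  · rw [bHat_eq, plusVec_coe v eμ, plusVec_coe v eν, extForm_weightVector v hμ hν]
  · rw [plusVec_of_not v hμ, map_zero, LinearMap.zero_apply, if_neg]
    intro h
    have : μ = 1 - ν := eq_sub_of_add_eq h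
    exact hμ (this ▸ hν.one_sub)

theorem sigma_self (x : W k V) : sigma x x = 0 := by
  refine Subtype.ext (LinearMap.ext fun w => ?_)
  change sigmaEnd x x w = 0
  rw [sigmaEnd_apply, sub_self]

theorem even_sum_add {μ : Fin l → ℤ} (he : Even (∑ i, μ i)) (a b : Fin l × Bool) :
    Even (∑ i, (μ + wt a + wt b) i) := by
  simp only [Pi.add_apply, Finset.sum_add_distrib]
  rw [add_assoc]
  exact he.add ((sum_wt a).add_odd (sum_wt b))

theorem bHat_sigma_of_ne (h2 : (2 : k) ≠ 0) {a b : Fin l × Bool} (hab : a.1 ≠ b.1)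
    {μ ν : Fin l → ℤ} (hμ : IsIndicator μ) (hν : IsIndicator ν)
    (eμ : Even (∑ i, μ i)) (eν : Even (∑ i, ν i)) :
    bHat v (halfSpin v (sigma (unitVec v a) (unitVec v b)) (plusVec v μ)) (plusVec v ν)
      = if μ + ν - 1 = -(wt a + wt b) then
        -sgn k (lowForm (wt a) μ + lowForm (wt a) (wt b) + lowForm (wt b) μ
          + lowForm (1 - ν) 1) else 0 := by
  rw [halfSpin_sigma_unitVec v h2 hab hμ eμ, map_smul, LinearMap.smul_apply,
    bHat_plusVec v hν (even_sum_add eμ a b) eν, sgn_add]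
  have : μ + wt a + wt b + ν = 1 ↔ μ + ν - 1 = -(wt a + wt b) := by
    rw [← sub_eq_zero, ← sub_eq_zero (b := -(wt a + wt b))]
    constructor <;> intro h <;> rw [← h] <;> abel
  by_cases h : μ + ν - 1 = -(wt a + wt b)
  · rw [if_pos h, if_pos (this.2 h), ← eq_sub_of_add_eq (this.2 h), smul_eq_mul, neg_mul,
      sgn_add _ (lowForm _ 1), sgn_add _ (lowForm (wt b) μ)]
  · rw [if_neg h, if_neg (fun h' => h (this.1 h')), smul_zero]

theorem halfSpin_sigma_opp (h2 : (2 : k) ≠ 0) (a : Fin l × Bool)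
    {μ : Fin l → ℤ} (hμ : IsIndicator μ) (eμ : Even (∑ i, μ i)) :
    halfSpin v (sigma (unitVec v (opp a)) (unitVec v a)) (plusVec v μ)
      = ((wt a a.1 : ℤ) * ((μ a.1 : k) - 1 / 2)) • plusVec v μ := by
  obtain ⟨i, b⟩ := a
  cases b
  · have : sigma (unitVec v (opp (i, false))) (unitVec v (i, false)) = -cartan v i := by
      rw [sigma_swap]
      rfl
    rw [this, map_neg, LinearMap.neg_apply, halfSpin_cartan v h2 i hμ eμ, ← neg_smul]
    simp [wt]
  · have : sigma (unitVec v (opp (i, true))) (unitVec v (i, true)) = cartan v i := rfl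
    rw [this, halfSpin_cartan v h2 i hμ eμ]
    simp [wt]

theorem eq_or_eq_opp {a b : Fin l × Bool} (h : a.1 = b.1) : a = b ∨ a = opp b := by
  obtain ⟨i, s⟩ := a
  obtain ⟨j, t⟩ := b
  obtain rfl : i = j := h
  cases s <;> cases t <;> simp [opp]

/-- The products of weight vectors of `S⁺` whose weights do not add up to a root or `0`. -/
theorem oddBracket_plusVec_eq_zero (h2 : (2 : k) ≠ 0) {μ ν : Fin l → ℤ}
    (hμ : IsIndicator μ) (hν : IsIndicator ν) (eμ : Even (∑ i, μ i)) (eν : Even (∑ i, ν i))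
    (h0 : μ + ν ≠ 1) (h : ∀ a b : Fin l × Bool, a.1 ≠ b.1 → μ + ν - 1 ≠ wt a + wt b) :
    oddBracket v (plusVec v μ) (plusVec v ν) = 0 := by
  refine so_eq_of_unitVec v fun c d => ?_
  rw [dualProd_oddBracket, ZeroMemClass.coe_zero, LinearMap.zero_apply, map_zero]
  by_cases hcd : c.1 = d.1
  · rcases eq_or_eq_opp hcd with rfl | rfl
    · rw [sigma_self, map_zero, LinearMap.zero_apply, map_zero, LinearMap.zero_apply]
    · rw [halfSpin_sigma_opp v h2 d hμ eμ, map_smul, LinearMap.smul_apply, bHat_plusVec v hν eμ eν,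
        if_neg h0, smul_zero]
  · rw [bHat_sigma_of_ne v h2 hcd hμ hν eμ eν, if_neg]
    have := h (opp c) (opp d) hcd
    rwa [wt_opp, wt_opp, ← neg_add] at this

/-- The products of weight vectors of `S⁺` whose weights add up to a root. -/
theorem oddBracket_plusVec_of_root (h2 : (2 : k) ≠ 0) {μ ν : Fin l → ℤ} {a b : Fin l × Bool}
    (hab : a.1 ≠ b.1)
    (hμ : IsIndicator μ) (hν : IsIndicator ν) (eμ : Even (∑ i, μ i)) (eν : Even (∑ i, ν i))
    (h : μ + ν - 1 = wt a + wt b) :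
    oddBracket v (plusVec v μ) (plusVec v ν)
      = -sgn k (lowForm (wt a + wt b) μ + lowForm (wt b) (wt a) + lowForm (1 - ν) 1)
        • sigma (unitVec v a) (unitVec v b) := by
  have h0 : μ + ν ≠ 1 := fun h0 => by
    rw [h0, sub_self] at h
    exact wt_add_ne_zero hab h.symm
  -- The coefficient at (c, d) requires wt c + wt d = -(wt a + wt b). This leaves the position (opp
  -- b, opp a) and its transpose, so a single value determines the product.
  have main : ∀ c d : Fin l × Bool, c = opp b → d = opp a →
      bHat v (halfSpin v (sigma (unitVec v c) (unitVec v d)) (plusVec v μ)) (plusVec v ν)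
        = -sgn k (lowForm (wt a + wt b) μ + lowForm (wt b) (wt a) + lowForm (1 - ν) 1) := by
    rintro c d rfl rfl
    rw [bHat_sigma_of_ne v h2 (a := opp b) (b := opp a) hab.symm hμ hν eμ eν, if_pos (by rw [h, wt_opp, wt_opp]; abel)]
    congr 1
    refine sgn_congr ?_
    rw [wt_opp, wt_opp, lowForm_add_left, lowForm_neg_left, lowForm_neg_left, lowForm_neg_left,
      lowForm_neg_right]
    exact ⟨lowForm (1 - ν) 1 + lowForm (wt b) (wt a), by ring⟩
  refine so_eq_of_unitVec v fun c d => ?_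
  rw [dualProd_oddBracket]
  rw [SetLike.val_smul, LinearMap.smul_apply]
  change _ = LinearMap.dualProd k V (unitVec v c) (_ • (sigmaEnd (unitVec v a) (unitVec v b)
    (unitVec v d)))
  rw [map_smul, sigmaEnd_apply, map_sub, map_smul, map_smul, dualProd_unitVec, dualProd_unitVec,
    dualProd_unitVec, dualProd_unitVec]
  -- Over one coordinate σ_{c,d} is zero or a Cartan element up to sign, which preserves `μ`; as μ +
  -- ν ≠ 1 the form then vanishes.
  by_cases hcd : c.1 = d.1
  · have hz : ∀ (a b : Fin l × Bool), a.1 ≠ b.1 →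
        (if d = opp a then (1 : k) else 0) • (if b = opp c then (1 : k) else 0) = 0 := by
      intro a b hab
      by_cases h1 : d = opp a
      · rw [if_neg (c := b = opp c), smul_zero]
        rintro rfl
        exact hab (by rw [opp_fst, hcd, h1, opp_fst])
      · rw [if_neg h1, zero_smul]
    rw [hz a b hab, hz b a hab.symm, sub_zero, smul_zero]
    rcases eq_or_eq_opp hcd with rfl | rfl
    · rw [sigma_self, map_zero, LinearMap.zero_apply, map_zero, LinearMap.zero_apply]
    · rw [halfSpin_sigma_opp v h2 d hμ eμ, map_smul, LinearMap.smul_apply, bHat_plusVec v hν eμ eν,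
        if_neg h0, smul_zero]
  · by_cases h1 : d = opp a ∧ c = opp b
    · rw [main c d h1.2 h1.1, if_pos h1.1, if_pos (by rw [h1.2, opp_opp]), if_neg (c := d = opp b)]
      · simp
      · intro h3
        exact hcd (by rw [h1.2, h3])
    · by_cases h1' : d = opp b ∧ c = opp a
      · have e1 : a = opp c := by rw [h1'.2, opp_opp]
        have e2 : d ≠ opp a := fun h3 => hcd (by rw [h1'.2, h3])
        rw [sigma_swap, map_neg, LinearMap.neg_apply, map_neg, LinearMap.neg_apply,
          main d c h1'.1 h1'.2, if_pos h1'.1, if_pos e1, if_neg e2]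
        simp
      · have hz : ∀ (a b : Fin l × Bool), ¬(d = opp a ∧ c = opp b) →
            (if d = opp a then (1 : k) else 0) • (if b = opp c then (1 : k) else 0) = 0 := by
          intro a b h
          by_cases h3 : d = opp a
          · rw [if_neg (c := b = opp c), smul_zero]
            intro h4
            exact h ⟨h3, by rw [h4, opp_opp]⟩
          · rw [if_neg h3, zero_smul]
        rw [hz a b h1, hz b a h1', sub_zero, smul_zero, bHat_sigma_of_ne v h2 hcd hμ hν eμ eν,
          if_neg]
        intro h5
        rw [h, ← neg_eq_iff_eq_neg, neg_add, ← wt_opp, ← wt_opp] at h5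
        rcases wt_add_eq (by exact hab) hcd h5 with ⟨h6, h7⟩ | ⟨h6, h7⟩
        · exact h1' ⟨h7.symm, h6.symm⟩
        · exact h1 ⟨h6.symm, h7.symm⟩

/-- The products of weight vectors of `S⁺` of opposite weights. -/
theorem oddBracket_plusVec_opp (h2 : (2 : k) ≠ 0) {μ ν : Fin l → ℤ}
    (hμ : IsIndicator μ) (hν : IsIndicator ν) (eμ : Even (∑ i, μ i)) (eν : Even (∑ i, ν i))
    (h : μ + ν = 1) :
    oddBracket v (plusVec v μ) (plusVec v ν)
      = sgn k (lowForm μ 1) • ∑ i, ((μ i : k) - 1 / 2) • cartan v i := by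
  -- The right-hand side is diagonal on the vectors v_i, f_i, so that only the coefficients at
  -- opposite positions have to be compared.
  have hcart : ∀ i (b : Fin l × Bool), (cartan v i).1 (unitVec v b)
      = (if b.1 = i then ((wt b b.1 : ℤ) : k) else 0) • unitVec v b := by
    rintro i ⟨j, b⟩
    change sigmaEnd (unitVec v (i, false)) (unitVec v (i, true)) (unitVec v (j, b)) = _
    rw [sigmaEnd_apply, dualProd_unitVec, dualProd_unitVec]
    by_cases hij : j = i
    · subst hij
      cases b <;> simp [opp, wt]
      exact (neg_one_smul k _).symm
    · simp [opp, hij]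
  refine so_eq_of_unitVec v fun c d => ?_
  rw [dualProd_oddBracket]
  have hR : (sgn k (lowForm μ 1) • ∑ i, ((μ i : k) - 1 / 2) • cartan v i : So k V).1 (unitVec v d)
      = (sgn k (lowForm μ 1) * (((μ d.1 : k) - 1 / 2) * ((wt d d.1 : ℤ) : k))) • unitVec v d := by
    change (sgn k (lowForm μ 1) • ((∑ i, ((μ i : k) - 1 / 2) • cartan v i : So k V) :
      Module.End k (W k V))) (unitVec v d) = _
    rw [AddSubmonoidClass.coe_finsetSum, LinearMap.smul_apply, LinearMap.sum_apply,
      Finset.sum_eq_single d.1]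
    · rw [SetLike.val_smul, LinearMap.smul_apply, hcart, if_pos rfl, smul_smul, smul_smul, mul_assoc]
    · intro i _ hi
      rw [SetLike.val_smul, LinearMap.smul_apply, hcart, if_neg (Ne.symm hi), zero_smul, smul_zero]
    · simp
  rw [hR, map_smul, dualProd_unitVec]
  by_cases hcd : c.1 = d.1
  · rcases eq_or_eq_opp hcd with rfl | rfl
    · rw [sigma_self, map_zero, LinearMap.zero_apply, map_zero, LinearMap.zero_apply, if_neg,
        smul_zero]
      intro h'
      have := congrArg Prod.snd h'
      simp [opp] at this
    · rw [halfSpin_sigma_opp v h2 d hμ eμ, map_smul, LinearMap.smul_apply, bHat_plusVec v hν eμ eν,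
        if_pos h, if_pos (by simp)]
      simp only [smul_eq_mul]
      ring
  · rw [bHat_sigma_of_ne v h2 hcd hμ hν eμ eν, if_neg, if_neg, smul_zero]
    · rintro rfl
      exact hcd rfl
    · rw [h, sub_self]
      intro h'
      exact wt_add_ne_zero hcd (neg_eq_zero.1 h'.symm)

end HalfSpin
end TypeD

namespace TypeD
open CliffordAlgebra (contractLeft evenOdd)

/-! ### Generation by extreme weight vectors and the cyclic sum of three odd elements -/

section HalfSpin

variable {k V : Type*} [Field k] [AddCommGroup V] [Module k V]
  {l : ℕ} (v : Module.Basis (Fin l) k V)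

theorem isIndicator_zero : IsIndicator (0 : Fin l → ℤ) := fun _ => Or.inl rfl

theorem isIndicator_one : IsIndicator (1 : Fin l → ℤ) := fun _ => Or.inr rfl

theorem even_sum_zero : Even (∑ i, (0 : Fin l → ℤ) i) := by simp

theorem even_sum_one (hl : Even l) : Even (∑ i, (1 : Fin l → ℤ) i) := by
  simpa using hl

theorem mem_of_halfSpin_sigma_mem (h2 : (2 : k) ≠ 0) {N : Submodule k (SPlus k V)}
    {a b : Fin l × Bool} (hab : a.1 ≠ b.1) {μ : Fin l → ℤ}
    (hμ : IsIndicator μ) (eμ : Even (∑ i, μ i))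
    (h : halfSpin v (sigma (unitVec v a) (unitVec v b)) (plusVec v μ) ∈ N) :
    plusVec v (μ + wt a + wt b) ∈ N := by
  rw [halfSpin_sigma_unitVec v h2 hab hμ eμ] at h
  exact (N.smul_mem_iff (neg_ne_zero.2 (sgn_ne_zero _))).1 h

theorem eq_top_of_plusVec_mem (h2 : (2 : k) ≠ 0) {N : Submodule k (SPlus k V)}
    (h : ∀ μ, IsIndicator μ → Even (∑ i, μ i) → plusVec v μ ∈ N) : N = ⊤ := by
  have := plus_ext v h2 (f := N.mkQ) (g := 0) fun μ hμ eμ => by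
    rw [LinearMap.zero_apply, Submodule.mkQ_apply, Submodule.Quotient.mk_eq_zero]
    exact h μ hμ eμ
  rw [eq_top_iff]
  intro s _
  have h' := LinearMap.congr_fun this s
  rwa [LinearMap.zero_apply, Submodule.mkQ_apply, Submodule.Quotient.mk_eq_zero] at h'

theorem ind_insert_insert {p q : Fin l} {J : Finset (Fin l)} (hp : p ∉ insert q J) (hq : q ∉ J) :
    ind (insert p (insert q J)) = ind J + wt (p, true) + wt (q, true) := by
  ext j
  have hpq : p ≠ q := fun h => hp (h ▸ Finset.mem_insert_self _ _)
  have hpJ : p ∉ J := fun h => hp (Finset.mem_insert_of_mem h)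
  by_cases h1 : j = p
  · subst h1; simp [ind, wt, hpq, hpJ]
  · by_cases h2 : j = q
    · subst h2; simp [ind, wt, hpq.symm, hq]
    · simp [ind, wt, h1, h2]

theorem exists_eq_insert_insert {J : Finset (Fin l)} (hJ : 1 < J.card) :
    ∃ (p q : Fin l) (K : Finset (Fin l)), p ∉ insert q K ∧ q ∉ K ∧ J = insert p (insert q K) := by
  obtain ⟨p, hp, q, hq, hpq⟩ := Finset.one_lt_card.1 hJ
  refine ⟨p, q, (J.erase p).erase q, by simp [hpq], by simp, ?_⟩
  rw [Finset.insert_erase (Finset.mem_erase.2 ⟨hpq.symm, hq⟩), Finset.insert_erase hp]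

theorem one_lt_card_of_even {J : Finset (Fin l)} (hJ : Even J.card) (hne : J.Nonempty) :
    1 < J.card := by
  have := hne.card_pos
  obtain ⟨m, hm⟩ := hJ
  omega

/-- `S⁺` is generated by its lowest weight vector under the raising operators. -/
theorem eq_top_of_raising (h2 : (2 : k) ≠ 0) {N : Submodule k (SPlus k V)}
    (h0 : plusVec v 0 ∈ N)
    (hN : ∀ p q : Fin l, p ≠ q → ∀ s ∈ N,
      halfSpin v (sigma (unitVec v (p, true)) (unitVec v (q, true))) s ∈ N) : N = ⊤ := by
  refine eq_top_of_plusVec_mem v h2 fun μ hμ eμ => ?_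
  obtain ⟨J, rfl⟩ := exists_ind hμ
  clear hμ
  rw [sum_ind] at eμ
  norm_cast at eμ
  induction hn : J.card using Nat.strong_induction_on generalizing J with
  | _ n ih =>
    subst hn
    rcases J.eq_empty_or_nonempty with rfl | hJ
    · have : ind (∅ : Finset (Fin l)) = 0 := by ext; simp [ind]
      rwa [this]
    · obtain ⟨p, q, K, hp, hq, rfl⟩ := exists_eq_insert_insert (one_lt_card_of_even eμ hJ)
      have hpq : p ≠ q := fun h => hp (h ▸ Finset.mem_insert_self _ _)
      rw [Finset.card_insert_of_notMem hp, Finset.card_insert_of_notMem hq] at eμ ih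
      have eK : Even K.card := by
        rw [add_assoc] at eμ
        exact (Nat.even_add.1 eμ).2 (by decide)
      rw [ind_insert_insert hp hq]
      exact mem_of_halfSpin_sigma_mem v h2 hpq (isIndicator_ind K)
        (by rw [sum_ind]; exact_mod_cast eK) (hN p q hpq _ (ih _ (by omega) K eK rfl))

/-- `S⁺` is generated by its highest weight vector under the lowering operators. -/
theorem eq_top_of_lowering (h2 : (2 : k) ≠ 0) (hl : Even l) {N : Submodule k (SPlus k V)}
    (h1 : plusVec v 1 ∈ N)
    (hN : ∀ p q : Fin l, p ≠ q → ∀ s ∈ N,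
      halfSpin v (sigma (unitVec v (p, false)) (unitVec v (q, false))) s ∈ N) : N = ⊤ := by
  -- Monomials are indexed by their missing factors, so that the induction on the cardinality starts
  -- at the top monomial.
  have key : ∀ J : Finset (Fin l), Even J.card → plusVec v (1 - ind J) ∈ N := by
    intro J eJ
    induction hn : J.card using Nat.strong_induction_on generalizing J with
    | _ n ih =>
      subst hn
      rcases J.eq_empty_or_nonempty with rfl | hJ
      · have : 1 - ind (∅ : Finset (Fin l)) = 1 := by ext; simp [ind]
        rwa [this]
      · obtain ⟨p, q, K, hp, hq, rfl⟩ := exists_eq_insert_insert (one_lt_card_of_even eJ hJ)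
        have hpq : p ≠ q := fun h => hp (h ▸ Finset.mem_insert_self _ _)
        rw [Finset.card_insert_of_notMem hp, Finset.card_insert_of_notMem hq] at eJ ih
        have eK : Even K.card := by
          rw [add_assoc] at eJ
          exact (Nat.even_add.1 eJ).2 (by decide)
        have hs : 1 - ind (insert p (insert q K))
            = 1 - ind K + wt (p, false) + wt (q, false) := by
          have h3 : wt (p, false) = -wt (p, true) := wt_opp (p, true)
          have h4 : wt (q, false) = -wt (q, true) := wt_opp (q, true)
          rw [ind_insert_insert hp hq, h3, h4]
          abel
        rw [hs]
        refine mem_of_halfSpin_sigma_mem v h2 hpq (isIndicator_ind K).one_sub ?_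
          (hN p q hpq _ (ih _ (by omega) K eK rfl))
        simp only [Pi.sub_apply, Finset.sum_sub_distrib]
        refine (even_sum_one hl).sub ?_
        rw [sum_ind]
        exact_mod_cast eK
  refine eq_top_of_plusVec_mem v h2 fun μ hμ eμ => ?_
  obtain ⟨J, hJ⟩ := exists_ind hμ.one_sub
  have : μ = 1 - ind J := by rw [← hJ, sub_sub_cancel]
  rw [this]
  refine key J ?_
  have h3 : ∑ i, ind J i = ∑ i, (1 : Fin l → ℤ) i - ∑ i, μ i := by
    rw [← hJ, ← Finset.sum_sub_distrib]
    rfl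
  have h4 : Even (∑ i, ind J i) := h3 ▸ (even_sum_one hl).sub eμ
  rw [sum_ind] at h4
  exact_mod_cast h4

/-- An equivariant trilinear map on `S⁺` vanishes if it vanishes on the triples that start with
the lowest and the highest weight vector. -/
theorem trilinear_eq_zero (h2 : (2 : k) ≠ 0) (hl : Even l)
    (T : SPlus k V →ₗ[k] SPlus k V →ₗ[k] SPlus k V →ₗ[k] SPlus k V)
    (hT : ∀ A s t u, halfSpin v A (T s t u) = T (halfSpin v A s) t u + T s (halfSpin v A t) u
      + T s t (halfSpin v A u))
    (h : ∀ μ, IsIndicator μ → Even (∑ i, μ i) →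
      T (plusVec v 0) (plusVec v 1) (plusVec v μ) = 0) : T = 0 := by
  -- Lowering operators kill the lowest weight vector. By equivariance the kernel of `T (plusVec v
  -- 0)` is stable under them, and it contains the highest weight vector.
  have h1 : LinearMap.ker (T (plusVec v 0)) = ⊤ := by
    refine eq_top_of_lowering v h2 hl ?_ fun p q hpq t ht => ?_
    · exact LinearMap.mem_ker.2 (plus_ext v h2 fun μ hμ eμ => by
        rw [h μ hμ eμ, LinearMap.zero_apply])
    · rw [LinearMap.mem_ker] at ht ⊢
      ext1 u
      have h3 := hT (sigma (unitVec v (p, false)) (unitVec v (q, false))) (plusVec v 0) t u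
      have h0 : halfSpin v (sigma (unitVec v (p, false)) (unitVec v (q, false))) (plusVec v 0)
          = 0 := by
        rw [halfSpin_sigma_unitVec v h2 hpq isIndicator_zero even_sum_zero, plusVec_of_not,
          smul_zero]
        intro h'
        have := h' p
        simp [wt, hpq] at this
      rw [h0, ht, map_zero, LinearMap.zero_apply, LinearMap.zero_apply, LinearMap.zero_apply,
        LinearMap.zero_apply, map_zero, zero_add, add_zero] at h3
      rw [← h3, LinearMap.zero_apply]
  -- The kernel of `T` is a submodule of S⁺, and it now contains the lowest weight vector.
  have h4 : LinearMap.ker T = ⊤ := by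
    refine eq_top_of_raising v h2 ?_ fun p q hpq s hs => ?_
    · rw [LinearMap.mem_ker]
      exact LinearMap.ker_eq_top.1 h1
    · rw [LinearMap.mem_ker] at hs ⊢
      ext1 t
      ext1 u
      have h3 := hT (sigma (unitVec v (p, true)) (unitVec v (q, true))) s t u
      simp only [hs, LinearMap.zero_apply, map_zero, add_zero] at h3
      simp only [LinearMap.zero_apply, h3.symm]
  exact LinearMap.ker_eq_top.1 h4

variable (l k) in
/-- The sign of the symmetry of the form `b̂`. -/
def epsilon : k := sgn k (lowForm (1 : Fin l → ℤ) 1)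

/-- For complementary weights the product of the two signs is (-1) to `lowForm 1 1`, by additivity
in the first argument. -/
theorem bHat_comm (h2 : (2 : k) ≠ 0) (s t : SPlus k V) :
    bHat v t s = epsilon k l * bHat v s t := by
  have : (bHat v).flip = epsilon k l • bHat v := by
    refine plus_ext v h2 fun μ hμ eμ => plus_ext v h2 fun ν hν eν => ?_
    rw [LinearMap.flip_apply, LinearMap.smul_apply, LinearMap.smul_apply,
      bHat_plusVec v hμ eν eμ, bHat_plusVec v hν eμ eν, add_comm ν μ]
    split_ifs with h
    · have e : lowForm (1 : Fin l → ℤ) 1 = lowForm μ 1 + lowForm ν 1 := by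
        rw [← lowForm_add_left, h]
      rw [epsilon, smul_eq_mul, ← sgn_add, e]
      exact sgn_congr ⟨lowForm μ 1 + lowForm ν 1, by ring⟩
    · rw [smul_zero]
  exact LinearMap.congr_fun₂ this s t

/-- Moving σ_{x,y} across b̂ costs -1, and exchanging the arguments of b̂ costs ε. -/
theorem oddBracket_comm (h2 : (2 : k) ≠ 0) (s t : SPlus k V) :
    oddBracket v t s = -epsilon k l • oddBracket v s t := by
  refine so_eq_of_dualProd v fun x y => ?_
  rw [SetLike.val_smul, LinearMap.smul_apply, map_smul, dualProd_oddBracket, dualProd_oddBracket,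
    bHat_halfSpin v h2, bHat_comm v h2]
  simp

/-- The triple product `[[s, t], u]` of `S⁺`. -/
noncomputable def spinTriple : SPlus k V →ₗ[k] SPlus k V →ₗ[k] SPlus k V →ₗ[k] SPlus k V :=
  (oddBracket v).compr₂ (halfSpin v)

theorem spinTriple_apply (s t u : SPlus k V) :
    spinTriple v s t u = halfSpin v (oddBracket v s t) u := rfl

theorem halfSpin_spinTriple (h2 : (2 : k) ≠ 0) (A : So k V) (s t u : SPlus k V) :
    halfSpin v A (spinTriple v s t u) = spinTriple v (halfSpin v A s) t u
      + spinTriple v s (halfSpin v A t) u + spinTriple v s t (halfSpin v A u) := by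
  have := halfSpin_lie v h2 A (oddBracket v s t) u
  rw [lie_oddBracket v h2, map_add, LinearMap.add_apply] at this
  simp only [spinTriple_apply]
  rw [this]
  abel

/-- The Jacobi expression `[[s, t], u] + [[t, u], s] + [[u, s], t]`. -/
noncomputable def jac : SPlus k V →ₗ[k] SPlus k V →ₗ[k] SPlus k V →ₗ[k] SPlus k V :=
  spinTriple v + (LinearMap.lflip.toLinearMap ∘ₗ spinTriple v).flip
    + LinearMap.lflip.toLinearMap ∘ₗ (spinTriple v).flip

theorem jac_apply (s t u : SPlus k V) : jac v s t u = halfSpin v (oddBracket v s t) u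
    + halfSpin v (oddBracket v t u) s + halfSpin v (oddBracket v u s) t := rfl

/-- The odd product of the two extreme vectors is -½ ∑ H_i, and ∑ H_i has the eigenvalue |J| - l/2.
-/
theorem spinTriple_zero_one (h2 : (2 : k) ≠ 0) (hl : Even l) {J : Finset (Fin l)}
    (hJ : Even J.card) :
    spinTriple v (plusVec v 0) (plusVec v 1) (plusVec v (ind J))
      = (((l : k) - 2 * J.card) / 4) • plusVec v (ind J) := by
  have eJ : Even (∑ i, ind J i) := by rw [sum_ind]; exact_mod_cast hJ
  rw [spinTriple_apply, oddBracket_plusVec_opp v h2 isIndicator_zero isIndicator_one even_sum_zero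
    (even_sum_one hl) (zero_add _), sgn_even (by simp [lowForm]), one_smul, map_sum,
    LinearMap.sum_apply]
  simp only [map_smul, LinearMap.smul_apply, halfSpin_cartan v h2 _ (isIndicator_ind J) eJ,
    smul_smul, ← Finset.sum_smul]
  congr 1
  simp only [Pi.zero_apply, Int.cast_zero]
  rw [← Finset.mul_sum, Finset.sum_sub_distrib]
  have : ∑ i, ((ind J i : ℤ) : k) = J.card := by
    rw [← Int.cast_sum, sum_ind, Int.cast_natCast]
  rw [this]
  have h4 : (4 : k) = 2 * 2 := by norm_num
  simp only [Finset.sum_const, Finset.card_univ, Fintype.card_fin,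
    nsmul_eq_mul, h4]
  field_simp
  ring

theorem wt_true_add (p q : Fin l) (hpq : p ≠ q) : wt (p, true) + wt (q, true) = ind {p, q} := by
  have h := ind_insert_insert (p := p) (q := q) (J := ∅) (by simp [hpq]) (by simp)
  have h0 : ind (∅ : Finset (Fin l)) = 0 := by ext; simp [ind]
  rw [h0, zero_add] at h
  rw [← h]
  rfl

theorem one_sub_ind (J : Finset (Fin l)) : 1 - ind J = ind Jᶜ := by
  ext j
  by_cases h : j ∈ J <;> simp [ind, h]

theorem wt_add_eq_ind {a b : Fin l × Bool} (hab : a.1 ≠ b.1) {J : Finset (Fin l)} (hJ : J.Nonempty)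
    (eJ : Even J.card) (h : ind J = wt a + wt b) :
    J.card = 2 ∧ a.2 = true ∧ b.2 = true := by
  have hs : (J.card : ℤ) = wt a a.1 + wt b b.1 := by
    rw [← sum_ind, h]
    simp only [Pi.add_apply, Finset.sum_add_distrib]
    congr 1
    · exact Finset.sum_eq_single a.1 (fun i _ hi => wt_apply_of_ne a hi) (by simp)
    · exact Finset.sum_eq_single b.1 (fun i _ hi => wt_apply_of_ne b hi) (by simp)
  have h1 := one_lt_card_of_even eJ hJ
  obtain ⟨i, s⟩ := a
  obtain ⟨j, t⟩ := b
  cases s <;> cases t <;>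
    simp only [wt, Pi.single_eq_same, if_true, Bool.false_eq_true, if_false] at hs <;>
    first
    | (exfalso; omega)
    | exact ⟨by omega, rfl, rfl⟩

theorem neg_sgn (n : ℤ) : -sgn k n = sgn k (n + 1) := by
  rw [sgn_add, sgn_odd odd_one, mul_neg_one]

/-- The product of e_1 and e_J has weight ind J, which is 0 or a root only for |J| = 0 or 2. The
first case is `spinTriple_zero_one` up to the sign -ε; in the second a root element raises e_0 to
e_J. -/
theorem spinTriple_one_self_zero (h2 : (2 : k) ≠ 0) (hl : Even l)
    {J : Finset (Fin l)} (hJ : Even J.card) :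
    spinTriple v (plusVec v 1) (plusVec v (ind J)) (plusVec v 0)
      = (-epsilon k l * (if J.card = 0 then (l : k) / 4 else if J.card = 2 then 1 else 0))
        • plusVec v (ind J) := by
  have eJ : Even (∑ i, ind J i) := by rw [sum_ind]; exact_mod_cast hJ
  rcases J.eq_empty_or_nonempty with rfl | hne
  · have h0 : ind (∅ : Finset (Fin l)) = 0 := by ext; simp [ind]
    have := spinTriple_zero_one v h2 hl (J := ∅) (by simp)
    rw [h0] at this ⊢
    rw [spinTriple_apply, oddBracket_comm v h2, map_smul, LinearMap.smul_apply,
      ← spinTriple_apply, this, smul_smul]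
    simp
  rw [if_neg (Finset.card_ne_zero.2 hne)]
  rw [spinTriple_apply]
  by_cases hc : J.card = 2
  · obtain ⟨p, q, hpq, rfl⟩ := Finset.card_eq_two.1 hc
    have hs := wt_true_add p q hpq
    rw [oddBracket_plusVec_of_root v h2 (a := (p, true)) (b := (q, true)) hpq isIndicator_one
      (isIndicator_ind _) (even_sum_one hl) eJ (by rw [hs]; abel), map_smul, LinearMap.smul_apply,
      halfSpin_sigma_unitVec v h2 hpq isIndicator_zero even_sum_zero, zero_add, hs, smul_smul,
      if_pos hc, neg_mul_neg, ← sgn_add, mul_one, epsilon]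
    congr 1
    rw [show (1 : Fin l → ℤ) - ind {p, q} = 1 + -ind {p, q} from sub_eq_add_neg _ _,
      lowForm_add_left 1, lowForm_neg_left, neg_sgn]
    have ho := odd_lowForm_wt (a := (p, true)) (b := (q, true)) hpq
    refine sgn_congr ?_
    have hz : ∀ x : Fin l → ℤ, lowForm x 0 = 0 := fun x => by simp [lowForm]
    rw [hz, hz]
    obtain ⟨m, hm⟩ := ho
    exact ⟨m + 1 + lowForm 1 1, by linear_combination hm⟩
  · rw [if_neg hc, oddBracket_plusVec_eq_zero v h2 isIndicator_one (isIndicator_ind _)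
      (even_sum_one hl) eJ]
    · simp
    · intro h
      obtain ⟨i, hi⟩ := hne
      have := congrFun h i
      simp [ind, hi] at this
    · intro a b hab h
      rw [add_sub_cancel_left] at h
      exact hc (wt_add_eq_ind hab hne hJ h).1

/-- Mirror image of `spinTriple_one_self_zero`: the product of e_J and e_0 has weight ind J - 1, so
the complement of J has 0 or 2 elements. -/
theorem spinTriple_self_zero_one (h2 : (2 : k) ≠ 0) (hl : Even l)
    {J : Finset (Fin l)} (hJ : Even J.card) :
    spinTriple v (plusVec v (ind J)) (plusVec v 0) (plusVec v 1)
      = (epsilon k l * (if J.card = l then (l : k) / 4 else if J.card + 2 = l then 1 else 0))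
        • plusVec v (ind J) := by
  have eJ : Even (∑ i, ind J i) := by rw [sum_ind]; exact_mod_cast hJ
  have hcard : Jᶜ.card + J.card = l := by
    rw [Finset.card_compl_add_card, Fintype.card_fin]
  have hJc : Even Jᶜ.card := (Nat.even_add.1 (by rw [hcard]; exact hl)).2 hJ
  rw [spinTriple_apply, oddBracket_comm v h2, map_smul, LinearMap.smul_apply]
  rcases Jᶜ.eq_empty_or_nonempty with he | hne
  · have h1 : ind J = 1 := by
      rw [← sub_sub_self (1 : Fin l → ℤ) (ind J), one_sub_ind, he]
      ext
      simp [ind]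
    have hJl : J.card = l := by rw [he] at hcard; simpa using hcard
    have := spinTriple_zero_one v h2 hl hJ
    rw [h1] at this ⊢
    rw [← spinTriple_apply, this, smul_smul, if_pos hJl, hJl]
    congr 1
    ring
  have hJl : J.card ≠ l := by
    have := hne.card_pos
    omega
  rw [if_neg hJl]
  by_cases hc : J.card + 2 = l
  · obtain ⟨p, q, hpq, hJpq⟩ := Finset.card_eq_two.1 (show Jᶜ.card = 2 by omega)
    have hs := wt_true_add p q hpq
    rw [← hJpq, ← one_sub_ind] at hs
    have hs' : wt (p, false) + wt (q, false) = ind J - 1 := by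
      have h3 : wt (p, false) = -wt (p, true) := wt_opp (p, true)
      have h4 : wt (q, false) = -wt (q, true) := wt_opp (q, true)
      rw [h3, h4, ← neg_add, hs, neg_sub]
    have hJ' : (1 : Fin l → ℤ) + wt (p, false) + wt (q, false) = ind J := by
      rw [add_assoc, hs', add_sub_cancel]
    rw [oddBracket_plusVec_of_root v h2 (a := (p, false)) (b := (q, false)) hpq isIndicator_zero
      (isIndicator_ind _) even_sum_zero eJ (by rw [hs', zero_add]), map_smul, LinearMap.smul_apply,
      halfSpin_sigma_unitVec v h2 hpq isIndicator_one (even_sum_one hl), hJ', smul_smul, smul_smul,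
      if_pos hc, neg_mul_neg, mul_neg, mul_assoc, ← sgn_add, mul_one, ← mul_neg]
    congr 1
    have hz : ∀ x : Fin l → ℤ, lowForm x 0 = 0 := fun x => by simp [lowForm]
    have ho := odd_lowForm_wt (a := (p, false)) (b := (q, false)) hpq
    have e1 : (1 : Fin l → ℤ) - ind J = -(wt (p, false) + wt (q, false)) := by rw [hs', neg_sub]
    rw [sgn_odd, neg_neg, mul_one]
    rw [hz, e1, lowForm_neg_left, lowForm_add_left]
    obtain ⟨m, hm⟩ := ho
    exact ⟨m, by linear_combination hm⟩
  · rw [if_neg hc, oddBracket_plusVec_eq_zero v h2 isIndicator_zero (isIndicator_ind _)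
      even_sum_zero eJ]
    · simp
    · intro h
      obtain ⟨i, hi⟩ := hne
      have := congrFun h i
      simp only [Finset.mem_compl] at hi
      simp [ind, hi] at this
    · intro a b hab h
      have h' : ind Jᶜ = wt (opp a) + wt (opp b) := by
        rw [wt_opp, wt_opp, ← neg_add, ← h, ← one_sub_ind]
        abel
      exact hc (by have := (wt_add_eq_ind (by exact hab) hne hJc h').1; omega)

/-- The eigenvalues of `jac(e₀, e₁, ·)`. -/
noncomputable def jacCoeff (k : Type*) [Field k] (l n : ℕ) : k :=
  ((l : k) - 2 * n) / 4
    - epsilon k l * (if n = 0 then (l : k) / 4 else if n = 2 then 1 else 0)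
    + epsilon k l * (if n = l then (l : k) / 4 else if n + 2 = l then 1 else 0)

theorem jac_zero_one (h2 : (2 : k) ≠ 0) (hl : Even l)
    {J : Finset (Fin l)} (hJ : Even J.card) :
    jac v (plusVec v 0) (plusVec v 1) (plusVec v (ind J))
      = jacCoeff k l J.card • plusVec v (ind J) := by
  rw [jac_apply, ← spinTriple_apply, ← spinTriple_apply, ← spinTriple_apply,
    spinTriple_zero_one v h2 hl hJ, spinTriple_one_self_zero v h2 hl hJ,
    spinTriple_self_zero_one v h2 hl hJ, ← add_smul, ← add_smul, jacCoeff, neg_mul,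
    ← sub_eq_add_neg]

theorem plusVec_ind_ne_zero {J : Finset (Fin l)} (hJ : Even J.card) :
    plusVec v (ind J) ≠ 0 := by
  intro h
  have := congrArg Subtype.val h
  rw [plusVec_coe v (by rw [sum_ind]; exact_mod_cast hJ), weightVector_ind] at this
  exact v.ExteriorAlgebra.ne_zero J this

/-- The cyclic sum is equivariant, so `trilinear_eq_zero` reduces its vanishing to the diagonal
operator of `jac_zero_one`. -/
theorem jac_eq_zero_iff (h2 : (2 : k) ≠ 0) (hl : Even l) :
    jac v = 0 ↔ ∀ n, Even n → n ≤ l → jacCoeff k l n = 0 := by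
  constructor
  · intro h n hn hnl
    obtain ⟨J, -, rfl⟩ := Finset.exists_subset_card_eq (s := (Finset.univ : Finset (Fin l)))
      (by simpa using hnl)
    have := jac_zero_one v h2 hl hn
    rw [h] at this
    exact (smul_eq_zero.1 this.symm).resolve_right (plusVec_ind_ne_zero v hn)
  · intro h
    refine trilinear_eq_zero v h2 hl _ (fun A s t u => ?_) fun μ hμ eμ => ?_
    · simp only [jac_apply, ← spinTriple_apply, map_add, halfSpin_spinTriple v h2]
      abel
    · obtain ⟨J, rfl⟩ := exists_ind hμ
      rw [sum_ind] at eμ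
      have eJ : Even J.card := by exact_mod_cast eμ
      rw [jac_zero_one v h2 hl eJ, h _ eJ (by simpa using J.card_le_univ), zero_smul]

/-- Hence ε = (-1)^(l(l-1)/2) depends on l modulo 4 only; doubling avoids the division. -/
theorem two_mul_lowForm_one : 2 * lowForm (1 : Fin l → ℤ) 1 = (l : ℤ) * (l - 1) := by
  rw [lowForm_one_right]
  simp only [Pi.one_apply, one_mul]
  have h := Finset.sum_range_id_mul_two l
  rw [← Fin.sum_univ_eq_sum_range (fun i => i)] at h
  rcases l.eq_zero_or_pos with h0 | h0
  · subst h0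
    simp
  · zify [Nat.one_le_iff_ne_zero.2 h0.ne'] at h
    linear_combination h

theorem epsilon_four_mul (m : ℕ) : epsilon k (4 * m) = 1 := by
  have h := two_mul_lowForm_one (l := 4 * m)
  refine sgn_even ⟨m * (4 * m - 1), ?_⟩
  push_cast at h
  linarith

theorem epsilon_four_mul_add_two (m : ℕ) : epsilon k (4 * m + 2) = -1 := by
  have h := two_mul_lowForm_one (l := 4 * m + 2)
  refine sgn_odd ⟨(4 * m ^ 2 + 3 * m), ?_⟩
  push_cast at h
  linarith

end HalfSpin
end TypeD

namespace Z2Algebra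

/-! ### Graded algebras of a representation with an equivariant odd product -/

section OfAction

variable {k L M : Type*} [Field k] [LieRing L] [LieAlgebra k L] [AddCommGroup M] [Module k M]
  (ρ : L →ₗ[k] M →ₗ[k] M) (β : M →ₗ[k] M →ₗ[k] L)

theorem ofAction_mul (x y : L × M) : (ofAction ρ β).mul x y
    = (⁅x.1, y.1⁆ + β x.2 y.2, ρ x.1 y.2 - ρ y.1 x.2) := by
  rw [sub_eq_add_neg]
  rfl

/-- The graded algebra of an equivariant `β` is a Lie algebra if and only if `β` is alternating and
the Jacobi identity holds for three odd elements. -/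
theorem ofAction_isLieAlgebra_iff
    (hρ : ∀ x y s, ρ ⁅x, y⁆ s = ρ x (ρ y s) - ρ y (ρ x s))
    (hβ : ∀ x s t, ⁅x, β s t⁆ = β (ρ x s) t + β s (ρ x t)) :
    (ofAction ρ β).IsLieAlgebra ↔
      (∀ s, β s s = 0) ∧ ∀ s t u, ρ (β s t) u + ρ (β t u) s + ρ (β u s) t = 0 := by
  constructor
  · intro h
    constructor
    · intro s
      have := congrArg Prod.fst (h.mul_self (0, s))
      rw [ofAction_mul] at this
      simpa using this
    · intro s t u
      have h3 := congrArg Prod.snd (h.jacobi (0, s) (0, t) (0, u))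
      simp only [ofAction_mul, Prod.snd_add, map_zero, LinearMap.zero_apply, lie_zero, zero_sub,
        sub_zero, zero_add, Prod.snd_zero] at h3
      rw [← neg_eq_zero, ← h3]
      abel
  · rintro ⟨hself, hj⟩
    have hskew : ∀ s t, β t s = -β s t := fun s t => by
      have h3 := hself (s + t)
      simp only [map_add, LinearMap.add_apply, hself] at h3
      rw [eq_neg_iff_add_eq_zero, ← h3]
      abel
    constructor
    · intro x
      rw [ofAction_mul, lie_self, hself, sub_self, zero_add]
      rfl
    · rintro ⟨A, s⟩ ⟨B, t⟩ ⟨C, u⟩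
      simp only [ofAction_mul, lie_add, hβ, map_sub, map_add, hρ, LinearMap.add_apply]
      refine Prod.ext ?_ ?_
      · simp only [Prod.fst_add, Prod.fst_zero]
        rw [hskew (ρ A t) u, hskew (ρ B u) s, hskew (ρ C s) t, ← lie_jacobi A B C]
        abel
      · simp only [Prod.snd_add, Prod.snd_zero]
        rw [← neg_zero, ← hj s t u]
        abel

/-- The graded algebra of an equivariant `β` is a Lie superalgebra if and only if `β` is symmetric
and the Jacobi identity and its cubic form hold for odd elements. -/
theorem ofAction_isLieSuperalgebra_iff
    (hρ : ∀ x y s, ρ ⁅x, y⁆ s = ρ x (ρ y s) - ρ y (ρ x s))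
    (hβ : ∀ x s t, ⁅x, β s t⁆ = β (ρ x s) t + β s (ρ x t)) :
    (ofAction ρ β).IsLieSuperalgebra ↔ (∀ s t, β s t = β t s) ∧
      (∀ s t u, ρ (β s t) u + ρ (β t u) s + ρ (β u s) t = 0) ∧ ∀ s, ρ (β s s) s = 0 := by
  constructor
  · exact fun h => ⟨h.oo_comm, h.jacobi_ooo, h.cube⟩
  · rintro ⟨hsymm, hj, hc⟩
    exact
      { ee_self := lie_self
        oe_eq := fun _ _ => rfl
        oo_comm := hsymm
        jacobi_eee := fun x y z => leibniz_lie x y z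
        jacobi_eeo := fun x y s => by
          change ρ x (ρ y s) = ρ ⁅x, y⁆ s + ρ y (ρ x s)
          rw [hρ]
          abel
        jacobi_eoo := hβ
        jacobi_ooo := hj
        cube := hc }

/-- The cubic map `s ↦ [[s, s], s]` is additive as soon as the Jacobi identity holds. -/
theorem cube_add (hsymm : ∀ s t, β s t = β t s)
    (hj : ∀ s t u, ρ (β s t) u + ρ (β t u) s + ρ (β u s) t = 0) (s t : M) :
    ρ (β (s + t) (s + t)) (s + t) = ρ (β s s) s + ρ (β t t) t := by
  have h3 := hj s s t
  have h4 := hj t t s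
  rw [hsymm t s] at h3
  rw [hsymm s t] at h4
  -- The mixed terms of the cube are exactly the Jacobi sums of (s, s, t) and (t, t, s).
  have h5 : ρ (β (s + t) (s + t)) (s + t) = ρ (β s s) s + ρ (β t t) t
      + (ρ (β s s) t + ρ (β s t) s + ρ (β s t) s)
      + (ρ (β t t) s + ρ (β t s) t + ρ (β t s) t) := by
    simp only [map_add, LinearMap.add_apply, hsymm t s]
    abel
  rw [h5, h3, h4, add_zero, add_zero]

end OfAction

end Z2Algebra

namespace TypeD
open CliffordAlgebra (contractLeft evenOdd)

/-! ### The values of l for which the Jacobi identities hold -/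

section HalfSpin

variable {k V : Type*} [Field k] [AddCommGroup V] [Module k V]
  {l : ℕ} (v : Module.Basis (Fin l) k V)

theorem eq_zero_of_smul_so {r : k} {A : So k V} (hr : r ≠ 0) (h : r • A = 0) : A = 0 := by
  rw [← one_smul k A, ← inv_mul_cancel₀ hr, mul_smul, h, smul_zero]

theorem halfSpin_smul (r : k) (A : So k V) (s : SPlus k V) :
    halfSpin v (r • A) s = r • halfSpin v A s := by
  rw [(halfSpin v).map_smul]
  rfl

/-- One nonzero product is enough to read off ε from the required symmetry of the odd product. -/
theorem oddBracket_zero_one_ne_zero (h2 : (2 : k) ≠ 0) (hl : Even l) (hl0 : 0 < l) :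
    oddBracket v (plusVec v 0) (plusVec v 1) ≠ 0 := by
  intro h
  have h3 := dualProd_oddBracket v (plusVec v 0) (plusVec v 1)
    (unitVec v (opp (⟨0, hl0⟩, true))) (unitVec v (⟨0, hl0⟩, true))
  rw [h, halfSpin_sigma_opp v h2 _ isIndicator_zero even_sum_zero, map_smul, LinearMap.smul_apply,
    bHat_plusVec v isIndicator_one even_sum_zero (even_sum_one hl), zero_add, if_pos rfl,
    ZeroMemClass.coe_zero, LinearMap.zero_apply, map_zero, sgn_even (by simp [lowForm])] at h3
  simp [wt] at h3
  exact h2 h3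

theorem isLieAlgebra_iff (h2 : (2 : k) ≠ 0) (hl : Even l) (hl0 : 0 < l) :
    (algebra v).IsLieAlgebra ↔ epsilon k l = 1 ∧ jac v = 0 := by
  rw [algebra, Z2Algebra.ofAction_isLieAlgebra_iff _ _ (halfSpin_lie v h2) (lie_oddBracket v h2)]
  constructor
  · rintro ⟨hself, hj⟩
    constructor
    · have h3 := hself (plusVec v 0 + plusVec v 1)
      rw [map_add, map_add, LinearMap.add_apply, LinearMap.add_apply, hself, hself, zero_add,
        add_zero, oddBracket_comm v h2 (plusVec v 0) (plusVec v 1)] at h3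
      have h4 : (1 - epsilon k l) • oddBracket v (plusVec v 0) (plusVec v 1) = 0 := by
        rw [← h3]; module
      by_contra hne
      exact oddBracket_zero_one_ne_zero v h2 hl hl0
        (eq_zero_of_smul_so (fun h => hne (sub_eq_zero.1 h).symm) h4)
    · ext1 s
      ext1 t
      ext1 u
      rw [jac_apply]
      exact hj s t u
  · rintro ⟨hε, hj⟩
    refine ⟨fun s => ?_, fun s t u => by rw [← jac_apply, hj]; rfl⟩
    have h3 : (2 : k) • oddBracket v s s = 0 := by
      rw [two_smul]
      nth_rewrite 1 [oddBracket_comm v h2, hε, neg_smul, one_smul]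
      exact neg_add_cancel _
    exact eq_zero_of_smul_so h2 h3

theorem plusVec_induction (h2 : (2 : k) ≠ 0) {P : SPlus k V → Prop}
    (hadd : ∀ s t, P s → P t → P (s + t)) (hsmul : ∀ (r : k) s, P s → P (r • s))
    (hvec : ∀ μ, IsIndicator μ → Even (∑ i, μ i) → P (plusVec v μ)) (s : SPlus k V) : P s := by
  let N : Submodule k (SPlus k V) :=
    { carrier := {s | P s}
      zero_mem' := by
        have := hsmul 0 _ (hvec 0 isIndicator_zero even_sum_zero)
        rwa [zero_smul] at this
      add_mem' := fun {s t} hs ht => hadd s t hs ht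
      smul_mem' := fun r s hs => hsmul r s hs }
  have hN : N = ⊤ := eq_top_of_plusVec_mem v h2 hvec
  have : s ∈ N := hN ▸ Submodule.mem_top
  exact this

theorem isLieSuperalgebra_iff (h2 : (2 : k) ≠ 0) (hl : Even l) (hl0 : 0 < l) :
    (algebra v).IsLieSuperalgebra ↔ epsilon k l = -1 ∧ jac v = 0 := by
  rw [algebra, Z2Algebra.ofAction_isLieSuperalgebra_iff _ _ (halfSpin_lie v h2)
    (lie_oddBracket v h2)]
  constructor
  · rintro ⟨hsymm, hj, -⟩
    constructor
    · have h3 := hsymm (plusVec v 1) (plusVec v 0)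
      rw [oddBracket_comm v h2 (plusVec v 0) (plusVec v 1)] at h3
      have h4 : (-epsilon k l - 1) • oddBracket v (plusVec v 0) (plusVec v 1) = 0 := by
        rw [sub_smul, h3, one_smul, sub_self]
      by_contra hne
      exact oddBracket_zero_one_ne_zero v h2 hl hl0
        (eq_zero_of_smul_so (fun h => hne (by linear_combination -h)) h4)
    · ext1 s
      ext1 t
      ext1 u
      rw [jac_apply]
      exact hj s t u
  · rintro ⟨hε, hj⟩
    have hsymm : ∀ s t, oddBracket v s t = oddBracket v t s := fun s t => by
      rw [oddBracket_comm v h2 t s, hε, neg_neg, one_smul]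
    have hJ : ∀ s t u, halfSpin v (oddBracket v s t) u + halfSpin v (oddBracket v t u) s
        + halfSpin v (oddBracket v u s) t = 0 := fun s t u => by
      rw [← jac_apply, hj]; rfl
    -- In characteristic 3 the cubic identity is not a consequence of the Jacobi identity. The cube
    -- is additive, however, so it may be checked on weight vectors.
    refine ⟨hsymm, hJ, plusVec_induction v h2 ?_ ?_ ?_⟩
    · exact fun s t hs ht => by
        rw [Z2Algebra.cube_add _ _ hsymm hJ, hs, ht, add_zero]
    · intro r s hs
      simp only [map_smul, LinearMap.smul_apply, hs, smul_zero]
    · intro μ hμ eμ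
      -- The product of e_μ with itself has weight 2μ - 1. If this is a root, then applying it to
      -- e_μ gives weight 3μ - 1, with the entry -1 or 2, and this is no weight.
      by_cases h : ∃ a b : Fin l × Bool, a.1 ≠ b.1 ∧ μ + μ - 1 = wt a + wt b
      · obtain ⟨a, b, hab, h⟩ := h
        rw [oddBracket_plusVec_of_root v h2 hab hμ hμ eμ eμ h, map_smul, LinearMap.smul_apply,
          halfSpin_sigma_unitVec v h2 hab hμ eμ, plusVec_of_not, smul_zero, smul_zero]
        intro h'
        have h3 := congrFun h a.1
        have h4 := h' a.1
        simp only [Pi.add_apply, Pi.sub_apply, Pi.one_apply, wt_apply_of_ne b hab] at h3 h4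
        rcases hμ a.1 with h5 | h5 <;> omega
      · rw [oddBracket_plusVec_eq_zero v h2 hμ hμ eμ eμ, map_zero, LinearMap.zero_apply]
        · intro h'
          have := congrFun h' ⟨0, hl0⟩
          simp only [Pi.add_apply, Pi.one_apply] at this
          omega
        · exact fun a b hab h' => h ⟨a, b, hab, h'⟩

/-- Neither 4 nor 6 is one of 0, 2, l - 2, l, so the eigenvalues are (l - 8)/4 and (l - 12)/4, which
differ by 1. -/
theorem jacCoeff_succ_eq_zero {l : ℕ} (hl : 10 ≤ l) (hle : Even l) (h2 : (2 : k) ≠ 0)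
    (h : ∀ n, Even n → n ≤ l → jacCoeff k l n = 0) : False := by
  have h4 := h 4 (by decide) (by omega)
  have h6 := h 6 (by decide) (by omega)
  obtain ⟨m, hm⟩ := hle
  have h44 : (4 : k) ≠ 0 := by
    have : (4 : k) = 2 * 2 := by norm_num
    rw [this]
    exact mul_ne_zero h2 h2
  rw [jacCoeff, if_neg (by norm_num), if_neg (by norm_num), if_neg (by omega), if_neg (by omega),
    mul_zero, sub_zero, add_zero] at h4 h6
  have : (1 : k) = 0 := by
    have e : (((l : k) - 2 * (4 : ℕ)) / 4) - (((l : k) - 2 * (6 : ℕ)) / 4) = 1 := by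
      field_simp
      push_cast
      ring
    rw [← e, h4, h6, sub_zero]
  exact one_ne_zero this

theorem four_ne_zero_of_two (h2 : (2 : k) ≠ 0) : (4 : k) ≠ 0 := by
  have : (4 : k) = 2 * 2 := by norm_num
  rw [this]
  exact mul_ne_zero h2 h2

theorem jacCoeff_of_eight (h2 : (2 : k) ≠ 0) {n : ℕ} (hn : Even n) (hn8 : n ≤ 8) :
    jacCoeff k 8 n = 0 := by
  have h4 := four_ne_zero_of_two h2
  have e : epsilon k 8 = 1 := epsilon_four_mul 2
  obtain ⟨m, rfl⟩ := hn
  have hm : m ≤ 4 := by omega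
  interval_cases m <;> simp [jacCoeff, e] <;> field_simp <;> norm_num

theorem jacCoeff_of_four (h2 : (2 : k) ≠ 0) {n : ℕ} (hn : Even n) (hn8 : n ≤ 4) :
    jacCoeff k 4 n = 0 := by
  have h4 := four_ne_zero_of_two h2
  have e : epsilon k 4 = 1 := epsilon_four_mul 1
  obtain ⟨m, rfl⟩ := hn
  have hm : m ≤ 2 := by omega
  interval_cases m <;> simp [jacCoeff, e] <;> field_simp <;> norm_num

theorem jacCoeff_of_two (h2 : (2 : k) ≠ 0) {n : ℕ} (hn : Even n) (hn8 : n ≤ 2) :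
    jacCoeff k 2 n = 0 := by
  have h4 := four_ne_zero_of_two h2
  have e : epsilon k 2 = -1 := epsilon_four_mul_add_two 0
  obtain ⟨m, rfl⟩ := hn
  have hm : m ≤ 1 := by omega
  interval_cases m <;> simp [jacCoeff, e] <;> field_simp <;> norm_num

/-- The eigenvalues for n = 0, 2, 4, 6 are 3, 3/2, -3/2 and -3. -/
theorem jacCoeff_of_six (h2 : (2 : k) ≠ 0) (h3 : (3 : k) = 0) {n : ℕ} (hn : Even n) (hn8 : n ≤ 6) :
    jacCoeff k 6 n = 0 := by
  have h4 := four_ne_zero_of_two h2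
  have e : epsilon k 6 = -1 := epsilon_four_mul_add_two 1
  obtain ⟨m, rfl⟩ := hn
  have hm : m ≤ 3 := by omega
  interval_cases m <;> simp [jacCoeff, e] <;> field_simp
  · linear_combination 4 * h3
  · linear_combination 2 * h3
  · linear_combination -2 * h3
  · linear_combination -4 * h3

theorem isLieAlgebra_iff_eq (h2 : (2 : k) ≠ 0) (hl : Even l) (hl0 : 0 < l) :
    (algebra v).IsLieAlgebra ↔ l = 8 ∨ l = 4 := by
  have hone : (1 : k) ≠ -1 := fun h => h2 (by linear_combination h)
  rw [isLieAlgebra_iff v h2 hl hl0, jac_eq_zero_iff v h2 hl]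
  constructor
  · rintro ⟨he, hj⟩
    have h10 : ¬10 ≤ l := fun h => jacCoeff_succ_eq_zero h hl h2 hj
    obtain ⟨m, rfl⟩ := hl
    have hm : m ≤ 4 := by omega
    interval_cases m
    · omega
    · exact absurd (he.symm.trans (epsilon_four_mul_add_two 0)) hone
    · exact Or.inr rfl
    · exact absurd (he.symm.trans (epsilon_four_mul_add_two 1)) hone
    · exact Or.inl rfl
  · rintro (rfl | rfl)
    · exact ⟨epsilon_four_mul 2, fun n hn hn' => jacCoeff_of_eight h2 hn hn'⟩
    · exact ⟨epsilon_four_mul 1, fun n hn hn' => jacCoeff_of_four h2 hn hn'⟩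

theorem isLieSuperalgebra_iff_eq (h2 : (2 : k) ≠ 0) (hl : Even l) (hl0 : 0 < l) :
    (algebra v).IsLieSuperalgebra ↔ (l = 6 ∧ (3 : k) = 0) ∨ l = 2 := by
  have hone : (-1 : k) ≠ 1 := fun h => h2 (by linear_combination -h)
  rw [isLieSuperalgebra_iff v h2 hl hl0, jac_eq_zero_iff v h2 hl]
  constructor
  · rintro ⟨he, hj⟩
    have h10 : ¬10 ≤ l := fun h => jacCoeff_succ_eq_zero h hl h2 hj
    obtain ⟨m, rfl⟩ := hl
    have hm : m ≤ 4 := by omega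
    interval_cases m
    · omega
    · exact Or.inr rfl
    · exact absurd (he.symm.trans (epsilon_four_mul 1)) hone
    · have h4 := four_ne_zero_of_two h2
      -- With ε = -1 the eigenvalue at 0 is 6/4 + 6/4 = 3.
      have h0 := hj 0 (by decide) (by omega)
      have e : epsilon k 6 = -1 := epsilon_four_mul_add_two 1
      refine Or.inl ⟨rfl, ?_⟩
      simp [jacCoeff, e] at h0
      field_simp at h0
      have h6 : (4 : k) * 3 = 0 := by linear_combination h0
      exact (mul_eq_zero.1 h6).resolve_left h4
    · exact absurd (he.symm.trans (epsilon_four_mul 2)) hone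
  · rintro (⟨rfl, h3⟩ | rfl)
    · exact ⟨epsilon_four_mul_add_two 1, fun n hn hn' => jacCoeff_of_six h2 h3 hn hn'⟩
    · exact ⟨epsilon_four_mul_add_two 0, fun n hn hn' => jacCoeff_of_two h2 hn hn'⟩

end HalfSpin
end TypeD

namespace Z2Algebra

/-! ### A criterion for simplicity -/

section Simple

variable {k L M : Type*} [Field k] [LieRing L] [LieAlgebra k L] [AddCommGroup M] [Module k M]

/-- A criterion for the simplicity of `L ⊕ M`. -/
theorem ofAction_isSimple [Nontrivial M] (ρ : L →ₗ[k] M →ₗ[k] M) (β : M →ₗ[k] M →ₗ[k] L)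
    (hfaithful : ∀ x, ρ x = 0 → x = 0)
    (hirr : ∀ N : Submodule k M, (∀ x, ∀ s ∈ N, ρ x s ∈ N) → N ≠ ⊥ → N = ⊤)
    (hspan : ∀ P : Submodule k L, (∀ s t, β s t ∈ P) → P = ⊤)
    (h₁ h₂ h₃ : L) (had : ∀ x : L, ⁅h₁, ⁅h₂, ⁅h₃, x⁆⁆⁆ = 0)
    (i₁ : Function.Injective (ρ h₁)) (i₂ : Function.Injective (ρ h₂))
    (i₃ : Function.Injective (ρ h₃)) : (ofAction ρ β).IsSimple := by
  constructor
  · obtain ⟨s, hs⟩ := exists_ne (0 : M)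
    refine ⟨(h₁, 0), (0, s), fun h => hs (i₁ ?_)⟩
    rw [ofAction_mul] at h
    simpa using congrArg Prod.snd h
  · intro I hI
    have hact : ∀ (x : L) (y : L × M), y ∈ I → (⁅x, y.1⁆, ρ x y.2) ∈ I := by
      intro x y hy
      have := (hI (x, 0) y hy).1
      rw [ofAction_mul] at this
      simpa using this
    by_cases hne : I = ⊥
    · exact Or.inl hne
    right
    let N : Submodule k M := I.comap (LinearMap.inr k L M)
    have hN : N = ⊤ := by
      refine hirr N (fun x s hs => ?_) ?_
      · have := hact x _ hs
        rw [LinearMap.inr_apply, lie_zero] at this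
        exact this
      · obtain ⟨y, hy, hy0⟩ := I.ne_bot_iff.1 hne
        -- To see that a nonzero ideal meets the odd part: an even element is multiplied by an odd
        -- one on which it acts nontrivially; any other element is multiplied by h₃, h₂, h₁, which
        -- kills its even component but not its odd one.
        by_cases hs : y.2 = 0
        · have hx : y.1 ≠ 0 := fun h => hy0 (Prod.ext h hs)
          have hx' : ρ y.1 ≠ 0 := fun h => hx (hfaithful _ h)
          obtain ⟨s, hs'⟩ : ∃ s, ρ y.1 s ≠ 0 := by
            by_contra! h
            exact hx' (LinearMap.ext h)
          refine N.ne_bot_iff.2 ⟨ρ y.1 s, ?_, hs'⟩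
          have := (hI (0, s) y hy).2
          rw [ofAction_mul, hs] at this
          rw [Submodule.mem_comap]
          simpa using this
        · refine N.ne_bot_iff.2 ⟨ρ h₁ (ρ h₂ (ρ h₃ y.2)), ?_, fun h => hs ?_⟩
          · have := hact h₁ _ (hact h₂ _ (hact h₃ _ hy))
            rw [had] at this
            exact this
          · rw [← map_zero (ρ h₁), ← map_zero (ρ h₂), ← map_zero (ρ h₃)] at h
            exact i₃ (i₂ (i₁ h))
    have hodd : ∀ s, ((0 : L), s) ∈ I := fun s => by
      have : s ∈ N := hN ▸ Submodule.mem_top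
      exact this
    have heven : I.comap (LinearMap.inl k L M) = ⊤ := by
      refine hspan _ fun s t => ?_
      have := (hI (0, s) _ (hodd t)).1
      rw [ofAction_mul] at this
      simpa using this
    rw [eq_top_iff]
    rintro ⟨x, s⟩ -
    have hx : x ∈ I.comap (LinearMap.inl k L M) := heven ▸ Submodule.mem_top
    have := I.add_mem hx (hodd s)
    simpa using this

end Simple

end Z2Algebra

namespace TypeD
open CliffordAlgebra (contractLeft evenOdd)

/-! ### Irreducibility, faithfulness and simplicity -/

section HalfSpin

variable {k V : Type*} [Field k] [AddCommGroup V] [Module k V]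
  {l : ℕ} (v : Module.Basis (Fin l) k V)

/-- The basis of the half-spin module that consists of the vectors `v_{i₁} ⋯ v_{i_{2r}}`. -/
noncomputable def plusBasis (h2 : (2 : k) ≠ 0) :
    Module.Basis {J : Finset (Fin l) // Even J.card} k (SPlus k V) :=
  Module.Basis.mk (v := fun J => plusVec v (ind J.1))
    (by
      have h : LinearIndependent k (fun J : {J : Finset (Fin l) // Even J.card} =>
          v.ExteriorAlgebra J.1) :=
        v.ExteriorAlgebra.linearIndependent.comp _ Subtype.val_injective
      refine LinearIndependent.of_comp (SPlus k V).subtype ?_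
      convert h with J
      change (plusVec v (ind J.1) : ExteriorAlgebra k V) = _
      rw [plusVec_coe v (by rw [sum_ind]; exact_mod_cast J.2), weightVector_ind])
    (by
      rw [eq_top_of_plusVec_mem v h2 (N := Submodule.span k (Set.range _)) fun μ hμ eμ => ?_]
      obtain ⟨J, rfl⟩ := exists_ind hμ
      rw [sum_ind] at eμ
      exact Submodule.subset_span ⟨⟨J, by exact_mod_cast eμ⟩, rfl⟩)

@[simp]
theorem plusBasis_apply (h2 : (2 : k) ≠ 0) (J : {J : Finset (Fin l) // Even J.card}) :
    plusBasis v h2 J = plusVec v (ind J.1) :=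
  Module.Basis.mk_apply _ _ _

theorem so_mem_of_sigma_unitVec (h2 : (2 : k) ≠ 0) {P : Submodule k (So k V)}
    (h : ∀ a b, sigma (unitVec v a) (unitVec v b) ∈ P) : P = ⊤ := by
  have h1 : sigma.compr₂ P.mkQ = (0 : W k V →ₗ[k] W k V →ₗ[k] _) := by
    refine linearMap_ext_unitVec v fun a => linearMap_ext_unitVec v fun b => ?_
    exact (Submodule.Quotient.mk_eq_zero P).2 (h a b)
  rw [eq_top_iff]
  intro A _
  rw [← Submodule.Quotient.mk_eq_zero]
  exact so_ext v h2 (f := P.mkQ) (g := 0)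
    (fun x y => LinearMap.congr_fun (LinearMap.congr_fun h1 x) y) A

theorem exists_ne_ne (hl : 3 ≤ l) (i j : Fin l) : ∃ m, m ≠ i ∧ m ≠ j := by
  by_contra! h
  have h1 : (Finset.univ : Finset (Fin l)) ⊆ {i, j} := fun m _ => by
    by_cases hm : m = i
    · simp [hm]
    · simp [h m hm]
  have := (Finset.card_le_card h1).trans Finset.card_le_two
  rw [Finset.card_univ, Fintype.card_fin] at this
  omega

/-- Every root `±ε_i ± ε_j` is the sum of two weights of the half-spin module. -/
theorem exists_add_eq_root (hl : Even l) (hl3 : 3 ≤ l) {a b : Fin l × Bool} (hab : a.1 ≠ b.1) :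
    ∃ μ ν, IsIndicator μ ∧ IsIndicator ν ∧ Even (∑ i, μ i) ∧ Even (∑ i, ν i) ∧
      μ + ν - 1 = wt a + wt b := by
  obtain ⟨c, hca, hcb⟩ := exists_ne_ne hl3 a.1 b.1
  -- The two weights agree at the coordinates of `a` and `b` and are complementary elsewhere. The
  -- entry at the third coordinate `c` makes the number of factors even.
  let μ : Fin l → ℤ := Pi.single a.1 (if a.2 then 1 else 0) + Pi.single b.1 (if b.2 then 1 else 0)
    + Pi.single c (if a.2 = b.2 then 0 else 1)
  have hμ : IsIndicator μ := by
    intro i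
    obtain ⟨i₁, b₁⟩ := a
    obtain ⟨i₂, b₂⟩ := b
    simp only [μ, Pi.add_apply, Pi.single_apply] at *
    by_cases h1 : i = i₁ <;> by_cases h2 : i = i₂ <;> by_cases h3 : i = c <;>
      cases b₁ <;> cases b₂ <;> simp_all
  have eμ : Even (∑ i, μ i) := by
    simp only [μ, Pi.add_apply, Finset.sum_add_distrib, Finset.sum_pi_single',
      Finset.mem_univ, if_true]
    obtain ⟨i₁, b₁⟩ := a
    obtain ⟨i₂, b₂⟩ := b
    cases b₁ <;> cases b₂ <;> simp
  refine ⟨μ, 1 + wt a + wt b - μ, hμ, ?_, eμ, ?_, by abel⟩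
  · intro i
    obtain ⟨i₁, b₁⟩ := a
    obtain ⟨i₂, b₂⟩ := b
    simp only [μ, Pi.add_apply, Pi.sub_apply, Pi.one_apply, Pi.single_apply, wt] at *
    by_cases h1 : i = i₁ <;> by_cases h2 : i = i₂ <;> by_cases h3 : i = c <;>
      cases b₁ <;> cases b₂ <;> simp_all
  · have := even_sum_add (even_sum_one hl) a b
    simp only [Pi.sub_apply, Finset.sum_sub_distrib]
    exact this.sub eμ

theorem sigma_unitVec_apply_opp {a b : Fin l × Bool} (hab : a.1 ≠ b.1) :
    (sigma (unitVec v a) (unitVec v b)).1 (unitVec v (opp a)) = unitVec v b := by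
  change sigmaEnd _ _ _ = _
  rw [sigmaEnd_apply, dualProd_unitVec, dualProd_unitVec, if_pos rfl, if_neg, one_smul, zero_smul,
    sub_zero]
  intro h
  have := congrArg Prod.fst h
  exact hab this

/-- The commutator that recovers the Cartan elements from root elements. -/
theorem lie_sigma_opp {a b : Fin l × Bool} (hab : a.1 ≠ b.1) :
    ⁅sigma (unitVec v a) (unitVec v b), sigma (unitVec v (opp a)) (unitVec v (opp b))⁆
      = sigma (unitVec v b) (unitVec v (opp b)) + sigma (unitVec v a) (unitVec v (opp a)) := by
  have h' : (sigma (unitVec v a) (unitVec v b)).1 (unitVec v (opp b)) = -unitVec v a := by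
    have h := sigma_unitVec_apply_opp v hab.symm
    rw [sigma_swap] at h
    exact neg_eq_iff_eq_neg.1 h
  rw [lie_sigma, h', sigma_unitVec_apply_opp v hab, map_neg, ← sigma_swap]

/-- The products of odd elements span the even part. -/
theorem oddBracket_span (h2 : (2 : k) ≠ 0) (hl : Even l) (hl3 : 3 ≤ l) (P : Submodule k (So k V))
    (hP : ∀ s t, oddBracket v s t ∈ P) : P = ⊤ := by
  let Q : Submodule k (So k V) :=
    Submodule.span k (Set.range fun x : SPlus k V × SPlus k V => oddBracket v x.1 x.2)
  have hQ : ∀ s t, oddBracket v s t ∈ Q := fun s t => Submodule.subset_span ⟨(s, t), rfl⟩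
  have hlie : ∀ A : So k V, ∀ B ∈ Q, ⁅A, B⁆ ∈ Q := by
    intro A B hB
    induction hB using Submodule.span_induction with
    | mem x hx =>
      obtain ⟨⟨s, t⟩, rfl⟩ := hx
      rw [lie_oddBracket v h2]
      exact Q.add_mem (hQ _ _) (hQ _ _)
    | zero => rw [lie_zero]; exact Q.zero_mem
    | add x y _ _ hx hy => rw [lie_add]; exact Q.add_mem hx hy
    | smul r x _ hx => rw [lie_smul]; exact Q.smul_mem r hx
  have hroot : ∀ a b : Fin l × Bool, a.1 ≠ b.1 → sigma (unitVec v a) (unitVec v b) ∈ Q := by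
    intro a b hab
    obtain ⟨μ, ν, hμ, hν, eμ, eν, h⟩ := exists_add_eq_root hl hl3 hab
    have := hQ (plusVec v μ) (plusVec v ν)
    rw [oddBracket_plusVec_of_root v h2 hab hμ hν eμ eν h] at this
    exact (Q.smul_mem_iff (neg_ne_zero.2 (sgn_ne_zero _))).1 this
  have hcartan : ∀ a : Fin l × Bool, sigma (unitVec v a) (unitVec v (opp a)) ∈ Q := by
    intro a
    obtain ⟨j, hc, -⟩ := exists_ne_ne hl3 a.1 a.1
    let c : Fin l × Bool := (j, true)
    have hc : c.1 ≠ a.1 := hc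
    -- In the sum of the commutators of σ_{a,c}, σ_{-a,-c} and of σ_{a,-c}, σ_{-a,c} the Cartan
    -- parts at `c` cancel, and twice the one at `a` remains.
    have h3 := Q.add_mem
      (hlie (sigma (unitVec v a) (unitVec v c)) _ (hroot (opp a) (opp c) hc.symm))
      (hlie (sigma (unitVec v a) (unitVec v (opp c))) _ (hroot (opp a) c hc.symm))
    have e := lie_sigma_opp v (a := a) (b := opp c) hc.symm
    rw [opp_opp] at e
    rw [e, lie_sigma_opp v hc.symm, sigma_swap (unitVec v (opp c))] at h3
    refine (Q.smul_mem_iff h2).1 ?_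
    convert h3 using 1
    module
  have hQP : Q = ⊤ := by
    refine so_mem_of_sigma_unitVec v h2 fun a b => ?_
    by_cases hab : a.1 = b.1
    · rcases eq_or_eq_opp hab with rfl | rfl
      · rw [sigma_self]
        exact Q.zero_mem
      · have := Q.neg_mem (hcartan b)
        rwa [← sigma_swap] at this
    · exact hroot a b hab
  rw [eq_top_iff, ← hQP]
  refine Submodule.span_le.2 ?_
  rintro _ ⟨⟨s, t⟩, rfl⟩
  exact hP s t

/-- The half-spin representation is faithful. -/
theorem halfSpin_faithful (h2 : (2 : k) ≠ 0) (hl : Even l) (hl3 : 3 ≤ l) (A : So k V)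
    (hA : halfSpin v A = 0) : A = 0 := by
  let F : So k V →ₗ[k] k := (1 / 2 : k) • (LinearMap.trace k (W k V) ∘ₗ
    (LinearMap.mulRight k A.1) ∘ₗ (So k V).toSubmodule.subtype)
  have hF : ∀ B : So k V, F B = (1 / 2 : k) * LinearMap.trace k (W k V) (B.1 * A.1) := fun B => rfl
  -- An element that acts as zero on S⁺ is orthogonal, for the trace form, to all odd products.
  -- These span, and the trace form is nondegenerate.
  have htop : LinearMap.ker F = ⊤ := by
    refine oddBracket_span v h2 hl hl3 _ fun s t => ?_
    rw [LinearMap.mem_ker, hF, LinearMap.trace_mul_comm, half_trace_oddBracket v h2, hA,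
      LinearMap.zero_apply, map_zero, LinearMap.zero_apply]
  refine so_eq_of_dualProd v (fun x y => ?_)
  have h1 : sigma x y ∈ LinearMap.ker F := htop ▸ Submodule.mem_top
  rw [LinearMap.mem_ker, hF, half_trace_sigma v _ _ _ h2] at h1
  rw [h1]
  exact (map_zero _).symm

/-- The projection to the span of a weight vector lies in the algebra that is generated by the
Cartan elements. -/
theorem exists_weight_projection (h2 : (2 : k) ≠ 0) (ν : Fin l → ℤ) (hν : IsIndicator ν)
    (L : List (Fin l)) : ∃ P : SPlus k V →ₗ[k] SPlus k V,
      (∀ N : Submodule k (SPlus k V), (∀ i, ∀ s ∈ N, halfSpin v (cartan v i) s ∈ N) →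
        ∀ s ∈ N, P s ∈ N) ∧
      ∀ μ, IsIndicator μ → Even (∑ i, μ i) →
        P (plusVec v μ) = if ∀ i ∈ L, μ i = ν i then plusVec v μ else 0 := by
  induction L with
  | nil => exact ⟨LinearMap.id, fun N _ s hs => hs, fun μ _ _ => by simp⟩
  | cons i L ih =>
    obtain ⟨P, hP, hP'⟩ := ih
    -- Since H_i acts as μ_i - ½, this factor is μ_i if ν_i = 1 and 1 - μ_i if ν_i = 0. Only one
    -- coordinate is tested at a time, so different weights are separated even in small
    -- characteristic.
    refine ⟨P ∘ₗ ((1 / 2 : k) • LinearMap.id + (2 * (ν i : k) - 1) • halfSpin v (cartan v i)),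
      fun N hN s hs => ?_, fun μ hμ eμ => ?_⟩
    · exact hP N hN _ (N.add_mem (N.smul_mem _ hs) (N.smul_mem _ (hN i s hs)))
    · have h : ((1 / 2 : k) • LinearMap.id + (2 * (ν i : k) - 1) • halfSpin v (cartan v i) :
            SPlus k V →ₗ[k] SPlus k V)
          (plusVec v μ) = if μ i = ν i then plusVec v μ else 0 := by
        rw [LinearMap.add_apply, LinearMap.smul_apply, LinearMap.smul_apply, LinearMap.id_apply,
          halfSpin_cartan v h2 i hμ eμ, smul_smul, ← add_smul]
        rcases hμ i with h | h <;> rcases hν i with h' | h' <;> rw [h, h']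
        · rw [if_pos rfl]
          convert one_smul k _ using 2
          push_cast
          field_simp
          ring
        · rw [if_neg (by norm_num)]
          convert zero_smul k _ using 2
          push_cast
          ring
        · rw [if_neg (by norm_num)]
          convert zero_smul k _ using 2
          push_cast
          field_simp
          ring
        · rw [if_pos rfl]
          convert one_smul k _ using 2
          push_cast
          field_simp
          ring
      rw [LinearMap.comp_apply, h]
      by_cases h' : μ i = ν i
      · rw [if_pos h', hP' μ hμ eμ]
        simp [h']
      · rw [if_neg h', map_zero, if_neg]
        exact fun h'' => h' (h'' i (by simp))

theorem weight_projection_apply (h2 : (2 : k) ≠ 0) {J : {J : Finset (Fin l) // Even J.card}}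
    {P : SPlus k V →ₗ[k] SPlus k V} (hP : ∀ μ, IsIndicator μ → Even (∑ i, μ i) →
      P (plusVec v μ) = if ∀ i ∈ List.finRange l, μ i = ind J.1 i then plusVec v μ else 0)
    (s : SPlus k V) : P s = (plusBasis v h2).repr s J • plusVec v (ind J.1) := by
  have : P = ((plusBasis v h2).coord J).smulRight (plusVec v (ind J.1)) := by
    refine (plusBasis v h2).ext fun K => ?_
    rw [LinearMap.smulRight_apply, Module.Basis.coord_apply, Module.Basis.repr_self,
      plusBasis_apply, hP _ (isIndicator_ind _) (by rw [sum_ind]; exact_mod_cast K.2)]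
    by_cases h : K = J
    · subst h
      simp
    · rw [Finsupp.single_eq_of_ne (Ne.symm h), zero_smul, if_neg]
      intro h'
      exact h (Subtype.ext (ind_injective (funext fun i => h' i (List.mem_finRange i))))
  rw [this]
  rfl

/-- The half-spin module is irreducible. -/
theorem halfSpin_irreducible (h2 : (2 : k) ≠ 0) (N : Submodule k (SPlus k V))
    (hN : ∀ A, ∀ s ∈ N, halfSpin v A s ∈ N) (hne : N ≠ ⊥) : N = ⊤ := by
  obtain ⟨s, hs, hs0⟩ := N.ne_bot_iff.1 hne
  obtain ⟨J, hJ⟩ : ∃ J, (plusBasis v h2).repr s J ≠ 0 := by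
    by_contra! h
    exact hs0 ((plusBasis v h2).repr.map_eq_zero_iff.1 (Finsupp.ext h))
  obtain ⟨P, hP, hP'⟩ := exists_weight_projection v h2 (ind J.1) (isIndicator_ind _)
    (List.finRange l)
  have h1 := hP N (fun i => hN _) s hs
  rw [weight_projection_apply v h2 hP', N.smul_mem_iff hJ] at h1
  refine eq_top_of_raising v h2 ?_ fun p q _ => hN _
  -- From any monomial one reaches the empty one by lowering operators, each of which removes two
  -- factors.
  have key : ∀ n, ∀ K : Finset (Fin l), K.card = n → Even K.card → plusVec v (ind K) ∈ N →
      plusVec v 0 ∈ N := by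
    intro n
    induction n using Nat.strong_induction_on with
    | _ n ih =>
      intro K hK eK hKN
      by_cases hne : K.Nonempty
      · obtain ⟨p, q, K', hp, hq, rfl⟩ := exists_eq_insert_insert (one_lt_card_of_even eK hne)
        have hpq : p ≠ q := fun h => hp (h ▸ Finset.mem_insert_self _ _)
        rw [Finset.card_insert_of_notMem hp, Finset.card_insert_of_notMem hq] at hK
        have e2 : Even K'.card := by
          rw [Finset.card_insert_of_notMem hp, Finset.card_insert_of_notMem hq] at eK
          rw [add_assoc, Nat.even_add] at eK
          exact eK.2 even_two
        refine ih K'.card (by omega) K' rfl e2 ?_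
        have h3 := mem_of_halfSpin_sigma_mem v h2 (a := opp (p, true)) (b := opp (q, true)) hpq
          (isIndicator_ind _) (by rw [sum_ind]; exact_mod_cast eK) (hN _ _ hKN)
        rw [ind_insert_insert hp hq, wt_opp, wt_opp] at h3
        convert h3 using 2
        abel
      · rw [Finset.not_nonempty_iff_eq_empty] at hne
        rw [hne] at hKN
        convert hKN using 2
        ext i
        simp [ind]
  exact key _ J.1 rfl J.2 h1

theorem lie_cartan_sigma (i : Fin l) (a b : Fin l × Bool) :
    ⁅cartan v i, sigma (unitVec v a) (unitVec v b)⁆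
      = ((wt a i : k) + (wt b i : k)) • sigma (unitVec v a) (unitVec v b) := by
  have h : ∀ a, (cartan v i).1 (unitVec v a) = (wt a i : k) • unitVec v a := by
    rintro ⟨j, c⟩
    have e : cartan v i = sigma (unitVec v (i, false)) (unitVec v (i, true)) := rfl
    rw [e]
    change sigmaEnd _ _ _ = _
    rw [sigmaEnd_apply, dualProd_unitVec, dualProd_unitVec]
    by_cases hij : j = i
    · subst hij
      cases c <;> simp [wt, opp]
      exact (neg_one_smul k _).symm
    · have : wt (j, c) i = 0 := wt_apply_of_ne _ (Ne.symm hij)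
      rw [this, if_neg, if_neg]
      · simp
      · simp [opp, hij]
      · simp [opp, hij]
  rw [lie_sigma, h, h, map_smul, map_smul, LinearMap.smul_apply, add_smul]

/-- A root has only two nonzero coordinates, so one of three different Cartan elements kills its
root element. -/
theorem lie_cartan_cartan_cartan (h2 : (2 : k) ≠ 0) {p q r : Fin l} (hpq : p ≠ q) (hpr : p ≠ r)
    (hqr : q ≠ r) (A : So k V) : ⁅cartan v p, ⁅cartan v q, ⁅cartan v r, A⁆⁆⁆ = 0 := by
  let F : So k V →ₗ[k] So k V := LieModule.toEnd k _ _ (cartan v p) ∘ₗ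
    LieModule.toEnd k _ _ (cartan v q) ∘ₗ LieModule.toEnd k _ _ (cartan v r)
  have : LinearMap.ker F = ⊤ := by
    refine so_mem_of_sigma_unitVec v h2 fun a b => ?_
    rw [LinearMap.mem_ker]
    change ⁅cartan v p, ⁅cartan v q, ⁅cartan v r, sigma (unitVec v a) (unitVec v b)⁆⁆⁆ = 0
    rw [lie_cartan_sigma, lie_smul, lie_cartan_sigma, lie_smul, lie_smul, lie_cartan_sigma,
      smul_smul, smul_smul]
    convert zero_smul k _ using 2
    have h : ∀ c : Fin l × Bool, ∀ i, (wt c i : k) = if c.1 = i then (wt c i : k) else 0 := by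
      intro c i
      split_ifs with h
      · rfl
      · rw [wt_apply_of_ne c (Ne.symm h), Int.cast_zero]
    rw [h a, h b, h a q, h b q, h a p, h b p]
    by_cases h1 : a.1 = p <;> by_cases h2 : b.1 = p <;> by_cases h3 : a.1 = q <;>
      by_cases h4 : b.1 = q <;> by_cases h5 : a.1 = r <;> by_cases h6 : b.1 = r <;>
      simp_all
  have h1 : A ∈ LinearMap.ker F := this ▸ Submodule.mem_top
  exact h1

/-- All eigenvalues are ±½, hence the square is ¼. -/
theorem halfSpin_cartan_injective (h2 : (2 : k) ≠ 0) (i : Fin l) :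
    Function.Injective (halfSpin v (cartan v i)) := by
  have h : (halfSpin v (cartan v i)) ∘ₗ (halfSpin v (cartan v i))
      = (1 / 4 : k) • LinearMap.id := by
    have h4 := four_ne_zero_of_two h2
    refine plus_ext v h2 fun μ hμ eμ => ?_
    rw [LinearMap.comp_apply, halfSpin_cartan v h2 i hμ eμ, map_smul,
      halfSpin_cartan v h2 i hμ eμ, smul_smul, LinearMap.smul_apply, LinearMap.id_apply]
    congr 1
    rcases hμ i with h | h <;> rw [h] <;> push_cast <;> field_simp <;> ring
  intro s t hst
  have := congrArg (halfSpin v (cartan v i)) hst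
  rw [← LinearMap.comp_apply, ← LinearMap.comp_apply, h] at this
  exact smul_right_injective _ (one_div_ne_zero (four_ne_zero_of_two h2)) this

theorem algebra_isSimple (h2 : (2 : k) ≠ 0) (hl : Even l) (hl3 : 3 ≤ l) :
    (algebra v).IsSimple := by
  have hp : (⟨0, by omega⟩ : Fin l) ≠ ⟨1, by omega⟩ := by simp
  obtain ⟨r, hr, hr'⟩ := exists_ne_ne hl3 ⟨0, by omega⟩ ⟨1, by omega⟩
  have : Nontrivial (SPlus k V) := by
    refine ⟨plusVec v (ind ∅), 0, plusVec_ind_ne_zero v (by simp)⟩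
  exact Z2Algebra.ofAction_isSimple _ _ (halfSpin_faithful v h2 hl hl3)
    (halfSpin_irreducible v h2) (oddBracket_span v h2 hl hl3)
    (cartan v ⟨0, by omega⟩) (cartan v ⟨1, by omega⟩) (cartan v r)
    (lie_cartan_cartan_cartan v h2 hp hr.symm hr'.symm) (halfSpin_cartan_injective v h2 _)
    (halfSpin_cartan_injective v h2 _) (halfSpin_cartan_injective v h2 _)

end HalfSpin
end TypeD

/-! ### Orthonormal bases and skew matrices -/

section Orthonormal

variable {k N : Type*} [Field k] [AddCommGroup N] [Module k N]

/-- Over an algebraically closed field of characteristic not two, a nondegenerate symmetric bilinear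
form has an orthonormal basis. -/
theorem LinearMap.exists_orthonormal_basis [IsAlgClosed k] [FiniteDimensional k N]
    (h2 : (2 : k) ≠ 0) {B : N →ₗ[k] N →ₗ[k] k} (hsymm : ∀ x y, B x y = B y x)
    (hnd : ∀ x, (∀ y, B x y = 0) → x = 0) {n : ℕ} (hn : Module.finrank k N = n) :
    ∃ b : Module.Basis (Fin n) k N, ∀ i j, B (b i) (b j) = if i = j then 1 else 0 := by
  subst hn
  have := invertibleOfNonzero h2
  obtain ⟨b, hb⟩ := LinearMap.BilinForm.exists_orthogonal_basis (B := B) ⟨hsymm⟩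
  have hne := hb.not_isOrtho_basis_self_of_separatingLeft hnd
  choose z hz using fun i => IsAlgClosed.exists_eq_mul_self (B (b i) (b i))
  have hz0 : ∀ i, z i ≠ 0 := fun i h => hne i (by rw [hz, h, mul_zero])
  refine ⟨b.unitsSMul fun i => (Units.mk0 (z i) (hz0 i))⁻¹, fun i j => ?_⟩
  rw [Module.Basis.unitsSMul_apply, Module.Basis.unitsSMul_apply, Units.smul_def, Units.smul_def,
    map_smul, map_smul, LinearMap.smul_apply, smul_eq_mul, smul_eq_mul]
  split_ifs with h
  · subst h
    rw [hz, Units.val_inv_eq_inv_val, Units.val_mk0]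
    have := hz0 i
    field_simp
  · rw [hb h, mul_zero, mul_zero]

theorem LinearMap.repr_orthonormal_basis {ι : Type*} [DecidableEq ι]
    {B : N →ₗ[k] N →ₗ[k] k} {b : Module.Basis ι k N}
    (hb : ∀ i j, B (b i) (b j) = if i = j then 1 else 0) (x : N) (i : ι) :
    b.repr x i = B (b i) x := by
  have : b.coord i = B (b i) := b.ext fun j => by
    rw [hb, Module.Basis.coord_apply, Module.Basis.repr_self, Finsupp.single_apply]
    simp only [eq_comm]
  exact LinearMap.congr_fun this x

theorem LinearMap.sum_orthonormal_basis {ι : Type*} [Fintype ι] [DecidableEq ι]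
    {B : N →ₗ[k] N →ₗ[k] k} {b : Module.Basis ι k N}
    (hb : ∀ i j, B (b i) (b j) = if i = j then 1 else 0) (x : N) : ∑ i, B (b i) x • b i = x := by
  conv_rhs => rw [← b.sum_repr x]
  simp only [LinearMap.repr_orthonormal_basis hb]

/-- The matrix of a skew endomorphism with respect to an orthonormal basis is skew. -/
theorem LinearMap.toMatrix_mem_so {ι : Type*} [Fintype ι] [DecidableEq ι]
    {B : N →ₗ[k] N →ₗ[k] k} {b : Module.Basis ι k N}
    (hb : ∀ i j, B (b i) (b j) = if i = j then 1 else 0) (F : Module.End k N) :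
    LinearMap.toMatrixAlgEquiv b F ∈ LieAlgebra.Orthogonal.so ι k ↔
      ∀ x y, B (F x) y = -B x (F y) := by
  have h1 : ∀ x i, b.repr x i = B (b i) x := LinearMap.repr_orthonormal_basis hb
  have h3 : ∀ x i, b.repr x i = B x (b i) :=
    LinearMap.repr_orthonormal_basis (B := B.flip) fun i j => by
      rw [LinearMap.flip_apply, hb]
      simp only [eq_comm]
  rw [LieAlgebra.Orthogonal.mem_so, ← Matrix.ext_iff]
  simp only [Matrix.transpose_apply, Matrix.neg_apply, LinearMap.toMatrixAlgEquiv_apply]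
  constructor
  · intro h
    have : B.comp F = -(B.compl₂ F) := by
      refine b.ext fun i => b.ext fun j => ?_
      simp only [LinearMap.comp_apply, LinearMap.neg_apply, LinearMap.compl₂_apply]
      rw [← h1, ← h3, h]
    exact fun x y => LinearMap.congr_fun (LinearMap.congr_fun this x) y
  · intro h i j
    rw [h3, h1, h]

end Orthonormal

namespace Z2Algebra

/-! ### The orthogonal Lie algebra of M ⊕ k -/

section Orthogonal

variable {k L M : Type*} [Field k] [LieRing L] [LieAlgebra k L] [AddCommGroup M] [Module k M]

/-- The endomorphism of `M ⊕ k` given by an element of `L ⊕ M`. -/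
def orthogonalAction (ρ : L →ₗ[k] M →ₗ[k] M) (B : M →ₗ[k] M →ₗ[k] k) :
    L × M →ₗ[k] Module.End k (M × k) where
  toFun x := LinearMap.prod (ρ x.1 ∘ₗ LinearMap.fst k M k + (LinearMap.snd k M k).smulRight x.2)
    (-(B x.2 ∘ₗ LinearMap.fst k M k))
  map_add' x y := by
    refine LinearMap.ext fun u => Prod.ext ?_ ?_
    · simp; abel
    · simp; abel
  map_smul' r x := by
    refine LinearMap.ext fun u => Prod.ext ?_ ?_
    · change ρ (r • x.1) u.1 + u.2 • r • x.2 = r • (ρ x.1 u.1 + u.2 • x.2)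
      rw [map_smul, LinearMap.smul_apply]
      module
    · simp

theorem orthogonalAction_apply (ρ : L →ₗ[k] M →ₗ[k] M) (B : M →ₗ[k] M →ₗ[k] k) (x : L × M)
    (u : M × k) : orthogonalAction ρ B x u = (ρ x.1 u.1 + u.2 • x.2, -B x.2 u.1) := rfl

/-- The symmetric bilinear form on `M ⊕ k` that extends `B`. -/
def orthogonalForm (B : M →ₗ[k] M →ₗ[k] k) : M × k →ₗ[k] M × k →ₗ[k] k :=
  B.compl₁₂ (LinearMap.fst k M k) (LinearMap.fst k M k)
    + (LinearMap.mul k k).compl₁₂ (LinearMap.snd k M k) (LinearMap.snd k M k)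

theorem orthogonalForm_apply (B : M →ₗ[k] M →ₗ[k] k) (x y : M × k) :
    orthogonalForm B x y = B x.1 y.1 + x.2 * y.2 := rfl

/-- If the odd products act as the elementary skew maps of an orthogonal space `M`, then `L ⊕ M` is
the orthogonal Lie algebra of `M ⊕ k`. -/
theorem ofAction_isoBracket_so [IsAlgClosed k] [FiniteDimensional k M] (h2 : (2 : k) ≠ 0)
    (ρ : L →ₗ[k] M →ₗ[k] M) (β : M →ₗ[k] M →ₗ[k] L) (B : M →ₗ[k] M →ₗ[k] k)
    (hρ : ∀ x y s, ρ ⁅x, y⁆ s = ρ x (ρ y s) - ρ y (ρ x s))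
    (hB : ∀ x s t, B (ρ x s) t = -B s (ρ x t))
    (hβ : ∀ s t u, ρ (β s t) u = B s u • t - B t u • s)
    (hfaithful : ∀ x, ρ x = 0 → x = 0) (hsymm : ∀ s t, B s t = B t s)
    (hnd : ∀ s, (∀ t, B s t = 0) → s = 0) {n : ℕ} (hn : Module.finrank k M + 1 = n) :
    (ofAction ρ β).IsoBracket k (LieAlgebra.Orthogonal.so (Fin n) k) := by
  have hfr : Module.finrank k (M × k) = n := by rw [Module.finrank_prod, Module.finrank_self, hn]
  have hsymm' : ∀ x y, orthogonalForm B x y = orthogonalForm B y x := fun x y => by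
    rw [orthogonalForm_apply, orthogonalForm_apply, hsymm, mul_comm]
  have hnd' : ∀ x, (∀ y, orthogonalForm B x y = 0) → x = 0 := by
    intro x hx
    refine Prod.ext (hnd _ fun t => ?_) ?_
    · simpa [orthogonalForm_apply] using hx (t, 0)
    · simpa [orthogonalForm_apply] using hx (0, 1)
  obtain ⟨b, hb⟩ := LinearMap.exists_orthonormal_basis h2 hsymm' hnd' hfr
  obtain ⟨e, he⟩ := LinearMap.exists_orthonormal_basis h2 hsymm hnd rfl
  let f : L × M →ₗ[k] LieAlgebra.Orthogonal.so (Fin n) k :=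
    LinearMap.codRestrict (LieAlgebra.Orthogonal.so (Fin n) k).toSubmodule
      ((LinearMap.toMatrixAlgEquiv b).toLinearMap ∘ₗ orthogonalAction ρ B) (fun x => by
        refine (LinearMap.toMatrix_mem_so hb _).2 fun u w => ?_
        simp only [orthogonalAction_apply, orthogonalForm_apply, map_add, LinearMap.add_apply,
          map_smul, LinearMap.smul_apply, smul_eq_mul, hB, hsymm u.1 x.2]
        ring)
  have hf : ∀ x, (f x : Matrix _ _ k) = LinearMap.toMatrixAlgEquiv b (orthogonalAction ρ B x) :=
    fun x => rfl
  have hinj : Function.Injective f := by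
    refine (injective_iff_map_eq_zero f).2 fun x hx => ?_
    have h0 : orthogonalAction ρ B x = 0 := by
      have := congrArg Subtype.val hx
      rw [hf] at this
      exact (map_eq_zero_iff _ (LinearMap.toMatrixAlgEquiv b).injective).1 this
    have hs : x.2 = 0 := by
      have := congrArg Prod.fst (LinearMap.congr_fun h0 (0, 1))
      simpa [orthogonalAction_apply] using this
    refine Prod.ext (hfaithful _ (LinearMap.ext fun u => ?_)) hs
    have := congrArg Prod.fst (LinearMap.congr_fun h0 (u, 0))
    simpa [orthogonalAction_apply] using this
  have hsurj : Function.Surjective f := by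
    rintro ⟨X, hX⟩
    obtain ⟨F, rfl⟩ := (LinearMap.toMatrixAlgEquiv b).surjective X
    rw [LinearMap.toMatrix_mem_so hb] at hX
    let G : M →ₗ[k] M := LinearMap.fst k M k ∘ₗ F ∘ₗ LinearMap.inl k M k
    have hG : ∀ u, G u = (F (u, 0)).1 := fun u => rfl
    have hGskew : ∀ u w, B (G u) w = -B u (G w) := fun u w => by
      have := hX (u, 0) (w, 0)
      simp only [orthogonalForm_apply, mul_zero, zero_mul, add_zero] at this
      exact this
    -- A skew endomorphism G is half the sum of the elementary skew maps of e_i and G e_i for an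
    -- orthonormal basis; the odd component is the image of the unit vector of k.
    refine ⟨((1 / 2 : k) • ∑ i, β (e i) (G (e i)), (F (0, 1)).1), Subtype.ext ?_⟩
    rw [hf]
    refine congrArg _ (LinearMap.ext fun u => ?_)
    rw [orthogonalAction_apply]
    have hu : F u = F (u.1, 0) + u.2 • F (0, 1) := by
      rw [← map_smul, ← map_add]
      simp
    have hF1 : (F (0, 1)).2 = 0 := by
      have := hX (0, 1) (0, 1)
      simp only [orthogonalForm_apply, map_zero, zero_add, LinearMap.zero_apply, mul_one,
        one_mul] at this
      have h3 : (2 : k) * (F (0, 1)).2 = 0 := by linear_combination this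
      exact (mul_eq_zero.1 h3).resolve_left h2
    rw [hu]
    refine Prod.ext ?_ ?_
    · change ρ ((1 / 2 : k) • ∑ i, β (e i) (G (e i))) u.1 + u.2 • (F (0, 1)).1
        = (F (u.1, 0)).1 + u.2 • (F (0, 1)).1
      rw [← hG, map_smul, map_sum, LinearMap.smul_apply, LinearMap.sum_apply]
      have h3 : ∑ i, ρ (β (e i) (G (e i))) u.1 = (2 : k) • G u.1 := by
        have h4 : ∑ i, B (e i) u.1 • G (e i) = G u.1 := by
          conv_rhs => rw [← LinearMap.sum_orthonormal_basis he u.1]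
          simp only [map_sum, map_smul]
        have h5 := LinearMap.sum_orthonormal_basis he (G u.1)
        simp only [hβ, hGskew, Finset.sum_sub_distrib, neg_smul, Finset.sum_neg_distrib, h4, h5]
        module
      rw [h3, smul_smul, one_div, inv_mul_cancel₀ h2, one_smul]
    · change -B (F (0, 1)).1 u.1 = (F (u.1, 0)).2 + u.2 * (F (0, 1)).2
      have := hX (0, 1) (u.1, 0)
      simp only [orthogonalForm_apply, mul_zero, add_zero, map_zero, LinearMap.zero_apply,
        zero_add, one_mul] at this
      rw [hF1, this]
      ring
  refine ⟨LinearEquiv.ofBijective f ⟨hinj, hsurj⟩, fun x y => Subtype.ext ?_⟩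
  change (f _).1 = (f x).1 * (f y).1 - (f y).1 * (f x).1
  rw [hf, hf, hf, ← map_mul (LinearMap.toMatrixAlgEquiv b), ← map_mul (LinearMap.toMatrixAlgEquiv b),
    ← map_sub (LinearMap.toMatrixAlgEquiv b)]
  refine congrArg _ (LinearMap.ext fun u => ?_)
  rw [ofAction_mul]
  simp only [LinearMap.sub_apply, Module.End.mul_apply, orthogonalAction_apply, map_add,
    LinearMap.add_apply, hρ, hβ, map_sub, map_smul, LinearMap.sub_apply]
  refine Prod.ext ?_ ?_
  · simp only [Prod.fst_sub]
    module
  · simp only [Prod.snd_sub, hB, smul_eq_mul, hsymm x.2 y.2]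
    ring

end Orthogonal

end Z2Algebra

namespace TypeD
open CliffordAlgebra (contractLeft evenOdd)

/-! ### The case l = 4 -/

section HalfSpin

variable {k V : Type*} [Field k] [AddCommGroup V] [Module k V]
  {l : ℕ} (v : Module.Basis (Fin l) k V)

/-- Pairing with the complementary monomial reads off a coordinate up to sign. -/
theorem bHat_nondegenerate (h2 : (2 : k) ≠ 0) (hl : Even l) (s : SPlus k V)
    (h : ∀ t, bHat v s t = 0) : s = 0 := by
  refine (plusBasis v h2).repr.map_eq_zero_iff.1 (Finsupp.ext fun J => ?_)
  have eJ : Even (∑ i, ind J.1 i) := by rw [sum_ind]; exact_mod_cast J.2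
  have eJ' : Even (∑ i, (1 - ind J.1 : Fin l → ℤ) i) := by
    simp only [Pi.sub_apply, Finset.sum_sub_distrib]
    exact (even_sum_one hl).sub eJ
  have key : (bHat v).flip (plusVec v (1 - ind J.1))
      = sgn k (lowForm (ind J.1) 1) • (plusBasis v h2).coord J := by
    refine (plusBasis v h2).ext fun K => ?_
    have eK : Even (∑ i, ind K.1 i) := by rw [sum_ind]; exact_mod_cast K.2
    rw [LinearMap.flip_apply, plusBasis_apply, bHat_plusVec v (isIndicator_ind _).one_sub eK eJ',
      LinearMap.smul_apply, Module.Basis.coord_apply, ← plusBasis_apply v h2,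
      Module.Basis.repr_self, Finsupp.single_apply, smul_eq_mul]
    by_cases hK : K = J
    · subst hK
      rw [if_pos (by abel), if_pos rfl, mul_one]
    · rw [if_neg, if_neg hK, mul_zero]
      intro h'
      refine hK (Subtype.ext (ind_injective ?_))
      rw [← sub_eq_zero, ← sub_eq_zero.2 h']
      abel
  have h1 := LinearMap.congr_fun key s
  rw [LinearMap.flip_apply, h, LinearMap.smul_apply, smul_eq_mul] at h1
  exact (mul_eq_zero.1 h1.symm).resolve_left (sgn_ne_zero _)

include v in
theorem finrank_plus (h2 : (2 : k) ≠ 0) :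
    Module.finrank k (SPlus k V) = Fintype.card {J : Finset (Fin l) // Even J.card} :=
  Module.finrank_eq_card_basis (plusBasis v h2)

/-- For `l = 4`, the odd products act on `S⁺` as the elementary skew maps of the form `b̂`. -/
theorem halfSpin_oddBracket_four (v : Module.Basis (Fin 4) k V) (h2 : (2 : k) ≠ 0)
    (s t u : SPlus k V) :
    halfSpin v (oddBracket v s t) u = bHat v t u • s - bHat v s u • t := by
  have hl : Even 4 := by decide
  have h4 := four_ne_zero_of_two h2
  let T : SPlus k V →ₗ[k] SPlus k V →ₗ[k] SPlus k V →ₗ[k] SPlus k V :=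
    LinearMap.mk₂ k (fun s t => (bHat v s).smulRight t - (bHat v t).smulRight s)
      (fun s s' t => LinearMap.ext fun u => by simp; module)
      (fun r s t => LinearMap.ext fun u => by simp; module)
      (fun s t t' => LinearMap.ext fun u => by simp; module)
      (fun r s t => LinearMap.ext fun u => by simp; module)
  have hT : ∀ s t u, T s t u = bHat v s u • t - bHat v t u • s := fun s t u => rfl
  -- Both trilinear maps are equivariant, so they are compared on (e_0, e_1, e_J), where the
  -- eigenvalue (4 - 2|J|)/4 is 1, 0, -1 for |J| = 0, 2, 4.
  have key : spinTriple v + T = 0 := by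
    refine trilinear_eq_zero v h2 hl _ (fun A s t u => ?_) fun μ hμ eμ => ?_
    · simp only [LinearMap.add_apply, hT, map_add, map_sub, halfSpin_spinTriple v h2, map_smul,
        bHat_halfSpin v h2 A]
      module
    · obtain ⟨J, rfl⟩ := exists_ind hμ
      have eJ : Even J.card := by rw [sum_ind] at eμ; exact_mod_cast eμ
      have e1 : sgn k (lowForm (1 : Fin 4 → ℤ) 1) = 1 := epsilon_four_mul 1
      have e0 : sgn k (lowForm (0 : Fin 4 → ℤ) 1) = 1 := sgn_even (by simp [lowForm])
      simp only [LinearMap.add_apply, hT]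
      rw [spinTriple_zero_one v h2 hl eJ, bHat_plusVec v hμ (even_sum_one hl) eμ,
        bHat_plusVec v hμ even_sum_zero eμ, e1, e0]
      have h0 : ind J = 0 ↔ J = ∅ := by
        rw [← ind_injective.eq_iff]
        have : ind (∅ : Finset (Fin 4)) = 0 := by ext; simp [ind]
        rw [this]
      have h1 : ind J = 1 ↔ J = Finset.univ := by
        rw [← ind_injective.eq_iff]
        have : ind (Finset.univ : Finset (Fin 4)) = 1 := by ext; simp [ind]
        rw [this]
      simp only [add_eq_left, zero_add]
      by_cases c0 : ind J = 0
      · have hne : (0 : Fin 4 → ℤ) ≠ 1 := by decide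
        rw [c0, if_pos rfl, if_neg hne, h0.1 c0]
        simp [div_self h4]
      · by_cases c1 : ind J = 1
        · have hne : (1 : Fin 4 → ℤ) ≠ 0 := by decide
          rw [c1, if_pos rfl, if_neg hne, h1.1 c1]
          have : ((4 : k) - 2 * 4) / 4 = -1 := by field_simp; ring
          simp [this]
        · rw [if_neg c0, if_neg c1]
          have hc : J.card = 2 := by
            have h5 : J.card ≤ 4 := by simpa using J.card_le_univ
            have h6 : J.card ≠ 0 := fun h => c0 (h0.2 (Finset.card_eq_zero.1 h))
            have h7 : J.card ≠ 4 := fun h => c1 (h1.2 (by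
              rw [← Finset.card_eq_iff_eq_univ, h, Fintype.card_fin]))
            obtain ⟨m, hm⟩ := eJ
            omega
          rw [hc]
          have : ((4 : k) - 2 * 2) / 4 = 0 := by field_simp; ring
          simp [this]
  have := LinearMap.congr_fun (LinearMap.congr_fun (LinearMap.congr_fun key s) t) u
  rw [LinearMap.add_apply, LinearMap.add_apply, LinearMap.add_apply, hT] at this
  rw [← spinTriple_apply, eq_neg_of_add_eq_zero_left this, neg_sub]

theorem algebra_isoBracket_so_nine [IsAlgClosed k] (v : Module.Basis (Fin 4) k V)
    (h2 : (2 : k) ≠ 0) : (algebra v).IsoBracket k (LieAlgebra.Orthogonal.so (Fin 9) k) := by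
  have hfin : FiniteDimensional k (SPlus k V) := (plusBasis v h2).finiteDimensional_of_finite
  have hl : Even 4 := by decide
  have hε : epsilon k 4 = 1 := epsilon_four_mul 1
  -- The invariant form is -b̂, because the odd products are the elementary skew maps of b̂ with the
  -- opposite sign. The dimension is 8 + 1.
  refine Z2Algebra.ofAction_isoBracket_so h2 (halfSpin v) (oddBracket v) (-bHat v)
    (halfSpin_lie v h2) (fun A s t => ?_) (fun s t u => ?_)
    (halfSpin_faithful v h2 hl (by norm_num)) (fun s t => ?_) (fun s hs => ?_) ?_
  · simp only [LinearMap.neg_apply, bHat_halfSpin v h2]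
  · rw [halfSpin_oddBracket_four v h2]
    simp only [LinearMap.neg_apply]
    module
  · simp only [LinearMap.neg_apply]
    rw [bHat_comm v h2, hε, one_mul]
  · exact bHat_nondegenerate v h2 hl s fun t => neg_eq_zero.1 (hs t)
  · rw [finrank_plus v h2]
    decide

end HalfSpin
end TypeD

namespace TypeD
open CliffordAlgebra (contractLeft evenOdd)

/-! ### Matrix coefficients -/

section Rank

variable {k V : Type*} [Field k] [AddCommGroup V] [Module k V]
  {l : ℕ} (v : Module.Basis (Fin l) k V)

/-- The matrix coefficients `q(u_a, A u_b)`. -/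
noncomputable def coeff (a b : Fin l × Bool) : So k V →ₗ[k] k :=
  (LinearMap.dualProd k V (unitVec v a)) ∘ₗ (LinearMap.applyₗ (unitVec v b)) ∘ₗ
    (So k V).toSubmodule.subtype

theorem coeff_apply (a b : Fin l × Bool) (A : So k V) :
    coeff v a b A = LinearMap.dualProd k V (unitVec v a) (A.1 (unitVec v b)) := rfl

theorem coeff_swap (a b : Fin l × Bool) (A : So k V) : coeff v a b A = -coeff v b a A := by
  rw [coeff_apply, coeff_apply, dualProd_comm (unitVec v a), mem_So.1 A.2]

theorem coeff_self (h2 : (2 : k) ≠ 0) (a : Fin l × Bool) (A : So k V) : coeff v a a A = 0 := by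
  have h := coeff_swap v a a A
  have h3 : (2 : k) * coeff v a a A = 0 := by linear_combination h
  exact (mul_eq_zero.1 h3).resolve_left h2

theorem coeff_sigma (a b c d : Fin l × Bool) :
    coeff v a b (sigma (unitVec v c) (unitVec v d))
      = (if b = opp c then 1 else 0) * (if d = opp a then 1 else 0)
        - (if b = opp d then 1 else 0) * (if c = opp a then 1 else 0) := by
  rw [coeff_apply]
  change LinearMap.dualProd k V _ (sigmaEnd _ _ _) = _
  rw [sigmaEnd_apply, map_sub, map_smul, map_smul, dualProd_unitVec, dualProd_unitVec,
    dualProd_unitVec, dualProd_unitVec, smul_eq_mul, smul_eq_mul]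

theorem coeff_lie (a b : Fin l × Bool) (A B : So k V) : coeff v a b ⁅A, B⁆
    = ∑ i, (coeff v a (i, true) A * coeff v (i, false) b B
        + coeff v a (i, false) A * coeff v (i, true) b B)
      - ∑ i, (coeff v a (i, true) B * coeff v (i, false) b A
        + coeff v a (i, false) B * coeff v (i, true) b A) := by
  have key : ∀ A B : So k V, LinearMap.dualProd k V (unitVec v a) (A.1 (B.1 (unitVec v b)))
      = ∑ i, (coeff v a (i, true) A * coeff v (i, false) b B
        + coeff v a (i, false) A * coeff v (i, true) b B) := by
    intro A B
    conv_lhs => rw [← sum_dualProd v (B.1 (unitVec v b))]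
    simp only [map_sum, map_add, map_smul, smul_eq_mul]
    refine Finset.sum_congr rfl fun i _ => ?_
    change coeff v (i, true) b B * coeff v a (i, false) A
      + coeff v (i, false) b B * coeff v a (i, true) A = _
    ring
  rw [← key A B, ← key B A, ← map_sub]
  rfl

theorem so_eq_of_coeff {A B : So k V} (h : ∀ a b, coeff v a b A = coeff v a b B) : A = B :=
  so_eq_of_unitVec v h

end Rank

/-! ### The case l = 2 -/

section RankTwo

variable {k V : Type*} [Field k] [AddCommGroup V] [Module k V] (v : Module.Basis (Fin 2) k V)

/-- The element of `so(V ⊕ V*)`, `dim V = 2`, with given coefficients. -/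
noncomputable def soTwo (p : Fin 2 → Fin 2 → k) (r s : k) : So k V :=
  p 0 0 • cartan v 0 + p 1 1 • cartan v 1
    + p 0 1 • sigma (unitVec v (1, false)) (unitVec v (0, true))
    + p 1 0 • sigma (unitVec v (0, false)) (unitVec v (1, true))
    - s • sigma (unitVec v (0, true)) (unitVec v (1, true))
    - r • sigma (unitVec v (0, false)) (unitVec v (1, false))

theorem coeff_soTwo (p : Fin 2 → Fin 2 → k) (r s : k) :
    (∀ i j, coeff v (i, false) (j, true) (soTwo v p r s) = p i j) ∧
      coeff v (0, true) (1, true) (soTwo v p r s) = r ∧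
      coeff v (0, false) (1, false) (soTwo v p r s) = s := by
  have e : ∀ i, cartan v i = sigma (unitVec v (i, false)) (unitVec v (i, true)) := fun _ => rfl
  simp only [soTwo, map_add, map_sub, map_smul, e, coeff_sigma, opp, Prod.mk.injEq, smul_eq_mul]
  refine ⟨fun i j => ?_, ?_, ?_⟩
  · fin_cases i <;> fin_cases j <;> simp
  · simp
  · simp

theorem soTwo_coeff (h2 : (2 : k) ≠ 0) (A : So k V) :
    A = soTwo v (fun i j => coeff v (i, false) (j, true) A) (coeff v (0, true) (1, true) A)
      (coeff v (0, false) (1, false) A) := by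
  obtain ⟨h, hr, hs⟩ := coeff_soTwo v (fun i j => coeff v (i, false) (j, true) A)
    (coeff v (0, true) (1, true) A) (coeff v (0, false) (1, false) A)
  generalize soTwo v _ _ _ = B at *
  refine so_eq_of_coeff v ?_
  have h' : ∀ i j, coeff v (j, true) (i, false) A = coeff v (j, true) (i, false) B := fun i j => by
    rw [coeff_swap, coeff_swap v _ _ B, h]
  have hr' : coeff v (1, true) (0, true) A = coeff v (1, true) (0, true) B := by
    rw [coeff_swap, coeff_swap v _ _ B, hr]
  have hs' : coeff v (1, false) (0, false) A = coeff v (1, false) (0, false) B := by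
    rw [coeff_swap, coeff_swap v _ _ B, hs]
  rintro ⟨i, b⟩ ⟨j, c⟩
  cases b <;> cases c
  · fin_cases i <;> fin_cases j <;> simp [coeff_self v h2, hs, hs']
  · exact (h i j).symm
  · exact h' j i
  · fin_cases i <;> fin_cases j <;> simp [coeff_self v h2, hr, hr']

/-- On Λ⁰ ⊕ Λ² the gl(V)-component acts through its trace, so the traceless part, a factor sl₂,
drops out. -/
theorem halfSpin_soTwo_zero (h2 : (2 : k) ≠ 0) (p : Fin 2 → Fin 2 → k) (r s : k) :
    halfSpin v (soTwo v p r s) (plusVec v 0)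
      = (-(1 / 2 : k) * (p 0 0 + p 1 1)) • plusVec v 0 + s • plusVec v 1 := by
  have h0 := isIndicator_zero (l := 2)
  have e0 := even_sum_zero (l := 2)
  have n1 : ¬IsIndicator (0 + wt (1, false) + wt (0, true) : Fin 2 → ℤ) := by decide
  have n2 : ¬IsIndicator (0 + wt (0, false) + wt (1, true) : Fin 2 → ℤ) := by decide
  have n3 : ¬IsIndicator (0 + wt (0, false) + wt (1, false) : Fin 2 → ℤ) := by decide
  have y : (0 + wt (0, true) + wt (1, true) : Fin 2 → ℤ) = 1 := by decide
  have c : lowForm (wt ((0 : Fin 2), true)) (0 : Fin 2 → ℤ) + lowForm (wt ((0 : Fin 2), true)) (wt (1, true))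
      + lowForm (wt ((1 : Fin 2), true)) (0 : Fin 2 → ℤ) = 0 := by decide
  simp only [soTwo, map_add, map_sub, map_smul, LinearMap.add_apply, LinearMap.sub_apply,
    LinearMap.smul_apply, halfSpin_cartan v h2 _ h0 e0]
  rw [halfSpin_sigma_unitVec v h2 (by decide) h0 e0, halfSpin_sigma_unitVec v h2 (by decide) h0 e0,
    halfSpin_sigma_unitVec v h2 (by decide) h0 e0, halfSpin_sigma_unitVec v h2 (by decide) h0 e0,
    plusVec_of_not v n1, plusVec_of_not v n2, plusVec_of_not v n3, y, c]
  simp only [smul_zero]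
  rw [sgn_even (by decide)]
  simp only [Pi.zero_apply, Int.cast_zero]
  module

theorem halfSpin_soTwo_one (h2 : (2 : k) ≠ 0) (p : Fin 2 → Fin 2 → k) (r s : k) :
    halfSpin v (soTwo v p r s) (plusVec v 1)
      = ((1 / 2 : k) * (p 0 0 + p 1 1)) • plusVec v 1 - r • plusVec v 0 := by
  have h0 := isIndicator_one (l := 2)
  have e0 := even_sum_one (l := 2) even_two
  have n1 : ¬IsIndicator (1 + wt (1, false) + wt (0, true) : Fin 2 → ℤ) := by decide
  have n2 : ¬IsIndicator (1 + wt (0, false) + wt (1, true) : Fin 2 → ℤ) := by decide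
  have n3 : ¬IsIndicator (1 + wt (0, true) + wt (1, true) : Fin 2 → ℤ) := by decide
  have y : (1 + wt (0, false) + wt (1, false) : Fin 2 → ℤ) = 0 := by decide
  have c : lowForm (wt ((0 : Fin 2), false)) (1 : Fin 2 → ℤ) + lowForm (wt ((0 : Fin 2), false)) (wt (1, false))
      + lowForm (wt ((1 : Fin 2), false)) (1 : Fin 2 → ℤ) = -1 := by decide
  simp only [soTwo, map_add, map_sub, map_smul, LinearMap.add_apply, LinearMap.sub_apply,
    LinearMap.smul_apply, halfSpin_cartan v h2 _ h0 e0]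
  rw [halfSpin_sigma_unitVec v h2 (by decide) h0 e0, halfSpin_sigma_unitVec v h2 (by decide) h0 e0,
    halfSpin_sigma_unitVec v h2 (by decide) h0 e0, halfSpin_sigma_unitVec v h2 (by decide) h0 e0,
    plusVec_of_not v n1, plusVec_of_not v n2, plusVec_of_not v n3, y, c]
  simp only [smul_zero]
  rw [sgn_odd (by decide)]
  simp only [Pi.one_apply, Int.cast_one]
  have : (1 : k) - 1 / 2 = 1 / 2 := by field_simp; ring
  rw [this]
  module

theorem oddBracket_two (h2 : (2 : k) ≠ 0) :
    oddBracket v (plusVec v 0) (plusVec v 0) = soTwo v 0 1 0 ∧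
    oddBracket v (plusVec v 1) (plusVec v 1) = soTwo v 0 0 1 ∧
    oddBracket v (plusVec v 0) (plusVec v 1)
      = soTwo v (fun i j => if i = j then -(1 / 2) else 0) 0 0 ∧
    oddBracket v (plusVec v 1) (plusVec v 0)
      = soTwo v (fun i j => if i = j then -(1 / 2) else 0) 0 0 := by
  have h0 := isIndicator_zero (l := 2)
  have e0 := even_sum_zero (l := 2)
  have h1 := isIndicator_one (l := 2)
  have e1 := even_sum_one (l := 2) even_two
  have h01 : oddBracket v (plusVec v 0) (plusVec v 1)
      = soTwo v (fun i j => if i = j then -(1 / 2) else 0) 0 0 := by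
    rw [oddBracket_plusVec_opp v h2 h0 h1 e0 e1 (by decide), sgn_even (by decide), one_smul,
      Fin.sum_univ_two]
    simp [soTwo]
  refine ⟨?_, ?_, h01, ?_⟩
  · rw [oddBracket_plusVec_of_root v h2 (a := (0, false)) (b := (1, false)) (by decide) h0 h0 e0 e0
      (by decide), sgn_even (by decide)]
    simp [soTwo]
  · rw [oddBracket_plusVec_of_root v h2 (a := (0, true)) (b := (1, true)) (by decide) h1 h1 e1 e1
      (by decide), sgn_even (by decide)]
    simp [soTwo]
  · have hε : epsilon k 2 = -1 := epsilon_four_mul_add_two 0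
    rw [oddBracket_comm v h2, h01, hε, neg_neg, one_smul]

/-- The matrix of an element of `so(V ⊕ V*)`, `dim V = 2`, on the half-spin module. -/
noncomputable def spinMatrix : So k V →ₗ[k] Matrix (Fin 1 ⊕ Fin 1) (Fin 1 ⊕ Fin 1) k where
  toFun A := Matrix.fromBlocks
    (fun _ _ => -(1 / 2 : k) * (coeff v (0, false) (0, true) A + coeff v (1, false) (1, true) A))
    (fun _ _ => -coeff v (0, true) (1, true) A)
    (fun _ _ => coeff v (0, false) (1, false) A)
    (fun _ _ => (1 / 2 : k) * (coeff v (0, false) (0, true) A + coeff v (1, false) (1, true) A))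
  map_add' A B := by
    ext i j
    rcases i with i | i <;> rcases j with j | j <;> simp [Matrix.fromBlocks] <;> ring
  map_smul' r A := by
    ext i j
    rcases i with i | i <;> rcases j with j | j <;> simp [Matrix.fromBlocks] <;> ring

/-- The traceless part of the `gl(V)`-component of an element of `so(V ⊕ V*)`, `dim V = 2`. -/
noncomputable def tracelessMatrix : So k V →ₗ[k] Matrix (Fin 2) (Fin 2) k where
  toFun A := !![(1 / 2 : k) * (coeff v (0, false) (0, true) A - coeff v (1, false) (1, true) A),
    coeff v (0, false) (1, true) A; coeff v (1, false) (0, true) A,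
    -(1 / 2 : k) * (coeff v (0, false) (0, true) A - coeff v (1, false) (1, true) A)]
  map_add' A B := by
    ext i j
    fin_cases i <;> fin_cases j <;> simp <;> ring
  map_smul' r A := by
    ext i j
    fin_cases i <;> fin_cases j <;> simp <;> ring

theorem spinMatrix_lie (h2 : (2 : k) ≠ 0) (A B : So k V) :
    spinMatrix v ⁅A, B⁆ = spinMatrix v A * spinMatrix v B - spinMatrix v B * spinMatrix v A := by
  have hA := fun i j => coeff_swap v (i, true) (j, false) A
  have hB := fun i j => coeff_swap v (i, true) (j, false) B
  have hA1 := coeff_swap v (1, true) (0, true) A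
  have hB1 := coeff_swap v (1, true) (0, true) B
  have hA2 := coeff_swap v (1, false) (0, false) A
  have hB2 := coeff_swap v (1, false) (0, false) B
  ext i j
  rcases i with i | i <;> rcases j with j | j <;> fin_cases i <;> fin_cases j <;>
    simp [spinMatrix, Matrix.fromBlocks, Matrix.mul_apply, coeff_lie, coeff_self v h2,
      Fin.sum_univ_two, hA, hB, hA1, hA2, hB1, hB2] <;>
    field_simp <;> ring

theorem tracelessMatrix_lie (h2 : (2 : k) ≠ 0) (A B : So k V) :
    tracelessMatrix v ⁅A, B⁆ = tracelessMatrix v A * tracelessMatrix v B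
      - tracelessMatrix v B * tracelessMatrix v A := by
  have hA := fun i j => coeff_swap v (i, true) (j, false) A
  have hB := fun i j => coeff_swap v (i, true) (j, false) B
  have hA1 := coeff_swap v (1, true) (0, true) A
  have hB1 := coeff_swap v (1, true) (0, true) B
  have hA2 := coeff_swap v (1, false) (0, false) A
  have hB2 := coeff_swap v (1, false) (0, false) B
  ext i j
  fin_cases i <;> fin_cases j <;>
    simp [tracelessMatrix, Matrix.mul_apply, coeff_lie, coeff_self v h2,
      Fin.sum_univ_two, hA, hB, hA1, hA2, hB1, hB2] <;>
    field_simp <;> ring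

theorem mem_sp_fin_one {D : Matrix (Fin 1 ⊕ Fin 1) (Fin 1 ⊕ Fin 1) k} :
    D.transpose * Matrix.J (Fin 1) k = -(Matrix.J (Fin 1) k * D) ↔
      D (Sum.inl 0) (Sum.inl 0) + D (Sum.inr 0) (Sum.inr 0) = 0 := by
  rw [← Matrix.ext_iff]
  constructor
  · intro h
    have := h (Sum.inl 0) (Sum.inr 0)
    simp [Matrix.mul_apply, Matrix.J, Matrix.fromBlocks] at this
    linear_combination -this
  · intro h i j
    rcases i with i | i <;> rcases j with j | j <;> fin_cases i <;> fin_cases j <;>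
      simp [Matrix.mul_apply, Matrix.J, Matrix.fromBlocks]
    · linear_combination -h
    · linear_combination h

/-- The coefficients of an element of `S⁺`, `dim V = 2`. -/
noncomputable def plusCoeff (i : Bool) : SPlus k V →ₗ[k] k :=
  if i then -(bHat v).flip (plusVec v 0) else (bHat v).flip (plusVec v 1)

theorem plusCoeff_zero :
    plusCoeff v false (plusVec v 0) = 1 ∧ plusCoeff v true (plusVec v 0) = 0 := by
  have h0 := isIndicator_zero (l := 2)
  have e0 := even_sum_zero (l := 2)
  have h1 := isIndicator_one (l := 2)
  have e1 := even_sum_one (l := 2) even_two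
  constructor
  · change bHat v (plusVec v 0) (plusVec v 1) = 1
    rw [bHat_plusVec v h1 e0 e1, if_pos (by decide), sgn_even (by decide)]
  · change -bHat v (plusVec v 0) (plusVec v 0) = 0
    rw [bHat_plusVec v h0 e0 e0, if_neg (by decide), neg_zero]

theorem plusCoeff_one :
    plusCoeff v false (plusVec v 1) = 0 ∧ plusCoeff v true (plusVec v 1) = 1 := by
  have h0 := isIndicator_zero (l := 2)
  have e0 := even_sum_zero (l := 2)
  have h1 := isIndicator_one (l := 2)
  have e1 := even_sum_one (l := 2) even_two
  constructor
  · change bHat v (plusVec v 1) (plusVec v 1) = 0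
    rw [bHat_plusVec v h1 e1 e1, if_neg (by decide)]
  · change -bHat v (plusVec v 1) (plusVec v 0) = 1
    rw [bHat_plusVec v h0 e1 e0, if_pos (by decide), sgn_odd (by decide), neg_neg]

theorem plus_eq (h2 : (2 : k) ≠ 0) (s : SPlus k V) :
    s = plusCoeff v false s • plusVec v 0 + plusCoeff v true s • plusVec v 1 := by
  have : LinearMap.id = (plusCoeff v false).smulRight (plusVec v 0)
      + (plusCoeff v true).smulRight (plusVec v 1) := by
    refine plus_ext v h2 fun μ hμ eμ => ?_
    have h : μ = 0 ∨ μ = 1 := by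
      rw [Fin.sum_univ_two] at eμ
      rcases hμ 0 with h0 | h0 <;> rcases hμ 1 with h1 | h1 <;> rw [h0, h1] at eμ
      · exact Or.inl (funext fun i => by fin_cases i <;> simp [h0, h1])
      · exact absurd eμ (by decide)
      · exact absurd eμ (by decide)
      · exact Or.inr (funext fun i => by fin_cases i <;> simp [h0, h1])
    rcases h with rfl | rfl
    · simp [plusCoeff_zero]
    · simp [plusCoeff_one]
  exact LinearMap.congr_fun this s

theorem spinMatrix_mem (A : So k V) :
    ((0, spinMatrix v A) : Matrix (Fin 1) (Fin 1) k × _) ∈ ospEven (Fin 1) (Fin 1) k := by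
  rw [mem_ospEven]
  refine ⟨by simp, mem_sp_fin_one.2 ?_⟩
  simp [spinMatrix, Matrix.fromBlocks]

theorem tracelessMatrix_mem (A : So k V) :
    tracelessMatrix v A ∈ LieAlgebra.SpecialLinear.sl (Fin 2) k := by
  change tracelessMatrix v A ∈ LinearMap.ker (Matrix.traceLinearMap (Fin 2) k k)
  rw [LinearMap.mem_ker, Matrix.traceLinearMap_apply, Matrix.trace_fin_two]
  simp [tracelessMatrix]

/-- The isomorphism of `so₄` with `sp₂ × sl₂`. -/
noncomputable def evenMap : So k V →ₗ[k]
    ospEven (Fin 1) (Fin 1) k × LieAlgebra.SpecialLinear.sl (Fin 2) k :=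
  LinearMap.prod
    (LinearMap.codRestrict _ (LinearMap.prod 0 (spinMatrix v)) (spinMatrix_mem v))
    (LinearMap.codRestrict (LieAlgebra.SpecialLinear.sl (Fin 2) k).toSubmodule
      (tracelessMatrix v) (tracelessMatrix_mem v))

theorem evenMap_injective (h2 : (2 : k) ≠ 0) : Function.Injective (evenMap v) := by
  refine (injective_iff_map_eq_zero _).2 fun A hA => ?_
  have h1 : spinMatrix v A = 0 := congrArg (fun x => x.1.1.2) hA
  have h3 : tracelessMatrix v A = 0 := congrArg (fun x => x.2.1) hA
  have hs := congrFun (congrFun h1 (Sum.inr 0)) (Sum.inl 0)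
  have hr := congrFun (congrFun h1 (Sum.inl 0)) (Sum.inr 0)
  have hp := congrFun (congrFun h1 (Sum.inr 0)) (Sum.inr 0)
  have hm := congrFun (congrFun h3 0) 0
  have h01 := congrFun (congrFun h3 0) 1
  have h10 := congrFun (congrFun h3 1) 0
  simp [spinMatrix, Matrix.fromBlocks] at hs hr hp
  simp [tracelessMatrix] at hm h01 h10
  have hp' := hp.resolve_left h2
  have hm' := hm.resolve_left h2
  have h00 : coeff v (0, false) (0, true) A = 0 := by
    have : (2 : k) * coeff v (0, false) (0, true) A = 0 := by linear_combination hp' + hm'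
    exact (mul_eq_zero.1 this).resolve_left h2
  have h11 : coeff v (1, false) (1, true) A = 0 := by
    have : (2 : k) * coeff v (1, false) (1, true) A = 0 := by linear_combination hp' - hm'
    exact (mul_eq_zero.1 this).resolve_left h2
  rw [soTwo_coeff v h2 A, soTwo, h00, h11, h01, h10, hs, hr]
  simp

theorem evenMap_surjective (h2 : (2 : k) ≠ 0) : Function.Surjective (evenMap v) := by
  rintro ⟨⟨⟨X, D⟩, hXD⟩, ⟨N, hN⟩⟩
  rw [mem_ospEven, mem_sp_fin_one] at hXD
  obtain ⟨hX, hD⟩ := hXD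
  have hN' : N 0 0 + N 1 1 = 0 := by
    change N ∈ LinearMap.ker (Matrix.traceLinearMap (Fin 2) k k) at hN
    rwa [LinearMap.mem_ker, Matrix.traceLinearMap_apply, Matrix.trace_fin_two] at hN
  obtain ⟨h, hr, hs⟩ := coeff_soTwo v
    ![![D (Sum.inr 0) (Sum.inr 0) + N 0 0, N 0 1], ![N 1 0, D (Sum.inr 0) (Sum.inr 0) - N 0 0]]
    (-D (Sum.inl 0) (Sum.inr 0)) (D (Sum.inr 0) (Sum.inl 0))
  -- The gl(V)-component has traceless part `N` and half trace equal to the lower right entry of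
  -- `D`.
  refine ⟨soTwo v ![![D (Sum.inr 0) (Sum.inr 0) + N 0 0, N 0 1],
    ![N 1 0, D (Sum.inr 0) (Sum.inr 0) - N 0 0]]
    (-D (Sum.inl 0) (Sum.inr 0)) (D (Sum.inr 0) (Sum.inl 0)),
    Prod.ext (Subtype.ext (Prod.ext ?_ ?_)) (Subtype.ext ?_)⟩
  · change (0 : Matrix (Fin 1) (Fin 1) k) = X
    ext i j
    have h3 := congrFun (congrFun hX i) j
    rw [Subsingleton.elim j i] at *
    have h4 : (2 : k) * X i i = 0 := by
      rw [Matrix.transpose_apply, Matrix.neg_apply] at h3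
      linear_combination h3
    exact ((mul_eq_zero.1 h4).resolve_left h2).symm
  · change spinMatrix v _ = D
    ext i j
    rcases i with i | i <;> rcases j with j | j <;> fin_cases i <;> fin_cases j <;>
      simp [spinMatrix, Matrix.fromBlocks, h, hr, hs] <;> field_simp
    · linear_combination -2 * hD
    · ring
  · change tracelessMatrix v _ = N
    ext i j
    fin_cases i <;> fin_cases j <;> simp [tracelessMatrix, h] <;> field_simp
    · ring
    · linear_combination -2 * hN'

/-- The linear map from `S⁺` to the odd part of `osp(1|2)` that is scaled by `c`. -/
noncomputable def oddMap (c : k) : SPlus k V →ₗ[k] ospOdd (Fin 1) (Fin 1) k where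
  toFun s := ⟨(Matrix.of fun _ j => c * Sum.elim (fun _ => -plusCoeff v true s)
      (fun _ => plusCoeff v false s) j,
    Matrix.of fun i _ => c * Sum.elim (fun _ => plusCoeff v false s)
      (fun _ => plusCoeff v true s) i), by
    rw [mem_ospOdd]
    ext i j
    rcases j with j | j <;> fin_cases j <;> simp [Matrix.mul_apply, Matrix.J]⟩
  map_add' s t := by
    refine Subtype.ext (Prod.ext ?_ ?_)
    · ext i j
      rcases j with j | j <;> simp <;> ring
    · ext i j
      rcases i with i | i <;> simp <;> ring
  map_smul' r s := by
    refine Subtype.ext (Prod.ext ?_ ?_)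
    · ext i j
      rcases j with j | j <;> simp <;> ring
    · ext i j
      rcases i with i | i <;> simp <;> ring

theorem oddMap_bijective (h2 : (2 : k) ≠ 0) {c : k} (hc : c ≠ 0) :
    Function.Bijective (oddMap v c) := by
  constructor
  · refine (injective_iff_map_eq_zero _).2 fun s hs => ?_
    have h1 : c * plusCoeff v false s = 0 := congrArg (fun x => x.1.2 (Sum.inl 0) 0) hs
    have h3 : c * plusCoeff v true s = 0 := congrArg (fun x => x.1.2 (Sum.inr 0) 0) hs
    rw [plus_eq v h2 s, (mul_eq_zero.1 h1).resolve_left hc, (mul_eq_zero.1 h3).resolve_left hc,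
      zero_smul, zero_smul, add_zero]
  · rintro ⟨⟨B, C⟩, h⟩
    have hB : B = -(C.transpose * Matrix.J (Fin 1) k) := mem_ospOdd.1 h
    subst hB
    refine ⟨(c⁻¹ * C (Sum.inl 0) 0) • plusVec v 0 + (c⁻¹ * C (Sum.inr 0) 0) • plusVec v 1,
      Subtype.ext (Prod.ext ?_ ?_)⟩
    · ext i j
      fin_cases i
      rcases j with j | j <;> fin_cases j <;>
        simp [oddMap, plusCoeff_zero, plusCoeff_one, Matrix.mul_apply, Matrix.J, hc]
    · ext i j
      fin_cases j
      rcases i with i | i <;> fin_cases i <;> simp [oddMap, plusCoeff_zero, plusCoeff_one, hc]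

theorem oddMap_halfSpin (h2 : (2 : k) ≠ 0) (c : k) (A : So k V) (s : SPlus k V) :
    (oddMap v c (halfSpin v A s)).1
      = (-((oddMap v c s).1.1 * spinMatrix v A), spinMatrix v A * (oddMap v c s).1.2) := by
  have hA : halfSpin v A s
      = (-(1 / 2 : k) * (coeff v (0, false) (0, true) A + coeff v (1, false) (1, true) A)
          * plusCoeff v false s - coeff v (0, true) (1, true) A * plusCoeff v true s) • plusVec v 0
        + ((1 / 2 : k) * (coeff v (0, false) (0, true) A + coeff v (1, false) (1, true) A)
          * plusCoeff v true s
          + coeff v (0, false) (1, false) A * plusCoeff v false s) • plusVec v 1 := by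
    conv_lhs => rw [soTwo_coeff v h2 A, plus_eq v h2 s]
    rw [map_add, map_smul, map_smul, halfSpin_soTwo_zero v h2, halfSpin_soTwo_one v h2]
    module
  rw [hA]
  refine Prod.ext ?_ ?_
  · ext i j
    rcases j with j | j <;> fin_cases j <;>
      simp [oddMap, spinMatrix, Matrix.fromBlocks, plusCoeff_zero, plusCoeff_one, Matrix.mul_apply] <;> ring
  · ext i j
    rcases i with i | i <;> fin_cases i <;>
      simp [oddMap, spinMatrix, Matrix.fromBlocks, plusCoeff_zero, plusCoeff_one, Matrix.mul_apply] <;> ring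

theorem oddBracket_eq_soTwo (h2 : (2 : k) ≠ 0) (s t : SPlus k V) :
    oddBracket v s t = soTwo v (fun i j => if i = j then -(1 / 2 : k)
        * (plusCoeff v false s * plusCoeff v true t + plusCoeff v true s * plusCoeff v false t) else 0)
      (plusCoeff v false s * plusCoeff v false t) (plusCoeff v true s * plusCoeff v true t) := by
  obtain ⟨h00, h11, h01, h10⟩ := oddBracket_two v h2
  conv_lhs => rw [plus_eq v h2 s, plus_eq v h2 t]
  simp only [map_add, map_smul, LinearMap.add_apply, LinearMap.smul_apply, h00, h01, h10, h11,
    soTwo, Pi.zero_apply, if_pos]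
  simp
  module

theorem algebra_iso_osp [IsAlgClosed k] (h2 : (2 : k) ≠ 0) : (algebra v).Iso
    ((osp (Fin 1) (Fin 1) k).sumLie (LieAlgebra.SpecialLinear.sl (Fin 2) k)) := by
  -- The matrix product of two odd elements is quadratic in the scale `c`; comparing it with the
  -- product of e_1 with itself gives -2c² = 1.
  obtain ⟨c, hc⟩ := IsAlgClosed.exists_eq_mul_self (-(1 / 2) : k)
  have hc0 : c ≠ 0 := by
    rintro rfl
    rw [mul_zero, neg_eq_zero] at hc
    exact one_div_ne_zero h2 hc
  refine ⟨LinearEquiv.ofBijective (evenMap v) ⟨evenMap_injective v h2, evenMap_surjective v h2⟩,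
    LinearEquiv.ofBijective (oddMap v c) (oddMap_bijective v h2 hc0), fun A B => ?_, fun A s => ?_,
    fun s A => ?_, fun s t => ?_⟩
  · refine Prod.ext (Subtype.ext (Prod.ext ?_ ?_)) (Subtype.ext ?_)
    · change (0 : Matrix (Fin 1) (Fin 1) k) = 0 * 0 - 0 * 0
      simp
    · exact spinMatrix_lie v h2 A B
    · exact tracelessMatrix_lie v h2 A B
  · refine Subtype.ext ?_
    change (oddMap v c (halfSpin v A s)).1 = ((0 : Matrix (Fin 1) (Fin 1) k) * (oddMap v c s).1.1
      - (oddMap v c s).1.1 * spinMatrix v A, spinMatrix v A * (oddMap v c s).1.2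
      - (oddMap v c s).1.2 * (0 : Matrix (Fin 1) (Fin 1) k))
    rw [oddMap_halfSpin v h2, Matrix.zero_mul, Matrix.mul_zero, zero_sub, sub_zero]
  · refine Subtype.ext ?_
    change (oddMap v c (-halfSpin v A s)).1 = ((oddMap v c s).1.1 * spinMatrix v A
      - (0 : Matrix (Fin 1) (Fin 1) k) * (oddMap v c s).1.1,
      (oddMap v c s).1.2 * (0 : Matrix (Fin 1) (Fin 1) k) - spinMatrix v A * (oddMap v c s).1.2)
    rw [map_neg, Submodule.coe_neg, oddMap_halfSpin v h2, Matrix.zero_mul, Matrix.mul_zero,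
      zero_sub, sub_zero]
    refine Prod.ext (neg_neg _) rfl
  · obtain ⟨h, hr, hs⟩ := coeff_soTwo v (fun i j => if i = j then -(1 / 2 : k)
        * (plusCoeff v false s * plusCoeff v true t + plusCoeff v true s * plusCoeff v false t) else 0)
      (plusCoeff v false s * plusCoeff v false t) (plusCoeff v true s * plusCoeff v true t)
    rw [← oddBracket_eq_soTwo v h2] at h hr hs
    refine Prod.ext (Subtype.ext (Prod.ext ?_ ?_)) (Subtype.ext ?_)
    · change (0 : Matrix (Fin 1) (Fin 1) k) = (oddMap v c s).1.1 * (oddMap v c t).1.2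
        + (oddMap v c t).1.1 * (oddMap v c s).1.2
      ext i j
      simp [oddMap, Matrix.mul_apply]
      ring
    · change spinMatrix v (oddBracket v s t) = (oddMap v c s).1.2 * (oddMap v c t).1.1
        + (oddMap v c t).1.2 * (oddMap v c s).1.1
      have hc' : c ^ 2 = -(1 / 2 : k) := by rw [hc, sq]
      ext i j
      rcases i with i | i <;> rcases j with j | j <;> fin_cases i <;> fin_cases j <;>
        simp [oddMap, spinMatrix, Matrix.fromBlocks, Matrix.mul_apply, h, hr, hs] <;> ring_nf <;> rw [hc'] <;>
        field_simp <;> ring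
    · change tracelessMatrix v (oddBracket v s t) = 0
      ext i j
      fin_cases i <;> fin_cases j <;> simp [tracelessMatrix, h]

end RankTwo
end TypeD

namespace TypeD

open CliffordAlgebra (contractLeft evenOdd)

/-! ### Normalized root elements and their structure constants -/

section RootElements

variable {k V : Type*} [Field k] [AddCommGroup V] [Module k V]
  {l : ℕ} (v : Module.Basis (Fin l) k V)

/-- The roots `±e_i ± e_j` of the orthogonal Lie algebra. -/
def IsRoot (α : Fin l → ℤ) : Prop :=
  ∃ a b : Fin l × Bool, a.1 ≠ b.1 ∧ α = wt a + wt b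

theorem wt_mul_self (a : Fin l × Bool) : wt a a.1 * wt a a.1 = 1 := by
  rcases wt_apply_self a with h | h <;> rw [h] <;> norm_num

theorem sum_wt_mul_wt_of_ne {a b : Fin l × Bool} (hab : a.1 ≠ b.1) :
    ∑ i, wt a i * wt b i = 0 := by
  rw [sum_wt_mul, wt_apply_of_ne b hab, mul_zero]

theorem sum_wt_mul_wt_nonneg {a b : Fin l × Bool} (hab : b ≠ opp a) :
    0 ≤ ∑ i, wt a i * wt b i := by
  by_cases h : a.1 = b.1
  · rcases eq_or_eq_opp h with h | h
    · rw [h, sum_wt_mul, wt_mul_self]; norm_num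
    · exact absurd (by rw [h, opp_opp]) hab
  · rw [sum_wt_mul_wt_of_ne h]

theorem IsRoot.sum_mul_self {α : Fin l → ℤ} (h : IsRoot α) : ∑ i, α i * α i = 2 := by
  obtain ⟨a, b, hab, rfl⟩ := h
  have e : ∀ i, (wt a + wt b) i * (wt a + wt b) i
      = wt a i * wt a i + 2 * (wt a i * wt b i) + wt b i * wt b i := fun i => by
    simp only [Pi.add_apply]; ring
  simp only [e, Finset.sum_add_distrib, ← Finset.mul_sum]
  rw [sum_wt_mul_wt_of_ne hab, sum_wt_mul, sum_wt_mul, wt_mul_self, wt_mul_self]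
  norm_num

theorem exists_wt {i : Fin l} {r : ℤ} (h : r = 1 ∨ r = -1) :
    ∃ a : Fin l × Bool, a.1 = i ∧ wt a = Pi.single i r := by
  rcases h with rfl | rfl
  · exact ⟨(i, true), rfl, by simp [wt]⟩
  · exact ⟨(i, false), rfl, by simp [wt]⟩

/-- An integral vector of norm 2 has exactly two nonzero entries, both ±1. The quadratic form of the
condition is the one to be compared with the norm of E₈. -/
theorem isRoot_iff {α : Fin l → ℤ} : IsRoot α ↔ ∑ i, α i * α i = 2 := by
  refine ⟨IsRoot.sum_mul_self, fun h => ?_⟩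
  have hle : ∀ i, α i * α i ≤ 2 := fun i => h ▸
    Finset.single_le_sum (f := fun i => α i * α i) (fun j _ => mul_self_nonneg _)
      (Finset.mem_univ i)
  have h1 : ∀ i, α i ≠ 0 → α i = 1 ∨ α i = -1 := by
    intro i hi
    have := hle i
    have h3 : α i < 2 := by nlinarith
    have h4 : -2 < α i := by nlinarith
    omega
  have h2 : ∀ i, α i * α i = if α i ≠ 0 then 1 else 0 := by
    intro i
    split_ifs with hi
    · rcases h1 i hi with e | e <;> rw [e] <;> norm_num
    · rw [not_not.1 hi, mul_zero]
  simp only [h2, Finset.sum_boole] at h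
  obtain ⟨p, q, hpq, hs⟩ := Finset.card_eq_two.1 (by exact_mod_cast h :
    (Finset.univ.filter fun i => α i ≠ 0).card = 2)
  have hm : ∀ i, α i ≠ 0 ↔ i = p ∨ i = q := fun i => by
    have := congrArg (i ∈ ·) hs
    simpa using this
  obtain ⟨a, ha, ha'⟩ := exists_wt (i := p) (h1 p ((hm p).2 (Or.inl rfl)))
  obtain ⟨b, hb, hb'⟩ := exists_wt (i := q) (h1 q ((hm q).2 (Or.inr rfl)))
  refine ⟨a, b, by rw [ha, hb]; exact hpq, ?_⟩
  funext i
  rw [ha', hb', Pi.add_apply, Pi.single_apply, Pi.single_apply]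
  by_cases hp : i = p
  · subst hp; rw [if_pos rfl, if_neg hpq, add_zero]
  · by_cases hq : i = q
    · subst hq; rw [if_neg hp, if_pos rfl, zero_add]
    · rw [if_neg hp, if_neg hq]
      by_contra hne
      exact ((hm i).1 hne).elim hp hq

/-- For integers μ² - μ is nonnegative and vanishes only at 0 and 1. Again this turns a
combinatorial condition into a norm. -/
theorem isIndicator_iff_sum {μ : Fin l → ℤ} :
    IsIndicator μ ↔ ∑ i, (μ i * μ i - μ i) = 0 := by
  have hn : ∀ i, 0 ≤ μ i * μ i - μ i := fun i => by
    rcases le_or_gt (μ i) 0 with h | h <;> nlinarith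
  rw [Finset.sum_eq_zero_iff_of_nonneg fun i _ => hn i]
  refine forall_congr' fun i => ?_
  constructor
  · rintro h
    rcases h with h | h <;> rw [h] <;> simp
  · intro h
    have : μ i * (μ i - 1) = 0 := by linarith [h (Finset.mem_univ i)]
    rcases mul_eq_zero.1 this with h | h
    · exact Or.inl h
    · exact Or.inr (by linarith)

open scoped Classical in
/-- The root element `∓σ` of the root `α`, normalized to act on the weight vectors by
the sign `(-1) ^ lowForm α μ`. -/
noncomputable def rootElt (α : Fin l → ℤ) : So k V :=
  if h : IsRoot α then
    -sgn k (lowForm (wt h.choose) (wt h.choose_spec.choose))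
      • sigma (unitVec v h.choose) (unitVec v h.choose_spec.choose)
  else 0

theorem rootElt_of_not {α : Fin l → ℤ} (h : ¬IsRoot α) : rootElt v α = 0 := dif_neg h

/-- The choice in the definition does not matter: exchanging the two weights changes the sign of σ
and, by `odd_lowForm_wt`, also the normalizing sign. -/
theorem rootElt_wt {a b : Fin l × Bool} (hab : a.1 ≠ b.1) :
    rootElt v (wt a + wt b)
      = -sgn k (lowForm (wt a) (wt b)) • sigma (unitVec v a) (unitVec v b) := by
  have h : IsRoot (wt a + wt b) := ⟨a, b, hab, rfl⟩
  rw [rootElt, dif_pos h]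
  obtain ⟨hcd, he⟩ := h.choose_spec.choose_spec
  generalize h.choose_spec.choose = d at hcd he ⊢
  generalize h.choose = c at hcd he ⊢
  rcases wt_add_eq hab hcd he with ⟨h1, h2⟩ | ⟨h1, h2⟩
  · rw [← h1, ← h2]
  · rw [← h1, ← h2, sigma_swap (unitVec v b), smul_neg, ← neg_smul, neg_neg, neg_sgn,
      sgn_congr (m := lowForm (wt b) (wt a)) (n := lowForm (wt a) (wt b) + 1)]
    have := odd_lowForm_wt hab
    grind

/-- The normalization cancels the term of the exponent that involves both constituents of the root,
and leaves a sign that is bilinear in the root and the weight. -/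
theorem halfSpin_rootElt (h2 : (2 : k) ≠ 0) {α : Fin l → ℤ} (hα : IsRoot α)
    {μ : Fin l → ℤ} (hμ : IsIndicator μ) (he : Even (∑ i, μ i)) :
    halfSpin v (rootElt v α) (plusVec v μ) = sgn k (lowForm α μ) • plusVec v (μ + α) := by
  obtain ⟨a, b, hab, rfl⟩ := hα
  rw [rootElt_wt v hab, halfSpin_smul, halfSpin_sigma_unitVec v h2 hab hμ he, smul_smul,
    neg_mul_neg, ← sgn_add, lowForm_add_left,
    show μ + (wt a + wt b) = μ + wt b + wt a by abel,
    show μ + wt a + wt b = μ + wt b + wt a by abel]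
  congr 1
  exact sgn_congr ⟨lowForm (wt a) (wt b) + lowForm (wt a) μ + lowForm (wt b) μ, by ring⟩

theorem lie_sigma_unitVec_of_ne {a b c d : Fin l × Bool} (h1 : c ≠ opp a) (h2 : c ≠ opp b)
    (h3 : d ≠ opp a) (h4 : d ≠ opp b) :
    ⁅sigma (unitVec v a) (unitVec v b), sigma (unitVec v c) (unitVec v d)⁆ = 0 := by
  rw [lie_sigma, sigma_coe_apply, sigma_coe_apply]
  simp only [dualProd_unitVec, if_neg h1, if_neg h2, if_neg h3, if_neg h4, zero_smul, sub_zero,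
    map_zero, LinearMap.zero_apply, add_zero]

theorem lie_rootElt_of_wt {a b d : Fin l × Bool} (hab : a.1 ≠ b.1) (had : a.1 ≠ d.1)
    (hbd : b.1 ≠ d.1) :
    ⁅rootElt v (wt a + wt b), rootElt v (wt (opp a) + wt d)⁆
      = sgn k (lowForm (wt a + wt b) (wt (opp a) + wt d)) • rootElt v (wt b + wt d) := by
  have had' : (opp a).1 ≠ d.1 := had
  rw [rootElt_wt v hab, rootElt_wt v had', rootElt_wt v hbd, smul_lie, lie_smul, lie_sigma,
    sigma_coe_apply, sigma_coe_apply]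
  have e1 : opp a ≠ opp b := fun h => hab (by simpa using congrArg Prod.fst h)
  have e2 : d ≠ opp a := fun h => had (by rw [h]; rfl)
  have e3 : d ≠ opp b := fun h => hbd (by rw [h]; rfl)
  simp only [dualProd_unitVec, if_neg e1, if_neg e2, if_neg e3, zero_smul, sub_zero, one_smul,
    map_zero, add_zero, if_true, smul_smul, ← sgn_add, neg_sgn]
  congr 1
  refine sgn_congr ?_
  rw [lowForm_add_left, lowForm_add_right, lowForm_add_right, wt_opp, lowForm_neg_right,
    lowForm_neg_right, lowForm_neg_left, lowForm_wt_of_fst_eq (rfl : a.1 = a.1)]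
  have := odd_lowForm_wt hab
  grind

theorem lie_rootElt_opp {a b : Fin l × Bool} (hab : a.1 ≠ b.1) :
    ⁅rootElt v (wt a + wt b), rootElt v (wt (opp a) + wt (opp b))⁆
      = -∑ i, (((wt a + wt b) i : ℤ) : k) • cartan v i := by
  have hab' : (opp a).1 ≠ (opp b).1 := hab
  have hc : ∀ a : Fin l × Bool, sigma (unitVec v a) (unitVec v (opp a))
      = -∑ i, ((wt a i : ℤ) : k) • cartan v i := by
    intro a
    rw [Finset.sum_eq_single a.1 (fun i _ h => by rw [wt_apply_of_ne a h, Int.cast_zero, zero_smul])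
      (fun h => absurd (Finset.mem_univ _) h)]
    obtain ⟨i, _ | _⟩ := a
    · simp [wt, cartan, opp, unitVec]
    · rw [sigma_swap]; simp [wt, cartan, opp, unitVec]
  rw [rootElt_wt v hab, rootElt_wt v hab', smul_lie, lie_smul, lie_sigma_opp v hab, smul_smul,
    neg_mul_neg, wt_opp, wt_opp, lowForm_neg_left, lowForm_neg_right, neg_neg, sgn_mul_self,
    one_smul, hc, hc, add_comm, ← neg_add, ← Finset.sum_add_distrib]
  congr 1
  refine Finset.sum_congr rfl fun i _ => ?_
  rw [← add_smul, Pi.add_apply, Int.cast_add]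

theorem sum_add_mul_self (α β : Fin l → ℤ) : ∑ i, (α + β) i * (α + β) i
    = ∑ i, α i * α i + 2 * ∑ i, α i * β i + ∑ i, β i * β i := by
  rw [Finset.mul_sum, ← Finset.sum_add_distrib, ← Finset.sum_add_distrib]
  refine Finset.sum_congr rfl fun i _ => ?_
  simp only [Pi.add_apply]; ring

/-- The opposite vectors contract and σ_{b,d} remains up to sign. It is zero if d = b, where 2 wt b
has norm 4 and is no root; if d is opposite to b, the roots are opposite and Cartan elements appear.
-/
theorem lie_rootElt_aux {a b d : Fin l × Bool} (hab : a.1 ≠ b.1) (had : (opp a).1 ≠ d.1) :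
    (wt a + wt b + (wt (opp a) + wt d) = 0 →
      ⁅rootElt v (wt a + wt b), rootElt v (wt (opp a) + wt d)⁆
        = -∑ i, (((wt a + wt b) i : ℤ) : k) • cartan v i) ∧
    (wt a + wt b + (wt (opp a) + wt d) ≠ 0 →
      ⁅rootElt v (wt a + wt b), rootElt v (wt (opp a) + wt d)⁆
        = sgn k (lowForm (wt a + wt b) (wt (opp a) + wt d))
          • rootElt v (wt a + wt b + (wt (opp a) + wt d))) := by
  have e : wt a + wt b + (wt (opp a) + wt d) = wt b + wt d := by rw [wt_opp]; abel
  rw [e]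
  by_cases hbd : b.1 = d.1
  · rcases eq_or_eq_opp hbd with rfl | h
    · have hn : ∑ i, (wt b + wt b) i * (wt b + wt b) i = 4 := by
        rw [sum_add_mul_self, sum_wt_mul, wt_mul_self]; norm_num
      refine ⟨fun h => by rw [h] at hn; simp at hn, fun _ => ?_⟩
      have h0 : ¬IsRoot (wt b + wt b) := fun h => by have := h.sum_mul_self; omega
      rw [rootElt_of_not v h0, smul_zero,
        rootElt_wt v hab, rootElt_wt v had, smul_lie, lie_smul, lie_sigma,
        sigma_coe_apply, sigma_coe_apply]
      have e1 : opp a ≠ opp b := fun h => hab (by simpa using congrArg Prod.fst h)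
      have e2 : b ≠ opp a := fun h => hab (by rw [h]; rfl)
      have e3 : b ≠ opp b := fun h => by
        have := congrArg Prod.snd h
        simp [opp] at this
      simp only [dualProd_unitVec, if_neg e1, if_neg e2, if_neg e3, zero_smul, sub_zero, one_smul,
        map_zero, add_zero, if_true, sigma_self, smul_zero]
    · obtain rfl : d = opp b := by rw [h, opp_opp]
      refine ⟨fun _ => lie_rootElt_opp v hab, fun h => absurd ?_ h⟩
      rw [wt_opp]; abel
  · exact ⟨fun h => absurd h (wt_add_ne_zero hbd), fun _ => lie_rootElt_of_wt v hab had hbd⟩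

/-- If no constituent of β is opposite to one of α, all inner products are nonnegative, so α + β has
norm at least 4 and is no root, while the two elements commute. All other cases are
`lie_rootElt_aux` up to the order of the constituents. The structure constants are thus the
bimultiplicative cocycle of `lowForm`. -/
theorem lie_rootElt {α β : Fin l → ℤ} (hα : IsRoot α) (hβ : IsRoot β) :
    (α + β = 0 → ⁅rootElt v α, rootElt v β⁆ = -∑ i, ((α i : ℤ) : k) • cartan v i) ∧
    (α + β ≠ 0 →
      ⁅rootElt v α, rootElt v β⁆ = sgn k (lowForm α β) • rootElt v (α + β)) := by
  have nα := hα.sum_mul_self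
  have nβ := hβ.sum_mul_self
  obtain ⟨a, b, hab, rfl⟩ := hα
  obtain ⟨c, d, hcd, rfl⟩ := hβ
  by_cases h1 : c = opp a
  · subst h1; exact lie_rootElt_aux v hab hcd
  by_cases h2 : c = opp b
  · subst h2; rw [add_comm (wt a)]; exact lie_rootElt_aux v hab.symm hcd
  by_cases h3 : d = opp a
  · subst h3; rw [add_comm (wt c)]; exact lie_rootElt_aux v hab hcd.symm
  by_cases h4 : d = opp b
  · subst h4; rw [add_comm (wt c), add_comm (wt a)]; exact lie_rootElt_aux v hab.symm hcd.symm
  have hn : 4 ≤ ∑ i, (wt a + wt b + (wt c + wt d)) i * (wt a + wt b + (wt c + wt d)) i := by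
    rw [sum_add_mul_self, nα, nβ]
    have : ∑ i, (wt a + wt b) i * (wt c + wt d) i = ∑ i, wt a i * wt c i
        + ∑ i, wt b i * wt c i + ∑ i, wt a i * wt d i + ∑ i, wt b i * wt d i := by
      simp only [← Finset.sum_add_distrib, Pi.add_apply]
      exact Finset.sum_congr rfl fun i _ => by ring
    rw [this]
    linarith [sum_wt_mul_wt_nonneg h1, sum_wt_mul_wt_nonneg h2, sum_wt_mul_wt_nonneg h3,
      sum_wt_mul_wt_nonneg h4]
  refine ⟨fun h => by rw [h] at hn; simp at hn, fun _ => ?_⟩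
  have h0 : ¬IsRoot (wt a + wt b + (wt c + wt d)) := fun h => by
    have := h.sum_mul_self
    omega
  rw [rootElt_of_not v h0, smul_zero,
    rootElt_wt v hab, rootElt_wt v hcd, smul_lie, lie_smul,
    lie_sigma_unitVec_of_ne v h1 h2 h3 h4, smul_zero, smul_zero]

theorem lie_cartan_rootElt (i : Fin l) (α : Fin l → ℤ) :
    ⁅cartan v i, rootElt v α⁆ = ((α i : ℤ) : k) • rootElt v α := by
  by_cases h : IsRoot α
  · obtain ⟨a, b, hab, rfl⟩ := h
    rw [rootElt_wt v hab, lie_smul, lie_cartan_sigma, smul_comm, Pi.add_apply, Int.cast_add]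
  · rw [rootElt_of_not v h, lie_zero, smul_zero]

/-- The product of two weight vectors of the half-spin module. -/
theorem oddBracket_plusVec (h2 : (2 : k) ≠ 0) {μ ν : Fin l → ℤ}
    (hμ : IsIndicator μ) (hν : IsIndicator ν) (eμ : Even (∑ i, μ i)) (eν : Even (∑ i, ν i))
    (h0 : μ + ν - 1 ≠ 0) :
    oddBracket v (plusVec v μ) (plusVec v ν)
      = sgn k (lowForm (μ + ν - 1) μ + lowForm (1 - ν) 1 + 1) • rootElt v (μ + ν - 1) := by
  by_cases h : IsRoot (μ + ν - 1)
  · obtain ⟨a, b, hab, e⟩ := h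
    rw [oddBracket_plusVec_of_root v h2 hab hμ hν eμ eν e, e, rootElt_wt v hab, smul_smul,
      mul_neg, ← sgn_add]
    congr 1
    rw [neg_inj]
    refine sgn_congr ?_
    have := odd_lowForm_wt hab
    grind
  · rw [rootElt_of_not v h, smul_zero]
    refine oddBracket_plusVec_eq_zero v h2 hμ hν eμ eν (fun e => h0 (by rw [e, sub_self])) ?_
    exact fun a b hab e => h ⟨a, b, hab, e⟩

end RootElements

end TypeD

namespace TypeD

/-! ### The lattice E₈ as the union of D₈ and a half-spin coset -/

section LatticeE8

/-- The coordinates, in terms of the orthonormal vectors, of the element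
`n₀ (2 α₁) + n₁ α₂ + ⋯ + n₇ α₈` of the lattice of type `D₈` inside the lattice of type `E₈`. -/
def dCoord {R : Type*} [Ring R] (n : Fin 8 → R) : Fin 8 → R :=
  ![n 0 + n 1 - n 2, -n 0 + n 1 + n 2 - n 3, -n 0 + n 3 - n 4, -n 0 + n 4 - n 5,
    -n 0 + n 5 - n 6, -n 0 + n 6 - n 7, -n 0 + n 7, n 0]

/-- The weight of the half-spin module that belongs to the element
`(2 n₀ + 1) α₁ + n₁ α₂ + ⋯ + n₇ α₈` of the lattice of type `E₈`. -/
def spinCoord (n : Fin 8 → ℤ) : Fin 8 → ℤ :=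
  ![n 0 + n 1 - n 2 + 1, -n 0 + n 1 + n 2 - n 3, -n 0 + n 3 - n 4, -n 0 + n 4 - n 5,
    -n 0 + n 5 - n 6, -n 0 + n 6 - n 7, -n 0 + n 7, n 0 + 1]

/-- The element `2 n₀ α₁ + n₁ α₂ + ⋯ + n₇ α₈` of the lattice of type `E₈`. -/
def evenPoint (n : Fin 8 → ℤ) : Fin 8 → ℤ := ![2 * n 0, n 1, n 2, n 3, n 4, n 5, n 6, n 7]

/-- The element `(2 n₀ + 1) α₁ + n₁ α₂ + ⋯ + n₇ α₈` of the lattice of type `E₈`. -/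
def oddPoint (n : Fin 8 → ℤ) : Fin 8 → ℤ := ![2 * n 0 + 1, n 1, n 2, n 3, n 4, n 5, n 6, n 7]

def halfFirst (x : Fin 8 → ℤ) : Fin 8 → ℤ := ![x 0 / 2, x 1, x 2, x 3, x 4, x 5, x 6, x 7]

theorem halfFirst_evenPoint (n : Fin 8 → ℤ) : halfFirst (evenPoint n) = n := by
  funext i; fin_cases i <;> simp [halfFirst, evenPoint]

theorem halfFirst_oddPoint (n : Fin 8 → ℤ) : halfFirst (oddPoint n) = n := by
  funext i; fin_cases i <;> simp [halfFirst, oddPoint]; omega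

theorem evenPoint_halfFirst {x : Fin 8 → ℤ} (h : Even (x 0)) : evenPoint (halfFirst x) = x := by
  funext i; fin_cases i <;> simp [halfFirst, evenPoint]; grind

theorem oddPoint_halfFirst {x : Fin 8 → ℤ} (h : ¬Even (x 0)) : oddPoint (halfFirst x) = x := by
  funext i; fin_cases i <;> simp [halfFirst, oddPoint]; grind

theorem latticeForm_E8 (x y : Fin 8 → ℤ) : latticeForm CartanMatrix.E₈ x y
    = 2 * (x 0 * y 0 + x 1 * y 1 + x 2 * y 2 + x 3 * y 3 + x 4 * y 4 + x 5 * y 5 + x 6 * y 6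
      + x 7 * y 7) - (x 0 * y 2 + x 2 * y 0 + x 1 * y 3 + x 3 * y 1 + x 2 * y 3 + x 3 * y 2
      + x 3 * y 4 + x 4 * y 3 + x 4 * y 5 + x 5 * y 4 + x 5 * y 6 + x 6 * y 5
      + x 6 * y 7 + x 7 * y 6) := by
  simp [latticeForm, Fin.sum_univ_eight, CartanMatrix.E₈]
  ring

theorem cocycleExponent_E8 (x y : Fin 8 → ℤ) : cocycleExponent CartanMatrix.E₈ x y
    = x 0 * y 0 + x 1 * y 1 + x 2 * y 2 + x 3 * y 3 + x 4 * y 4 + x 5 * y 5 + x 6 * y 6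
      + x 7 * y 7 - (x 2 * y 0 + x 3 * y 1 + x 3 * y 2
      + x 4 * y 3 + x 5 * y 4 + x 6 * y 5 + x 7 * y 6) := by
  simp [cocycleExponent, Fin.sum_univ_eight, CartanMatrix.E₈]
  ring

theorem lowForm_eight (a b : Fin 8 → ℤ) : lowForm a b
    = a 1 * b 0 + a 2 * (b 0 + b 1) + a 3 * (b 0 + b 1 + b 2) + a 4 * (b 0 + b 1 + b 2 + b 3)
      + a 5 * (b 0 + b 1 + b 2 + b 3 + b 4) + a 6 * (b 0 + b 1 + b 2 + b 3 + b 4 + b 5)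
      + a 7 * (b 0 + b 1 + b 2 + b 3 + b 4 + b 5 + b 6) := by
  simp [lowForm, Fin.sum_univ_eight]
  ring

/-- The exponent of the sign of the root vector of `evenPoint n`. -/
def signEven (n : Fin 8 → ℤ) : ℤ :=
  n 0 * (n 1 + n 2 + n 3 + n 4 + n 5 + n 6 + n 7) + n 1 * n 2 + n 0

/-- The exponent of the sign of the root vector of `oddPoint n`. -/
def signOdd (n : Fin 8 → ℤ) : ℤ :=
  n 0 * (n 1 + n 2 + n 3 + n 4 + n 5 + n 6 + n 7) + n 1 * n 2 + n 1

/-- The simple roots are α₁ = ½(ε₁ + ε₈ - ε₂ - … - ε₇), α₂ = ε₁ + ε₂ and α_i = ε_{i-1} - ε_{i-2} for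
i ≥ 3. All points with an even coefficient of α₁ are integral, and the lattice form is the standard
one. -/
theorem latticeForm_evenPoint (n : Fin 8 → ℤ) :
    latticeForm CartanMatrix.E₈ (evenPoint n) (evenPoint n) = ∑ i, dCoord n i * dCoord n i := by
  simp only [latticeForm_E8, evenPoint, dCoord, Fin.sum_univ_eight, Matrix.cons_val]
  ring

/-- The weight label is the lattice vector shifted by ½(1,…,1), and the sum of (μ_i - ½)² over eight
coordinates is ∑ (μ_i² - μ_i) + 2. -/
theorem latticeForm_oddPoint (n : Fin 8 → ℤ) :
    latticeForm CartanMatrix.E₈ (oddPoint n) (oddPoint n)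
      = ∑ i, (spinCoord n i * spinCoord n i - spinCoord n i) + 2 := by
  simp only [latticeForm_E8, oddPoint, spinCoord, Fin.sum_univ_eight, Matrix.cons_val]
  ring

theorem even_sum_spinCoord (n : Fin 8 → ℤ) : Even (∑ i, spinCoord n i) :=
  ⟨1 - 2 * n 0 + n 1, by
    simp only [spinCoord, Fin.sum_univ_eight, Matrix.cons_val]
    ring⟩

theorem evenPoint_add (n m : Fin 8 → ℤ) : evenPoint n + evenPoint m = evenPoint (n + m) := by
  funext i; fin_cases i <;> simp [evenPoint]; ring

theorem evenPoint_add_oddPoint (n m : Fin 8 → ℤ) :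
    evenPoint n + oddPoint m = oddPoint (n + m) := by
  funext i; fin_cases i <;> simp [evenPoint, oddPoint]; ring

theorem oddPoint_add (n m : Fin 8 → ℤ) :
    oddPoint n + oddPoint m = evenPoint (n + m + Pi.single 0 1) := by
  funext i; fin_cases i <;> simp [evenPoint, oddPoint]; ring

theorem dCoord_add (n m : Fin 8 → ℤ) : dCoord n + dCoord m = dCoord (n + m) := by
  funext i; fin_cases i <;> simp [dCoord] <;> ring

theorem spinCoord_add_dCoord (n m : Fin 8 → ℤ) :
    spinCoord m + dCoord n = spinCoord (n + m) := by
  funext i; fin_cases i <;> simp [dCoord, spinCoord] <;> ring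

theorem spinCoord_add_sub_one (n m : Fin 8 → ℤ) :
    spinCoord n + spinCoord m - 1 = dCoord (n + m + Pi.single 0 1) := by
  funext i; fin_cases i <;> simp [dCoord, spinCoord] <;> ring

/-- On D₈ the two cocycles, of `lowForm` and of the Chevalley algebra, differ by a coboundary;
`signEven` is the quadratic function modulo 2 whose polarization is their difference. The witness is
half of the polynomial in question. -/
theorem sign_even_even (n m : Fin 8 → ℤ) :
    Even (signEven n + signEven m + lowForm (dCoord n) (dCoord m)
      + (cocycleExponent CartanMatrix.E₈ (evenPoint n) (evenPoint m) + signEven (n + m))) :=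
  ⟨m 0 + m 0*m 1 + m 0*m 2 + m 0*m 3 + m 0*m 4 + m 0*m 5 + m 0*m 6 + m 0*m 7 + 4*m
      0*n 0 + m 0*n 1 + m 1*m 2 - 4*m 1*n 0 + m 1*n 1 + m 1*n 2 + m 2*n 0 + m 3*n 0 + m
      4*n 0 + m 5*n 0 + m 6*n 0 + m 7*n 0 + n 0 + n 0*n 1 + n 0*n 2 + n 0*n 3 + n 0*n 4
      + n 0*n 5 + n 0*n 6 + n 0*n 7 + n 1*n 2, by
    simp only [signEven, lowForm_eight, cocycleExponent_E8, dCoord, evenPoint, Pi.add_apply,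
      Matrix.cons_val]
    ring⟩

theorem sign_even_odd (n m : Fin 8 → ℤ) :
    Even (signEven n + signOdd m + lowForm (dCoord n) (spinCoord m)
      + (cocycleExponent CartanMatrix.E₈ (evenPoint n) (oddPoint m) + signOdd (n + m))) :=
  ⟨m 0*m 1 + m 0*m 2 + m 0*m 3 + m 0*m 4 + m 0*m 5 + m 0*m 6 + m 0*m 7 + 4*m 0*n 0 +
      m 0*n 1 + m 1 + m 1*m 2 - 4*m 1*n 0 + m 1*n 1 + m 1*n 2 + m 2*n 0 + m 3*n 0 + m
      4*n 0 + m 5*n 0 + m 6*n 0 + m 7*n 0 - n 0 + n 0*n 1 + n 0*n 2 + n 0*n 3 + n 0*n 4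
      + n 0*n 5 + n 0*n 6 + n 0*n 7 + n 1 + n 1*n 2, by
    simp only [signEven, signOdd, lowForm_eight, cocycleExponent_E8, dCoord, spinCoord, evenPoint,
      oddPoint, Pi.add_apply, Matrix.cons_val]
    ring⟩

/-- The exponent for two weight vectors is not bilinear, and the comparison uses that the first
point is a root and that the inner product is -1, as it must be when the sum of two roots is a root.
-/
theorem sign_odd_odd {n m : Fin 8 → ℤ}
    (hn : latticeForm CartanMatrix.E₈ (oddPoint n) (oddPoint n) = 2)
    (hnm : latticeForm CartanMatrix.E₈ (oddPoint n) (oddPoint m) = -1) :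
    Even (signOdd n + signOdd m + (lowForm (spinCoord n + spinCoord m - 1) (spinCoord n)
        + lowForm (1 - spinCoord m) 1 + 1)
      + (cocycleExponent CartanMatrix.E₈ (oddPoint n) (oddPoint m)
        + signEven (n + m + Pi.single 0 1))) :=
  ⟨8 + 4*m 0 + m 0*m 1 + m 0*m 2 + m 0*m 3 + m 0*m 4 + m 0*m 5 + m 0*m 6 + m 0*m 7 -
      4*m 0*n 1 + m 0*n 2 + m 0*n 3 + m 0*n 4 + m 0*n 5 + m 0*n 6 + m 0*n 7 + m 1 + m
      1*m 2 + m 1*n 0 + m 2 + 2*m 2*n 0 + m 2*n 1 - m 2*n 2 + m 3*n 1 + m 3*n 2 - m 3*n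
      3 + m 4*n 3 - m 4*n 4 + m 5*n 4 - m 5*n 5 + m 6*n 5 - m 6*n 6 + m 7*n 6 - m 7*n 7
      - 3*n 0 - 3*n 0*n 1 + 3*n 0*n 2 + n 0*n 3 + n 0*n 4 + n 0*n 5 + n 0*n 6 + n 0*n 7
      - 3*n 1 + n 1*n 2 + n 1*n 3 + 2*n 2 - n 2*n 2 + n 2*n 3 + n 3 - n 3*n 3 + n 3*n 4
      + n 4 - n 4*n 4 + n 4*n 5 + n 5 - n 5*n 5 + n 5*n 6 + n 6 - n 6*n 6 + n 6*n 7 + n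
      7 - n 7*n 7, by
    simp only [latticeForm_E8, oddPoint, Matrix.cons_val] at hn hnm
    -- The identity needs half of `hn`, so it is doubled to stay in the integers.
    refine mul_left_cancel₀ (two_ne_zero (α := ℤ)) ?_
    simp only [signEven, signOdd, lowForm_eight, cocycleExponent_E8, spinCoord, oddPoint,
      Pi.add_apply, Pi.sub_apply, Pi.one_apply, Pi.single_eq_same, Pi.single_apply, Fin.reduceEq,
      if_false, Matrix.cons_val]
    linear_combination hn + 2 * hnm⟩

/-- Odd parity produces the minus sign in [e_α, e_{-α}] = -α. -/
theorem sign_odd_opp {n m : Fin 8 → ℤ} (h : n + m + Pi.single 0 1 = 0) :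
    Odd (signOdd n + signOdd m + lowForm (spinCoord n) 1) := by
  have hm : m = -n - Pi.single 0 1 := by linear_combination h
  refine ⟨4 - 7*n 0 + n 0*n 1 + n 0*n 2 + n 0*n 3 + n 0*n 4 + n 0*n 5 + n 0*n 6 + n 0*n 7 +
      n 1 + n 1*n 2 + n 2 + n 3 + n 4 + n 5 + n 6 + n 7 - 1, ?_⟩
  rw [hm]
  simp only [signOdd, lowForm_eight, spinCoord, Pi.neg_apply, Pi.sub_apply, Pi.one_apply,
    Pi.single_eq_same, Pi.single_apply, Fin.reduceEq, if_false, Matrix.cons_val]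
  ring

theorem signEven_neg (n : Fin 8 → ℤ) : Even (signEven n + signEven (-n)) :=
  ⟨n 0 * (n 1 + n 2 + n 3 + n 4 + n 5 + n 6 + n 7) + n 1 * n 2, by
    simp only [signEven, Pi.neg_apply]
    ring⟩

theorem latticeForm_E8_add (x y : Fin 8 → ℤ) : latticeForm CartanMatrix.E₈ (x + y) (x + y)
    = latticeForm CartanMatrix.E₈ x x + 2 * latticeForm CartanMatrix.E₈ x y
      + latticeForm CartanMatrix.E₈ y y := by
  simp only [latticeForm_E8, Pi.add_apply]
  ring

theorem cocycleExponent_E8_add_swap (x y : Fin 8 → ℤ) :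
    cocycleExponent CartanMatrix.E₈ x y + cocycleExponent CartanMatrix.E₈ y x
      = latticeForm CartanMatrix.E₈ x y := by
  simp only [latticeForm_E8, cocycleExponent_E8]
  ring

end LatticeE8

end TypeD

namespace Z2Algebra

variable {k E O : Type*} [CommRing k] [AddCommGroup E] [Module k E] [AddCommGroup O] [Module k O]

/-- The multiplication as a bilinear map. -/
def mulHom (G : Z2Algebra k E O) : (E × O) →ₗ[k] (E × O) →ₗ[k] (E × O) :=
  LinearMap.mk₂ k G.mul
    (fun x y z => by
      ext <;> simp only [mul, Prod.fst_add, Prod.snd_add, map_add, LinearMap.add_apply] <;> abel)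
    (fun r x y => by
      ext <;> simp only [mul, Prod.smul_fst, Prod.smul_snd, map_smul, LinearMap.smul_apply,
        smul_add])
    (fun x y z => by
      ext <;> simp only [mul, Prod.fst_add, Prod.snd_add, map_add] <;> abel)
    (fun r x y => by
      ext <;> simp only [mul, Prod.smul_fst, Prod.smul_snd, map_smul, smul_add])

theorem mulHom_apply (G : Z2Algebra k E O) (x y : E × O) : G.mulHom x y = G.mul x y := rfl

end Z2Algebra

/-! ### Linear maps out of a Chevalley algebra -/

namespace ChevalleyAlgebra

variable {k : Type*} [CommRing k] {n : ℕ} {A : Matrix (Fin n) (Fin n) ℤ}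
  {G : Type*} [AddCommGroup G] [Module k G]

/-- The linear map on the Chevalley algebra with given values on the Cartan subalgebra and on the
root vectors. -/
noncomputable def toModule (c : (Fin n → k) →ₗ[k] G) (r : LatticeRoot A → G) :
    ChevalleyAlgebra A k →ₗ[k] G :=
  LinearMap.coprod (M := Fin n → k) (M₂ := LatticeRoot A →₀ k) c (Finsupp.linearCombination k r)

theorem toModule_apply (c : (Fin n → k) →ₗ[k] G) (r : LatticeRoot A → G)
    (x : ChevalleyAlgebra A k) :
    toModule c r x = c x.1 + Finsupp.linearCombination k r x.2 := rfl

theorem toModule_cartan (c : (Fin n → k) →ₗ[k] G) (r : LatticeRoot A → G) (h : Fin n → k) :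
    toModule c r (h, 0) = c h := by
  change c h + Finsupp.linearCombination k r 0 = c h
  rw [map_zero, add_zero]

theorem toModule_rootVector (c : (Fin n → k) →ₗ[k] G) (r : LatticeRoot A → G)
    (α : LatticeRoot A) : toModule c r (rootVector α) = r α := by
  rw [toModule_apply, rootVector, map_zero, zero_add, Finsupp.linearCombination_single, one_smul]

theorem toModule_bracket (c : (Fin n → k) →ₗ[k] G) (r : LatticeRoot A → G)
    (B : G →ₗ[k] G →ₗ[k] G) (h₁ : ∀ h h', B (c h) (c h') = 0)
    (h₂ : ∀ h α, B (c h) (r α) = rootEval α h • r α)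
    (h₃ : ∀ h α, B (r α) (c h) = -(rootEval α h • r α))
    (h₄ : ∀ α β, B (r α) (r β) = toModule c r (rootBracket α β)) (x y : ChevalleyAlgebra A k) :
    toModule c r ⁅x, y⁆ = B (toModule c r x) (toModule c r y) := by
  have e : ⁅x, y⁆ = (y.2.sum fun β b => (rootEval β x.1 * b) • rootVector β)
      - (x.2.sum fun α a => (rootEval α y.1 * a) • rootVector α)
      + x.2.sum fun α a => y.2.sum fun β b => (a * b) • rootBracket α β := rfl
  rw [e, toModule_apply c r x, toModule_apply c r y]
  simp only [Finsupp.sum, map_add, map_sub, map_sum, map_smul, toModule_rootVector,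
    Finsupp.linearCombination_apply, LinearMap.add_apply, LinearMap.sum_apply,
    LinearMap.smul_apply, h₁, h₂, h₃, ← h₄, zero_add, smul_neg, Finset.sum_neg_distrib, smul_smul,
    Finset.smul_sum, smul_add, Finset.sum_add_distrib]
  rw [Finset.sum_comm]
  simp only [mul_comm]
  abel

/-- Anticommutativity of the target supplies the products with the Cartan element on the right. -/
theorem toModule_bracket_of_isLieAlgebra {E O : Type*} [AddCommGroup E] [Module k E]
    [AddCommGroup O] [Module k O] {G : Z2Algebra k E O} (hG : G.IsLieAlgebra)
    (c : (Fin n → k) →ₗ[k] E × O) (r : LatticeRoot A → E × O)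
    (h₁ : ∀ h h', G.mul (c h) (c h') = 0)
    (h₂ : ∀ h α, G.mul (c h) (r α) = rootEval α h • r α)
    (h₃ : ∀ α β, G.mul (r α) (r β) = toModule c r (rootBracket α β)) (x y : ChevalleyAlgebra A k) :
    toModule c r ⁅x, y⁆ = G.mul (toModule c r x) (toModule c r y) := by
  have hanti : ∀ x y, G.mul x y = -G.mul y x := by
    intro x y
    have e := hG.mul_self (x + y)
    rw [← Z2Algebra.mulHom_apply] at e
    simp only [map_add, LinearMap.add_apply, Z2Algebra.mulHom_apply, hG.mul_self, zero_add,
      add_zero] at e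
    exact eq_neg_of_add_eq_zero_right e
  refine toModule_bracket c r G.mulHom h₁ h₂ (fun h α => ?_) h₃ x y
  rw [Z2Algebra.mulHom_apply, hanti, h₂]

theorem toModule_rootBracket_opp (c : (Fin n → k) →ₗ[k] G) (r : LatticeRoot A → G)
    {α β : LatticeRoot A} (h : α.1 + β.1 = 0) :
    toModule c r (rootBracket α β) = c fun i => -(α.1 i : k) := by
  have e : rootBracket α β = ((fun i => -(α.1 i : k), 0) : ChevalleyAlgebra A k) := if_pos h
  rw [e]
  exact toModule_cartan c r _

theorem toModule_rootBracket_of_root (c : (Fin n → k) →ₗ[k] G) (r : LatticeRoot A → G)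
    {α β : LatticeRoot A} (h : α.1 + β.1 ≠ 0)
    (h' : latticeForm A (α.1 + β.1) (α.1 + β.1) = 2) :
    toModule c r (rootBracket α β)
      = (((cocycleExponent A α.1 β.1).negOnePow : ℤ) : k) • r ⟨α.1 + β.1, h'⟩ := by
  have e : rootBracket α β = (((cocycleExponent A α.1 β.1).negOnePow : ℤ) : k)
      • rootVector ⟨α.1 + β.1, h'⟩ := (if_neg h).trans (dif_pos h')
  rw [e, map_smul, toModule_rootVector]

theorem toModule_rootBracket_of_not (c : (Fin n → k) →ₗ[k] G) (r : LatticeRoot A → G)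
    {α β : LatticeRoot A} (h : α.1 + β.1 ≠ 0)
    (h' : latticeForm A (α.1 + β.1) (α.1 + β.1) ≠ 2) :
    toModule c r (rootBracket α β) = 0 := by
  have e : rootBracket α β = (0 : ChevalleyAlgebra A k) := (if_neg h).trans (dif_neg h')
  rw [e, map_zero]

/-- The functionals isolate the coefficient of each root vector; when all of these vanish, only the
Cartan part is left. -/
theorem toModule_injective (c : (Fin n → k) →ₗ[k] G) (r : LatticeRoot A → G) [NoZeroDivisors k]
    (hc : Function.Injective c)
    (h : ∀ α, ∃ F : G →ₗ[k] k, (∀ h, F (c h) = 0) ∧ (∀ β, β ≠ α → F (r β) = 0) ∧ F (r α) ≠ 0) :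
    Function.Injective (toModule c r) := by
  rw [injective_iff_map_eq_zero]
  intro x hx
  have h2 : x.2 = 0 := by
    ext α
    obtain ⟨F, hF, hF0, hF1⟩ := h α
    have := congrArg F hx
    rw [toModule_apply, map_add, hF, zero_add, Finsupp.linearCombination_apply, Finsupp.sum,
      map_sum, map_zero, Finset.sum_eq_single α
        (fun β _ hβ => by rw [map_smul, hF0 β hβ, smul_zero])
        (fun hα => by rw [Finsupp.notMem_support_iff.1 hα, zero_smul, map_zero]),
      map_smul, smul_eq_mul] at this
    exact (mul_eq_zero.1 this).resolve_right hF1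
  rw [toModule_apply, h2, map_zero, add_zero, ← map_zero c] at hx
  exact Prod.ext (hc hx) h2

end ChevalleyAlgebra

namespace TypeD

/-! ### Root vectors of E₈ in so₁₆ ⊕ S⁺ -/

section RootVectorsE8

variable {k V : Type*} [Field k] [AddCommGroup V] [Module k V] (v : Module.Basis (Fin 8) k V)

/-- The vector of `so(V ⊕ V*) ⊕ S⁺` that belongs to the point `x` of the lattice of type `E₈`;
it is zero if `x` is not a root. -/
noncomputable def rootVec (x : Fin 8 → ℤ) : So k V × SPlus k V :=
  if Even (x 0) then (sgn k (signEven (halfFirst x)) • rootElt v (dCoord (halfFirst x)), 0)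
  else (0, sgn k (signOdd (halfFirst x)) • plusVec v (spinCoord (halfFirst x)))

theorem rootVec_evenPoint (n : Fin 8 → ℤ) :
    rootVec v (evenPoint n) = (sgn k (signEven n) • rootElt v (dCoord n), 0) := by
  rw [rootVec, if_pos (by simp [evenPoint]), halfFirst_evenPoint]

theorem rootVec_oddPoint (n : Fin 8 → ℤ) :
    rootVec v (oddPoint n) = (0, sgn k (signOdd n) • plusVec v (spinCoord n)) := by
  rw [rootVec, if_neg (by simp [oddPoint]), halfFirst_oddPoint]

theorem exists_point (x : Fin 8 → ℤ) : ∃ n, x = evenPoint n ∨ x = oddPoint n := by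
  by_cases h : Even (x 0)
  · exact ⟨_, Or.inl (evenPoint_halfFirst h).symm⟩
  · exact ⟨_, Or.inr (oddPoint_halfFirst h).symm⟩

theorem isRoot_dCoord {n : Fin 8 → ℤ} :
    IsRoot (dCoord n) ↔ latticeForm CartanMatrix.E₈ (evenPoint n) (evenPoint n) = 2 := by
  rw [isRoot_iff, latticeForm_evenPoint]

theorem isIndicator_spinCoord {n : Fin 8 → ℤ} :
    IsIndicator (spinCoord n) ↔ latticeForm CartanMatrix.E₈ (oddPoint n) (oddPoint n) = 2 := by
  rw [isIndicator_iff_sum, latticeForm_oddPoint, add_eq_right]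

/-- With this convention the product formula for root vectors need not distinguish whether a nonzero
sum is a root. -/
theorem rootVec_of_ne {x : Fin 8 → ℤ} (h : latticeForm CartanMatrix.E₈ x x ≠ 2) :
    rootVec v x = 0 := by
  obtain ⟨n, rfl | rfl⟩ := exists_point x
  · rw [rootVec_evenPoint, rootElt_of_not v (mt isRoot_dCoord.1 h), smul_zero]; rfl
  · rw [rootVec_oddPoint, plusVec_of_not v (mt isIndicator_spinCoord.1 h), smul_zero]; rfl

/-- The map from the Cartan subalgebra of `E₈` to the one of `so(V ⊕ V*)`. -/
noncomputable def cartanMap : (Fin 8 → k) →ₗ[k] So k V where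
  -- `dCoord` counts multiples of 2α₁, so the coefficient of α₁ is halved.
  toFun h := ∑ i, dCoord ![h 0 / 2, h 1, h 2, h 3, h 4, h 5, h 6, h 7] i • cartan v i
  map_add' h h' := by
    rw [← Finset.sum_add_distrib]
    refine Finset.sum_congr rfl fun i _ => ?_
    rw [← add_smul]
    congr 1
    fin_cases i <;> simp [dCoord] <;> ring
  map_smul' c h := by
    rw [RingHom.id_apply, Finset.smul_sum]
    refine Finset.sum_congr rfl fun i _ => ?_
    rw [smul_smul]
    congr 1
    fin_cases i <;> simp [dCoord] <;> ring

theorem cartanMap_apply (h : Fin 8 → k) : cartanMap v h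
    = ∑ i, dCoord ![h 0 / 2, h 1, h 2, h 3, h 4, h 5, h 6, h 7] i • cartan v i := rfl

theorem cartanMap_neg_evenPoint (h2 : (2 : k) ≠ 0) (n : Fin 8 → ℤ) :
    cartanMap v (fun i => -((evenPoint n i : ℤ) : k)) = -∑ i, ((dCoord n i : ℤ) : k) • cartan v i := by
  rw [cartanMap_apply, ← Finset.sum_neg_distrib]
  refine Finset.sum_congr rfl fun i _ => ?_
  rw [← neg_smul]
  congr 1
  fin_cases i <;> simp [dCoord, evenPoint] <;> field_simp <;> ring

theorem cartanMap_neg_oddPoint (h2 : (2 : k) ≠ 0) (n : Fin 8 → ℤ) :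
    cartanMap v (fun i => -((oddPoint n i : ℤ) : k))
      = -∑ i, (((spinCoord n i : ℤ) : k) - 1 / 2) • cartan v i := by
  rw [cartanMap_apply, ← Finset.sum_neg_distrib]
  refine Finset.sum_congr rfl fun i _ => ?_
  rw [← neg_smul]
  congr 1
  fin_cases i <;> simp [dCoord, oddPoint, spinCoord] <;> field_simp <;> ring

theorem rootEval_E8 (α : LatticeRoot CartanMatrix.E₈) (h : Fin 8 → k) :
    ChevalleyAlgebra.rootEval α h
    = 2 * (α.1 0 * h 0 + α.1 1 * h 1 + α.1 2 * h 2 + α.1 3 * h 3 + α.1 4 * h 4 + α.1 5 * h 5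
      + α.1 6 * h 6 + α.1 7 * h 7) - (α.1 0 * h 2 + α.1 2 * h 0 + α.1 1 * h 3 + α.1 3 * h 1
      + α.1 2 * h 3 + α.1 3 * h 2 + α.1 3 * h 4 + α.1 4 * h 3 + α.1 4 * h 5 + α.1 5 * h 4
      + α.1 5 * h 6 + α.1 6 * h 5 + α.1 6 * h 7 + α.1 7 * h 6) := by
  simp [ChevalleyAlgebra.rootEval, Fin.sum_univ_eight, CartanMatrix.E₈]
  ring

theorem lie_cartanMap_rootElt (h : Fin 8 → k) (α : Fin 8 → ℤ) :
    ⁅cartanMap v h, rootElt v α⁆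
      = (∑ i, dCoord ![h 0 / 2, h 1, h 2, h 3, h 4, h 5, h 6, h 7] i * ((α i : ℤ) : k))
        • rootElt v α := by
  rw [cartanMap_apply, sum_lie, Finset.sum_smul]
  refine Finset.sum_congr rfl fun i _ => ?_
  rw [smul_lie, lie_cartan_rootElt, smul_smul]

theorem halfSpin_cartanMap (h2 : (2 : k) ≠ 0) (h : Fin 8 → k) {μ : Fin 8 → ℤ}
    (hμ : IsIndicator μ) (he : Even (∑ i, μ i)) :
    halfSpin v (cartanMap v h) (plusVec v μ)
      = (∑ i, dCoord ![h 0 / 2, h 1, h 2, h 3, h 4, h 5, h 6, h 7] i * (((μ i : ℤ) : k) - 1 / 2))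
        • plusVec v μ := by
  rw [cartanMap_apply, map_sum, LinearMap.sum_apply, Finset.sum_smul]
  refine Finset.sum_congr rfl fun i _ => ?_
  rw [halfSpin_smul, halfSpin_cartan v h2 i hμ he, smul_smul]

theorem cartanMap_mul_rootVec (h2 : (2 : k) ≠ 0) (h : Fin 8 → k)
    (α : LatticeRoot CartanMatrix.E₈) :
    (algebra v).mul (cartanMap v h, 0) (rootVec v α.1)
      = ChevalleyAlgebra.rootEval α h • rootVec v α.1 := by
  obtain ⟨x, hx⟩ := α
  rw [rootEval_E8, algebra, Z2Algebra.ofAction_mul]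
  obtain ⟨n, rfl | rfl⟩ := exists_point x
  · rw [rootVec_evenPoint, map_zero, map_zero, map_zero, add_zero, sub_zero, lie_smul,
      lie_cartanMap_rootElt, smul_comm, Prod.smul_mk, smul_zero]
    congr 2
    simp [Fin.sum_univ_eight, dCoord, evenPoint]
    field_simp
    ring
  · rw [rootVec_oddPoint, map_zero, map_zero, LinearMap.zero_apply, lie_zero, add_zero, sub_zero,
      map_smul, halfSpin_cartanMap v h2 h (isIndicator_spinCoord.2 hx) (even_sum_spinCoord n),
      smul_comm, Prod.smul_mk, smul_zero]
    congr 2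
    simp [Fin.sum_univ_eight, dCoord, spinCoord, oddPoint]
    field_simp
    ring

theorem dCoord_eq_zero {R : Type*} [CommRing R] [NoZeroDivisors R] (h2 : (2 : R) ≠ 0)
    {n : Fin 8 → R} (h : dCoord n = 0) : n = 0 := by
  have h0 := congrFun h 0
  have h1 := congrFun h 1
  have h2' := congrFun h 2
  have h3 := congrFun h 3
  have h4 := congrFun h 4
  have h5 := congrFun h 5
  have h6 := congrFun h 6
  have h7 := congrFun h 7
  simp only [dCoord, Matrix.cons_val, Pi.zero_apply] at h0 h1 h2' h3 h4 h5 h6 h7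
  have n7 : n 7 = 0 := by linear_combination h6 + h7
  have n6 : n 6 = 0 := by linear_combination h5 + h7 + n7
  have n5 : n 5 = 0 := by linear_combination h4 + h7 + n6
  have n4 : n 4 = 0 := by linear_combination h3 + h7 + n5
  have n3 : n 3 = 0 := by linear_combination h2' + h7 + n4
  have n1 : n 1 = 0 := by
    refine (mul_eq_zero.1 (?_ : 2 * n 1 = 0)).resolve_left h2
    linear_combination h0 + h1 + n3
  have n2 : n 2 = 0 := by linear_combination h7 + n1 - h0
  funext i
  fin_cases i <;> assumption

theorem dCoord_zero {R : Type*} [Ring R] : dCoord (0 : Fin 8 → R) = 0 := by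
  funext i; fin_cases i <;> simp [dCoord]

theorem evenPoint_eq_zero {n : Fin 8 → ℤ} : evenPoint n = 0 ↔ n = 0 := by
  refine ⟨fun h => ?_, fun h => by rw [h]; funext i; fin_cases i <;> rfl⟩
  rw [← halfFirst_evenPoint n, h]; funext i; fin_cases i <;> rfl

theorem dCoord_ne_zero {n : Fin 8 → ℤ} (h : n ≠ 0) : dCoord n ≠ 0 :=
  mt (dCoord_eq_zero two_ne_zero) h

theorem rootVec_mul_even_even {n m : Fin 8 → ℤ}
    (hn : latticeForm CartanMatrix.E₈ (evenPoint n) (evenPoint n) = 2)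
    (hm : latticeForm CartanMatrix.E₈ (evenPoint m) (evenPoint m) = 2) (h2 : (2 : k) ≠ 0) :
    (evenPoint n + evenPoint m = 0 → (algebra v).mul (rootVec v (evenPoint n))
        (rootVec v (evenPoint m)) = (cartanMap v (fun i => -((evenPoint n i : ℤ) : k)), 0)) ∧
    (evenPoint n + evenPoint m ≠ 0 →
      (algebra v).mul (rootVec v (evenPoint n)) (rootVec v (evenPoint m))
        = sgn k (cocycleExponent CartanMatrix.E₈ (evenPoint n) (evenPoint m))
          • rootVec v (evenPoint n + evenPoint m)) := by
  obtain ⟨e0, e1⟩ := lie_rootElt v (isRoot_dCoord.2 hn) (isRoot_dCoord.2 hm)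
  rw [evenPoint_add, algebra, Z2Algebra.ofAction_mul, rootVec_evenPoint, rootVec_evenPoint,
    rootVec_evenPoint, map_zero, map_zero, map_zero, add_zero, sub_zero, smul_lie, lie_smul,
    smul_smul, ← sgn_add]
  rw [dCoord_add] at e0 e1
  rw [Ne, evenPoint_eq_zero]
  refine ⟨fun h => ?_, fun h => ?_⟩
  · obtain rfl : m = -n := by linear_combination h
    rw [e0 (by rw [h, dCoord_zero]), sgn_even (signEven_neg n), one_smul,
      cartanMap_neg_evenPoint v h2]
  · rw [e1 (dCoord_ne_zero h), smul_smul, ← sgn_add, Prod.smul_mk, smul_zero, smul_smul, ← sgn_add,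
      sgn_congr (sign_even_even n m)]

theorem rootVec_mul_even_odd {n m : Fin 8 → ℤ}
    (hn : latticeForm CartanMatrix.E₈ (evenPoint n) (evenPoint n) = 2)
    (hm : latticeForm CartanMatrix.E₈ (oddPoint m) (oddPoint m) = 2) (h2 : (2 : k) ≠ 0) :
    (algebra v).mul (rootVec v (evenPoint n)) (rootVec v (oddPoint m))
      = sgn k (cocycleExponent CartanMatrix.E₈ (evenPoint n) (oddPoint m))
        • rootVec v (evenPoint n + oddPoint m) := by
  rw [evenPoint_add_oddPoint, algebra, Z2Algebra.ofAction_mul, rootVec_evenPoint,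
    rootVec_oddPoint, rootVec_oddPoint, map_zero, map_zero, LinearMap.zero_apply, lie_zero,
    add_zero, sub_zero, map_smul, halfSpin_smul,
    halfSpin_rootElt v h2 (isRoot_dCoord.2 hn) (isIndicator_spinCoord.2 hm) (even_sum_spinCoord m),
    spinCoord_add_dCoord, Prod.smul_mk, smul_zero, smul_smul, smul_smul, smul_smul, ← sgn_add,
    ← sgn_add, ← sgn_add, ← sgn_congr (sign_even_odd n m), add_comm (signOdd m)]

/-- Exchanging the arguments gives -1 in the algebra. In the cocycle it gives (-1)^(x,y), which is
-1 when x + y is a root; otherwise both sides are 0. -/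
theorem rootVec_mul_odd_even {n m : Fin 8 → ℤ}
    (hn : latticeForm CartanMatrix.E₈ (oddPoint n) (oddPoint n) = 2)
    (hm : latticeForm CartanMatrix.E₈ (evenPoint m) (evenPoint m) = 2) (h2 : (2 : k) ≠ 0) :
    (algebra v).mul (rootVec v (oddPoint n)) (rootVec v (evenPoint m))
      = sgn k (cocycleExponent CartanMatrix.E₈ (oddPoint n) (evenPoint m))
        • rootVec v (oddPoint n + evenPoint m) := by
  have e : (algebra v).mul (rootVec v (oddPoint n)) (rootVec v (evenPoint m))
      = -(algebra v).mul (rootVec v (evenPoint m)) (rootVec v (oddPoint n)) := by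
    rw [algebra, Z2Algebra.ofAction_mul, Z2Algebra.ofAction_mul, rootVec_evenPoint,
      rootVec_oddPoint]
    simp only [map_zero, LinearMap.zero_apply, lie_zero, zero_lie, add_zero, sub_zero, zero_sub,
      Prod.neg_mk, neg_zero]
  rw [e, rootVec_mul_even_odd v hm hn h2, add_comm (oddPoint n), ← neg_smul, neg_sgn]
  by_cases h : latticeForm CartanMatrix.E₈ (evenPoint m + oddPoint n)
      (evenPoint m + oddPoint n) = 2
  · rw [latticeForm_E8_add, hn, hm] at h
    have := cocycleExponent_E8_add_swap (evenPoint m) (oddPoint n)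
    rw [sgn_congr]
    exact ⟨0, by linarith⟩
  · rw [rootVec_of_ne v h, smul_zero, smul_zero]

/-- In weight labels the sum of two odd points is μ + ν - 1, because each label is shifted by
½(1,…,1); this is the weight of the odd product. -/
theorem rootVec_mul_odd_odd {n m : Fin 8 → ℤ}
    (hn : latticeForm CartanMatrix.E₈ (oddPoint n) (oddPoint n) = 2)
    (hm : latticeForm CartanMatrix.E₈ (oddPoint m) (oddPoint m) = 2) (h2 : (2 : k) ≠ 0) :
    (oddPoint n + oddPoint m = 0 → (algebra v).mul (rootVec v (oddPoint n))
        (rootVec v (oddPoint m)) = (cartanMap v (fun i => -((oddPoint n i : ℤ) : k)), 0)) ∧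
    (oddPoint n + oddPoint m ≠ 0 →
      (algebra v).mul (rootVec v (oddPoint n)) (rootVec v (oddPoint m))
        = sgn k (cocycleExponent CartanMatrix.E₈ (oddPoint n) (oddPoint m))
          • rootVec v (oddPoint n + oddPoint m)) := by
  have e := spinCoord_add_sub_one n m
  have hn' := isIndicator_spinCoord.2 hn
  have hm' := isIndicator_spinCoord.2 hm
  have en := even_sum_spinCoord n
  have em := even_sum_spinCoord m
  have hmul : (algebra v).mul (rootVec v (oddPoint n)) (rootVec v (oddPoint m))
      = (sgn k (signOdd n + signOdd m)
        • oddBracket v (plusVec v (spinCoord n)) (plusVec v (spinCoord m)), 0) := by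
    rw [algebra, Z2Algebra.ofAction_mul, rootVec_oddPoint, rootVec_oddPoint]
    simp only [map_zero, map_smul, LinearMap.zero_apply, LinearMap.smul_apply, lie_zero, zero_add,
      smul_zero, sub_self, smul_smul, ← sgn_add, add_comm (signOdd m)]
  have hz : oddPoint n + oddPoint m = 0 ↔ n + m + Pi.single 0 1 = 0 := by
    rw [oddPoint_add, evenPoint_eq_zero]
  rw [hmul]
  refine ⟨fun h => ?_, fun h => ?_⟩
  · rw [hz] at h
    rw [h, dCoord_zero, sub_eq_zero] at e
    rw [oddBracket_plusVec_opp v h2 hn' hm' en em e, smul_smul, ← sgn_add,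
      sgn_odd (sign_odd_opp h), cartanMap_neg_oddPoint v h2, neg_smul, one_smul]
  · have h0 : spinCoord n + spinCoord m - 1 ≠ 0 := by
      rw [e]
      exact dCoord_ne_zero (mt hz.2 h)
    rw [oddBracket_plusVec v h2 hn' hm' en em h0, smul_smul, ← sgn_add]
    by_cases hs : latticeForm CartanMatrix.E₈ (oddPoint n + oddPoint m)
      (oddPoint n + oddPoint m) = 2
    · have hnm : latticeForm CartanMatrix.E₈ (oddPoint n) (oddPoint m) = -1 := by
        rw [latticeForm_E8_add, hn, hm] at hs
        linarith
      rw [sgn_congr (sign_odd_odd hn hnm), oddPoint_add, rootVec_evenPoint, e, Prod.smul_mk,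
        smul_smul, ← sgn_add, smul_zero]
    · rw [rootVec_of_ne v hs, e, rootElt_of_not v, smul_zero, smul_zero]
      · rfl
      · rw [isRoot_dCoord, ← oddPoint_add]
        exact hs

theorem rootVec_mul_rootVec (h2 : (2 : k) ≠ 0) (α β : LatticeRoot CartanMatrix.E₈) :
    (α.1 + β.1 = 0 → (algebra v).mul (rootVec v α.1) (rootVec v β.1)
      = (cartanMap v (fun i => -((α.1 i : ℤ) : k)), 0)) ∧
    (α.1 + β.1 ≠ 0 → (algebra v).mul (rootVec v α.1) (rootVec v β.1)
      = sgn k (cocycleExponent CartanMatrix.E₈ α.1 β.1) • rootVec v (α.1 + β.1)) := by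
  obtain ⟨x, hx⟩ := α
  obtain ⟨y, hy⟩ := β
  have hne : ∀ n m, evenPoint n + oddPoint m ≠ 0 := by
    intro n m h
    have := congrFun h 0
    simp [evenPoint, oddPoint] at this
    omega
  obtain ⟨n, rfl | rfl⟩ := exists_point x <;> obtain ⟨m, rfl | rfl⟩ := exists_point y
  · exact rootVec_mul_even_even v hx hy h2
  · exact ⟨fun h => absurd h (hne n m), fun _ => rootVec_mul_even_odd v hx hy h2⟩
  · exact ⟨fun h => absurd h (add_comm (evenPoint m) (oddPoint n) ▸ hne m n),
      fun _ => rootVec_mul_odd_even v hx hy h2⟩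
  · exact rootVec_mul_odd_odd v hx hy h2

theorem lie_cartan_cartan (i j : Fin 8) : ⁅cartan v i, cartan v j⁆ = 0 := by
  have := lie_cartan_sigma v i (j, false) (j, true)
  have e : wt (j, false) i + wt (j, true) i = 0 := by
    rw [show (j, false) = opp (j, true) from rfl, wt_opp, Pi.neg_apply, neg_add_cancel]
  rw [← Int.cast_add, e, Int.cast_zero, zero_smul] at this
  exact this

theorem lie_cartanMap_cartanMap (h h' : Fin 8 → k) : ⁅cartanMap v h, cartanMap v h'⁆ = 0 := by
  rw [cartanMap_apply, cartanMap_apply, sum_lie]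
  refine Finset.sum_eq_zero fun i _ => ?_
  rw [lie_sum]
  refine Finset.sum_eq_zero fun j _ => ?_
  rw [smul_lie, lie_smul, lie_cartan_cartan, smul_zero, smul_zero]

/-- The root vectors, as a family indexed by the roots. -/
noncomputable def rootFamily (α : LatticeRoot CartanMatrix.E₈) : So k V × SPlus k V :=
  rootVec v α.1

/-- The inclusion of the Cartan subalgebra. -/
noncomputable def cartanIncl : (Fin 8 → k) →ₗ[k] So k V × SPlus k V :=
  LinearMap.inl k (So k V) (SPlus k V) ∘ₗ cartanMap v

theorem cartanIncl_apply (h : Fin 8 → k) : cartanIncl v h = (cartanMap v h, 0) := rfl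

/-- The comparison map from the Chevalley algebra of type `E₈`. -/
noncomputable def ofE8 : LieE8 k →ₗ[k] So k V × SPlus k V :=
  ChevalleyAlgebra.toModule (cartanIncl v) (rootFamily v)

theorem ofE8_rootBracket (h2 : (2 : k) ≠ 0) (α β : LatticeRoot CartanMatrix.E₈) :
    (algebra v).mul (rootFamily v α) (rootFamily v β)
      = ChevalleyAlgebra.toModule (cartanIncl v) (rootFamily v)
        (ChevalleyAlgebra.rootBracket α β) := by
  obtain ⟨e0, e1⟩ := rootVec_mul_rootVec v h2 α β
  by_cases h : α.1 + β.1 = 0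
  · rw [ChevalleyAlgebra.toModule_rootBracket_opp _ _ h]
    exact e0 h
  · by_cases h' : latticeForm CartanMatrix.E₈ (α.1 + β.1) (α.1 + β.1) = 2
    · rw [ChevalleyAlgebra.toModule_rootBracket_of_root _ _ h h']
      exact e1 h
    · rw [ChevalleyAlgebra.toModule_rootBracket_of_not _ _ h h']
      exact (e1 h).trans (by rw [rootVec_of_ne v h', smul_zero])

theorem cartanIncl_mul_cartanIncl (h h' : Fin 8 → k) :
    (algebra v).mul (cartanIncl v h) (cartanIncl v h') = 0 := by
  rw [algebra, Z2Algebra.ofAction_mul, cartanIncl_apply, cartanIncl_apply,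
    lie_cartanMap_cartanMap, map_zero, map_zero, map_zero, zero_add, sub_zero]
  rfl

theorem cartanIncl_mul_rootFamily (h2 : (2 : k) ≠ 0) (h : Fin 8 → k)
    (α : LatticeRoot CartanMatrix.E₈) :
    (algebra v).mul (cartanIncl v h) (rootFamily v α)
      = ChevalleyAlgebra.rootEval α h • rootFamily v α :=
  cartanMap_mul_rootVec v h2 h α

theorem ofE8_bracket (h2 : (2 : k) ≠ 0) (x y : LieE8 k) :
    ofE8 v ⁅x, y⁆ = (algebra v).mul (ofE8 v x) (ofE8 v y) := by
  have hL : (algebra v).IsLieAlgebra :=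
    (isLieAlgebra_iff_eq v h2 (by decide) (by norm_num)).2 (Or.inl rfl)
  exact ChevalleyAlgebra.toModule_bracket_of_isLieAlgebra hL (cartanIncl v) (rootFamily v)
    (cartanIncl_mul_cartanIncl v) (cartanIncl_mul_rootFamily v h2) (ofE8_rootBracket v h2) x y

end RootVectorsE8

end TypeD

namespace TypeD

/-! ### Bijectivity of the comparison map from E₈ -/

section IsoE8

variable {k V : Type*} [Field k] [AddCommGroup V] [Module k V] (v : Module.Basis (Fin 8) k V)

theorem exists_dCoord_eq (h2 : (2 : k) ≠ 0) (y : Fin 8 → k) : ∃ n, dCoord n = y := by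
  refine ⟨![y 7, (y 0 + y 1 + (y 2 + y 3 + y 4 + y 5 + y 6 + 6 * y 7 - y 7)) / 2,
    (y 1 - y 0 + 2 * y 7 + (y 2 + y 3 + y 4 + y 5 + y 6 + 6 * y 7 - y 7)) / 2,
    y 2 + y 3 + y 4 + y 5 + y 6 + 6 * y 7 - y 7, y 3 + y 4 + y 5 + y 6 + 4 * y 7,
    y 4 + y 5 + y 6 + 3 * y 7, y 5 + y 6 + 2 * y 7, y 6 + y 7], ?_⟩
  funext i
  fin_cases i <;> simp [dCoord] <;> field_simp <;> ring

/-- D₈ consists of the integral vectors with even coordinate sum. The witness solves the triangular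
system from the last coordinate upwards, with half the coordinate sum in place of a division. -/
theorem exists_dCoord_eq_of_even {y : Fin 8 → ℤ} (h : Even (∑ i, y i)) : ∃ n, dCoord n = y := by
  obtain ⟨r, hr⟩ := h
  rw [Fin.sum_univ_eight] at hr
  refine ⟨![y 7, r + 2 * y 7, r + 3 * y 7 - y 0,
    y 2 + y 3 + y 4 + y 5 + y 6 + 5 * y 7, y 3 + y 4 + y 5 + y 6 + 4 * y 7,
    y 4 + y 5 + y 6 + 3 * y 7, y 5 + y 6 + 2 * y 7, y 6 + y 7], ?_⟩
  funext i
  fin_cases i <;> simp [dCoord] <;> linarith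

theorem spinCoord_eq (n : Fin 8 → ℤ) : spinCoord n = dCoord n + ![1, 0, 0, 0, 0, 0, 0, 1] := by
  funext i; fin_cases i <;> simp [dCoord, spinCoord]

theorem exists_spinCoord_eq_of_even {μ : Fin 8 → ℤ} (h : Even (∑ i, μ i)) :
    ∃ n, spinCoord n = μ := by
  obtain ⟨n, hn⟩ := exists_dCoord_eq_of_even (y := μ - ![1, 0, 0, 0, 0, 0, 0, 1]) (by
    obtain ⟨r, hr⟩ := h
    refine ⟨r - 1, ?_⟩
    rw [Fin.sum_univ_eight] at *
    simp
    linarith)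
  exact ⟨n, by rw [spinCoord_eq, hn, sub_add_cancel]⟩

theorem dCoord_injective {R : Type*} [CommRing R] [NoZeroDivisors R] (h2 : (2 : R) ≠ 0) :
    Function.Injective (dCoord (R := R)) := by
  intro n m h
  rw [← sub_eq_zero]
  refine dCoord_eq_zero h2 ?_
  have e : dCoord (n - m) = dCoord n - dCoord m := by
    funext i; fin_cases i <;> simp [dCoord] <;> ring
  rw [e, h, sub_self]

theorem cartanMap_surjective (h2 : (2 : k) ≠ 0) (i : Fin 8) : ∃ h, cartanMap v h = cartan v i := by
  obtain ⟨n, hn⟩ := exists_dCoord_eq h2 (Pi.single i 1)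
  refine ⟨![2 * n 0, n 1, n 2, n 3, n 4, n 5, n 6, n 7], ?_⟩
  have e : ![2 * n 0 / 2, n 1, n 2, n 3, n 4, n 5, n 6, n 7] = n := by
    funext i; fin_cases i <;> simp [h2]
  rw [cartanMap_apply]
  simp only [Matrix.cons_val]
  rw [e, hn, Finset.sum_eq_single i
    (fun j _ hj => by rw [Pi.single_eq_of_ne hj, zero_smul])
    (fun hi => absurd (Finset.mem_univ _) hi), Pi.single_eq_same, one_smul]

theorem ofE8_surjective (h2 : (2 : k) ≠ 0) : Function.Surjective (ofE8 v) := by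
  set N := LinearMap.range (ofE8 v) with hN
  have hr : ∀ x : Fin 8 → ℤ, rootVec v x ∈ N := by
    intro x
    by_cases hx : latticeForm CartanMatrix.E₈ x x = 2
    · exact ⟨_, ChevalleyAlgebra.toModule_rootVector (cartanIncl v) (rootFamily v) ⟨x, hx⟩⟩
    · rw [rootVec_of_ne v hx]; exact zero_mem _
  have hc : ∀ h, cartanIncl v h ∈ N := fun h =>
    ⟨_, ChevalleyAlgebra.toModule_cartan (cartanIncl v) (rootFamily v) h⟩
  have hs : N.comap (LinearMap.inl k (So k V) (SPlus k V)) = ⊤ := by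
    refine so_mem_of_sigma_unitVec v h2 fun a b => ?_
    by_cases hab : a.1 = b.1
    · have hcar : ∀ i, cartan v i ∈ N.comap (LinearMap.inl k (So k V) (SPlus k V)) := by
        intro i
        obtain ⟨h, hh⟩ := cartanMap_surjective v h2 i
        rw [← hh]
        exact hc h
      rcases eq_or_eq_opp hab with rfl | rfl
      · rw [sigma_self]; exact zero_mem _
      · obtain ⟨i, _ | _⟩ := b
        · rw [sigma_swap]
          exact neg_mem (hcar i)
        · exact hcar i
    · obtain ⟨n, hn⟩ := exists_dCoord_eq_of_even (y := wt a + wt b) (by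
        simp only [Pi.add_apply, Finset.sum_add_distrib]
        exact (sum_wt a).add_odd (sum_wt b))
      have e := hr (evenPoint n)
      rw [rootVec_evenPoint, hn, rootElt_wt v hab, smul_smul] at e
      exact (Submodule.smul_mem_iff _ (mul_ne_zero (sgn_ne_zero (signEven n))
        (neg_ne_zero.2 (sgn_ne_zero (lowForm (wt a) (wt b)))))).1 e
  have hp : N.comap (LinearMap.inr k (So k V) (SPlus k V)) = ⊤ := by
    refine eq_top_of_plusVec_mem v h2 fun μ _ he => ?_
    obtain ⟨n, hn⟩ := exists_spinCoord_eq_of_even he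
    have e := hr (oddPoint n)
    rw [rootVec_oddPoint, hn] at e
    exact (Submodule.smul_mem_iff _ (sgn_ne_zero _)).1
      (e : _ • plusVec v μ ∈ N.comap (LinearMap.inr k (So k V) (SPlus k V)))
  rintro ⟨A, s⟩
  have h1 : A ∈ N.comap (LinearMap.inl k (So k V) (SPlus k V)) := hs ▸ Submodule.mem_top
  have h3 : s ∈ N.comap (LinearMap.inr k (So k V) (SPlus k V)) := hp ▸ Submodule.mem_top
  have h4 : (A, s) ∈ N := by
    have := add_mem (Submodule.mem_comap.1 h1) (Submodule.mem_comap.1 h3)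
    rwa [LinearMap.inl_apply, LinearMap.inr_apply, Prod.mk_add_mk, add_zero, zero_add] at this
  exact h4

theorem coeff_cartan_of_ne {a b : Fin 8 × Bool} (hab : a.1 ≠ b.1) (i : Fin 8) :
    coeff v (opp b) (opp a) (cartan v i) = 0 := by
  have e : coeff v (opp b) (opp a) (cartan v i) = _ :=
    coeff_sigma v (opp b) (opp a) (i, false) (i, true)
  rw [e, opp_opp]
  have h1 : ¬(opp a = opp (i, false) ∧ (i, true) = b) := fun ⟨h, h'⟩ =>
    hab (by rw [← h', ← opp_fst a, h]; rfl)
  have h2 : ¬(opp a = opp (i, true) ∧ (i, false) = b) := fun ⟨h, h'⟩ =>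
    hab (by rw [← h', ← opp_fst a, h]; rfl)
  grind

theorem opp_injective {l : ℕ} : Function.Injective (opp (l := l)) := fun a b h => by
  rw [← opp_opp a, h, opp_opp]

theorem coeff_rootElt_of_ne {a b : Fin 8 × Bool} {β : Fin 8 → ℤ} (h : β ≠ wt a + wt b) :
    coeff v (opp b) (opp a) (rootElt v β) = 0 := by
  by_cases hβ : IsRoot β
  · obtain ⟨c, d, hcd, rfl⟩ := hβ
    rw [rootElt_wt v hcd, map_smul, coeff_sigma, opp_opp, smul_eq_mul]
    have h1 : ¬(opp a = opp c ∧ d = b) := fun ⟨e, e'⟩ => h (by rw [e', opp_injective e])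
    have h2 : ¬(opp a = opp d ∧ c = b) := fun ⟨e, e'⟩ =>
      h (by rw [e', opp_injective e, add_comm])
    grind
  · rw [rootElt_of_not v hβ, map_zero]

theorem coeff_rootElt_self {a b : Fin 8 × Bool} (hab : a.1 ≠ b.1) :
    coeff v (opp b) (opp a) (rootElt v (wt a + wt b)) ≠ 0 := by
  have h : a ≠ b := fun h => hab (by rw [h])
  rw [rootElt_wt v hab, map_smul, coeff_sigma, opp_opp, if_pos rfl, if_pos rfl, if_neg h, mul_zero,
    sub_zero, mul_one, smul_eq_mul, mul_one]
  exact neg_ne_zero.2 (sgn_ne_zero _)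

theorem plusBasis_repr_plusVec_ind (h2 : (2 : k) ≠ 0) {J : {J : Finset (Fin 8) // Even J.card}}
    {μ : Fin 8 → ℤ} (hμ : IsIndicator μ) (he : Even (∑ i, μ i)) :
    (plusBasis v h2).repr (plusVec v μ) J = if μ = ind J.1 then 1 else 0 := by
  obtain ⟨I, rfl⟩ := exists_ind hμ
  rw [sum_ind] at he
  have e := plusBasis_apply v h2 ⟨I, by exact_mod_cast he⟩
  rw [← e, Module.Basis.repr_self, Finsupp.single_apply]
  refine if_congr ?_ rfl rfl
  rw [Subtype.ext_iff, ind_injective.eq_iff]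

theorem cartanMap_injective (h2 : (2 : k) ≠ 0) : Function.Injective (cartanMap v) := by
  rw [injective_iff_map_eq_zero]
  intro h hh
  have e : dCoord ![h 0 / 2, h 1, h 2, h 3, h 4, h 5, h 6, h 7] = 0 := by
    funext i
    have := congrArg (coeff v (i, false) (i, true)) hh
    rw [cartanMap_apply, map_sum, map_zero, Finset.sum_eq_single i] at this
    · rw [map_smul] at this
      have e : coeff v (i, false) (i, true) (cartan v i) = _ :=
        coeff_sigma v (i, false) (i, true) (i, false) (i, true)
      rw [e] at this
      simpa [opp] using this
    · intro j _ hj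
      rw [map_smul]
      have e : coeff v (i, false) (i, true) (cartan v j) = _ :=
        coeff_sigma v (i, false) (i, true) (j, false) (j, true)
      rw [e]
      simp [opp, hj, hj.symm]
    · exact fun hi => absurd (Finset.mem_univ _) hi
  have e' := dCoord_eq_zero h2 e
  have e0 : h 0 / 2 = 0 := congrFun e' 0
  funext i
  fin_cases i
  · simpa [h2] using e0
  all_goals first
    | exact congrFun e' 1 | exact congrFun e' 2 | exact congrFun e' 3 | exact congrFun e' 4
    | exact congrFun e' 5 | exact congrFun e' 6 | exact congrFun e' 7

/-- Root elements are separated by off-diagonal matrix coefficients and weight vectors by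
coordinates of S⁺; neither kind of functional sees the Cartan part. -/
theorem ofE8_injective (h2 : (2 : k) ≠ 0) : Function.Injective (ofE8 v) := by
  refine ChevalleyAlgebra.toModule_injective (cartanIncl v) (rootFamily v) ?_ ?_
  · exact LinearMap.inl_injective.comp (cartanMap_injective v h2)
  rintro ⟨x, hx⟩
  obtain ⟨n, rfl | rfl⟩ := exists_point x
  · obtain ⟨a, b, hab, e⟩ := isRoot_dCoord.2 hx
    refine ⟨coeff v (opp b) (opp a) ∘ₗ LinearMap.fst k (So k V) (SPlus k V), fun h => ?_, ?_, ?_⟩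
    · rw [cartanIncl_apply, LinearMap.comp_apply, LinearMap.fst_apply, cartanMap_apply, map_sum]
      refine Finset.sum_eq_zero fun i _ => ?_
      rw [map_smul, coeff_cartan_of_ne v hab, smul_zero]
    · rintro ⟨y, hy⟩ hne
      rw [rootFamily, LinearMap.comp_apply, LinearMap.fst_apply]
      obtain ⟨m, rfl | rfl⟩ := exists_point y
      · rw [rootVec_evenPoint, map_smul, coeff_rootElt_of_ne, smul_zero]
        rw [← e]
        exact fun h => hne (Subtype.ext (congrArg evenPoint (dCoord_injective two_ne_zero h)))
      · rw [rootVec_oddPoint, map_zero]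
    · rw [rootFamily, LinearMap.comp_apply, LinearMap.fst_apply, rootVec_evenPoint, map_smul, e]
      exact smul_ne_zero (sgn_ne_zero _) (coeff_rootElt_self v hab)
  · have hn := isIndicator_spinCoord.2 hx
    obtain ⟨J, hJ⟩ := exists_ind hn
    have en := even_sum_spinCoord n
    have eJ : Even J.card := by
      rw [hJ, sum_ind] at en
      exact_mod_cast en
    refine ⟨(plusBasis v h2).coord ⟨J, eJ⟩ ∘ₗ LinearMap.snd k (So k V) (SPlus k V),
      fun h => ?_, ?_, ?_⟩
    · rw [cartanIncl_apply, LinearMap.comp_apply, LinearMap.snd_apply, map_zero]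
    · rintro ⟨y, hy⟩ hne
      rw [rootFamily, LinearMap.comp_apply, LinearMap.snd_apply]
      obtain ⟨m, rfl | rfl⟩ := exists_point y
      · rw [rootVec_evenPoint, map_zero]
      · rw [rootVec_oddPoint, map_smul, Module.Basis.coord_apply,
          plusBasis_repr_plusVec_ind v h2 (isIndicator_spinCoord.2 hy) (even_sum_spinCoord m),
          if_neg, smul_zero]
        rw [← hJ, spinCoord_eq, spinCoord_eq]
        exact fun h => hne (Subtype.ext (congrArg oddPoint
          (dCoord_injective two_ne_zero (add_right_cancel h))))
    · rw [rootFamily, LinearMap.comp_apply, LinearMap.snd_apply, rootVec_oddPoint, map_smul,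
        Module.Basis.coord_apply, plusBasis_repr_plusVec_ind v h2 hn en, if_pos hJ, smul_eq_mul,
        mul_one]
      exact sgn_ne_zero _

theorem algebra_isoBracket_e8 (h2 : (2 : k) ≠ 0) : (algebra v).IsoBracket k (LieE8 k) := by
  let e := LinearEquiv.ofBijective (ofE8 v) ⟨ofE8_injective v h2, ofE8_surjective v h2⟩
  refine ⟨e.symm, fun x y => ?_⟩
  rw [LinearEquiv.symm_apply_eq]
  have h := ofE8_bracket v h2 (e.symm x) (e.symm y)
  have hx : ofE8 v (e.symm x) = x := e.apply_symm_apply x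
  have hy : ofE8 v (e.symm y) = y := e.apply_symm_apply y
  rw [hx, hy] at h
  exact h.symm

end IsoE8

end TypeD

/-! ### Raising and lowering operators of a Freudenthal triple system -/

namespace FreudenthalSpace

variable {k J : Type*} [CommRing k] [AddCommGroup J] [Module k J]
  (t : J →ₗ[k] J →ₗ[k] k) (c : J →ₗ[k] J →ₗ[k] J)

/-- The raising operator `(α, a, b, β) ↦ (0, α e, e × a, t(e, b))`. -/
def raise (e : J) (x : FreudenthalSpace k J) : FreudenthalSpace k J :=
  (0, x.1 • e, c e x.2.1, t e x.2.2.1)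

/-- The lowering operator `(α, a, b, β) ↦ (t(e, a), e × b, β e, 0)`. -/
def lower (e : J) (x : FreudenthalSpace k J) : FreudenthalSpace k J :=
  (t e x.2.1, c e x.2.2.1, x.2.2.2 • e, 0)

theorem lower_neg (e : J) (x : FreudenthalSpace k J) :
    lower t c e (-x) = -lower t c e x := by
  simp [lower]

theorem raise_neg (e : J) (x : FreudenthalSpace k J) :
    raise t c e (-x) = -raise t c e x := by
  simp [raise]

theorem swap_raise (e : J) (x : FreudenthalSpace k J) :
    swap (raise t c e x) = lower t c e (swap x) := rfl

theorem swap_lower (e : J) (x : FreudenthalSpace k J) :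
    swap (lower t c e x) = raise t c e (swap x) := rfl

/-- This symmetry turns every statement about raising into one about lowering. -/
theorem triple_swap (x y z : FreudenthalSpace k J) :
    triple t c (swap x) (swap y) (swap z) = -swap (triple t c x y z) := by
  simp [triple, swap]

variable {t c}

theorem triple_comm (hc : ∀ a b, c a b = c b a)
    (x y z : FreudenthalSpace k J) : triple t c x y z = triple t c y x z := by
  obtain ⟨α₁, a₁, b₁, β₁⟩ := x
  obtain ⟨α₂, a₂, b₂, β₂⟩ := y
  obtain ⟨α₃, a₃, b₃, β₃⟩ := z
  simp only [triple, tripleScalar, tripleVector, swap, hc a₂ a₁, hc b₂ b₁]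
  refine Prod.ext ?_ (Prod.ext ?_ (Prod.ext ?_ ?_))
  · dsimp only; ring
  · dsimp only; module
  · dsimp only; module
  · dsimp only; ring

/-- The Leibniz rule is proved only for an extreme first argument. There the symmetry of the
trilinear form t(a, b × d) suffices, and no adjoint identity of a cubic Jordan algebra enters. -/
theorem raise_triple_scalar (ht : ∀ a b, t a b = t b a) (hc : ∀ a b, c a b = c b a)
    (htc : ∀ a b d, t a (c b d) = t b (c a d)) (e : J) (r : k) (y z : FreudenthalSpace k J) :
    raise t c e (triple t c (r, 0, 0, 0) y z)
      = triple t c (raise t c e (r, 0, 0, 0)) y z + triple t c (r, 0, 0, 0) (raise t c e y) z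
        + triple t c (r, 0, 0, 0) y (raise t c e z) := by
  obtain ⟨α₂, a₂, b₂, β₂⟩ := y
  obtain ⟨α₃, a₃, b₃, β₃⟩ := z
  simp only [triple, tripleScalar, tripleVector, swap, raise, map_zero, map_add, map_neg, map_smul,
    LinearMap.zero_apply, LinearMap.smul_apply, smul_zero, zero_smul, mul_zero, zero_mul,
    add_zero, zero_add, sub_zero, zero_sub, smul_eq_mul, neg_zero]
  refine Prod.ext ?_ (Prod.ext ?_ (Prod.ext ?_ ?_))
  · simp only [Prod.fst_add, ht b₂ e, ht (c e a₂) a₃, htc a₃ e a₂]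
    ring
  · simp only [Prod.fst_add, Prod.snd_add, ht b₂ e, hc b₂ (c e a₃)]
    module
  · simp only [Prod.fst_add, Prod.snd_add, ht b₂ e, hc (c b₂ b₃) e]
    module
  · simp only [Prod.snd_add, ht b₂ e]
    ring

/-- Lowering kills (r, 0, 0, 0), hence one term of the Leibniz rule is absent. -/
theorem lower_triple_scalar (hc : ∀ a b, c a b = c b a)
    (htc : ∀ a b d, t a (c b d) = t b (c a d)) (e : J) (r : k) (y z : FreudenthalSpace k J) :
    lower t c e (triple t c (r, 0, 0, 0) y z)
      = triple t c (r, 0, 0, 0) (lower t c e y) z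
        + triple t c (r, 0, 0, 0) y (lower t c e z) := by
  obtain ⟨α₂, a₂, b₂, β₂⟩ := y
  obtain ⟨α₃, a₃, b₃, β₃⟩ := z
  simp only [triple, tripleScalar, tripleVector, swap, lower, map_zero, map_add, map_neg, map_smul,
    LinearMap.zero_apply, LinearMap.smul_apply, smul_zero, zero_smul, mul_zero, zero_mul,
    add_zero, zero_add, sub_zero, zero_sub, smul_eq_mul, neg_zero]
  refine Prod.ext ?_ (Prod.ext ?_ (Prod.ext ?_ ?_))
  · simp only [Prod.fst_add, htc b₂ e b₃]
    ring
  · simp only [Prod.fst_add, Prod.snd_add, hc b₂ e]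
    module
  · simp only [Prod.fst_add, Prod.snd_add]
    module
  · simp only [Prod.snd_add]
    ring

theorem raise_triple_scalar' (hc : ∀ a b, c a b = c b a)
    (htc : ∀ a b d, t a (c b d) = t b (c a d)) (e : J) (r : k) (y z : FreudenthalSpace k J) :
    raise t c e (triple t c (0, 0, 0, r) y z)
      = triple t c (0, 0, 0, r) (raise t c e y) z
        + triple t c (0, 0, 0, r) y (raise t c e z) := by
  have h := congrArg swap (lower_triple_scalar hc htc e r (swap y) (swap z))
  have h0 : ((0, 0, 0, r) : FreudenthalSpace k J) = swap (r, 0, 0, 0) := rfl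
  have e1 : ∀ y z, triple t c (swap (r, 0, 0, 0)) y z
      = -swap (triple t c (r, 0, 0, 0) (swap y) (swap z)) :=
    fun y z => triple_swap t c _ (swap y) (swap z)
  rw [h0, e1, e1, e1, raise_neg, ← swap_lower, h, swap_add, neg_add, swap_raise, swap_raise]

theorem lower_triple_scalar' (ht : ∀ a b, t a b = t b a) (hc : ∀ a b, c a b = c b a)
    (htc : ∀ a b d, t a (c b d) = t b (c a d)) (e : J) (r : k) (y z : FreudenthalSpace k J) :
    lower t c e (triple t c (0, 0, 0, r) y z)
      = triple t c (lower t c e (0, 0, 0, r)) y z + triple t c (0, 0, 0, r) (lower t c e y) z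
        + triple t c (0, 0, 0, r) y (lower t c e z) := by
  have h := congrArg swap (raise_triple_scalar ht hc htc e r (swap y) (swap z))
  have h0 : ((0, 0, 0, r) : FreudenthalSpace k J) = swap (r, 0, 0, 0) := rfl
  have e1 : ∀ x y z, triple t c (swap x) y z = -swap (triple t c x (swap y) (swap z)) :=
    fun x y z => triple_swap t c x (swap y) (swap z)
  rw [h0, ← swap_raise, e1, e1, e1, e1, lower_neg, ← swap_raise, h, swap_add, swap_add, neg_add,
    neg_add, swap_lower, swap_lower]

end FreudenthalSpace

/-! ### The Jordan algebra H₃(Q) in coordinates -/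

namespace QuatHerm

open scoped Quaternion

section

variable {k : Type*} [CommRing k]

theorem trForm_apply (a b : QuatHerm k) : trForm a b = tr (a.1 * b.1) := rfl

theorem cross_coe (a b : QuatHerm k) : (cross a b).1 = crossMatrix a.1 b.1 := rfl

theorem tr_mul_comm (a b : Matrix (Fin 3) (Fin 3) ℍ[k]) : tr (a * b) = tr (b * a) := by
  change ∑ i, ((a * b) i i).re = ∑ i, ((b * a) i i).re
  have h : ∀ x : Fin 3 → ℍ[k], (∑ i, x i).re = ∑ i, (x i).re := fun x => by
    simp [Fin.sum_univ_three]
  simp only [Matrix.mul_apply, h]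
  rw [Finset.sum_comm]
  refine Finset.sum_congr rfl fun i _ => Finset.sum_congr rfl fun j _ => ?_
  rw [Quaternion.re_mul, Quaternion.re_mul]
  ring

theorem trForm_comm (a b : QuatHerm k) : trForm a b = trForm b a := tr_mul_comm _ _

theorem cross_comm (a b : QuatHerm k) : cross a b = cross b a := by
  refine Subtype.ext ?_
  rw [cross_coe, cross_coe, crossMatrix, crossMatrix, tr_mul_comm b.1, mul_comm (tr b.1)]
  abel

/-- After the trace terms are matched, this is cyclicity of the reduced trace. -/
theorem trForm_cross (a b d : QuatHerm k) : trForm a (cross b d) = trForm b (cross a d) := by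
  rw [trForm_apply, trForm_apply, cross_coe, cross_coe, crossMatrix, crossMatrix]
  simp only [mul_add, mul_sub, map_add, map_sub, mul_smul_comm, map_smul, smul_eq_mul, mul_one]
  have e1 : tr (a.1 * (b.1 * d.1)) = tr (b.1 * (d.1 * a.1)) := by
    rw [tr_mul_comm, mul_assoc]
  have e2 : tr (a.1 * (d.1 * b.1)) = tr (b.1 * (a.1 * d.1)) := by
    rw [← mul_assoc, tr_mul_comm]
  linear_combination e1 + e2 - tr d.1 * tr_mul_comm a.1 b.1

/-- The hermitian matrix with the given diagonal and the given entries above the diagonal. -/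
def mk (d : Fin 3 → k) (x : Fin 3 → ℍ[k]) : QuatHerm k :=
  ⟨!![(d 0 : ℍ[k]), x 2, x 1; star (x 2), (d 1 : ℍ[k]), x 0; star (x 1), star (x 0), (d 2 : ℍ[k])],
    by
      change Matrix.conjTranspose _ = _
      ext i j : 1
      fin_cases i <;> fin_cases j <;> simp [Matrix.conjTranspose_apply]⟩

theorem trForm_mk (d d' : Fin 3 → k) (x x' : Fin 3 → ℍ[k]) :
    trForm (mk d x) (mk d' x') = ∑ i, (d i * d' i + 2 * (x i * star (x' i)).re) := by
  rw [trForm_apply]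
  change ∑ i, ((_ * _ : Matrix (Fin 3) (Fin 3) ℍ[k]) i i).re = _
  simp [mk, Matrix.mul_apply, Fin.sum_univ_three]
  ring

theorem tr_eq (a : Matrix (Fin 3) (Fin 3) ℍ[k]) :
    tr a = (a 0 0).re + (a 1 1).re + (a 2 2).re :=
  Fin.sum_univ_three fun i => (a i i).re

theorem coe_mk (d : Fin 3 → k) (x : Fin 3 → ℍ[k]) : (mk d x).1
    = !![(d 0 : ℍ[k]), x 2, x 1; star (x 2), (d 1 : ℍ[k]), x 0;
        star (x 1), star (x 0), (d 2 : ℍ[k])] := rfl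

end

section

variable {k : Type*} [Field k]

/-- A self-conjugate quaternion is a scalar when 2 is invertible, so the diagonal of a hermitian
matrix is scalar. -/
theorem eq_mk (h2 : (2 : k) ≠ 0) (a : QuatHerm k) :
    a = mk (fun i => (a.1 i i).re) ![a.1 1 2, a.1 0 2, a.1 0 1] := by
  have h : ∀ i j, star (a.1 i j) = a.1 j i := fun i j => congrFun (congrFun a.2 j) i
  have hd : ∀ i, a.1 i i = (((a.1 i i).re : k) : ℍ[k]) := by
    intro i
    have hi := h i i
    have e : ∀ x : k, -x = x → x = 0 := fun x hx => by
      refine (mul_eq_zero.1 (?_ : 2 * x = 0)).resolve_left h2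
      linear_combination -hx
    ext
    · simp
    · simpa using e _ (by simpa using congrArg QuaternionAlgebra.imI hi)
    · simpa using e _ (by simpa using congrArg QuaternionAlgebra.imJ hi)
    · simpa using e _ (by simpa using congrArg QuaternionAlgebra.imK hi)
  refine Subtype.ext ?_
  rw [coe_mk]
  ext i j : 1
  fin_cases i <;> fin_cases j <;> simp [h] <;> exact hd _

theorem ext_entries (h2 : (2 : k) ≠ 0) {a b : QuatHerm k}
    (h : ∀ i, (a.1 i i).re = (b.1 i i).re) (h0 : a.1 1 2 = b.1 1 2) (h1 : a.1 0 2 = b.1 0 2)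
    (h3 : a.1 0 1 = b.1 0 1) : a = b := by
  rw [eq_mk h2 a, eq_mk h2 b, h0, h1, h3, funext h]

theorem mk_00 (d : Fin 3 → k) (x : Fin 3 → ℍ[k]) : (mk d x).1 0 0 = (d 0 : ℍ[k]) := rfl

theorem mk_01 (d : Fin 3 → k) (x : Fin 3 → ℍ[k]) : (mk d x).1 0 1 = x 2 := rfl

theorem mk_02 (d : Fin 3 → k) (x : Fin 3 → ℍ[k]) : (mk d x).1 0 2 = x 1 := rfl

theorem mk_10 (d : Fin 3 → k) (x : Fin 3 → ℍ[k]) : (mk d x).1 1 0 = star (x 2) := rfl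

theorem mk_11 (d : Fin 3 → k) (x : Fin 3 → ℍ[k]) : (mk d x).1 1 1 = (d 1 : ℍ[k]) := rfl

theorem mk_12 (d : Fin 3 → k) (x : Fin 3 → ℍ[k]) : (mk d x).1 1 2 = x 0 := rfl

theorem mk_20 (d : Fin 3 → k) (x : Fin 3 → ℍ[k]) : (mk d x).1 2 0 = star (x 1) := rfl

theorem mk_21 (d : Fin 3 → k) (x : Fin 3 → ℍ[k]) : (mk d x).1 2 1 = star (x 0) := rfl

theorem mk_22 (d : Fin 3 → k) (x : Fin 3 → ℍ[k]) : (mk d x).1 2 2 = (d 2 : ℍ[k]) := rfl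

theorem cross_mk_apply (d d' : Fin 3 → k) (x x' : Fin 3 → ℍ[k]) (i j : Fin 3) :
    (cross (mk d x) (mk d' x')).1 i j
      = (mk d x).1 i 0 * (mk d' x').1 0 j + (mk d x).1 i 1 * (mk d' x').1 1 j
        + (mk d x).1 i 2 * (mk d' x').1 2 j
        + ((mk d' x').1 i 0 * (mk d x).1 0 j + (mk d' x').1 i 1 * (mk d x).1 1 j
          + (mk d' x').1 i 2 * (mk d x).1 2 j)
        - (d 0 + d 1 + d 2) • (mk d' x').1 i j - (d' 0 + d' 1 + d' 2) • (mk d x).1 i j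
        + ((d 0 + d 1 + d 2) * (d' 0 + d' 1 + d' 2)
          - ∑ i, (d i * d' i + 2 * (x i * star (x' i)).re))
          • (1 : Matrix (Fin 3) (Fin 3) ℍ[k]) i j := by
  rw [← trForm_mk, trForm_apply]
  have h1 : tr (mk d x).1 = d 0 + d 1 + d 2 := by rw [tr_eq]; rfl
  have h1' : tr (mk d' x').1 = d' 0 + d' 1 + d' 2 := by rw [tr_eq]; rfl
  rw [← h1, ← h1', ← Fin.sum_univ_three fun m => (mk d x).1 i m * (mk d' x').1 m j,
    ← Fin.sum_univ_three fun m => (mk d' x').1 i m * (mk d x).1 m j]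
  rfl

theorem cross_mk_00 (d d' : Fin 3 → k) (x x' : Fin 3 → ℍ[k]) :
    ((cross (mk d x) (mk d' x')).1 0 0).re
      = d 1 * d' 2 + d 2 * d' 1 - 2 * (x 0 * star (x' 0)).re := by
  rw [cross_mk_apply]
  simp only [mk_00, mk_01, mk_02, mk_10, mk_11, mk_12, mk_20, mk_21, mk_22,
    Matrix.one_apply_eq, Fin.sum_univ_three]
  simp
  ring

theorem cross_mk_11 (d d' : Fin 3 → k) (x x' : Fin 3 → ℍ[k]) :
    ((cross (mk d x) (mk d' x')).1 1 1).re
      = d 0 * d' 2 + d 2 * d' 0 - 2 * (x 1 * star (x' 1)).re := by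
  rw [cross_mk_apply]
  simp only [mk_00, mk_01, mk_02, mk_10, mk_11, mk_12, mk_20, mk_21, mk_22,
    Matrix.one_apply_eq, Fin.sum_univ_three]
  simp
  ring

theorem cross_mk_22 (d d' : Fin 3 → k) (x x' : Fin 3 → ℍ[k]) :
    ((cross (mk d x) (mk d' x')).1 2 2).re
      = d 0 * d' 1 + d 1 * d' 0 - 2 * (x 2 * star (x' 2)).re := by
  rw [cross_mk_apply]
  simp only [mk_00, mk_01, mk_02, mk_10, mk_11, mk_12, mk_20, mk_21, mk_22,
    Matrix.one_apply_eq, Fin.sum_univ_three]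
  simp
  ring

theorem cross_mk_12 (d d' : Fin 3 → k) (x x' : Fin 3 → ℍ[k]) :
    (cross (mk d x) (mk d' x')).1 1 2
      = star (x 2) * x' 1 + star (x' 2) * x 1 - d 0 • x' 0 - d' 0 • x 0 := by
  rw [cross_mk_apply, Matrix.one_apply_ne (by decide), smul_zero, add_zero]
  simp only [mk_00, mk_01, mk_02, mk_10, mk_11, mk_12, mk_20, mk_21, mk_22]
  ext <;> simp <;> ring

theorem cross_mk_02 (d d' : Fin 3 → k) (x x' : Fin 3 → ℍ[k]) :
    (cross (mk d x) (mk d' x')).1 0 2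
      = x 2 * x' 0 + x' 2 * x 0 - d 1 • x' 1 - d' 1 • x 1 := by
  rw [cross_mk_apply, Matrix.one_apply_ne (by decide), smul_zero, add_zero]
  simp only [mk_00, mk_01, mk_02, mk_10, mk_11, mk_12, mk_20, mk_21, mk_22]
  ext <;> simp <;> ring

theorem cross_mk_01 (d d' : Fin 3 → k) (x x' : Fin 3 → ℍ[k]) :
    (cross (mk d x) (mk d' x')).1 0 1
      = x 1 * star (x' 0) + x' 1 * star (x 0) - d 2 • x' 2 - d' 2 • x 2 := by
  rw [cross_mk_apply, Matrix.one_apply_ne (by decide), smul_zero, add_zero]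
  simp only [mk_00, mk_01, mk_02, mk_10, mk_11, mk_12, mk_20, mk_21, mk_22]
  ext <;> simp <;> ring

theorem cross_mk (h2 : (2 : k) ≠ 0) (d d' : Fin 3 → k) (x x' : Fin 3 → ℍ[k]) :
    cross (mk d x) (mk d' x') = mk
      ![d 1 * d' 2 + d 2 * d' 1 - 2 * (x 0 * star (x' 0)).re,
        d 0 * d' 2 + d 2 * d' 0 - 2 * (x 1 * star (x' 1)).re,
        d 0 * d' 1 + d 1 * d' 0 - 2 * (x 2 * star (x' 2)).re]
      ![star (x 2) * x' 1 + star (x' 2) * x 1 - d 0 • x' 0 - d' 0 • x 0,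
        x 2 * x' 0 + x' 2 * x 0 - d 1 • x' 1 - d' 1 • x 1,
        x 1 * star (x' 0) + x' 1 * star (x 0) - d 2 • x' 2 - d' 2 • x 2] := by
  refine ext_entries h2 (fun i => ?_) (cross_mk_12 d d' x x') (cross_mk_02 d d' x x')
    (cross_mk_01 d d' x x')
  fin_cases i
  · exact cross_mk_00 d d' x x'
  · exact cross_mk_11 d d' x x'
  · exact cross_mk_22 d d' x x'

end

end QuatHerm

namespace TypeD

/-! ### Pairs in six points and the polarized Pfaffian -/

section Pfaffian

/-- The smaller element of the `I`-th two-element subset of `Fin 6`. -/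
def pairFst : Fin 15 → Fin 6 := ![0, 0, 0, 0, 0, 1, 1, 1, 1, 2, 2, 2, 3, 3, 4]

/-- The larger element of the `I`-th two-element subset of `Fin 6`. -/
def pairSnd : Fin 15 → Fin 6 := ![1, 2, 3, 4, 5, 2, 3, 4, 5, 3, 4, 5, 4, 5, 5]

/-- The weight of the product of two basis vectors. -/
def pairWt (I : Fin 15) : Fin 6 → ℤ := wt (pairFst I, true) + wt (pairSnd I, true)

/-- The complement of two disjoint pairs. -/
def pairThird : Fin 15 → Fin 15 → Fin 15 := ![
    ![0, 0, 0, 0, 0, 0, 0, 0, 0, 14, 13, 12, 11, 10, 9],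
    ![0, 0, 0, 0, 0, 0, 14, 13, 12, 0, 0, 0, 8, 7, 6],
    ![0, 0, 0, 0, 0, 14, 0, 11, 10, 0, 8, 7, 0, 0, 5],
    ![0, 0, 0, 0, 0, 13, 11, 0, 9, 8, 0, 6, 0, 5, 0],
    ![0, 0, 0, 0, 0, 12, 10, 9, 0, 7, 6, 0, 5, 0, 0],
    ![0, 0, 14, 13, 12, 0, 0, 0, 0, 0, 0, 0, 4, 3, 2],
    ![0, 14, 0, 11, 10, 0, 0, 0, 0, 0, 4, 3, 0, 0, 1],
    ![0, 13, 11, 0, 9, 0, 0, 0, 0, 4, 0, 2, 0, 1, 0],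
    ![0, 12, 10, 9, 0, 0, 0, 0, 0, 3, 2, 0, 1, 0, 0],
    ![14, 0, 0, 8, 7, 0, 0, 4, 3, 0, 0, 0, 0, 0, 0],
    ![13, 0, 8, 0, 6, 0, 4, 0, 2, 0, 0, 0, 0, 0, 0],
    ![12, 0, 7, 6, 0, 0, 3, 2, 0, 0, 0, 0, 0, 0, 0],
    ![11, 8, 0, 0, 5, 4, 0, 0, 1, 0, 0, 0, 0, 0, 0],
    ![10, 7, 0, 5, 0, 3, 0, 1, 0, 0, 0, 0, 0, 0, 0],
    ![9, 6, 5, 0, 0, 2, 1, 0, 0, 0, 0, 0, 0, 0, 0]]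

/-- The sign of the partition of `Fin 6` into the pairs `I`, `J` and `pairThird I J`, and zero if
`I` and `J` are not disjoint. -/
def pairSign : Fin 15 → Fin 15 → ℤ := ![
    ![0, 0, 0, 0, 0, 0, 0, 0, 0, 1, -1, 1, 1, -1, 1],
    ![0, 0, 0, 0, 0, 0, -1, 1, -1, 0, 0, 0, -1, 1, -1],
    ![0, 0, 0, 0, 0, 1, 0, -1, 1, 0, 1, -1, 0, 0, 1],
    ![0, 0, 0, 0, 0, -1, 1, 0, -1, -1, 0, 1, 0, -1, 0],
    ![0, 0, 0, 0, 0, 1, -1, 1, 0, 1, -1, 0, 1, 0, 0],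
    ![0, 0, 1, -1, 1, 0, 0, 0, 0, 0, 0, 0, 1, -1, 1],
    ![0, -1, 0, 1, -1, 0, 0, 0, 0, 0, -1, 1, 0, 0, -1],
    ![0, 1, -1, 0, 1, 0, 0, 0, 0, 1, 0, -1, 0, 1, 0],
    ![0, -1, 1, -1, 0, 0, 0, 0, 0, -1, 1, 0, -1, 0, 0],
    ![1, 0, 0, -1, 1, 0, 0, 1, -1, 0, 0, 0, 0, 0, 1],
    ![-1, 0, 1, 0, -1, 0, -1, 0, 1, 0, 0, 0, 0, -1, 0],
    ![1, 0, -1, 1, 0, 0, 1, -1, 0, 0, 0, 0, 1, 0, 0],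
    ![1, -1, 0, 0, 1, 1, 0, 0, -1, 0, 0, 1, 0, 0, 0],
    ![-1, 1, 0, -1, 0, -1, 0, 1, 0, 0, -1, 0, 0, 0, 0],
    ![1, -1, 1, 0, 0, 1, -1, 0, 0, 1, 0, 0, 0, 0, 0]]

theorem pairFst_lt_pairSnd (I : Fin 15) : pairFst I < pairSnd I := by
  revert I; decide

theorem exists_pair {p q : Fin 6} (h : p < q) : ∃ I, pairFst I = p ∧ pairSnd I = q := by
  revert p q; decide

/-- A finite check that the tabulated sign of a partition into three pairs is the one met when a
raising operator goes from degree two to degree four. -/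
theorem pairSign_spec (I J : Fin 15) :
    (pairSign I J = 0 ∧ ¬IsIndicator (1 - pairWt I - pairWt J)) ∨
      (1 - pairWt I - pairWt J = pairWt (pairThird I J) ∧
        pairSign I J = if Even (lowForm (pairWt I) (1 - pairWt I)
          + lowForm (pairWt J) (1 - pairWt I - pairWt J)) then 1 else -1) := by
  revert I J
  decide

variable {k : Type*} [CommRing k]

/-- The symmetric bilinear form on alternating matrices with values in alternating matrices that is
obtained from the Pfaffian by polarization and duality. -/
def pfaffian (a c : Fin 15 → k) (I : Fin 15) : k :=
  ∑ J, (pairSign I J : k) * (a J * c (pairThird I J))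

theorem pfaffian_single (K I : Fin 15) (c : Fin 15 → k) :
    pfaffian (Pi.single K 1) c I = pairSign I K * c (pairThird I K) := by
  rw [pfaffian, Finset.sum_eq_single K (fun J _ hJ => by rw [Pi.single_eq_of_ne hJ]; ring)
    (fun h => absurd (Finset.mem_univ _) h), Pi.single_eq_same, one_mul]

theorem sum_fin_fifteen (f : Fin 15 → k) : ∑ i, f i = f 0 + f 1 + f 2 + f 3 + f 4 + f 5 + f 6
    + f 7 + f 8 + f 9 + f 10 + f 11 + f 12 + f 13 + f 14 := by
  simp only [Fin.sum_univ_castSucc, Fin.sum_univ_zero, zero_add]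
  rfl

theorem pfaffian_eq (a c : Fin 15 → k) : pfaffian a c = ![
    a 9 * c 14 - a 10 * c 13 + a 11 * c 12 + a 12 * c 11 - a 13 * c 10 + a 14 * c 9,
    - a 6 * c 14 + a 7 * c 13 - a 8 * c 12 - a 12 * c 8 + a 13 * c 7 - a 14 * c 6,
    a 5 * c 14 - a 7 * c 11 + a 8 * c 10 + a 10 * c 8 - a 11 * c 7 + a 14 * c 5,
    - a 5 * c 13 + a 6 * c 11 - a 8 * c 9 - a 9 * c 8 + a 11 * c 6 - a 13 * c 5,
    a 5 * c 12 - a 6 * c 10 + a 7 * c 9 + a 9 * c 7 - a 10 * c 6 + a 12 * c 5,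
    a 2 * c 14 - a 3 * c 13 + a 4 * c 12 + a 12 * c 4 - a 13 * c 3 + a 14 * c 2,
    - a 1 * c 14 + a 3 * c 11 - a 4 * c 10 - a 10 * c 4 + a 11 * c 3 - a 14 * c 1,
    a 1 * c 13 - a 2 * c 11 + a 4 * c 9 + a 9 * c 4 - a 11 * c 2 + a 13 * c 1,
    - a 1 * c 12 + a 2 * c 10 - a 3 * c 9 - a 9 * c 3 + a 10 * c 2 - a 12 * c 1,
    a 0 * c 14 - a 3 * c 8 + a 4 * c 7 + a 7 * c 4 - a 8 * c 3 + a 14 * c 0,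
    - a 0 * c 13 + a 2 * c 8 - a 4 * c 6 - a 6 * c 4 + a 8 * c 2 - a 13 * c 0,
    a 0 * c 12 - a 2 * c 7 + a 3 * c 6 + a 6 * c 3 - a 7 * c 2 + a 12 * c 0,
    a 0 * c 11 - a 1 * c 8 + a 4 * c 5 + a 5 * c 4 - a 8 * c 1 + a 11 * c 0,
    - a 0 * c 10 + a 1 * c 7 - a 3 * c 5 - a 5 * c 3 + a 7 * c 1 - a 10 * c 0,
    a 0 * c 9 - a 1 * c 6 + a 2 * c 5 + a 5 * c 2 - a 6 * c 1 + a 9 * c 0] := by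
  funext I
  rw [pfaffian, sum_fin_fifteen]
  fin_cases I <;> simp [pairSign, pairThird] <;> ring

end Pfaffian

/-! ### Alternating 6 × 6 matrices as hermitian quaternionic 3 × 3 matrices -/

section Theta

open scoped Quaternion

variable {k : Type*} [Field k]

/-- The quaternion that corresponds to the matrix `(p, q; r, s) (0, -1; 1, 0)`, with `ι² = -1`. -/
def block (ι p q r s : k) : ℍ[k] :=
  ⟨(q - r) / 2, -(ι * (q + r) / 2), -((p + s) / 2), ι * (p - s) / 2⟩

section

variable (ι p q r s : k)

theorem block_re : (block ι p q r s).re = (q - r) / 2 := rfl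

theorem block_imI : (block ι p q r s).imI = -(ι * (q + r) / 2) := rfl

theorem block_imJ : (block ι p q r s).imJ = -((p + s) / 2) := rfl

theorem block_imK : (block ι p q r s).imK = ι * (p - s) / 2 := rfl

end

theorem block_add (ι p q r s p' q' r' s' : k) : block ι (p + p') (q + q') (r + r') (s + s')
    = block ι p q r s + block ι p' q' r' s' := by
  ext <;> simp only [Quaternion.re_add, Quaternion.imI_add, Quaternion.imJ_add,
    Quaternion.imK_add, block_re, block_imI, block_imJ, block_imK] <;> ring

theorem block_smul (ι c p q r s : k) : block ι (c * p) (c * q) (c * r) (c * s)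
    = c • block ι p q r s := by
  ext <;> simp only [Quaternion.re_smul, Quaternion.imI_smul, Quaternion.imJ_smul,
    Quaternion.imK_smul, smul_eq_mul, block_re, block_imI, block_imJ, block_imK] <;> ring

/-- The quaternion norm of a block is its determinant. Replacing ι by -ι passes to the cofactor
matrix (`block_neg`), and the polarized determinant of a matrix with a cofactor matrix is the dot
product of the entries. -/
theorem re_block_mul_star_block (h2 : (2 : k) ≠ 0) {ι : k} (hι : ι * ι = -1)
    (p q r s p' q' r' s' : k) :
    2 * (block ι p q r s * star (block (-ι) p' q' r' s')).re
      = p * p' + q * q' + r * r' + s * s' := by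
  simp only [Quaternion.re_mul, Quaternion.re_star, Quaternion.imI_star, Quaternion.imJ_star,
    Quaternion.imK_star, block_re, block_imI, block_imJ, block_imK]
  field_simp
  linear_combination ((-(q + r) * (q' + r') - (p - s) * (p' - s'))) * hι

theorem star_block (ι p q r s : k) : star (block ι p q r s) = block ι (-p) (-r) (-q) (-s) := by
  ext <;> simp only [Quaternion.re_star, Quaternion.imI_star, Quaternion.imJ_star,
    Quaternion.imK_star, block_re, block_imI, block_imJ, block_imK] <;> ring

theorem block_neg (ι p q r s : k) : block (-ι) p q r s = block ι s (-r) (-q) p := by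
  ext <;> simp only [block_re, block_imI, block_imJ, block_imK] <;> ring

theorem block_sub (ι p q r s p' q' r' s' : k) : block ι p q r s - block ι p' q' r' s'
    = block ι (p - p') (q - q') (r - r') (s - s') := by
  rw [sub_eq_iff_eq_add, ← block_add]
  simp only [sub_add_cancel]

theorem block_mul (h2 : (2 : k) ≠ 0) {ι : k} (hι : ι * ι = -1) (p q r s p' q' r' s' : k) :
    block ι p q r s * block ι p' q' r' s'
      = block ι (q * p' - p * r') (q * q' - p * s') (s * p' - r * r') (s * q' - r * s') := by
  ext <;> simp only [Quaternion.re_mul, Quaternion.imI_mul, Quaternion.imJ_mul,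
    Quaternion.imK_mul, block_re, block_imI, block_imJ, block_imK] <;> field_simp
  · linear_combination (-(q + r) * (q' + r') - (p - s) * (p' - s')) * hι
  · ring
  · linear_combination ((q + r) * (p' - s') - (p - s) * (q' + r')) * hι
  · ring

theorem exists_block (h2 : (2 : k) ≠ 0) {ι : k} (hι : ι * ι = -1) (x : ℍ[k]) :
    ∃ p q r s, x = block ι p q r s := by
  refine ⟨-x.imJ - ι * x.imK, x.re + ι * x.imI, ι * x.imI - x.re, ι * x.imK - x.imJ, ?_⟩
  ext <;> simp only [block_re, block_imI, block_imJ, block_imK] <;> field_simp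
  · ring
  · linear_combination (2 * x.imI) * hι
  · ring
  · linear_combination (2 * x.imK) * hι

/-- The isomorphism of the alternating matrices with the hermitian quaternionic matrices. -/
def theta (ι : k) : (Fin 15 → k) →ₗ[k] QuatHerm k where
  toFun a := QuatHerm.mk ![a 0, a 9, a 14] ![block ι (a 10) (a 11) (a 12) (a 13),
    block ι (a 3) (a 4) (a 7) (a 8), block ι (a 1) (a 2) (a 5) (a 6)]
  map_add' a b := by
    refine Subtype.ext ?_
    rw [Submodule.coe_add, QuatHerm.coe_mk, QuatHerm.coe_mk, QuatHerm.coe_mk]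
    simp [block_add]
  map_smul' r a := by
    have h : ∀ x : k, r • (x : ℍ[k]) = ((r * x : k) : ℍ[k]) := fun x => by ext <;> simp
    refine Subtype.ext ?_
    rw [RingHom.id_apply, Submodule.coe_smul, QuatHerm.coe_mk, QuatHerm.coe_mk]
    simp [block_smul, h, -Quaternion.coe_mul]

theorem theta_apply (ι : k) (a : Fin 15 → k) : theta ι a
    = QuatHerm.mk ![a 0, a 9, a 14] ![block ι (a 10) (a 11) (a 12) (a 13),
      block ι (a 3) (a 4) (a 7) (a 8), block ι (a 1) (a 2) (a 5) (a 6)] := rfl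

/-- The maps for ι and -ι are dual to each other under the trace form; this is why Λ⁴, the dual of
Λ², is identified with J by means of -ι. -/
theorem trForm_theta (h2 : (2 : k) ≠ 0) {ι : k} (hι : ι * ι = -1) (a b : Fin 15 → k) :
    QuatHerm.trForm (theta ι a) (theta (-ι) b) = ∑ I, a I * b I := by
  rw [theta_apply, theta_apply, QuatHerm.trForm_mk, Fin.sum_univ_three, sum_fin_fifteen]
  simp only [Matrix.cons_val, re_block_mul_star_block h2 hι]
  ring

/-- The Pfaffian corresponds to the norm of H₃(Q), so its polarization corresponds to ×. The values
lie in the dual space, hence the change to -ι. -/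
theorem cross_theta (h2 : (2 : k) ≠ 0) {ι : k} (hι : ι * ι = -1) (a b : Fin 15 → k) :
    QuatHerm.cross (theta ι a) (theta ι b) = theta (-ι) (pfaffian a b) := by
  have h3 : ∀ {α : Type _} {x y z x' y' z' : α}, x = x' → y = y' → z = z' →
      ![x, y, z] = ![x', y', z'] := by
    rintro α x y z x' y' z' rfl rfl rfl; rfl
  have hb : ∀ {p q r s p' q' r' s' : k}, p = p' → q = q' → r = r' → s = s' →
      block ι p q r s = block ι p' q' r' s' := by
    rintro p q r s p' q' r' s' rfl rfl rfl rfl; rfl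
  rw [theta_apply, theta_apply, theta_apply, QuatHerm.cross_mk h2, pfaffian_eq]
  have h : ∀ x : k, 2 * (x / 2) = x := fun x => by field_simp
  simp only [Matrix.cons_val, star_block, block_neg, block_mul h2 hι, block_re, h, ← block_smul, ← block_add, block_sub]
  refine congrArg₂ _ (h3 ?_ ?_ ?_) (h3 (hb ?_ ?_ ?_ ?_) (hb ?_ ?_ ?_ ?_) (hb ?_ ?_ ?_ ?_)) <;> ring

theorem theta_injective (h2 : (2 : k) ≠ 0) {ι : k} (hι : ι * ι = -1) :
    Function.Injective (theta ι) := by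
  rw [← LinearMap.ker_eq_bot, LinearMap.ker_eq_bot']
  intro a ha
  funext I
  have h := trForm_theta h2 hι a (Pi.single I 1)
  rw [ha, map_zero, LinearMap.zero_apply, Finset.sum_eq_single I
    (fun J _ hJ => by rw [Pi.single_eq_of_ne hJ, mul_zero])
    (fun h => absurd (Finset.mem_univ _) h), Pi.single_eq_same, mul_one] at h
  exact h.symm

theorem theta_surjective (h2 : (2 : k) ≠ 0) {ι : k} (hι : ι * ι = -1) :
    Function.Surjective (theta ι) := by
  intro x
  obtain ⟨p, q, r, s, h0⟩ := exists_block h2 hι (x.1 1 2)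
  obtain ⟨p', q', r', s', h1⟩ := exists_block h2 hι (x.1 0 2)
  obtain ⟨p'', q'', r'', s'', h3⟩ := exists_block h2 hι (x.1 0 1)
  refine ⟨![(x.1 0 0).re, p'', q'', p', q', r'', s'', r', s', (x.1 1 1).re, p, q, r, s,
    (x.1 2 2).re], ?_⟩
  rw [theta_apply, QuatHerm.eq_mk h2 x, h0, h1, h3]
  refine congrArg₂ _ ?_ rfl
  funext i
  fin_cases i <;> rfl

end Theta

end TypeD

namespace TypeD

/-! ### Weight coordinates on the half-spin module -/

section WeightCoord

variable {k V : Type*} [Field k] [AddCommGroup V] [Module k V]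
  {l : ℕ} (v : Module.Basis (Fin l) k V)

open scoped Classical in
/-- The coordinate of weight `μ` on `S⁺`, or `0` if `μ` is not a weight. -/
noncomputable def weightCoord (μ : Fin l → ℤ) : SPlus k V →ₗ[k] k :=
  if IsIndicator μ then
    v.ExteriorAlgebra.coord (Finset.univ.filter fun i => μ i = 1) ∘ₗ (SPlus k V).subtype
  else 0

theorem weightCoord_of_not {μ : Fin l → ℤ} (h : ¬IsIndicator μ) (s : SPlus k V) :
    weightCoord v μ s = 0 := by
  rw [weightCoord, if_neg h, LinearMap.zero_apply]

theorem weightCoord_ind (J : Finset (Fin l)) (s : SPlus k V) :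
    weightCoord v (ind J) s = v.ExteriorAlgebra.coord J s.1 := by
  have e : (Finset.univ.filter fun i => ind J i = 1) = J := by
    ext i
    simp [ind]
  rw [weightCoord, if_pos (isIndicator_ind J), e]
  rfl

theorem weightCoord_plusVec {μ ν : Fin l → ℤ} (hν : IsIndicator ν) (eν : Even (∑ i, ν i)) :
    weightCoord v μ (plusVec v ν) = if μ = ν then 1 else 0 := by
  by_cases hμ : IsIndicator μ
  · obtain ⟨I, rfl⟩ := exists_ind hμ
    obtain ⟨J, rfl⟩ := exists_ind hν
    rw [weightCoord_ind, plusVec_coe v eν, weightVector_ind, Module.Basis.coord_apply,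
      Module.Basis.repr_self, Finsupp.single_apply]
    exact if_congr (by rw [ind_injective.eq_iff, eq_comm]) rfl rfl
  · rw [weightCoord_of_not v hμ, if_neg]
    rintro rfl
    exact hμ hν

theorem weightCoord_plusVec_self {ν : Fin l → ℤ} (hν : IsIndicator ν) (eν : Even (∑ i, ν i)) :
    weightCoord v ν (plusVec v ν) = 1 := by
  rw [weightCoord_plusVec v hν eν, if_pos rfl]

theorem weightCoord_plusVec_of_ne {μ ν : Fin l → ℤ} (hν : IsIndicator ν) (eν : Even (∑ i, ν i))
    (h : μ ≠ ν) : weightCoord v μ (plusVec v ν) = 0 := by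
  rw [weightCoord_plusVec v hν eν, if_neg h]

theorem eq_zero_of_weightCoord (h2 : (2 : k) ≠ 0) {s : SPlus k V}
    (h : ∀ J : Finset (Fin l), Even J.card → weightCoord v (ind J) s = 0) : s = 0 := by
  refine (plusBasis v h2).repr.map_eq_zero_iff.1 (Finsupp.ext fun J => ?_)
  have : (plusBasis v h2).coord J = weightCoord v (ind J.1) := by
    refine (plusBasis v h2).ext fun K => ?_
    have eK : Even (∑ i, ind K.1 i) := by rw [sum_ind]; exact_mod_cast K.2
    rw [Module.Basis.coord_apply, Module.Basis.repr_self, plusBasis_apply,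
      weightCoord_plusVec v (isIndicator_ind _) eK, Finsupp.single_apply]
    exact if_congr (by rw [ind_injective.eq_iff, eq_comm, Subtype.ext_iff]) rfl rfl
  exact (LinearMap.congr_fun this s).trans (h J.1 J.2)

/-- The transpose of `halfSpin_sigma_unitVec`: a coordinate after the action is a signed coordinate
before it, shifted back by the root. -/
theorem weightCoord_halfSpin (h2 : (2 : k) ≠ 0) {a b : Fin l × Bool} (hab : a.1 ≠ b.1)
    {μ : Fin l → ℤ} (hμ : IsIndicator μ) (s : SPlus k V) :
    weightCoord v μ (halfSpin v (sigma (unitVec v a) (unitVec v b)) s)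
      = -sgn k (lowForm (wt a + wt b) (μ - (wt a + wt b)) + lowForm (wt a) (wt b))
        * weightCoord v (μ - (wt a + wt b)) s := by
  have : weightCoord v μ ∘ₗ halfSpin v (sigma (unitVec v a) (unitVec v b))
      = -sgn k (lowForm (wt a + wt b) (μ - (wt a + wt b)) + lowForm (wt a) (wt b))
        • weightCoord v (μ - (wt a + wt b)) := by
    refine plus_ext v h2 fun ν hν eν => ?_
    rw [LinearMap.comp_apply, halfSpin_sigma_unitVec v h2 hab hν eν, map_smul,
      LinearMap.smul_apply]
    have eν' : Even (∑ i, (ν + wt a + wt b) i) := even_sum_add eν a b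
    by_cases h : μ - (wt a + wt b) = ν
    · obtain rfl : μ = ν + wt a + wt b := by rw [← h]; abel
      rw [h, weightCoord_plusVec_self v hν eν, weightCoord_plusVec_self v hμ eν',
        lowForm_add_left]
      congr 3
      ring
    · rw [weightCoord_plusVec_of_ne v hν eν h]
      by_cases hν' : IsIndicator (ν + wt a + wt b)
      · rw [weightCoord_plusVec_of_ne v hν' eν', smul_zero, smul_zero]
        rintro rfl
        exact h (by abel)
      · rw [plusVec_of_not v hν', map_zero, smul_zero, smul_zero]
  exact LinearMap.congr_fun this s

end WeightCoord

/-! ### Even subsets of six points -/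

section PairCoord

theorem lowForm_pair_eq_zero {l : ℕ} {p q : Fin l} (h : p < q) (r s : Bool) :
    lowForm (wt (p, r)) (wt (q, s)) = 0 := by
  rw [wt, lowForm_single_left, Finset.sum_eq_zero, mul_zero]
  intro j _
  split_ifs with hj
  · exact Pi.single_eq_of_ne (hj.trans h).ne _
  · rfl

/-- The counterpart of `pairSign_spec` for a lowering operator from degree four to degree two. -/
theorem pairSign_spec' (I J : Fin 15) :
    (pairSign I J = 0 ∧ ¬IsIndicator (pairWt I + pairWt J)) ∨
      (pairWt I + pairWt J = 1 - pairWt (pairThird I J) ∧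
        pairSign I J = if Even (lowForm (pairWt J) (pairWt I)
          + lowForm (pairWt (pairThird I J)) (1 - pairWt (pairThird I J))) then 1 else -1) := by
  revert I J
  decide

theorem isIndicator_pairWt (I : Fin 15) : IsIndicator (pairWt I) := by
  revert I; decide

theorem not_isIndicator_neg_pairWt (I : Fin 15) : ¬IsIndicator (-pairWt I) := by
  revert I; decide

theorem not_isIndicator_pairWt_sub {I J : Fin 15} (h : I ≠ J) :
    ¬IsIndicator (pairWt I - pairWt J) := by
  revert I J; decide

theorem odd_lowForm_pairWt (I : Fin 15) : Odd (lowForm (pairWt I) (pairWt I)) := by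
  revert I; decide

/-- An even subset of six points has 0, 2, 4 or 6 elements; Boolean functions make this a finite
check. -/
theorem weight_cases (b : Fin 6 → Bool) (h : Even (∑ i, if b i then (1 : ℤ) else 0)) :
    (fun i => if b i then (1 : ℤ) else 0) = 0
      ∨ (∃ I, (fun i => if b i then (1 : ℤ) else 0) = pairWt I)
      ∨ (∃ I, (fun i => if b i then (1 : ℤ) else 0) = 1 - pairWt I)
      ∨ (fun i => if b i then (1 : ℤ) else 0) = 1 := by
  revert b
  decide

theorem ind_cases {J : Finset (Fin 6)} (hJ : Even J.card) :
    ind J = 0 ∨ (∃ I, ind J = pairWt I) ∨ (∃ I, ind J = 1 - pairWt I) ∨ ind J = 1 := by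
  have e : ind J = fun i => if decide (i ∈ J) then (1 : ℤ) else 0 := by
    ext i
    simp [ind]
  have h : Even (∑ i, ind J i) := by rw [sum_ind]; exact_mod_cast hJ
  rw [e] at h ⊢
  exact weight_cases _ h

end PairCoord

end TypeD

namespace TypeD

open FreudenthalSpace (raise lower)

/-! ### The half-spin module for l = 6 as a Freudenthal space -/

section ToFreudenthal

variable {k V : Type*} [Field k] [AddCommGroup V] [Module k V] (v : Module.Basis (Fin 6) k V)

/-- The coordinates of degree two on `S⁺`, for `l = 6`. -/
noncomputable def pairCoord : SPlus k V →ₗ[k] (Fin 15 → k) :=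
  LinearMap.pi fun I => weightCoord v (pairWt I)

/-- The coordinates of degree four on `S⁺`, for `l = 6`. -/
noncomputable def copairCoord : SPlus k V →ₗ[k] (Fin 15 → k) :=
  -- The sign is that of v_I times the complementary monomial, so Λ⁴ is identified with the dual of
  -- Λ² by the wedge product.
  LinearMap.pi fun I =>
    sgn k (lowForm (pairWt I) (1 - pairWt I)) • weightCoord v (1 - pairWt I)

theorem pairCoord_apply (s : SPlus k V) (I : Fin 15) :
    pairCoord v s I = weightCoord v (pairWt I) s := rfl

theorem copairCoord_apply (s : SPlus k V) (I : Fin 15) : copairCoord v s I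
    = sgn k (lowForm (pairWt I) (1 - pairWt I)) * weightCoord v (1 - pairWt I) s := rfl

theorem sgn_ite (n : ℤ) : sgn k n = ((if Even n then 1 else -1 : ℤ) : k) := by
  split_ifs with h
  · rw [sgn_even h, Int.cast_one]
  · rw [sgn_odd (Int.not_even_iff_odd.1 h), Int.cast_neg, Int.cast_one]

variable (k V) in
/-- The raising operator that belongs to the `K`-th pair. -/
noncomputable def raiseOp (K : Fin 15) : So k V :=
  sigma (unitVec v (pairFst K, true)) (unitVec v (pairSnd K, true))

variable (k V) in
/-- The lowering operator that belongs to the `K`-th pair. -/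
noncomputable def lowerOp (K : Fin 15) : So k V :=
  sigma (unitVec v (pairFst K, false)) (unitVec v (pairSnd K, false))

theorem weightCoord_raiseOp (h2 : (2 : k) ≠ 0) (K : Fin 15) {μ : Fin 6 → ℤ} (hμ : IsIndicator μ)
    (s : SPlus k V) : weightCoord v μ (halfSpin v (raiseOp k V v K) s)
      = -sgn k (lowForm (pairWt K) (μ - pairWt K)) * weightCoord v (μ - pairWt K) s := by
  rw [raiseOp, weightCoord_halfSpin v h2 (pairFst_lt_pairSnd K).ne hμ,
    lowForm_pair_eq_zero (pairFst_lt_pairSnd K), add_zero]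
  rfl

theorem weightCoord_lowerOp (h2 : (2 : k) ≠ 0) (K : Fin 15) {μ : Fin 6 → ℤ} (hμ : IsIndicator μ)
    (s : SPlus k V) : weightCoord v μ (halfSpin v (lowerOp k V v K) s)
      = -sgn k (lowForm (pairWt K) (μ + pairWt K)) * weightCoord v (μ + pairWt K) s := by
  have e : wt (pairFst K, false) + wt (pairSnd K, false) = -pairWt K := by
    rw [pairWt, neg_add, ← wt_opp, ← wt_opp]
    rfl
  rw [lowerOp, weightCoord_halfSpin v h2 (pairFst_lt_pairSnd K).ne hμ,
    lowForm_pair_eq_zero (pairFst_lt_pairSnd K), add_zero, e, lowForm_neg_left, sgn_neg,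
    sub_neg_eq_add]

theorem weightCoord_zero_raiseOp (h2 : (2 : k) ≠ 0) (K : Fin 15) (s : SPlus k V) :
    weightCoord v 0 (halfSpin v (raiseOp k V v K) s) = 0 := by
  rw [weightCoord_raiseOp v h2 K isIndicator_zero, zero_sub,
    weightCoord_of_not v (not_isIndicator_neg_pairWt K), mul_zero]

theorem weightCoord_one_raiseOp (h2 : (2 : k) ≠ 0) (K : Fin 15) (s : SPlus k V) :
    weightCoord v 1 (halfSpin v (raiseOp k V v K) s) = -copairCoord v s K := by
  rw [weightCoord_raiseOp v h2 K isIndicator_one, copairCoord_apply, neg_mul]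

theorem pairCoord_raiseOp (h2 : (2 : k) ≠ 0) (K : Fin 15) (s : SPlus k V) :
    pairCoord v (halfSpin v (raiseOp k V v K) s)
      = -(weightCoord v 0 s • Pi.single K 1) := by
  funext I
  rw [pairCoord_apply, weightCoord_raiseOp v h2 K (isIndicator_pairWt I), Pi.neg_apply,
    Pi.smul_apply]
  by_cases h : I = K
  · rw [h, sub_self, sgn_even (by simp [lowForm]), Pi.single_eq_same]
    simp
  · rw [weightCoord_of_not v (not_isIndicator_pairWt_sub h), Pi.single_eq_of_ne h]
    simp

theorem copairCoord_raiseOp (h2 : (2 : k) ≠ 0) (K : Fin 15) (s : SPlus k V) :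
    copairCoord v (halfSpin v (raiseOp k V v K) s)
      = -pfaffian (Pi.single K 1) (pairCoord v s) := by
  funext I
  rw [copairCoord_apply, weightCoord_raiseOp v h2 K (isIndicator_pairWt I).one_sub, Pi.neg_apply,
    pfaffian_single, pairCoord_apply]
  rcases pairSign_spec I K with ⟨h, hn⟩ | ⟨h, hs⟩
  · rw [weightCoord_of_not v hn, h]
    simp
  · rw [hs, ← sgn_ite, sgn_add, h]
    ring

theorem weightCoord_one_lowerOp (h2 : (2 : k) ≠ 0) (K : Fin 15) (s : SPlus k V) :
    weightCoord v 1 (halfSpin v (lowerOp k V v K) s) = 0 := by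
  have : ¬IsIndicator (1 + pairWt K) := fun h => not_isIndicator_neg_pairWt K (by
    have := h.one_sub
    rwa [sub_add_cancel_left] at this)
  rw [weightCoord_lowerOp v h2 K isIndicator_one, weightCoord_of_not v this, mul_zero]

theorem weightCoord_zero_lowerOp (h2 : (2 : k) ≠ 0) (K : Fin 15) (s : SPlus k V) :
    weightCoord v 0 (halfSpin v (lowerOp k V v K) s) = pairCoord v s K := by
  rw [weightCoord_lowerOp v h2 K isIndicator_zero, zero_add, sgn_odd (odd_lowForm_pairWt K),
    neg_neg, one_mul, pairCoord_apply]

theorem pairCoord_lowerOp (h2 : (2 : k) ≠ 0) (K : Fin 15) (s : SPlus k V) :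
    pairCoord v (halfSpin v (lowerOp k V v K) s)
      = pfaffian (Pi.single K 1) (copairCoord v s) := by
  funext I
  rw [pairCoord_apply, weightCoord_lowerOp v h2 K (isIndicator_pairWt I), pfaffian_single,
    copairCoord_apply]
  rcases pairSign_spec' I K with ⟨h, hn⟩ | ⟨h, hs⟩
  · rw [weightCoord_of_not v hn, h]
    simp
  · rw [hs, ← sgn_ite, sgn_add, lowForm_add_right, sgn_add, sgn_odd (odd_lowForm_pairWt K), h,
      mul_assoc, ← mul_assoc (sgn k (lowForm (pairWt (pairThird I K)) _)), sgn_mul_self]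
    ring

theorem copairCoord_lowerOp (h2 : (2 : k) ≠ 0) (K : Fin 15) (s : SPlus k V) :
    copairCoord v (halfSpin v (lowerOp k V v K) s) = weightCoord v 1 s • Pi.single K 1 := by
  funext I
  rw [copairCoord_apply, weightCoord_lowerOp v h2 K (isIndicator_pairWt I).one_sub, Pi.smul_apply]
  by_cases h : I = K
  · subst h
    rw [sub_add_cancel, Pi.single_eq_same, ← mul_assoc, mul_neg, ← sgn_add,
      ← lowForm_add_right, smul_eq_mul, mul_one]
    have e : (1 - pairWt I + 1 : Fin 6 → ℤ) = (1 + 1) - pairWt I := by abel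
    rw [e, sub_eq_add_neg, lowForm_add_right, lowForm_neg_right, lowForm_add_right, sgn_add,
      sgn_even (Even.add_self _), sgn_neg, sgn_odd (odd_lowForm_pairWt I)]
    ring
  · have hn : ¬IsIndicator (1 - pairWt I + pairWt K) := fun hi => by
      have := hi.one_sub
      have e : (1 - (1 - pairWt I + pairWt K) : Fin 6 → ℤ) = pairWt I - pairWt K := by abel
      rw [e] at this
      exact not_isIndicator_pairWt_sub h this
    rw [weightCoord_of_not v hn, Pi.single_eq_of_ne h]
    simp

/-- The isomorphism of the half-spin module of `so₁₂` with the Freudenthal triple system. -/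
noncomputable def toFreudenthal (ι : k) : SPlus k V →ₗ[k] FreudenthalSpace k (QuatHerm k) :=
  -- With the scalars -2, 1, -½, ¼ the raising operators become `raise` of ½θ(ι) and the lowering
  -- operators `lower` of -2θ(-ι) at the unit vectors. The product -½ of the outer scalars gives the
  -- triple product of the two extreme vectors the eigenvalue 3/2 = l/4 on the lowest one.
  ((-2 : k) • weightCoord v 0).prod ((theta ι ∘ₗ pairCoord v).prod
    ((-(1 / 2 : k) • theta (-ι) ∘ₗ copairCoord v).prod ((1 / 4 : k) • weightCoord v 1)))

theorem toFreudenthal_apply (ι : k) (s : SPlus k V) : toFreudenthal v ι s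
    = (-2 * weightCoord v 0 s, theta ι (pairCoord v s),
      -(1 / 2 : k) • theta (-ι) (copairCoord v s), (1 / 4) * weightCoord v 1 s) := rfl

theorem toFreudenthal_raiseOp (h2 : (2 : k) ≠ 0) {ι : k} (hι : ι * ι = -1) (K : Fin 15)
    (s : SPlus k V) : toFreudenthal v ι (halfSpin v (raiseOp k V v K) s)
      = raise QuatHerm.trForm QuatHerm.cross ((1 / 2 : k) • theta ι (Pi.single K 1))
        (toFreudenthal v ι s) := by
  rw [toFreudenthal_apply, toFreudenthal_apply, weightCoord_zero_raiseOp v h2,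
    weightCoord_one_raiseOp v h2, pairCoord_raiseOp v h2, copairCoord_raiseOp v h2, raise]
  have e4 : (4 : k) = 2 * 2 := by norm_num
  refine Prod.ext (mul_zero _) (Prod.ext ?_ (Prod.ext ?_ ?_))
  · dsimp only
    have : (-2 * weightCoord v 0 s * (1 / 2) : k) = -weightCoord v 0 s := by field_simp
    rw [map_neg, map_smul, smul_smul, this]
    exact (neg_smul _ _).symm
  · dsimp only
    rw [map_smul, LinearMap.smul_apply, cross_theta h2 hι, map_neg, smul_neg, neg_smul, neg_neg]
  · dsimp only
    rw [map_smul, map_smul, LinearMap.smul_apply, trForm_theta h2 hι, Finset.sum_eq_single K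
      (fun J _ hJ => by rw [Pi.single_eq_of_ne hJ, zero_mul])
      (fun h => absurd (Finset.mem_univ _) h), Pi.single_eq_same, e4, smul_eq_mul, smul_eq_mul]
    field_simp

theorem toFreudenthal_lowerOp (h2 : (2 : k) ≠ 0) {ι : k} (hι : ι * ι = -1) (K : Fin 15)
    (s : SPlus k V) : toFreudenthal v ι (halfSpin v (lowerOp k V v K) s)
      = lower QuatHerm.trForm QuatHerm.cross ((-2 : k) • theta (-ι) (Pi.single K 1))
        (toFreudenthal v ι s) := by
  rw [toFreudenthal_apply, toFreudenthal_apply, weightCoord_zero_lowerOp v h2,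
    weightCoord_one_lowerOp v h2, pairCoord_lowerOp v h2, copairCoord_lowerOp v h2, lower]
  have e4 : (4 : k) = 2 * 2 := by norm_num
  have hι' : -ι * -ι = -1 := by rw [neg_mul_neg, hι]
  refine Prod.ext ?_ (Prod.ext ?_ (Prod.ext ?_ (mul_zero _)))
  · dsimp only
    rw [map_smul, LinearMap.smul_apply, QuatHerm.trForm_comm, trForm_theta h2 hι,
      Finset.sum_eq_single K
      (fun J _ hJ => by rw [Pi.single_eq_of_ne hJ, mul_zero])
      (fun h => absurd (Finset.mem_univ _) h), Pi.single_eq_same, smul_eq_mul, mul_one]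
  · dsimp only
    rw [map_smul, map_smul, LinearMap.smul_apply, cross_theta h2 hι', neg_neg, smul_smul]
    have : (-(1 / 2) * -2 : k) = 1 := by field_simp
    rw [this, one_smul]
  · dsimp only
    rw [map_smul, smul_smul, smul_smul, e4]
    congr 1
    field_simp

theorem toFreudenthal_injective (h2 : (2 : k) ≠ 0) {ι : k} (hι : ι * ι = -1) :
    Function.Injective (toFreudenthal v ι) := by
  have hι' : -ι * -ι = -1 := by rw [neg_mul_neg, hι]
  have h4 : (4 : k) ≠ 0 := by
    have e4 : (4 : k) = 2 * 2 := by norm_num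
    rw [e4]
    exact mul_ne_zero h2 h2
  rw [← LinearMap.ker_eq_bot, LinearMap.ker_eq_bot']
  intro s hs
  rw [toFreudenthal_apply, Prod.mk_eq_zero, Prod.mk_eq_zero, Prod.mk_eq_zero] at hs
  obtain ⟨h0, hA, hB, h1⟩ := hs
  replace h0 := (mul_eq_zero.1 h0).resolve_left (neg_ne_zero.2 h2)
  replace h1 := (mul_eq_zero.1 h1).resolve_left (one_div_ne_zero h4)
  replace hA := (map_eq_zero_iff _ (theta_injective h2 hι)).1 hA
  replace hB := (map_eq_zero_iff _ (theta_injective h2 hι')).1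
    ((smul_eq_zero.1 hB).resolve_left (neg_ne_zero.2 (one_div_ne_zero h2)))
  refine eq_zero_of_weightCoord v h2 fun J hJ => ?_
  rcases ind_cases hJ with h | ⟨I, h⟩ | ⟨I, h⟩ | h
  · rw [h, h0]
  · rw [h]
    exact congrFun hA I
  · rw [h]
    exact (mul_eq_zero.1 (congrFun hB I)).resolve_left (sgn_ne_zero _)
  · rw [h, h1]

theorem toFreudenthal_bijective (h2 : (2 : k) ≠ 0) {ι : k} (hι : ι * ι = -1) :
    Function.Bijective (toFreudenthal v ι) := by
  let f := LinearEquiv.ofBijective (theta ι) ⟨theta_injective h2 hι, theta_surjective h2 hι⟩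
  have : Module.Finite k (QuatHerm k) := Module.Finite.equiv f
  have : Module.Finite k (SPlus k V) := (plusBasis v h2).finiteDimensional_of_finite
  have hf : Module.finrank k (QuatHerm k) = 15 := by
    rw [← f.finrank_eq, Module.finrank_fin_fun]
  refine ⟨toFreudenthal_injective v h2 hι,
    (LinearMap.injective_iff_surjective_of_finrank_eq_finrank ?_).1
      (toFreudenthal_injective v h2 hι)⟩
  rw [Module.finrank_prod, Module.finrank_prod, Module.finrank_prod, hf, Module.finrank_self,
    finrank_plus v h2]
  rfl

end ToFreudenthal

end TypeD

/-! ### The defect of a homomorphism of triple systems -/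

namespace FreudenthalSpace

variable {k J M : Type*} [CommRing k] [AddCommGroup J] [Module k J] [AddCommGroup M] [Module k M]
  (t : J →ₗ[k] J →ₗ[k] k) (c : J →ₗ[k] J →ₗ[k] J) (τ : M →ₗ[k] M →ₗ[k] M →ₗ[k] M)
  (f : M →ₗ[k] FreudenthalSpace k J)

/-- The bilinear map `(x, y) ↦ d_{x,y}` with values in the endomorphisms. -/
def dEnd : FreudenthalSpace k J →ₗ[k] FreudenthalSpace k J →ₗ[k]
    Module.End k (FreudenthalSpace k J) :=
  (dMap t c).compr₂ (inder t c).toSubmodule.subtype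

/-- The deviation of a linear map from a homomorphism of triple systems. -/
def defect : M →ₗ[k] M →ₗ[k] M →ₗ[k] FreudenthalSpace k J :=
  LinearMap.mk₂ k (fun x y => f ∘ₗ τ x y - dEnd t c (f x) (f y) ∘ₗ f)
    (fun x x' y => by
      rw [map_add, map_add, map_add, LinearMap.add_apply, LinearMap.add_apply, LinearMap.comp_add,
        LinearMap.add_comp, add_sub_add_comm])
    (fun r x y => by
      rw [map_smul, map_smul, map_smul, LinearMap.smul_apply, LinearMap.smul_apply,
        LinearMap.comp_smul, LinearMap.smul_comp, smul_sub])
    (fun x y y' => by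
      rw [map_add, map_add, map_add, LinearMap.comp_add, LinearMap.add_comp, add_sub_add_comm])
    (fun r x y => by
      rw [map_smul, map_smul, map_smul, LinearMap.comp_smul, LinearMap.smul_comp, smul_sub])

theorem defect_apply (x y z : M) :
    defect t c τ f x y z = f (τ x y z) - triple t c (f x) (f y) (f z) := rfl

end FreudenthalSpace

namespace TypeD

section PairWeights

variable (I : Fin 15)

theorem zero_ne_pairWt : 0 ≠ pairWt I := by revert I; decide

theorem one_ne_pairWt : 1 ≠ pairWt I := by revert I; decide

theorem zero_ne_one_sub_pairWt : 0 ≠ 1 - pairWt I := by revert I; decide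

theorem one_ne_one_sub_pairWt : 1 ≠ 1 - pairWt I := by revert I; decide

theorem sum_pairWt : ∑ i, pairWt I i = 2 := by revert I; decide

theorem sum_one_sub_pairWt : ∑ i, (1 - pairWt I) i = 4 := by revert I; decide

variable {I}

theorem pairWt_ne {J : Fin 15} (h : I ≠ J) : pairWt I ≠ pairWt J := by revert I J; decide

theorem one_sub_pairWt_ne {J : Fin 15} (h : I ≠ J) : 1 - pairWt I ≠ 1 - pairWt J :=
  fun e => pairWt_ne h (sub_right_injective e)

theorem one_sub_pairWt_ne_pairWt (I J : Fin 15) : 1 - pairWt I ≠ pairWt J := by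
  revert I J; decide

end PairWeights

open FreudenthalSpace (raise lower triple dOp dMap inder)

/-! ### The defect for the two extreme weight vectors -/

section TripleProduct

variable {k V : Type*} [Field k] [AddCommGroup V] [Module k V] (v : Module.Basis (Fin 6) k V)

/-- The deviation of `toFreudenthal` from a homomorphism of triple systems. -/
noncomputable def tripleDefect (ι : k) : SPlus k V →ₗ[k] SPlus k V →ₗ[k] SPlus k V →ₗ[k]
    FreudenthalSpace k (QuatHerm k) :=
  FreudenthalSpace.defect QuatHerm.trForm QuatHerm.cross (spinTriple v) (toFreudenthal v ι)

theorem tripleDefect_apply (ι : k) (s t u : SPlus k V) : tripleDefect v ι s t u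
    = toFreudenthal v ι (spinTriple v s t u) - triple QuatHerm.trForm QuatHerm.cross
      (toFreudenthal v ι s) (toFreudenthal v ι t) (toFreudenthal v ι u) :=
  FreudenthalSpace.defect_apply _ _ _ _ _ _ _

theorem tripleDefect_comm (h2 : (2 : k) ≠ 0) (ι : k) (s t u : SPlus k V) :
    tripleDefect v ι s t u = tripleDefect v ι t s u := by
  have h : oddBracket v s t = oddBracket v t s := by
    rw [oddBracket_comm v h2 t s, show epsilon k 6 = -1 from epsilon_four_mul_add_two 1, neg_neg,
      one_smul]
  rw [tripleDefect_apply, tripleDefect_apply, FreudenthalSpace.triple_comm QuatHerm.cross_comm,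
    spinTriple_apply, spinTriple_apply, h]

theorem exists_raiseOp_eq {p q : Fin 6} (h : p ≠ q) : ∃ K, ∃ r : k,
    sigma (unitVec v (p, true)) (unitVec v (q, true)) = r • raiseOp k V v K := by
  rcases lt_or_gt_of_ne h with h | h
  · obtain ⟨K, rfl, rfl⟩ := exists_pair h
    exact ⟨K, 1, (one_smul _ _).symm⟩
  · obtain ⟨K, rfl, rfl⟩ := exists_pair h
    exact ⟨K, -1, by rw [neg_one_smul]; exact sigma_swap _ _⟩

theorem exists_lowerOp_eq {p q : Fin 6} (h : p ≠ q) : ∃ K, ∃ r : k,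
    sigma (unitVec v (p, false)) (unitVec v (q, false)) = r • lowerOp k V v K := by
  rcases lt_or_gt_of_ne h with h | h
  · obtain ⟨K, rfl, rfl⟩ := exists_pair h
    exact ⟨K, 1, (one_smul _ _).symm⟩
  · obtain ⟨K, rfl, rfl⟩ := exists_pair h
    exact ⟨K, -1, by rw [neg_one_smul]; exact sigma_swap _ _⟩

theorem toFreudenthal_zero (ι : k) : toFreudenthal v ι (plusVec v 0) = (-2, 0, 0, 0) := by
  have hA : pairCoord v (plusVec v 0) = 0 := funext fun I =>
    weightCoord_plusVec_of_ne v isIndicator_zero even_sum_zero (by revert I; decide)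
  have hB : copairCoord v (plusVec v 0) = 0 := funext fun I => by
    rw [copairCoord_apply, weightCoord_plusVec_of_ne v isIndicator_zero even_sum_zero
      (by revert I; decide), mul_zero]
    rfl
  rw [toFreudenthal_apply, hA, hB, weightCoord_plusVec_self v isIndicator_zero even_sum_zero,
    weightCoord_plusVec_of_ne v isIndicator_zero even_sum_zero (by decide), map_zero, map_zero,
    smul_zero, mul_zero, mul_one]

theorem toFreudenthal_one (ι : k) : toFreudenthal v ι (plusVec v 1) = (0, 0, 0, 1 / 4) := by
  have he : Even (∑ i, (1 : Fin 6 → ℤ) i) := even_sum_one (by decide)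
  have hA : pairCoord v (plusVec v 1) = 0 := funext fun I =>
    weightCoord_plusVec_of_ne v isIndicator_one he (by revert I; decide)
  have hB : copairCoord v (plusVec v 1) = 0 := funext fun I => by
    rw [copairCoord_apply, weightCoord_plusVec_of_ne v isIndicator_one he
      (by revert I; decide), mul_zero]
    rfl
  rw [toFreudenthal_apply, hA, hB, weightCoord_plusVec_self v isIndicator_one he,
    weightCoord_plusVec_of_ne v isIndicator_one he (by decide), map_zero, map_zero,
    smul_zero, mul_zero, mul_one]

theorem toFreudenthal_pair (ι : k) (I : Fin 15) :
    toFreudenthal v ι (plusVec v (pairWt I)) = (0, theta ι (Pi.single I 1), 0, 0) := by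
  have he : Even (∑ i, pairWt I i) := by rw [sum_pairWt]; decide
  have hA : pairCoord v (plusVec v (pairWt I)) = Pi.single I 1 := funext fun J => by
    by_cases h : J = I
    · rw [h, Pi.single_eq_same]
      exact weightCoord_plusVec_self v (isIndicator_pairWt I) he
    · rw [Pi.single_eq_of_ne h]
      exact weightCoord_plusVec_of_ne v (isIndicator_pairWt I) he (pairWt_ne h)
  have hB : copairCoord v (plusVec v (pairWt I)) = 0 := funext fun J => by
    rw [copairCoord_apply, weightCoord_plusVec_of_ne v (isIndicator_pairWt I) he
      (one_sub_pairWt_ne_pairWt J I), mul_zero]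
    rfl
  rw [toFreudenthal_apply, hA, hB,
    weightCoord_plusVec_of_ne v (isIndicator_pairWt I) he (zero_ne_pairWt I),
    weightCoord_plusVec_of_ne v (isIndicator_pairWt I) he (one_ne_pairWt I), map_zero,
    smul_zero, mul_zero, mul_zero]

theorem toFreudenthal_copair (ι : k) (I : Fin 15) :
    ∃ r : k, toFreudenthal v ι (plusVec v (1 - pairWt I))
      = (0, 0, r • theta (-ι) (Pi.single I 1), 0) := by
  have hi := (isIndicator_pairWt I).one_sub
  have he : Even (∑ i, (1 - pairWt I) i) := by rw [sum_one_sub_pairWt]; decide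
  have hB : copairCoord v (plusVec v (1 - pairWt I))
      = sgn k (lowForm (pairWt I) (1 - pairWt I)) • Pi.single I 1 := funext fun J => by
    rw [copairCoord_apply, Pi.smul_apply]
    by_cases h : J = I
    · rw [h, Pi.single_eq_same, weightCoord_plusVec_self v hi he, smul_eq_mul]
    · rw [Pi.single_eq_of_ne h, smul_zero,
        weightCoord_plusVec_of_ne v hi he (one_sub_pairWt_ne h), mul_zero]
  have hA : pairCoord v (plusVec v (1 - pairWt I)) = 0 := funext fun J =>
    weightCoord_plusVec_of_ne v hi he (one_sub_pairWt_ne_pairWt I J).symm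
  refine ⟨-(1 / 2 : k) * sgn k (lowForm (pairWt I) (1 - pairWt I)), ?_⟩
  rw [toFreudenthal_apply, hA, hB,
    weightCoord_plusVec_of_ne v hi he (zero_ne_one_sub_pairWt I),
    weightCoord_plusVec_of_ne v hi he (one_ne_one_sub_pairWt I), map_zero,
    mul_zero, mul_zero, map_smul, smul_smul]

theorem triple_zero_one (h2 : (2 : k) ≠ 0) (z : FreudenthalSpace k (QuatHerm k)) :
    triple QuatHerm.trForm QuatHerm.cross (-2, 0, 0, 0) (0, 0, 0, 1 / 4) z
      = ((3 / 2) * z.1, (1 / 2 : k) • z.2.1, -(1 / 2 : k) • z.2.2.1, -(3 / 2) * z.2.2.2) := by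
  have e4 : (4 : k) = 2 * 2 := by norm_num
  obtain ⟨α, a, b, β⟩ := z
  simp only [triple, FreudenthalSpace.tripleScalar, FreudenthalSpace.tripleVector,
    FreudenthalSpace.swap, map_zero, LinearMap.zero_apply, smul_zero, mul_zero, zero_mul,
    add_zero, zero_add, sub_zero, e4]
  refine Prod.ext ?_ (Prod.ext ?_ (Prod.ext ?_ ?_))
  · dsimp only; field_simp
  · dsimp only; congr 1; field_simp
  · have e : (-(1 / (2 * 2) * -2) : k) = 1 / 2 := by field_simp
    dsimp only
    rw [e]
    exact (neg_smul _ _).symm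
  · dsimp only; field_simp

/-- Both triple products with the two extreme vectors are diagonal, with the eigenvalues 3/2, ½, -½,
-3/2 in degrees 0, 2, 4, 6. -/
theorem tripleDefect_zero_one (h2 : (2 : k) ≠ 0) (ι : k) :
    tripleDefect v ι (plusVec v 0) (plusVec v 1) = 0 := by
  have e4 : (4 : k) = 2 * 2 := by norm_num
  refine plus_ext v h2 fun μ hμ eμ => ?_
  obtain ⟨J, rfl⟩ := exists_ind hμ
  have eJ : Even J.card := by rw [sum_ind] at eμ; exact_mod_cast eμ
  rw [tripleDefect_apply, toFreudenthal_zero, toFreudenthal_one, triple_zero_one h2,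
    spinTriple_zero_one v h2 (by decide) eJ, map_smul, LinearMap.zero_apply, sub_eq_zero]
  have hJ : (J.card : ℤ) = ∑ i, ind J i := (sum_ind J).symm
  rcases ind_cases eJ with h | ⟨I, h⟩ | ⟨I, h⟩ | h
  · have hc : J.card = 0 := by
      rw [h] at hJ
      simpa using hJ
    rw [h, hc, toFreudenthal_zero, Prod.smul_mk, Prod.smul_mk, Prod.smul_mk]
    simp only [smul_zero, mul_zero, smul_eq_mul]
    congr 1
    rw [e4]
    field_simp
    norm_num
  · have hc : J.card = 2 := by
      rw [h, sum_pairWt] at hJ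
      exact_mod_cast hJ
    rw [h, hc, toFreudenthal_pair, Prod.smul_mk, Prod.smul_mk, Prod.smul_mk]
    simp only [smul_zero, mul_zero]
    congr 3
    rw [e4]
    field_simp
    norm_num
  · have hc : J.card = 4 := by
      rw [h, sum_one_sub_pairWt] at hJ
      exact_mod_cast hJ
    obtain ⟨r, hr⟩ := toFreudenthal_copair v ι I
    rw [h, hc, hr, Prod.smul_mk, Prod.smul_mk, Prod.smul_mk]
    simp only [smul_zero, mul_zero]
    congr 4
    rw [e4]
    field_simp
    norm_num
  · have hc : J.card = 6 := by
      have e : ∑ i, (1 : Fin 6 → ℤ) i = 6 := by decide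
      rw [h, e] at hJ
      exact_mod_cast hJ
    rw [h, hc, toFreudenthal_one, Prod.smul_mk, Prod.smul_mk, Prod.smul_mk]
    simp only [smul_zero, mul_zero, smul_eq_mul]
    congr 3
    rw [e4]
    field_simp
    norm_num

end TripleProduct

end TypeD

namespace FreudenthalSpace

/-! ### From triple products to superalgebras -/

section Iso

variable {k J L M : Type*} [CommRing k] [AddCommGroup J] [Module k J] [AddCommGroup M] [Module k M]
  [LieRing L] [LieAlgebra k L] {t : J →ₗ[k] J →ₗ[k] k} {c : J →ₗ[k] J →ₗ[k] J}

theorem triple_zero_left (y z : FreudenthalSpace k J) : triple t c 0 y z = 0 := by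
  change dEnd t c 0 y z = 0
  rw [map_zero, LinearMap.zero_apply, LinearMap.zero_apply]

/-- A faithful module whose odd product realizes the triple product of a Freudenthal triple system
gives the superalgebra of this triple system. -/
theorem ofAction_iso_superalgebra (ρ : L →ₗ[k] M →ₗ[k] M) (β : M →ₗ[k] M →ₗ[k] L)
    (f : M ≃ₗ[k] FreudenthalSpace k J)
    (hρ : ∀ x y s, ρ ⁅x, y⁆ s = ρ x (ρ y s) - ρ y (ρ x s))
    (hfaithful : ∀ x, ρ x = 0 → x = 0)
    (hspan : ∀ P : Submodule k L, (∀ s u, β s u ∈ P) → P = ⊤)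
    (hf : ∀ s u w, f (ρ (β s u) w) = triple t c (f s) (f u) (f w)) :
    (Z2Algebra.ofAction ρ β).Iso (superalgebra t c) := by
  let φ : L →ₗ[k] Module.End k (FreudenthalSpace k J) := f.conj.toLinearMap ∘ₗ ρ
  have hφ : ∀ x s, φ x (f s) = f (ρ x s) := fun x s => by
    change f (ρ x (f.symm (f s))) = _
    rw [f.symm_apply_apply]
  have hβ : ∀ s u, φ (β s u) = dOp t c (f s) (f u) := fun s u => LinearMap.ext fun z => by
    obtain ⟨w, rfl⟩ := f.surjective z
    rw [hφ, hf]
    rfl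
  have hlie : ∀ x y, φ ⁅x, y⁆ = ⁅φ x, φ y⁆ := fun x y => LinearMap.ext fun z => by
    obtain ⟨w, rfl⟩ := f.surjective z
    rw [hφ, hρ, map_sub, Ring.lie_def, LinearMap.sub_apply, Module.End.mul_apply,
      Module.End.mul_apply, hφ, hφ, hφ, hφ]
  have hmem : ∀ x, φ x ∈ inder t c := by
    have := hspan ((inder t c).toSubmodule.comap φ) fun s u => by
      rw [Submodule.mem_comap, hβ]
      exact LieSubalgebra.subset_lieSpan ⟨_, _, rfl⟩
    exact fun x => (this.symm ▸ Submodule.mem_top : x ∈ (inder t c).toSubmodule.comap φ)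
  -- The image of `φ` is closed under brackets and contains all d_{x,y}, hence contains the Lie
  -- algebra they generate; the opposite inclusion holds because the odd products span `L`.
  let R : LieSubalgebra k (Module.End k (FreudenthalSpace k J)) :=
    { LinearMap.range φ with
      lie_mem' := by
        rintro _ _ ⟨x, rfl⟩ ⟨y, rfl⟩
        exact ⟨⁅x, y⁆, hlie x y⟩ }
  have hR : inder t c ≤ R := by
    refine LieSubalgebra.lieSpan_le.2 ?_
    rintro _ ⟨x, y, rfl⟩
    obtain ⟨s, rfl⟩ := f.surjective x
    obtain ⟨u, rfl⟩ := f.surjective y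
    exact ⟨β s u, hβ s u⟩
  let e : L ≃ₗ[k] inder t c := LinearEquiv.ofBijective (φ.codRestrict (inder t c).toSubmodule hmem)
    ⟨(injective_iff_map_eq_zero _).2 fun x hx => hfaithful x <| LinearMap.ext fun s => by
      have h0 : φ x = 0 := congrArg Subtype.val hx
      refine f.injective ?_
      rw [← hφ, h0, LinearMap.zero_apply, LinearMap.zero_apply, map_zero],
    fun D => by
      obtain ⟨x, hx⟩ := hR D.2
      exact ⟨x, Subtype.ext hx⟩⟩
  refine ⟨e, f, fun x y => Subtype.ext (hlie x y), fun x s => (hφ x s).symm, fun s x => ?_,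
    fun s u => Subtype.ext (hβ s u)⟩
  change f (-(ρ x s)) = -(φ x (f s))
  rw [map_neg, hφ]

end Iso

end FreudenthalSpace

namespace TypeD

open FreudenthalSpace (raise lower triple triple_zero_left raise_triple_scalar lower_triple_scalar
  raise_triple_scalar' lower_triple_scalar')

/-! ### Vanishing of the defect -/

section TripleProduct

variable {k V : Type*} [Field k] [AddCommGroup V] [Module k V] (v : Module.Basis (Fin 6) k V)

/-- Apply `A` to the equation expressed by `h`. Equivariance on one side and the Leibniz rule on the
other leave three terms each, and those with `A` in the last slot agree by `h` itself. -/
theorem tripleDefect_halfSpin (h2 : (2 : k) ≠ 0) {ι : k} {A : So k V}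
    {F : FreudenthalSpace k (QuatHerm k) → FreudenthalSpace k (QuatHerm k)}
    (hA : ∀ s, toFreudenthal v ι (halfSpin v A s) = F (toFreudenthal v ι s)) {s t : SPlus k V}
    (hF : ∀ y z, F (triple QuatHerm.trForm QuatHerm.cross (toFreudenthal v ι s) y z)
      = triple QuatHerm.trForm QuatHerm.cross (F (toFreudenthal v ι s)) y z
        + triple QuatHerm.trForm QuatHerm.cross (toFreudenthal v ι s) (F y) z
        + triple QuatHerm.trForm QuatHerm.cross (toFreudenthal v ι s) y (F z))
    (h : tripleDefect v ι s t = 0) :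
    tripleDefect v ι (halfSpin v A s) t + tripleDefect v ι s (halfSpin v A t) = 0 := by
  refine LinearMap.ext fun u => ?_
  have h' : ∀ u, toFreudenthal v ι (spinTriple v s t u) = triple QuatHerm.trForm QuatHerm.cross
      (toFreudenthal v ι s) (toFreudenthal v ι t) (toFreudenthal v ι u) := fun u =>
    sub_eq_zero.1 (LinearMap.congr_fun h u)
  have e := congrArg (toFreudenthal v ι) (halfSpin_spinTriple v h2 A s t u)
  rw [map_add, map_add, hA, h', h', hF, hA] at e
  rw [LinearMap.add_apply, tripleDefect_apply, tripleDefect_apply, hA, hA, LinearMap.zero_apply]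
  rw [sub_add_sub_comm, sub_eq_zero]
  exact (add_right_cancel e).symm

theorem halfSpin_lowerOp_zero (h2 : (2 : k) ≠ 0) {ι : k} (hι : ι * ι = -1) (K : Fin 15) :
    halfSpin v (lowerOp k V v K) (plusVec v 0) = 0 := by
  refine toFreudenthal_injective v h2 hι ?_
  rw [toFreudenthal_lowerOp v h2 hι, toFreudenthal_zero, map_zero, lower]
  simp only [map_zero, zero_smul]
  rfl

theorem halfSpin_raiseOp_one (h2 : (2 : k) ≠ 0) {ι : k} (hι : ι * ι = -1) (K : Fin 15) :
    halfSpin v (raiseOp k V v K) (plusVec v 1) = 0 := by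
  refine toFreudenthal_injective v h2 hι ?_
  rw [toFreudenthal_raiseOp v h2 hι, toFreudenthal_one, map_zero, raise]
  simp only [map_zero, zero_smul]
  rfl

/-- Lowering kills e_0, so vanishing spreads in the second argument from e_1 to all of S⁺, as in
`trilinear_eq_zero`. -/
theorem tripleDefect_zero (h2 : (2 : k) ≠ 0) {ι : k} (hι : ι * ι = -1) :
    tripleDefect v ι (plusVec v 0) = 0 := by
  refine LinearMap.ker_eq_top.1 (eq_top_of_lowering v h2 (by decide)
    (tripleDefect_zero_one v h2 ι) fun p q hpq t ht => ?_)
  obtain ⟨K, r, hr⟩ := exists_lowerOp_eq (k := k) v hpq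
  rw [hr, halfSpin_smul]
  refine Submodule.smul_mem _ _ ?_
  have h0 := halfSpin_lowerOp_zero v h2 hι K
  have := tripleDefect_halfSpin v h2 (toFreudenthal_lowerOp v h2 hι K) (s := plusVec v 0)
    (fun y z => by
      rw [← toFreudenthal_lowerOp v h2 hι, h0, map_zero, triple_zero_left, zero_add,
        toFreudenthal_zero, lower_triple_scalar QuatHerm.cross_comm QuatHerm.trForm_cross]) ht
  rwa [h0, map_zero, LinearMap.zero_apply, zero_add] at this

/-- The mirror image: symmetry of the defect provides the pair (e_1, e_0), and raising operators,
which kill e_1, spread from e_0. -/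
theorem tripleDefect_one (h2 : (2 : k) ≠ 0) {ι : k} (hι : ι * ι = -1) :
    tripleDefect v ι (plusVec v 1) = 0 := by
  refine LinearMap.ker_eq_top.1 (eq_top_of_raising v h2 ?_ fun p q hpq t ht => ?_)
  · refine LinearMap.ext fun u => ?_
    rw [tripleDefect_comm v h2, tripleDefect_zero_one v h2]
  obtain ⟨K, r, hr⟩ := exists_raiseOp_eq (k := k) v hpq
  rw [hr, halfSpin_smul]
  refine Submodule.smul_mem _ _ ?_
  have h0 := halfSpin_raiseOp_one v h2 hι K
  have := tripleDefect_halfSpin v h2 (toFreudenthal_raiseOp v h2 hι K) (s := plusVec v 1)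
    (fun y z => by
      rw [← toFreudenthal_raiseOp v h2 hι, h0, map_zero, triple_zero_left, zero_add,
        toFreudenthal_one, raise_triple_scalar' QuatHerm.cross_comm QuatHerm.trForm_cross]) ht
  rwa [h0, map_zero, LinearMap.zero_apply, zero_add] at this

/-- The defect with first argument e_0 vanishes identically, so of the two terms of
`tripleDefect_halfSpin` only the one with e_0 raised is left. -/
theorem tripleDefect_raiseOp_zero (h2 : (2 : k) ≠ 0) {ι : k} (hι : ι * ι = -1) (I : Fin 15) :
    tripleDefect v ι (halfSpin v (raiseOp k V v I) (plusVec v 0)) = 0 := by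
  have h0 := tripleDefect_zero v h2 hι
  refine LinearMap.ext fun t => ?_
  have := tripleDefect_halfSpin v h2 (toFreudenthal_raiseOp v h2 hι I) (s := plusVec v 0)
    (t := t) (fun y z => by
      rw [toFreudenthal_zero, raise_triple_scalar QuatHerm.trForm_comm QuatHerm.cross_comm
        QuatHerm.trForm_cross]) (by rw [h0, LinearMap.zero_apply])
  rw [h0, LinearMap.zero_apply, add_zero] at this
  rw [this, LinearMap.zero_apply]

theorem tripleDefect_lowerOp_one (h2 : (2 : k) ≠ 0) {ι : k} (hι : ι * ι = -1) (I : Fin 15) :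
    tripleDefect v ι (halfSpin v (lowerOp k V v I) (plusVec v 1)) = 0 := by
  have h1 := tripleDefect_one v h2 hι
  refine LinearMap.ext fun t => ?_
  have := tripleDefect_halfSpin v h2 (toFreudenthal_lowerOp v h2 hι I) (s := plusVec v 1)
    (t := t) (fun y z => by
      rw [toFreudenthal_one, lower_triple_scalar' QuatHerm.trForm_comm QuatHerm.cross_comm
        QuatHerm.trForm_cross]) (by rw [h1, LinearMap.zero_apply])
  rw [h1, LinearMap.zero_apply, add_zero] at this
  rw [this, LinearMap.zero_apply]

/-- For l = 6 every weight vector is e_0, e_1, one raising step away from e_0 or one lowering step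
away from e_1. Hence Leibniz rules with extreme first argument are enough. -/
theorem tripleDefect_eq_zero (h2 : (2 : k) ≠ 0) {ι : k} (hι : ι * ι = -1) :
    tripleDefect v ι = 0 := by
  refine LinearMap.ker_eq_top.1 (eq_top_of_plusVec_mem v h2 fun μ hμ eμ => ?_)
  obtain ⟨J, rfl⟩ := exists_ind hμ
  have eJ : Even J.card := by rw [sum_ind] at eμ; exact_mod_cast eμ
  rcases ind_cases eJ with h | ⟨I, h⟩ | ⟨I, h⟩ | h
  · rw [h]
    exact LinearMap.mem_ker.2 (tripleDefect_zero v h2 hι)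
  · have e : ind J = 0 + wt (pairFst I, true) + wt (pairSnd I, true) := by
      rw [h, zero_add]
      rfl
    have hm := LinearMap.mem_ker.2 (tripleDefect_raiseOp_zero v h2 hι I)
    rw [raiseOp] at hm
    rw [e]
    exact mem_of_halfSpin_sigma_mem v h2 (pairFst_lt_pairSnd I).ne isIndicator_zero
      even_sum_zero hm
  · have e : ind J = 1 + wt (pairFst I, false) + wt (pairSnd I, false) := by
      have e1 := wt_opp (pairFst I, true)
      have e2 := wt_opp (pairSnd I, true)
      change wt (pairFst I, false) = _ at e1
      change wt (pairSnd I, false) = _ at e2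
      rw [h, e1, e2, pairWt]
      abel
    have hm := LinearMap.mem_ker.2 (tripleDefect_lowerOp_one v h2 hι I)
    rw [lowerOp] at hm
    rw [e]
    exact mem_of_halfSpin_sigma_mem v h2 (pairFst_lt_pairSnd I).ne isIndicator_one
      (even_sum_one (by decide)) hm
  · rw [h]
    exact LinearMap.mem_ker.2 (tripleDefect_one v h2 hι)

theorem algebra_iso_quaternionicSuperalgebra [IsAlgClosed k] (h2 : (2 : k) ≠ 0) :
    (algebra v).Iso (quaternionicSuperalgebra k) := by
  obtain ⟨ι, hι⟩ := IsAlgClosed.exists_eq_mul_self (-1 : k)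
  have h6 : Even 6 := by decide
  refine FreudenthalSpace.ofAction_iso_superalgebra (halfSpin v) (oddBracket v)
    (LinearEquiv.ofBijective (toFreudenthal v ι) (toFreudenthal_bijective v h2 hι.symm))
    (halfSpin_lie v h2) (halfSpin_faithful v h2 h6 (by norm_num))
    (oddBracket_span v h2 h6 (by norm_num)) fun s t u => ?_
  have := LinearMap.congr_fun (LinearMap.congr_fun (LinearMap.congr_fun
    (tripleDefect_eq_zero v h2 hι.symm) s) t) u
  exact sub_eq_zero.1 this

end TripleProduct

end TypeD

theorem theorem4p1 {k : Type*} [Field k] [IsAlgClosed k] (hk : ringChar k ≠ 2)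
    {V : Type*} [AddCommGroup V] [Module k V] (l : ℕ) (hl : Even l) (hl0 : 0 < l)
    (v : Module.Basis (Fin l) k V) :
    ((TypeD.algebra v).IsLieAlgebra ↔ l = 8 ∨ l = 4) ∧
    (l = 8 → (TypeD.algebra v).IsSimple ∧ (TypeD.algebra v).IsoBracket k (LieE8 k)) ∧
    (l = 4 → (TypeD.algebra v).IsSimple ∧
      (TypeD.algebra v).IsoBracket k (LieAlgebra.Orthogonal.so (Fin 9) k)) ∧
    ((TypeD.algebra v).IsLieSuperalgebra ↔ (l = 6 ∧ ringChar k = 3) ∨ l = 2) ∧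
    (l = 6 ∧ ringChar k = 3 → (TypeD.algebra v).Iso (quaternionicSuperalgebra k)) ∧
    (l = 2 → (TypeD.algebra v).Iso
      ((osp (Fin 1) (Fin 1) k).sumLie (LieAlgebra.SpecialLinear.sl (Fin 2) k))) := by
  have h2 : (2 : k) ≠ 0 := Ring.two_ne_zero hk
  have h3 : ringChar k = 3 ↔ (3 : k) = 0 := by
    refine ⟨fun h => ?_, fun h => ?_⟩
    · have := ringChar.Nat.cast_ringChar (R := k)
      rw [h] at this
      exact_mod_cast this
    · have hd : ringChar k ∣ 3 := ringChar.dvd (by exact_mod_cast h)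
      exact ((Nat.dvd_prime Nat.prime_three).1 hd).resolve_left CharP.ringChar_ne_one
  refine ⟨TypeD.isLieAlgebra_iff_eq v h2 hl hl0, ?_, ?_, ?_, ?_, ?_⟩
  · rintro rfl
    exact ⟨TypeD.algebra_isSimple v h2 hl (by norm_num), TypeD.algebra_isoBracket_e8 v h2⟩
  · rintro rfl
    exact ⟨TypeD.algebra_isSimple v h2 hl (by norm_num), TypeD.algebra_isoBracket_so_nine v h2⟩
  · rw [h3]
    exact TypeD.isLieSuperalgebra_iff_eq v h2 hl hl0
  · rintro ⟨rfl, -⟩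
    exact TypeD.algebra_iso_quaternionicSuperalgebra v h2
  · rintro rfl
    exact TypeD.algebra_iso_osp v h2
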